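/- Let $X$ be a (not necessarily compact) complex manifold of dimension $n$, let $1\le m\le n$, let $\omega$ be a Kähler form on $X$ and let $\Omega$ be a real $C^\infty$ form of bidegree $(n-m,n-m)$ on $X$ with $\partial\bar\partial\Omega=0$ which is weakly (strictly) positive: at every point, $\Omega\wedge i\alpha_1\wedge\bar\alpha_1\wedge\dots\wedge i\alpha_m\wedge\bar\alpha_m>0$ for all linearly independent $(1,0)$-covectors $\alpha_1,\dots,\alpha_m$. Put $dV_\omega=\omega^n/n!$. For a $C^\infty$ Hermitian metric $h$ on a holomorphic vector bundle $F$ on $X$, let $\Theta_h(F)$ be the curvature form of its Chern connection. The metric $h$ is called $(\omega,\Omega)$-Hermite–Einstein with Einstein factor $\lambda\in\mathbb R$ if $i\Theta_h(F)\wedge\omega^{m-1}\wedge\Omega=\lambda\,dV_\omega\otimes\mathrm{Id}_F$. Let $$d_{\omega,\Omega,h}(F):=\frac{i\Theta_h(\det F)\wedge\omega^{m-1}\wedge\Omega}{dV_\omega}:X\to\mathbb R,$$ where $\det F$ carries the metric induced by $h$. If $X$ is compact and $F$ is non-zero, let $$\mu_{\omega,\Omega}(F):=\frac1{\operatorname{rk}F}\int_X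 i\Theta_k(\det F)\wedge\omega^{m-1}\wedge\Omega,$$ where $k$ is any Hermitian metric on $\det F$ (the assertions below hold for every choice of these metrics). Let $0\to S\to E\to Q\to 0$ be a short exact sequence of holomorphic vector bundles on $X$ with $\operatorname{rk}S\ge1$ and $\operatorname{rk}Q\ge1$. Let $h_E$ be a Hermitian metric on $E$, and let $h_S$ and $h_Q$ be the induced metric on $S$ and the quotient metric on $Q$. Suppose that $h_E$ is $(\omega,\Omega)$-Hermite–Einstein with Einstein factor $\lambda_E$. Then: 1. At every point of $X$, $$\frac{d_{\omega,\Omega,h_S}(S)}{\operatorname{rk}S}\ \overset{(i)}{\le}\ \frac{d_{\omega,\Omega,h_E}(E)}{\operatorname{rk}E}\ \overset{(ii)}{\le}\ \frac{d_{\omega,\Omega,h_Q}(Q)}{\operatorname{rk}Q}.$$ 2. Equality holds in (i) on all of $X$ if and only if equality holds in (ii) on all of $X$, if and only if the sequence splits holomorphically as a sequence of Hermitian bundles, that is, $E\to Q$ has a holomorphic right inverse whose image is $h_E$-orthogonal to $S$. In this case $h_S$ and $h_Q$ are $(\omega,\Omega)$-Hermite–Einstein with the same Einstein factor $\lambda_S=\lambda_E=\lambda_Q$.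 3. If $X$ is compact, then equality holds in (i) (equivalently, in (ii)) on all of $X$ if and only if the sequence of holomorphic bundles splits holomorphically. Moreover $\mu_{\omega,\Omega}(S)\le\mu_{\omega,\Omega}(E)\le\mu_{\omega,\Omega}(Q)$, and equality holds in the first, respectively in the second, of these inequalities if and only if the sequence splits holomorphically. -/

import Mathlib

open scoped Manifold Topology ComplexConjugate Bundle
open Bundle

noncomputable section

namespace HermiteEinstein

/-! ### Linear algebra of complex-valued exterior forms on `ℂⁿ` -/

/-- The model space `ℂⁿ` of a complex manifold of dimension `n`. -/
abbrev Cn (n : ℕ) : Type := Fin n → ℂ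

/-- The order of smoothness `C^∞`. Over `ℂ`, being of class `C^∞` means being holomorphic. -/
abbrev smoothOrder : WithTop ℕ∞ := ((⊤ : ℕ∞) : WithTop ℕ∞)

section Algebra

variable {W : Type*} [AddCommGroup W] [Module ℝ W]

/-- The exterior product `α ∧ β` of two complex-valued real-multilinear alternating forms
(sum over shuffles, so that `(α ∧ β) (v, w) = α v * β w - α w * β v` for 1-forms). -/
def wedge {p q : ℕ} (α : W [⋀^Fin p]→ₗ[ℝ] ℂ) (β : W [⋀^Fin q]→ₗ[ℝ] ℂ) :
    W [⋀^Fin (p + q)]→ₗ[ℝ] ℂ :=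
  ((LinearMap.mul' ℝ ℂ).compAlternatingMap (α.domCoprod β)).domDomCongr finSumFinEquiv

/-- The exterior power `α ∧ ⋯ ∧ α` (`k` factors) of a 2-form; it is `1` for `k = 0`. -/
def wedgePow (α : W [⋀^Fin 2]→ₗ[ℝ] ℂ) : (k : ℕ) → W [⋀^Fin (2 * k)]→ₗ[ℝ] ℂ
  | 0 => (AlternatingMap.constOfIsEmpty ℝ W (Fin 0) (1 : ℂ) : W [⋀^Fin 0]→ₗ[ℝ] ℂ)
  | k + 1 => wedge (wedgePow α k) α

/-- A real-linear map `W → ℂ`, seen as a 1-form. -/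
def oneForm (l : W →ₗ[ℝ] ℂ) : W [⋀^Fin 1]→ₗ[ℝ] ℂ :=
  AlternatingMap.ofSubsingleton ℝ W ℂ (0 : Fin 1) l

end Algebra

section ModelForms

variable {n : ℕ}

/-- The conjugate `v ↦ conj (a v)` of a complex-linear form `a`, a form of type `(0,1)`. -/
def conjForm (a : Cn n →ₗ[ℂ] ℂ) : Cn n →ₗ[ℝ] ℂ :=
  Complex.conjAe.toLinearMap ∘ₗ a.restrictScalars ℝ

/-- The elementary positive `(k,k)`-form
`(i a₁ ∧ conj a₁) ∧ ⋯ ∧ (i a_k ∧ conj a_k)` attached to complex-linear forms `a₁, …, a_k`. -/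
def elementaryPositive : (k : ℕ) → (Fin k → (Cn n →ₗ[ℂ] ℂ)) → Cn n [⋀^Fin (2 * k)]→ₗ[ℝ] ℂ
  | 0, _ => (AlternatingMap.constOfIsEmpty ℝ (Cn n) (Fin 0) (1 : ℂ) : Cn n [⋀^Fin 0]→ₗ[ℝ] ℂ)
  | k + 1, a =>
      wedge (elementaryPositive k (fun j => a j.castSucc))
        (Complex.I • wedge (oneForm ((a (Fin.last k)).restrictScalars ℝ))
          (oneForm (conjForm (a (Fin.last k)))))

/-- The positively oriented real basis `(e₁, i e₁, …, e_n, i e_n)` of `ℂⁿ`. -/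
def orientedFrame (n : ℕ) (j : Fin (2 * n)) : Cn n :=
  Pi.single (⟨j.1 / 2, by omega⟩ : Fin n) (if j.1 % 2 = 0 then 1 else Complex.I)

/-- The coefficient of a form of top degree `2n` on `ℂⁿ` with respect to the Lebesgue volume form
`dx₁ ∧ dy₁ ∧ ⋯ ∧ dx_n ∧ dy_n`. -/
def topCoeff (η : Cn n [⋀^Fin (2 * n)]→ₗ[ℝ] ℂ) : ℂ := η (orientedFrame n)

/-- The form `η` is of type (bidegree) `(p,q)`. -/
def IsOfType (p q : ℕ) {k : ℕ} (η : Cn n [⋀^Fin k]→ₗ[ℝ] ℂ) : Prop :=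
  k = p + q ∧
    ∀ (ζ : ℂ) (v : Fin k → Cn n), η (fun j => ζ • v j) = ζ ^ p * conj ζ ^ q * η v

/-- The form `η` is real. -/
def IsRealForm {k : ℕ} (η : Cn n [⋀^Fin k]→ₗ[ℝ] ℂ) : Prop :=
  ∀ v, conj (η v) = η v

/-- Weak (strict) positivity of a form `Ω` of degree `2(n-m)`: for all linearly independent
complex-linear forms `a₁, …, a_m`, the form `Ω ∧ (i a₁ ∧ conj a₁) ∧ ⋯ ∧ (i a_m ∧ conj a_m)` of top
degree is a strictly positive multiple of the Lebesgue volume form. -/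
def IsWeaklyPositive {m : ℕ} (hmn : m ≤ n) (Ω : Cn n [⋀^Fin (2 * (n - m))]→ₗ[ℝ] ℂ) : Prop :=
  ∀ a : Fin m → (Cn n →ₗ[ℂ] ℂ), LinearIndependent ℂ a →
    ∃ t : ℝ, 0 < t ∧
      topCoeff ((wedge Ω (elementaryPositive m a)).domDomCongr
        (finCongr (show 2 * (n - m) + 2 * m = 2 * n by omega))) = (t : ℂ)

/-- The volume form `ωⁿ / n!`. -/
def volumeForm (ω : Cn n [⋀^Fin 2]→ₗ[ℝ] ℂ) : Cn n [⋀^Fin (2 * n)]→ₗ[ℝ] ℂ :=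
  ((n.factorial : ℂ)⁻¹) • wedgePow ω n

/-- The form `α ∧ ω^{m-1} ∧ Ω` of top degree, for a 2-form `α`. -/
def topProduct {m : ℕ} (hm : 1 ≤ m) (hmn : m ≤ n) (ω : Cn n [⋀^Fin 2]→ₗ[ℝ] ℂ)
    (Ω : Cn n [⋀^Fin (2 * (n - m))]→ₗ[ℝ] ℂ) (α : Cn n [⋀^Fin 2]→ₗ[ℝ] ℂ) :
    Cn n [⋀^Fin (2 * n)]→ₗ[ℝ] ℂ :=
  (wedge (wedge α (wedgePow ω (m - 1))) Ω).domDomCongr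
    (finCongr (show 2 + 2 * (m - 1) + 2 * (n - m) = 2 * n by omega))

/-! ### Differential operators on forms defined on open subsets of `ℂⁿ` -/

/-- Multiplication by `i` on `ℂⁿ`, as a real-linear map. -/
def mulI (n : ℕ) : Cn n →L[ℝ] Cn n :=
  (Complex.I • ContinuousLinearMap.id ℂ (Cn n)).restrictScalars ℝ

/-- The operator `∂`: for `η = ∑ η_{IJ} dz_I ∧ dz̄_J` it is
`∑_{I,J,k} (∂η_{IJ}/∂z_k) dz_k ∧ dz_I ∧ dz̄_J`. It is obtained from `d` by replacing the derivative
of the coefficients with its complex-linear part. -/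
def del {k : ℕ} (η : Cn n → Cn n [⋀^Fin k]→L[ℝ] ℂ) (z : Cn n) : Cn n [⋀^Fin (k + 1)]→L[ℝ] ℂ :=
  ContinuousAlternatingMap.alternatizeUncurryFin
    ((1 / 2 : ℂ) • (fderiv ℝ η z - Complex.I • (fderiv ℝ η z).comp (mulI n)))

/-- The operator `∂̄`: for `η = ∑ η_{IJ} dz_I ∧ dz̄_J` it is
`∑_{I,J,k} (∂η_{IJ}/∂z̄_k) dz̄_k ∧ dz_I ∧ dz̄_J`. It is obtained from `d` by replacing the derivative
of the coefficients with its complex-antilinear part. -/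
def delbar {k : ℕ} (η : Cn n → Cn n [⋀^Fin k]→L[ℝ] ℂ) (z : Cn n) :
    Cn n [⋀^Fin (k + 1)]→L[ℝ] ℂ :=
  ContinuousAlternatingMap.alternatizeUncurryFin
    ((1 / 2 : ℂ) • (fderiv ℝ η z + Complex.I • (fderiv ℝ η z).comp (mulI n)))

/-- The connection matrix `θ = H⁻¹ ∂H` of the Chern connection in a holomorphic frame `(e_j)` with
Gram matrix `H = (h(e_i, e_j))`, where `h` is antilinear in its first argument:
`D e_j = ∑ θ_{ij} ⊗ e_i`. -/
def chernConnection {r : ℕ} (H : Cn n → Matrix (Fin r) (Fin r) ℂ) (i j : Fin r) (z : Cn n) :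
    Cn n [⋀^Fin 1]→L[ℝ] ℂ :=
  ∑ k, ((H z)⁻¹ i k) •
    del (fun w => ContinuousAlternatingMap.constOfIsEmpty ℝ (Cn n) (Fin 0) (H w k j)) z

/-- The matrix of the curvature `Θ = D²` of the Chern connection in a holomorphic frame with Gram
matrix `H`: `Θ = dθ + θ ∧ θ`. -/
def chernCurvature {r : ℕ} (H : Cn n → Matrix (Fin r) (Fin r) ℂ) (i j : Fin r) (z : Cn n) :
    Cn n [⋀^Fin 2]→ₗ[ℝ] ℂ :=
  (extDeriv (chernConnection H i j) z).toAlternatingMap +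
    ∑ k, wedge (chernConnection H i k z).toAlternatingMap
      (chernConnection H k j z).toAlternatingMap

end ModelForms

/-! ### Differential forms on a complex manifold -/

section Forms

variable (n : ℕ) (X : Type*) [TopologicalSpace X] [ChartedSpace (Cn n) X]

/-- A complex-valued differential form of degree `k` on `X`. As always in Mathlib, the tangent space
at `x` is the model space `ℂⁿ`, identified through the preferred chart at `x`. -/
abbrev DiffForm (k : ℕ) : Type _ := X → Cn n [⋀^Fin k]→L[ℝ] ℂ

variable {n X}

/-- The derivative at `z` of the inverse of the preferred chart at `p`. -/
def chartSymmDeriv (p : X) (z : Cn n) : Cn n →L[ℝ] Cn n :=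
  mfderiv 𝓘(ℝ, Cn n) 𝓘(ℝ, Cn n) (chartAt (Cn n) p).symm z

/-- The expression of a form in the preferred chart at `p`, i.e. its pull-back by the inverse of
this chart. Only its values on the target of the chart are meaningful. -/
def DiffForm.inChart {k : ℕ} (η : DiffForm n X k) (p : X) (z : Cn n) : Cn n [⋀^Fin k]→L[ℝ] ℂ :=
  (η ((chartAt (Cn n) p).symm z)).compContinuousLinearMap (chartSymmDeriv p z)

/-- A form is of class `C^∞`. -/
def DiffForm.IsSmooth {k : ℕ} (η : DiffForm n X k) : Prop :=
  ∀ p : X, ContDiffOn ℝ smoothOrder (η.inChart p) (chartAt (Cn n) p).target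

/-- `ω` is (the fundamental form of) a Kähler metric: a smooth real positive definite
`(1,1)`-form with `dω = 0`. -/
structure IsKahlerForm (ω : DiffForm n X 2) : Prop where
  smooth : ω.IsSmooth
  real : ∀ x, IsRealForm (ω x).toAlternatingMap
  type_one_one : ∀ x, IsOfType 1 1 (ω x).toAlternatingMap
  pos : ∀ x (v : Cn n), v ≠ 0 → 0 < (ω x ![v, Complex.I • v]).re
  closed : ∀ p : X, ∀ z ∈ (chartAt (Cn n) p).target, extDeriv (ω.inChart p) z = 0

/-- `Ω` is a smooth real `(n-m,n-m)`-form which is weakly positive and satisfies `∂∂̄Ω = 0`. -/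
structure IsAdmissibleForm {m : ℕ} (hmn : m ≤ n) (Ω : DiffForm n X (2 * (n - m))) : Prop where
  smooth : Ω.IsSmooth
  real : ∀ x, IsRealForm (Ω x).toAlternatingMap
  type_pp : ∀ x, IsOfType (n - m) (n - m) (Ω x).toAlternatingMap
  weakly_positive : ∀ x, IsWeaklyPositive hmn (Ω x).toAlternatingMap
  ddbar_closed : ∀ p : X, ∀ z ∈ (chartAt (Cn n) p).target, del (delbar (Ω.inChart p)) z = 0

/-- A continuous partition of unity on a compact Hausdorff `X`, indexed by the points of `X` and
subordinate to the sources of the preferred charts. -/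
def chartPartition [CompactSpace X] [T2Space X] : PartitionOfUnity X X Set.univ :=
  Classical.choose (PartitionOfUnity.exists_isSubordinate (X := X) isClosed_univ
    (fun p : X => (chartAt (Cn n) p).source) (fun p => (chartAt (Cn n) p).open_source)
    (fun x _ => Set.mem_iUnion.2 ⟨x, mem_chart_source (Cn n) x⟩))

theorem chartPartition_isSubordinate [CompactSpace X] [T2Space X] :
    (chartPartition (n := n) (X := X)).IsSubordinate (fun p : X => (chartAt (Cn n) p).source) :=
  Classical.choose_spec (PartitionOfUnity.exists_isSubordinate (X := X) isClosed_univ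
    (fun p : X => (chartAt (Cn n) p).source) (fun p => (chartAt (Cn n) p).open_source)
    (fun x _ => Set.mem_iUnion.2 ⟨x, mem_chart_source (Cn n) x⟩))

/-- The integral `∫_X η` of a form of top degree over a compact complex manifold (with its complex
orientation): the form is cut by a partition of unity, and each piece is integrated in a chart with
respect to the Lebesgue measure. -/
def integralTop [CompactSpace X] [T2Space X] (η : X → Cn n [⋀^Fin (2 * n)]→ₗ[ℝ] ℂ) : ℂ :=
  ∑ᶠ p : X, ∫ z in (chartAt (Cn n) p).target,
    ((chartPartition (n := n) (X := X) p ((chartAt (Cn n) p).symm z) : ℝ) : ℂ) *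
      topCoeff ((η ((chartAt (Cn n) p).symm z)).compLinearMap
        (chartSymmDeriv p z : Cn n →ₗ[ℝ] Cn n))

end Forms

/-! ### Hermitian metrics on holomorphic vector bundles -/

section Bundles

variable {n r : ℕ} {X : Type*} [TopologicalSpace X] [ChartedSpace (Cn n) X]
  {E : X → Type*} [∀ x, AddCommGroup (E x)] [∀ x, Module ℂ (E x)]
  [TopologicalSpace (TotalSpace (Fin r → ℂ) E)] [∀ x, TopologicalSpace (E x)]
  [FiberBundle (Fin r → ℂ) E]

/-- The local frame `(e_1, …, e_r)` defined by a local trivialization. -/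
def frame (e : Trivialization (Fin r → ℂ) (π (Fin r → ℂ) E)) (i : Fin r) (x : X) : E x :=
  e.symm x (Pi.single i 1)

variable (n r E) in
/-- A `C^∞` Hermitian metric on the fibres of a complex vector bundle of rank `r`; it is antilinear
in its first argument and linear in the second one. -/
structure HermitianMetric where
  inner : ∀ x, E x →ₗ⋆[ℂ] E x →ₗ[ℂ] ℂ
  conj_symm : ∀ x u v, conj (inner x u v) = inner x v u
  pos : ∀ x u, u ≠ 0 → 0 < (inner x u u).re
  smooth : ∀ (e : Trivialization (Fin r → ℂ) (π (Fin r → ℂ) E)) [MemTrivializationAtlas e]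
    (i j : Fin r), ContMDiffOn 𝓘(ℝ, Cn n) 𝓘(ℝ, ℂ) smoothOrder
      (fun x => inner x (frame e i x) (frame e j x)) e.baseSet

/-- The Gram matrix of the frame defined by a local trivialization. -/
def HermitianMetric.gram (h : HermitianMetric n r E)
    (e : Trivialization (Fin r → ℂ) (π (Fin r → ℂ) E)) (x : X) : Matrix (Fin r) (Fin r) ℂ :=
  Matrix.of fun i j => h.inner x (frame e i x) (frame e j x)

/-- The curvature form `Θ_h(E)` at `x` of the Chern connection, as a matrix of 2-forms on the
tangent space at `x`; it is computed in the preferred chart and the preferred local (holomorphic)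
frame of `E` at `x`. -/
def HermitianMetric.curvature (h : HermitianMetric n r E) (x : X) (i j : Fin r) :
    Cn n [⋀^Fin 2]→ₗ[ℝ] ℂ :=
  chernCurvature (fun z => h.gram (trivializationAt (Fin r → ℂ) E x) ((chartAt (Cn n) x).symm z))
    i j (chartAt (Cn n) x x)

/-- `h` is `(ω,Ω)`-Hermite–Einstein with (constant) Einstein factor `lam`:
`iΘ_h(E) ∧ ω^{m-1} ∧ Ω = lam · ωⁿ/n! ⊗ Id_E`. -/
def IsHermiteEinstein {m : ℕ} (hm : 1 ≤ m) (hmn : m ≤ n) (ω : DiffForm n X 2)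
    (Ω : DiffForm n X (2 * (n - m))) (h : HermitianMetric n r E) (lam : ℝ) : Prop :=
  ∀ (x : X) (i j : Fin r),
    topProduct hm hmn (ω x).toAlternatingMap (Ω x).toAlternatingMap
        (Complex.I • h.curvature x i j) =
      ((lam : ℂ) * (1 : Matrix (Fin r) (Fin r) ℂ) i j) • volumeForm (ω x).toAlternatingMap

end Bundles

/-! ### The determinant line bundle -/

section Det

variable {n r : ℕ} {X : Type*} [TopologicalSpace X]

section Core

variable (r) (E : X → Type*) [∀ x, AddCommGroup (E x)] [∀ x, Module ℂ (E x)]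
  [TopologicalSpace (TotalSpace (Fin r → ℂ) E)] [∀ x, TopologicalSpace (E x)]
  [FiberBundle (Fin r → ℂ) E] [VectorBundle ℂ (Fin r → ℂ) E]

/-- The determinant of the change of frame of `E` from the preferred trivialization at `p` to the
one at `q`. -/
def detTransition (p q x : X) : ℂ :=
  ContinuousLinearMap.det (((trivializationAt (Fin r → ℂ) E p).coordChangeL ℂ
    (trivializationAt (Fin r → ℂ) E q) x : (Fin r → ℂ) ≃L[ℂ] (Fin r → ℂ)) :
      (Fin r → ℂ) →L[ℂ] (Fin r → ℂ))

theorem detTransition_self (p x : X) (hx : x ∈ (trivializationAt (Fin r → ℂ) E p).baseSet) :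
    detTransition r E p p x = 1 := by
  have h : (((trivializationAt (Fin r → ℂ) E p).coordChangeL ℂ
    (trivializationAt (Fin r → ℂ) E p) x : (Fin r → ℂ) ≃L[ℂ] (Fin r → ℂ)) :
      (Fin r → ℂ) →L[ℂ] (Fin r → ℂ)) = ContinuousLinearMap.id ℂ _ := by
    ext1 v
    simp only [ContinuousLinearEquiv.coe_coe, ContinuousLinearMap.id_apply]
    rw [Trivialization.coordChangeL_apply _ _ ⟨hx, hx⟩,
      Trivialization.apply_mk_symm _ hx]
  rw [detTransition, h]
  simp [ContinuousLinearMap.det]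

theorem detTransition_mul (p q k x : X)
    (hp : x ∈ (trivializationAt (Fin r → ℂ) E p).baseSet)
    (hq : x ∈ (trivializationAt (Fin r → ℂ) E q).baseSet)
    (hk : x ∈ (trivializationAt (Fin r → ℂ) E k).baseSet) :
    detTransition r E q k x * detTransition r E p q x = detTransition r E p k x := by
  unfold detTransition ContinuousLinearMap.det
  rw [← LinearMap.det_comp]
  congr 1
  refine LinearMap.ext fun v => ?_
  change (trivializationAt (Fin r → ℂ) E q).coordChangeL ℂ (trivializationAt (Fin r → ℂ) E k) x
    ((trivializationAt (Fin r → ℂ) E p).coordChangeL ℂ (trivializationAt (Fin r → ℂ) E q) x v) =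
    (trivializationAt (Fin r → ℂ) E p).coordChangeL ℂ (trivializationAt (Fin r → ℂ) E k) x v
  rw [Trivialization.coordChangeL_apply _ _ ⟨hp, hq⟩,
    Trivialization.coordChangeL_apply _ _ ⟨hq, hk⟩,
    Trivialization.coordChangeL_apply _ _ ⟨hp, hk⟩]
  congr 3
  exact Trivialization.symm_apply_apply_mk _ hq _

/-- The determinant line bundle `det E`, given by the determinants of the transition functions
of `E`. -/
def detCore : VectorBundleCore ℂ X (Fin 1 → ℂ) X where
  baseSet p := (trivializationAt (Fin r → ℂ) E p).baseSet
  isOpen_baseSet p := (trivializationAt (Fin r → ℂ) E p).open_baseSet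
  indexAt x := x
  mem_baseSet_at x := FiberBundle.mem_baseSet_trivializationAt' x
  coordChange p q x := detTransition r E p q x • ContinuousLinearMap.id ℂ (Fin 1 → ℂ)
  coordChange_self p x hx v := by simp [detTransition_self r E p x hx]
  continuousOn_coordChange p q :=
    (ContinuousLinearMap.continuous_det.comp_continuousOn
      (VectorBundle.continuousOn_coordChange' (R := ℂ) (trivializationAt (Fin r → ℂ) E p)
        (trivializationAt (Fin r → ℂ) E q))).smul continuousOn_const
  coordChange_comp p q k x hx v := by
    simp [smul_smul, ← detTransition_mul r E p q k x hx.1.1 hx.1.2 hx.2, mul_comm]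

/-- The fibres of the determinant line bundle `det E`. -/
abbrev DetBundle : X → Type := (detCore r E).Fiber

end Core

section Holomorphic

variable [ChartedSpace (Cn n) X]
  (E : X → Type*) [∀ x, AddCommGroup (E x)] [∀ x, Module ℂ (E x)]
  [TopologicalSpace (TotalSpace (Fin r → ℂ) E)] [∀ x, TopologicalSpace (E x)]
  [FiberBundle (Fin r → ℂ) E] [VectorBundle ℂ (Fin r → ℂ) E]
  [ContMDiffVectorBundle smoothOrder (Fin r → ℂ) E 𝓘(ℂ, Cn n)]

theorem contDiff_clm_det (k : WithTop ℕ∞) :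
    ContDiff ℂ k (fun f : (Fin r → ℂ) →L[ℂ] (Fin r → ℂ) => f.det) := by
  have h : (fun f : (Fin r → ℂ) →L[ℂ] (Fin r → ℂ) => f.det) =
      fun f => (LinearMap.toMatrix' f.toLinearMap).det := by
    funext f
    simp [ContinuousLinearMap.det]
  rw [h]
  simp only [Matrix.det_apply, LinearMap.toMatrix'_apply]
  refine ContDiff.sum fun σ _ => ContDiff.const_smul _ (contDiff_prod fun i _ => ?_)
  have h2 : ContDiff ℂ k (fun f : (Fin r → ℂ) →L[ℂ] (Fin r → ℂ) =>
      f (Pi.single i 1)) := contDiff_id.clm_apply contDiff_const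
  exact (contDiff_pi.1 h2) (σ i)

/-- The determinant line bundle of a holomorphic vector bundle is holomorphic. -/
instance detCore_isContMDiff : (detCore r E).IsContMDiff 𝓘(ℂ, Cn n) smoothOrder where
  contMDiffOn_coordChange p q :=
    ((contDiff_clm_det smoothOrder).contMDiff.comp_contMDiffOn
      (contMDiffOn_coordChangeL (IB := 𝓘(ℂ, Cn n)) (trivializationAt (Fin r → ℂ) E p)
        (trivializationAt (Fin r → ℂ) E q))).smul contMDiffOn_const

end Holomorphic

section Metric

variable [ChartedSpace (Cn n) X]
  {E : X → Type*} [∀ x, AddCommGroup (E x)] [∀ x, Module ℂ (E x)]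
  [TopologicalSpace (TotalSpace (Fin r → ℂ) E)] [∀ x, TopologicalSpace (E x)]
  [FiberBundle (Fin r → ℂ) E] [VectorBundle ℂ (Fin r → ℂ) E]

open Matrix in
theorem HermitianMetric.inner_symm_symm (h : HermitianMetric n r E)
    (e : Trivialization (Fin r → ℂ) (π (Fin r → ℂ) E)) [MemTrivializationAtlas e]
    (x : X) (hx : x ∈ e.baseSet) (u v : Fin r → ℂ) :
    h.inner x (e.symm x u) (e.symm x v) = star u ⬝ᵥ (h.gram e x *ᵥ v) := by
  have key : ∀ w : Fin r → ℂ, e.symm x w = ∑ i, w i • frame e i x := by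
    intro w
    have hw : w = ∑ i, w i • (Pi.single i (1 : ℂ) : Fin r → ℂ) := pi_eq_sum_univ' w
    have h1 : ∀ w, e.symm x w = e.symmₗ ℂ x w := fun w => (e.symmₗ_apply hx w).symm
    simp only [frame, h1]
    conv_lhs => rw [hw]
    simp only [map_sum, map_smul]
  rw [key u, key v]
  simp only [map_sum, LinearMap.map_smulₛₗ, LinearMap.sum_apply, LinearMap.smul_apply,
    smul_eq_mul, dotProduct, Matrix.mulVec, HermitianMetric.gram, Matrix.of_apply, Finset.mul_sum,
    Pi.star_apply, RingHom.id_apply]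
  rw [Finset.sum_comm]
  refine Finset.sum_congr rfl fun i _ => Finset.sum_congr rfl fun j _ => ?_
  simp only [starRingEnd_apply]
  ring

open scoped ComplexOrder in
theorem HermitianMetric.gram_posDef (h : HermitianMetric n r E)
    (e : Trivialization (Fin r → ℂ) (π (Fin r → ℂ) E)) [MemTrivializationAtlas e]
    (x : X) (hx : x ∈ e.baseSet) : (h.gram e x).PosDef := by
  refine Matrix.PosDef.of_dotProduct_mulVec_pos ?_ ?_
  · ext i j
    simp [HermitianMetric.gram, Matrix.conjTranspose_apply, ← h.conj_symm x (frame e j x)]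
  · intro v hv
    rw [← h.inner_symm_symm e x hx]
    have hne : e.symm x v ≠ 0 := by
      intro h0
      apply hv
      have h1 := e.linearMapAt_symm (R := ℂ) hx v
      rw [h0, map_zero] at h1
      exact h1.symm
    rw [Complex.pos_iff]
    refine ⟨h.pos x _ hne, ?_⟩
    exact (Complex.conj_eq_iff_im.1 (h.conj_symm x _ _)).symm

/-- The change of the Gram determinant under a change of trivialization. -/
theorem HermitianMetric.det_gram_change (h : HermitianMetric n r E) (p x : X)
    (hp : x ∈ (trivializationAt (Fin r → ℂ) E p).baseSet) :
    (h.gram (trivializationAt (Fin r → ℂ) E p) x).det =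
      conj (detTransition r E p x x) * detTransition r E p x x *
        (h.gram (trivializationAt (Fin r → ℂ) E x) x).det := by
  set g := (((trivializationAt (Fin r → ℂ) E p).coordChangeL ℂ
    (trivializationAt (Fin r → ℂ) E x) x : (Fin r → ℂ) ≃L[ℂ] (Fin r → ℂ)) :
      (Fin r → ℂ) →L[ℂ] (Fin r → ℂ)) with hg
  set G := LinearMap.toMatrix' (g : (Fin r → ℂ) →ₗ[ℂ] (Fin r → ℂ)) with hG
  have hx : x ∈ (trivializationAt (Fin r → ℂ) E x).baseSet :=
    FiberBundle.mem_baseSet_trivializationAt' x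
  have hfr : ∀ i, frame (trivializationAt (Fin r → ℂ) E p) i x =
      (trivializationAt (Fin r → ℂ) E x).symm x (g (Pi.single i 1)) := by
    intro i
    simp only [hg, ContinuousLinearEquiv.coe_coe]
    rw [Trivialization.coordChangeL_apply _ _ ⟨hp, hx⟩]
    exact (Trivialization.symm_apply_apply_mk _ hx _).symm
  have hcol : ∀ i k, g (Pi.single i 1) k = G k i := by
    intro i k
    simp only [hG, LinearMap.toMatrix'_apply, ContinuousLinearMap.coe_coe]
  have hmat : h.gram (trivializationAt (Fin r → ℂ) E p) x =
      G.conjTranspose * (h.gram (trivializationAt (Fin r → ℂ) E x) x) * G := by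
    ext i j
    have h1 : h.gram (trivializationAt (Fin r → ℂ) E p) x i j =
        h.inner x (frame (trivializationAt (Fin r → ℂ) E p) i x)
          (frame (trivializationAt (Fin r → ℂ) E p) j x) := rfl
    rw [h1, hfr i, hfr j, h.inner_symm_symm _ x hx, Matrix.mul_assoc, Matrix.mul_apply]
    simp only [dotProduct, Pi.star_apply, hcol, Matrix.mulVec, Matrix.conjTranspose_apply,
      Matrix.mul_apply]
  have hdet : detTransition r E p x x = G.det := by
    simp [detTransition, ContinuousLinearMap.det, hG, hg]
  rw [hmat, Matrix.det_mul, Matrix.det_mul, Matrix.det_conjTranspose, hdet]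
  simp only [starRingEnd_apply]
  ring

/-- The sesquilinear form `(u, v) ↦ D * conj u * v` on a complex line. -/
def lineForm (D : ℂ) : (Fin 1 → ℂ) →ₗ⋆[ℂ] (Fin 1 → ℂ) →ₗ[ℂ] ℂ :=
  LinearMap.mk₂'ₛₗ (starRingEnd ℂ) (RingHom.id ℂ)
    (fun u v => conj (u 0) * v 0 * D)
    (fun u u' v => by simp only [Pi.add_apply, map_add]; ring)
    (fun c u v => by simp only [Pi.smul_apply, smul_eq_mul, map_mul]; ring)
    (fun u v v' => by simp only [Pi.add_apply]; ring)
    (fun c u v => by simp only [Pi.smul_apply, smul_eq_mul, RingHom.id_apply]; ring)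

open scoped ComplexOrder in
/-- The metric induced on `det E` by a Hermitian metric `h` on `E`: the square norm of
`e_1 ∧ ⋯ ∧ e_r` is the Gram determinant of `(e_1, …, e_r)`. -/
def HermitianMetric.det (h : HermitianMetric n r E) : HermitianMetric n 1 (DetBundle r E) where
  inner x := lineForm (h.gram (trivializationAt (Fin r → ℂ) E x) x).det
  conj_symm x := by
    have hD := (h.gram_posDef (trivializationAt (Fin r → ℂ) E x) x
      (FiberBundle.mem_baseSet_trivializationAt' x)).det_pos
    rw [Complex.pos_iff] at hD
    have hc := Complex.conj_eq_iff_im.2 hD.2.symm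
    intro (u : Fin 1 → ℂ) (v : Fin 1 → ℂ)
    change conj (conj (u 0) * v 0 * _) = conj (v 0) * u 0 * _
    simp only [map_mul, Complex.conj_conj, hc]
    ring
  pos x := by
    have hD := (h.gram_posDef (trivializationAt (Fin r → ℂ) E x) x
      (FiberBundle.mem_baseSet_trivializationAt' x)).det_pos
    intro (u : Fin 1 → ℂ) (hu : u ≠ 0)
    have h0 : u 0 ≠ 0 := by
      intro h0
      apply hu
      funext i
      rw [Subsingleton.elim i 0, h0]
      rfl
    have h1 : (0 : ℂ) < conj (u 0) * u 0 := by
      rw [mul_comm, Complex.mul_conj]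
      exact_mod_cast Complex.normSq_pos.2 h0
    exact (Complex.pos_iff.1 (mul_pos h1 hD)).1
  smooth := by
    intro e he i j
    obtain ⟨p, rfl⟩ : ∃ p : X, e = (detCore r E).localTriv p := by
      obtain ⟨p, hp⟩ := he.out
      exact ⟨p, hp.symm⟩
    have hsm : ContMDiffOn 𝓘(ℝ, Cn n) 𝓘(ℝ, ℂ) smoothOrder
        (fun x => (h.gram (trivializationAt (Fin r → ℂ) E p) x).det)
        (trivializationAt (Fin r → ℂ) E p).baseSet := by
      have hdet : ContDiff ℝ smoothOrder
          (fun A : Fin r → Fin r → ℂ => (Matrix.of A).det) := by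
        simp only [Matrix.det_apply, Matrix.of_apply]
        exact ContDiff.sum fun σ _ => ContDiff.const_smul _ (contDiff_prod fun i _ => by fun_prop)
      exact hdet.contMDiff.comp_contMDiffOn (contMDiffOn_pi_space.2 fun i =>
        contMDiffOn_pi_space.2 fun j => h.smooth (trivializationAt (Fin r → ℂ) E p) i j)
    refine hsm.congr fun x (hx : x ∈ (trivializationAt (Fin r → ℂ) E p).baseSet) => ?_
    have hfr : ∀ k : Fin 1, frame ((detCore r E).localTriv p) k x =
        (fun _ => detTransition r E p x x : Fin 1 → ℂ) := by
      intro k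
      refine ((detCore r E).localTriv_symm_apply p hx _).trans ?_
      change detTransition r E p x x • (Pi.single k (1 : ℂ) : Fin 1 → ℂ) = _
      funext l
      simp [Subsingleton.elim l k]
    rw [hfr i, hfr j, h.det_gram_change p x hx]
    rfl

end Metric

end Det

/-! ### Degrees and slopes -/

section Degree

variable {n m : ℕ} {X : Type*} [TopologicalSpace X] [ChartedSpace (Cn n) X]

/-- The function `iΘ_k(L) ∧ ω^{m-1} ∧ Ω / (ωⁿ/n!)` attached to a Hermitian metric `k` on a line
bundle `L`. (The quotient of these two real forms of top degree is real.) -/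
def lineDegreeFunction {L : X → Type*} [∀ x, AddCommGroup (L x)] [∀ x, Module ℂ (L x)]
    [TopologicalSpace (TotalSpace (Fin 1 → ℂ) L)] [∀ x, TopologicalSpace (L x)]
    [FiberBundle (Fin 1 → ℂ) L] (hm : 1 ≤ m) (hmn : m ≤ n) (ω : DiffForm n X 2)
    (Ω : DiffForm n X (2 * (n - m))) (k : HermitianMetric n 1 L) (x : X) : ℝ :=
  (topCoeff (topProduct hm hmn (ω x).toAlternatingMap (Ω x).toAlternatingMap
      (Complex.I • k.curvature x 0 0)) /
    topCoeff (volumeForm (ω x).toAlternatingMap)).re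

/-- The function `d_{ω,Ω,h}(E) = iΘ_h(det E) ∧ ω^{m-1} ∧ Ω / (ωⁿ/n!)`, where `det E` carries the
metric induced by `h`. -/
def degreeFunction {r : ℕ} {E : X → Type*} [∀ x, AddCommGroup (E x)] [∀ x, Module ℂ (E x)]
    [TopologicalSpace (TotalSpace (Fin r → ℂ) E)] [∀ x, TopologicalSpace (E x)]
    [FiberBundle (Fin r → ℂ) E] [VectorBundle ℂ (Fin r → ℂ) E] (hm : 1 ≤ m) (hmn : m ≤ n)
    (ω : DiffForm n X 2) (Ω : DiffForm n X (2 * (n - m))) (h : HermitianMetric n r E) : X → ℝ :=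
  lineDegreeFunction hm hmn ω Ω h.det

/-- The degree `∫_X iΘ_k(L) ∧ ω^{m-1} ∧ Ω` of a line bundle `L` on a compact manifold, computed by
means of a Hermitian metric `k` on `L`. (The integrand is a real form.) -/
def lineDegree [CompactSpace X] [T2Space X]
    {L : X → Type*} [∀ x, AddCommGroup (L x)] [∀ x, Module ℂ (L x)]
    [TopologicalSpace (TotalSpace (Fin 1 → ℂ) L)] [∀ x, TopologicalSpace (L x)]
    [FiberBundle (Fin 1 → ℂ) L] (hm : 1 ≤ m) (hmn : m ≤ n) (ω : DiffForm n X 2)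
    (Ω : DiffForm n X (2 * (n - m))) (k : HermitianMetric n 1 L) : ℝ :=
  (integralTop fun x => topProduct hm hmn (ω x).toAlternatingMap (Ω x).toAlternatingMap
    (Complex.I • k.curvature x 0 0)).re

/-- The slope `deg(det E) / rk E` of a vector bundle `E` of rank `r` on a compact manifold, where
the degree of `det E` is computed by means of a Hermitian metric `k` on `det E`. -/
def slope [CompactSpace X] [T2Space X] {r : ℕ}
    {E : X → Type*} [∀ x, AddCommGroup (E x)] [∀ x, Module ℂ (E x)]
    [TopologicalSpace (TotalSpace (Fin r → ℂ) E)] [∀ x, TopologicalSpace (E x)]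
    [FiberBundle (Fin r → ℂ) E] [VectorBundle ℂ (Fin r → ℂ) E] (hm : 1 ≤ m) (hmn : m ≤ n)
    (ω : DiffForm n X 2) (Ω : DiffForm n X (2 * (n - m)))
    (k : HermitianMetric n 1 (DetBundle r E)) : ℝ :=
  lineDegree hm hmn ω Ω k / r

end Degree

/-! ### Short exact sequences -/

section Exact

variable {n s r q : ℕ} {X : Type*} [TopologicalSpace X] [ChartedSpace (Cn n) X]
  {S : X → Type*} [∀ x, AddCommGroup (S x)] [∀ x, Module ℂ (S x)]
  [TopologicalSpace (TotalSpace (Fin s → ℂ) S)] [∀ x, TopologicalSpace (S x)]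
  [FiberBundle (Fin s → ℂ) S]
  {E : X → Type*} [∀ x, AddCommGroup (E x)] [∀ x, Module ℂ (E x)]
  [TopologicalSpace (TotalSpace (Fin r → ℂ) E)] [∀ x, TopologicalSpace (E x)]
  [FiberBundle (Fin r → ℂ) E]
  {Q : X → Type*} [∀ x, AddCommGroup (Q x)] [∀ x, Module ℂ (Q x)]
  [TopologicalSpace (TotalSpace (Fin q → ℂ) Q)] [∀ x, TopologicalSpace (Q x)]
  [FiberBundle (Fin q → ℂ) Q]

variable (n s r) in
/-- A family of linear maps between the fibres of two holomorphic vector bundles (of ranks `s` and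
`r`) is holomorphic. -/
def IsHolomorphicHom (f : ∀ x, S x →ₗ[ℂ] E x) : Prop :=
  ContMDiff ((𝓘(ℂ, Cn n)).prod 𝓘(ℂ, Fin s → ℂ)) ((𝓘(ℂ, Cn n)).prod 𝓘(ℂ, Fin r → ℂ)) smoothOrder
    (fun v : TotalSpace (Fin s → ℂ) S => (⟨v.1, f v.1 v.2⟩ : TotalSpace (Fin r → ℂ) E))

variable (n s r q) in
/-- `0 → S → E → Q → 0` is a short exact sequence of holomorphic vector bundles. -/
structure IsShortExact (f : ∀ x, S x →ₗ[ℂ] E x) (g : ∀ x, E x →ₗ[ℂ] Q x) : Prop where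
  holomorphic_left : IsHolomorphicHom n s r f
  holomorphic_right : IsHolomorphicHom n r q g
  injective : ∀ x, Function.Injective (f x)
  exact : ∀ x, LinearMap.range (f x) = LinearMap.ker (g x)
  surjective : ∀ x, Function.Surjective (g x)

/-- `hS` is the metric on `S` induced by the metric `hE` through `f : S → E`. -/
def IsInducedMetric (f : ∀ x, S x →ₗ[ℂ] E x) (hS : HermitianMetric n s S)
    (hE : HermitianMetric n r E) : Prop :=
  ∀ x (u v : S x), hS.inner x u v = hE.inner x (f x u) (f x v)

/-- `hQ` is the quotient metric of `hE` through the surjection `g : E → Q`, i.e. `g` is isometric on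
the orthogonal complement of its kernel. -/
def IsQuotientMetric (g : ∀ x, E x →ₗ[ℂ] Q x) (hE : HermitianMetric n r E)
    (hQ : HermitianMetric n q Q) : Prop :=
  ∀ x (u v : E x), (∀ w ∈ LinearMap.ker (g x), hE.inner x w u = 0) →
    (∀ w ∈ LinearMap.ker (g x), hE.inner x w v = 0) →
      hQ.inner x (g x u) (g x v) = hE.inner x u v

variable (n r q) in
/-- The short exact sequence with surjection `g : E → Q` splits holomorphically: `g` has a
holomorphic right inverse. -/
def SplitsHolomorphically (g : ∀ x, E x →ₗ[ℂ] Q x) : Prop :=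
  ∃ σ : ∀ x, Q x →ₗ[ℂ] E x, IsHolomorphicHom n q r σ ∧ ∀ x w, g x (σ x w) = w

variable (q) in
/-- The short exact sequence of Hermitian bundles splits holomorphically: `g : E → Q` has a
holomorphic right inverse with image orthogonal to the kernel of `g`, so that `E` is the holomorphic
and orthogonal direct sum of `S` and `Q`. -/
def SplitsOrthogonally (g : ∀ x, E x →ₗ[ℂ] Q x) (hE : HermitianMetric n r E) : Prop :=
  ∃ σ : ∀ x, Q x →ₗ[ℂ] E x, IsHolomorphicHom n q r σ ∧ (∀ x w, g x (σ x w) = w) ∧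
    ∀ x (w : Q x), ∀ v ∈ LinearMap.ker (g x), hE.inner x v (σ x w) = 0

end Exact

end HermiteEinstein

end

open scoped Manifold Bundle
open Bundle HermiteEinstein

noncomputable section

open scoped Manifold Topology ComplexConjugate Bundle

set_option linter.unusedSectionVars false
set_option linter.unusedSimpArgs false

/-! In local holomorphic frames the theorem becomes matrix calculus. Let `H` be the Gram matrix of
E, `F` the holomorphic matrix of S → E, and K = Fᴴ H F. With the orthogonal projection P = K⁻¹ Fᴴ H
and the second fundamental form B = (1 - F P) D'F, the Gauss equation
(`IsInducedGram.curvaturePiece_eq`) says that the curvature of S is that of E compressed to S,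
corrected by a quadratic term in B. Taking traces, iΘ(det S) = tr(F P iΘ(E)) - ∑ i b ∧ b̄, where b
runs through finitely many (1,0)-forms which vanish together exactly when B does.

Now wedge with ω^{m-1} ∧ Ω. The Einstein equation turns the first term into s λ dV. The second is
nonnegative and vanishes only for B = 0 (`topProduct_elementaryTwoForm`): write ω = ∑ i a_j ∧ ā_j
for a basis (a_j) and expand. Each term is Ω wedged with m elementary forms, hence positive if the
covectors are independent and zero otherwise, and a nonzero b can be completed to an independent
family by m - 1 of the a_j. This gives (i). Inequality (ii) is the same statement for Q* ⊂ E*,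
because dualizing reverses the sign of the curvature (`chernCurvature_dualGram`).

For equality, let σ : Q → E be the adjoint of g, which is the orthogonal right inverse of g. From F
P + σ G = 1 it follows that ∂̄P and ∂̄σ vanish together, and ∂̄P is the adjoint of B. So equality in
(i) and in (ii) both mean that σ is holomorphic (`splitsOrthogonally_iff`). When B = 0 the curvature
is exactly the compression, and S and Q inherit the Einstein equation.

On a compact X, the curvatures of two metrics on a line bundle differ by some ∂̄∂φ, and ∫ ∂̄∂φ ∧
ω^{m-1} ∧ Ω = 0 by Stokes, since dω = 0 and ∂∂̄Ω = 0. Hence degrees do not depend on the metric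
(`lineDegree_eq`), and the slope statements follow by integrating the pointwise ones: a continuous
nonnegative function with zero integral vanishes. If the sequence merely splits holomorphically, the
splitting makes Q a subbundle of E. The metric thus induced on Q has degree function at most q λ,
the quotient metric has degree function at least q λ, and the two have the same integral. So both
equal q λ everywhere (`degreeFunction_eq_of_splits`), which is equality in (ii). -/

namespace HermiteEinstein

/-! ### Algebra of the exterior product -/

section WedgeAlgebra

variable {W : Type*} [AddCommGroup W] [Module ℝ W]

/-- Reindexing of a form along an equality of degrees. -/
def castDeg {p q : ℕ} (h : p = q) (α : W [⋀^Fin p]→ₗ[ℝ] ℂ) : W [⋀^Fin q]→ₗ[ℝ] ℂ :=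
  α.domDomCongr (finCongr h)

@[simp]
theorem castDeg_rfl {p : ℕ} (h : p = p) (α : W [⋀^Fin p]→ₗ[ℝ] ℂ) : castDeg h α = α := rfl

@[simp]
theorem castDeg_castDeg {p q r : ℕ} (h : p = q) (h' : q = r) (α : W [⋀^Fin p]→ₗ[ℝ] ℂ) :
    castDeg h' (castDeg h α) = castDeg (h.trans h') α := rfl

theorem wedge_castDeg_left {p p' q : ℕ} (h : p = p') (α : W [⋀^Fin p]→ₗ[ℝ] ℂ)
    (β : W [⋀^Fin q]→ₗ[ℝ] ℂ) :
    wedge (castDeg h α) β = castDeg (congrArg (· + q) h) (wedge α β) := by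
  subst h; rfl

/-- The evaluation of forms at a tuple of vectors. -/
def evalForm {k : ℕ} (v : Fin k → W) : (W [⋀^Fin k]→ₗ[ℝ] ℂ) →ₗ[ℂ] ℂ where
  toFun α := α v
  map_add' _ _ := rfl
  map_smul' _ _ := rfl

theorem form_sum_apply {k : ℕ} {ι : Type*} (s : Finset ι) (α : ι → W [⋀^Fin k]→ₗ[ℝ] ℂ)
    (v : Fin k → W) : (∑ i ∈ s, α i) v = ∑ i ∈ s, α i v :=
  map_sum (evalForm v) α s

/-- The product of two multilinear forms in separate variables. -/
def multilinearProd {p q : ℕ} (a : MultilinearMap ℝ (fun _ : Fin p => W) ℂ)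
    (b : MultilinearMap ℝ (fun _ : Fin q => W) ℂ) : MultilinearMap ℝ (fun _ : Fin (p + q) => W) ℂ :=
  ((LinearMap.mul' ℝ ℂ).compMultilinearMap (a.domCoprod b)).domDomCongr finSumFinEquiv

theorem multilinearProd_apply {p q : ℕ} (a : MultilinearMap ℝ (fun _ : Fin p => W) ℂ)
    (b : MultilinearMap ℝ (fun _ : Fin q => W) ℂ) (v : Fin (p + q) → W) :
    multilinearProd a b v =
      a (fun i => v (Fin.castAdd q i)) * b (fun j => v (Fin.natAdd p j)) := by
  simp [multilinearProd, MultilinearMap.domCoprod_apply]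

theorem alternatization_domDomCongr {ι ι' : Type*} [Fintype ι] [DecidableEq ι] [Fintype ι']
    [DecidableEq ι'] (e : ι ≃ ι') (m : MultilinearMap ℝ (fun _ : ι => W) ℂ) :
    MultilinearMap.alternatization (m.domDomCongr e) =
      (MultilinearMap.alternatization m).domDomCongr e := by
  ext v
  rw [AlternatingMap.domDomCongr_apply, MultilinearMap.alternatization_apply,
    MultilinearMap.alternatization_apply, ← Equiv.sum_comp e.permCongr]
  refine Finset.sum_congr rfl fun σ _ => ?_
  rw [Equiv.Perm.sign_permCongr]
  simp [MultilinearMap.domDomCongr_apply]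

/-- The unnormalized alternatization (sum over all permutations) makes the wedge of alternatizations
the alternatization of the plain product, with no constant. Identities for `wedge` can then be
checked on products of multilinear forms. -/
theorem wedge_alternatization {p q : ℕ} (a : MultilinearMap ℝ (fun _ : Fin p => W) ℂ)
    (b : MultilinearMap ℝ (fun _ : Fin q => W) ℂ) :
    wedge (MultilinearMap.alternatization a) (MultilinearMap.alternatization b) =
      MultilinearMap.alternatization (multilinearProd a b) := by
  rw [wedge, multilinearProd, ← MultilinearMap.domCoprod_alternization,
    ← LinearMap.compMultilinearMap_alternatization, alternatization_domDomCongr]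

/-- In characteristic zero a form is the alternatization of itself divided by p!, so
`wedge_alternatization` applies to all forms. -/
theorem exists_alternatization_eq {p : ℕ} (α : W [⋀^Fin p]→ₗ[ℝ] ℂ) :
    ∃ a : MultilinearMap ℝ (fun _ : Fin p => W) ℂ, MultilinearMap.alternatization a = α := by
  refine ⟨((p.factorial : ℝ)⁻¹ • α : W [⋀^Fin p]→ₗ[ℝ] ℂ), ?_⟩
  rw [AlternatingMap.coe_alternatization, Fintype.card_fin]
  rw [← Nat.cast_smul_eq_nsmul ℝ, smul_smul, mul_inv_cancel₀ (by positivity), one_smul]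

/-- Replacing the sum over shuffles by the sum over all permutations counts each shuffle p! q!
times. The resulting explicit formula makes linearity, pull-back and smoothness of the wedge
immediate. -/
theorem wedge_apply {p q : ℕ} (α : W [⋀^Fin p]→ₗ[ℝ] ℂ) (β : W [⋀^Fin q]→ₗ[ℝ] ℂ)
    (v : Fin (p + q) → W) :
    wedge α β v = ((p.factorial * q.factorial : ℝ)⁻¹ : ℝ) • ∑ σ : Equiv.Perm (Fin (p + q)),
      (Equiv.Perm.sign σ) • (α (fun i => v (σ (Fin.castAdd q i))) *
        β (fun j => v (σ (Fin.natAdd p j)))) := by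
  have h := wedge_alternatization (α : MultilinearMap ℝ (fun _ : Fin p => W) ℂ)
    (β : MultilinearMap ℝ (fun _ : Fin q => W) ℂ)
  rw [AlternatingMap.coe_alternatization, AlternatingMap.coe_alternatization, Fintype.card_fin,
    Fintype.card_fin] at h
  have h2 : wedge (p.factorial • α) (q.factorial • β) =
      (p.factorial * q.factorial : ℝ) • wedge α β := by
    rw [← Nat.cast_smul_eq_nsmul ℝ, ← Nat.cast_smul_eq_nsmul ℝ]
    simp only [wedge, ← AlternatingMap.domCoprod'_apply]
    rw [TensorProduct.smul_tmul_smul, map_smul]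
    ext v
    simp
  have h3 := congrArg (fun η => η v) h
  simp only [h2, AlternatingMap.smul_apply, MultilinearMap.alternatization_apply,
    MultilinearMap.domDomCongr_apply, multilinearProd_apply] at h3
  rw [eq_inv_smul_iff₀ (by positivity), h3]
  rfl

theorem wedge_add_left {p q : ℕ} (α α' : W [⋀^Fin p]→ₗ[ℝ] ℂ) (β : W [⋀^Fin q]→ₗ[ℝ] ℂ) :
    wedge (α + α') β = wedge α β + wedge α' β := by
  ext v
  simp only [AlternatingMap.add_apply, wedge_apply, add_mul, smul_add, Finset.sum_add_distrib]

theorem wedge_add_right {p q : ℕ} (α : W [⋀^Fin p]→ₗ[ℝ] ℂ) (β β' : W [⋀^Fin q]→ₗ[ℝ] ℂ) :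
    wedge α (β + β') = wedge α β + wedge α β' := by
  ext v
  simp only [AlternatingMap.add_apply, wedge_apply, mul_add, smul_add, Finset.sum_add_distrib]

theorem wedge_smul_left {p q : ℕ} (c : ℂ) (α : W [⋀^Fin p]→ₗ[ℝ] ℂ) (β : W [⋀^Fin q]→ₗ[ℝ] ℂ) :
    wedge (c • α) β = c • wedge α β := by
  ext v
  simp only [AlternatingMap.smul_apply, wedge_apply, smul_mul_assoc, smul_comm _ c,
    Finset.smul_sum]

theorem wedge_smul_right {p q : ℕ} (c : ℂ) (α : W [⋀^Fin p]→ₗ[ℝ] ℂ) (β : W [⋀^Fin q]→ₗ[ℝ] ℂ) :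
    wedge α (c • β) = c • wedge α β := by
  ext v
  simp only [AlternatingMap.smul_apply, wedge_apply, mul_smul_comm, smul_comm _ c,
    Finset.smul_sum]

/-- The exterior product as a bilinear map. -/
def wedgeLin (p q : ℕ) : (W [⋀^Fin p]→ₗ[ℝ] ℂ) →ₗ[ℂ] (W [⋀^Fin q]→ₗ[ℝ] ℂ) →ₗ[ℂ]
    (W [⋀^Fin (p + q)]→ₗ[ℝ] ℂ) :=
  LinearMap.mk₂ ℂ wedge wedge_add_left wedge_smul_left wedge_add_right wedge_smul_right

theorem wedgeLin_apply {p q : ℕ} (α : W [⋀^Fin p]→ₗ[ℝ] ℂ) (β : W [⋀^Fin q]→ₗ[ℝ] ℂ) :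
    wedgeLin p q α β = wedge α β := rfl

theorem wedge_sum_left {ι : Type*} {p q : ℕ} (s : Finset ι) (α : ι → W [⋀^Fin p]→ₗ[ℝ] ℂ)
    (β : W [⋀^Fin q]→ₗ[ℝ] ℂ) : wedge (∑ i ∈ s, α i) β = ∑ i ∈ s, wedge (α i) β := by
  simp only [← wedgeLin_apply, map_sum, LinearMap.sum_apply]

theorem wedge_sum_right {ι : Type*} {p q : ℕ} (s : Finset ι) (α : W [⋀^Fin p]→ₗ[ℝ] ℂ)
    (β : ι → W [⋀^Fin q]→ₗ[ℝ] ℂ) : wedge α (∑ i ∈ s, β i) = ∑ i ∈ s, wedge α (β i) := by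
  simp only [← wedgeLin_apply, map_sum]

@[simp]
theorem wedge_zero_left {p q : ℕ} (β : W [⋀^Fin q]→ₗ[ℝ] ℂ) :
    wedge (0 : W [⋀^Fin p]→ₗ[ℝ] ℂ) β = 0 := by
  simp only [← wedgeLin_apply, map_zero, LinearMap.zero_apply]

@[simp]
theorem wedge_zero_right {p q : ℕ} (α : W [⋀^Fin p]→ₗ[ℝ] ℂ) :
    wedge α (0 : W [⋀^Fin q]→ₗ[ℝ] ℂ) = 0 := by
  simp only [← wedgeLin_apply, map_zero]

theorem wedge_compLinearMap {V : Type*} [AddCommGroup V] [Module ℝ V] {p q : ℕ}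
    (α : W [⋀^Fin p]→ₗ[ℝ] ℂ) (β : W [⋀^Fin q]→ₗ[ℝ] ℂ) (L : V →ₗ[ℝ] W) :
    wedge (α.compLinearMap L) (β.compLinearMap L) = (wedge α β).compLinearMap L := by
  ext v
  simp only [AlternatingMap.compLinearMap_apply, wedge_apply]

/-- After lifting the three forms to multilinear ones, both sides alternate the same product of
three factors in consecutive blocks of variables. -/
theorem wedge_assoc {p q r : ℕ} (α : W [⋀^Fin p]→ₗ[ℝ] ℂ) (β : W [⋀^Fin q]→ₗ[ℝ] ℂ)
    (γ : W [⋀^Fin r]→ₗ[ℝ] ℂ) :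
    wedge (wedge α β) γ = castDeg (add_assoc p q r).symm (wedge α (wedge β γ)) := by
  obtain ⟨a, rfl⟩ := exists_alternatization_eq α
  obtain ⟨b, rfl⟩ := exists_alternatization_eq β
  obtain ⟨c, rfl⟩ := exists_alternatization_eq γ
  rw [wedge_alternatization, wedge_alternatization, wedge_alternatization, wedge_alternatization,
    castDeg, ← alternatization_domDomCongr]
  congr 1
  ext v
  simp only [multilinearProd_apply, MultilinearMap.domDomCongr_apply, mul_assoc]
  refine congrArg₂ _ (congrArg a (funext fun i => congrArg v (Fin.ext rfl)))
    (congrArg₂ _ (congrArg b (funext fun i => congrArg v (Fin.ext rfl)))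
      (congrArg c (funext fun i => congrArg v (Fin.ext ?_))))
  simp [add_assoc]

theorem val_finRotate : ∀ (N : ℕ) (j : Fin N), (finRotate N j).1 = (j.1 + 1) % N
  | 0, j => j.elim0
  | N + 1, j => by rw [finRotate_apply]; simp [Fin.val_add]

/-- The exchange of the two blocks is the q-th power of the long cycle, whose sign is (-1)^(p+q-1).
In the exponent (p+q-1)q = pq + q(q-1) the last summand is even. -/
theorem sign_finAddFlip_cast (p q : ℕ) :
    Equiv.Perm.sign (finAddFlip.trans (finCongr (add_comm q p)) : Equiv.Perm (Fin (p + q))) =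
      (-1) ^ (p * q) := by
  rcases Nat.eq_zero_or_pos q with rfl | hq
  · have : (finAddFlip.trans (finCongr (add_comm 0 p)) : Equiv.Perm (Fin (p + 0))) = 1 := by
      ext i
      have := finAddFlip_apply_mk_left (m := p) (n := 0) (k := i.1) i.2
      simp [this]
    rw [this]; simp
  · have key : (finAddFlip.trans (finCongr (add_comm q p)) : Equiv.Perm (Fin (p + q))) =
        finRotate (p + q) ^ q := by
      have hpow : ∀ k, k ≤ q → ∀ i : Fin (p + q),
          ((finRotate (p + q) ^ k) i).1 = (i.1 + k) % (p + q) := by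
        intro k hk
        induction k with
        | zero => intro i; simp [Nat.mod_eq_of_lt i.2]
        | succ k ih =>
          intro i
          rw [pow_succ', Equiv.Perm.mul_apply]
          rw [val_finRotate, ih (by omega) i, Nat.mod_add_mod, add_assoc]
      ext i
      rw [hpow q le_rfl]
      by_cases hi : i.1 < p
      · have := finAddFlip_apply_mk_left (n := q) hi
        simp only [Equiv.trans_apply, this, finCongr_apply, Fin.val_cast]
        rw [Nat.mod_eq_of_lt (by omega), add_comm]
      · have := finAddFlip_apply_mk_right (n := q) (m := p) (not_lt.1 hi) i.2
        simp only [Equiv.trans_apply, this, finCongr_apply, Fin.val_cast]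
        have : i.1 + q = (i.1 - p) + (p + q) := by omega
        rw [this, Nat.add_mod_right, Nat.mod_eq_of_lt (by omega)]
    rw [key, map_pow, sign_finRotate, ← pow_mul]
    have hq' : (p + q - 1) * q = p * q + q * (q - 1) := by
      obtain ⟨k, rfl⟩ : ∃ k, q = k + 1 := ⟨q - 1, by omega⟩
      simp only [← add_assoc, Nat.add_sub_cancel]; ring
    rw [hq', pow_add, (Nat.even_mul_pred_self q).neg_one_pow, mul_one]

theorem wedge_comm {p q : ℕ} (α : W [⋀^Fin p]→ₗ[ℝ] ℂ) (β : W [⋀^Fin q]→ₗ[ℝ] ℂ) :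
    wedge α β = (-1 : ℂ) ^ (p * q) • castDeg (add_comm q p) (wedge β α) := by
  obtain ⟨a, rfl⟩ := exists_alternatization_eq α
  obtain ⟨b, rfl⟩ := exists_alternatization_eq β
  rw [wedge_alternatization, wedge_alternatization]
  have h1 : multilinearProd b a = (multilinearProd a b).domDomCongr finAddFlip := by
    ext v
    simp only [multilinearProd_apply, MultilinearMap.domDomCongr_apply]
    rw [mul_comm]
    refine congrArg₂ _ (congrArg a (funext fun i => congrArg v ?_))
      (congrArg b (funext fun i => congrArg v ?_))
    · exact (finAddFlip_apply_castAdd i q).symm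
    · exact (finAddFlip_apply_natAdd i p).symm
  rw [h1, alternatization_domDomCongr, castDeg, ← AlternatingMap.domDomCongr_trans,
    AlternatingMap.domDomCongr_perm, sign_finAddFlip_cast]
  ext v
  -- The sign is produced in `ℤˣ` and wanted in `ℂ`; both are decided by the parity of `p * q`.
  rcases neg_one_pow_eq_or ℤˣ (p * q) with h | h <;>
  rcases neg_one_pow_eq_or ℂ (p * q) with h' | h' <;>
  rcases Nat.even_or_odd (p * q) with h'' | h'' <;>
  simp [h''.neg_one_pow]

theorem wedge_comm_of_even {p q : ℕ} (hp : Even p) (α : W [⋀^Fin p]→ₗ[ℝ] ℂ)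
    (β : W [⋀^Fin q]→ₗ[ℝ] ℂ) : wedge α β = castDeg (add_comm q p) (wedge β α) := by
  rw [wedge_comm, (hp.mul_right q).neg_one_pow, one_smul]

end WedgeAlgebra

end HermiteEinstein

namespace HermiteEinstein

/-! ### Products of linear forms as determinants -/

section ElementaryForms

variable {W : Type*} [AddCommGroup W] [Module ℝ W]

/-- The product of linear forms in separate variables. -/
def prodForm {k : ℕ} (l : Fin k → (W →ₗ[ℝ] ℂ)) : MultilinearMap ℝ (fun _ : Fin k => W) ℂ :=
  (MultilinearMap.mkPiAlgebra ℝ (Fin k) ℂ).compLinearMap l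

theorem prodForm_apply {k : ℕ} (l : Fin k → (W →ₗ[ℝ] ℂ)) (v : Fin k → W) :
    prodForm l v = ∏ i, l i (v i) := by
  simp [prodForm]

theorem multilinearProd_prodForm {p q : ℕ} (l : Fin p → (W →ₗ[ℝ] ℂ)) (l' : Fin q → (W →ₗ[ℝ] ℂ)) :
    multilinearProd (prodForm l) (prodForm l') = prodForm (Fin.append l l') := by
  ext v
  simp [multilinearProd_apply, prodForm_apply, Fin.prod_univ_add]

/-- This determinant (rows are vectors, columns are linear forms) turns vanishing and positivity of
elementary forms into statements about matrices. -/
theorem alternatization_prodForm_apply {k : ℕ} (l : Fin k → (W →ₗ[ℝ] ℂ)) (v : Fin k → W) :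
    MultilinearMap.alternatization (prodForm l) v =
      (Matrix.of fun j i => l i (v j) : Matrix (Fin k) (Fin k) ℂ).det := by
  simp [MultilinearMap.alternatization_apply, Matrix.det_apply, prodForm_apply]

theorem oneForm_eq_alternatization (l : W →ₗ[ℝ] ℂ) :
    oneForm l = MultilinearMap.alternatization (prodForm fun _ : Fin 1 => l) := by
  ext v
  rw [alternatization_prodForm_apply]
  simp [oneForm]

theorem wedge_oneForm_apply (l l' : W →ₗ[ℝ] ℂ) (v : Fin 2 → W) :
    wedge (oneForm l) (oneForm l') v = l (v 0) * l' (v 1) - l (v 1) * l' (v 0) := by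
  have h : wedge (oneForm l) (oneForm l') v =
      MultilinearMap.alternatization (prodForm (Fin.append (fun _ : Fin 1 => l)
        (fun _ : Fin 1 => l'))) v := by
    rw [oneForm_eq_alternatization, oneForm_eq_alternatization, wedge_alternatization,
      multilinearProd_prodForm]
  rw [h, alternatization_prodForm_apply]
  -- The index type is `Fin (1 + 1)`, which is `Fin 2` only up to unfolding.
  erw [Matrix.det_fin_two]
  simp only [Matrix.of_apply]
  have h0 : Fin.append (fun _ : Fin 1 => l) (fun _ : Fin 1 => l') 0 = l := rfl
  have h1 : Fin.append (fun _ : Fin 1 => l) (fun _ : Fin 1 => l') 1 = l' := rfl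
  erw [h0, h1]
  ring

end ElementaryForms

/-! ### Elementary positive forms -/

section Positivity

variable {n : ℕ}

/-- The `(1,1)`-form `i b ∧ conj b`. -/
def elementaryTwoForm (b : Cn n →ₗ[ℂ] ℂ) : Cn n [⋀^Fin 2]→ₗ[ℝ] ℂ :=
  Complex.I • wedge (oneForm (b.restrictScalars ℝ)) (oneForm (conjForm b))

theorem elementaryTwoForm_apply (b : Cn n →ₗ[ℂ] ℂ) (v : Fin 2 → Cn n) :
    elementaryTwoForm b v =
      Complex.I * (b (v 0) * conj (b (v 1)) - b (v 1) * conj (b (v 0))) := by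
  rw [elementaryTwoForm, AlternatingMap.smul_apply, wedge_oneForm_apply]
  rfl

theorem elementaryPositive_succ {k : ℕ} (a : Fin (k + 1) → (Cn n →ₗ[ℂ] ℂ)) :
    elementaryPositive (k + 1) a =
      wedge (elementaryPositive k fun j => a j.castSucc) (elementaryTwoForm (a (Fin.last k))) :=
  rfl

/-- The list `a₁, conj a₁, …, a_k, conj a_k`. -/
def conjPairs {k : ℕ} (a : Fin k → (Cn n →ₗ[ℂ] ℂ)) (j : Fin (2 * k)) : Cn n →ₗ[ℝ] ℂ :=
  if j.1 % 2 = 0 then (a ⟨j.1 / 2, by omega⟩).restrictScalars ℝ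
  else conjForm (a ⟨j.1 / 2, by omega⟩)

/-- Each factor contributes one i, and the wedges concatenate the pairs into the single list a₁, ā₁,
…, a_k, ā_k. -/
theorem elementaryPositive_eq_alternatization (k : ℕ) (a : Fin k → (Cn n →ₗ[ℂ] ℂ)) :
    elementaryPositive k a =
      Complex.I ^ k • MultilinearMap.alternatization (prodForm (conjPairs a)) := by
  induction k with
  | zero =>
    ext v
    rw [AlternatingMap.smul_apply, alternatization_prodForm_apply]
    simp only [elementaryPositive, AlternatingMap.constOfIsEmpty_apply, pow_zero, one_smul]
    exact (Matrix.det_isEmpty (n := Fin 0)).symm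
  | succ k ih =>
    rw [elementaryPositive_succ, ih, elementaryTwoForm, wedge_smul_left, wedge_smul_right,
      oneForm_eq_alternatization, oneForm_eq_alternatization, wedge_alternatization,
      wedge_alternatization, multilinearProd_prodForm, multilinearProd_prodForm, smul_smul,
      ← pow_succ]
    congr 3
    funext j
    have hj : j.1 < 2 * k + (1 + 1) := j.2
    -- An index lies in the first k pairs, or is the holomorphic entry 2k or the conjugate entry 2k
    -- + 1 of the last pair.
    by_cases h1 : j.1 < 2 * k
    · have : j = Fin.castAdd (1 + 1) ⟨j.1, h1⟩ := rfl
      rw [this]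
      erw [Fin.append_left]
      simp only [conjPairs, Fin.val_castAdd]
      rfl
    · by_cases h2 : j.1 = 2 * k
      · have : j = Fin.natAdd (2 * k) (Fin.castAdd 1 0 : Fin (1 + 1)) := Fin.ext h2
        rw [this]
        erw [Fin.append_right, Fin.append_left]
        have h3 : (Fin.natAdd (2 * k) (Fin.castAdd 1 0 : Fin (1 + 1))).1 = 2 * k := rfl
        unfold conjPairs
        simp only [h3, Nat.mul_mod_right, if_true]
        congr 2
        exact Fin.ext (show k = 2 * k / 2 by omega)
      · have : j = Fin.natAdd (2 * k) (Fin.natAdd 1 0 : Fin (1 + 1)) :=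
          Fin.ext (show j.1 = 2 * k + 1 by omega)
        rw [this]
        erw [Fin.append_right, Fin.append_right]
        have h3 : (Fin.natAdd (2 * k) (Fin.natAdd 1 0 : Fin (1 + 1))).1 = 2 * k + 1 := rfl
        unfold conjPairs
        have h4 : ¬ ((2 * k + 1) % 2 = 0) := by omega
        simp only [h3, h4, if_false]
        congr 2
        exact Fin.ext (show k = (2 * k + 1) / 2 by omega)

/-- The splitting of an index of a list of `k` pairs. -/
def pairEquiv (k : ℕ) : Fin k × Fin 2 ≃ Fin (2 * k) :=
  finProdFinEquiv.trans (finCongr (mul_comm k 2))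

theorem pairEquiv_val {k : ℕ} (x : Fin k × Fin 2) : (pairEquiv k x).1 = x.2.1 + 2 * x.1.1 := rfl

theorem conjPairs_pairEquiv_zero {k : ℕ} (a : Fin k → (Cn n →ₗ[ℂ] ℂ)) (j : Fin k) (v : Cn n) :
    conjPairs a (pairEquiv k (j, 0)) v = a j v := by
  have h : (pairEquiv k (j, 0)).1 = 2 * j.1 := by simp [pairEquiv_val]
  have h2 : (⟨2 * j.1 / 2, by omega⟩ : Fin k) = j := Fin.ext (by simp)
  simp [conjPairs, h]

theorem conjPairs_pairEquiv_one {k : ℕ} (a : Fin k → (Cn n →ₗ[ℂ] ℂ)) (j : Fin k) (v : Cn n) :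
    conjPairs a (pairEquiv k (j, 1)) v = conj (a j v) := by
  have h : (pairEquiv k (j, 1)).1 = 1 + 2 * j.1 := by simp [pairEquiv_val]
  have h2 : (⟨(1 + 2 * j.1) / 2, by omega⟩ : Fin k) = j :=
    Fin.ext (show (1 + 2 * j.1) / 2 = j.1 by omega)
  have h3 : ¬ ((1 + 2 * j.1) % 2 = 0) := by omega
  simp only [conjPairs, h, h3, if_false, h2]
  rfl

theorem elementaryPositive_eq_zero {k : ℕ} (a : Fin k → (Cn n →ₗ[ℂ] ℂ))
    (ha : ¬ LinearIndependent ℂ a) : elementaryPositive k a = 0 := by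
  rw [elementaryPositive_eq_alternatization]
  ext v
  rw [AlternatingMap.smul_apply, alternatization_prodForm_apply]
  obtain ⟨c, hc, j, hj⟩ := Fintype.not_linearIndependent_iff.1 ha
  have hdet : (Matrix.of fun j i => conjPairs a i (v j) : Matrix _ _ ℂ).det = 0 := by
    rw [← Matrix.exists_mulVec_eq_zero_iff]
    -- A relation among the a_j is a relation among the columns in even position; the coefficients
    -- of the conjugate columns are taken to be 0.
    refine ⟨fun i => if ((pairEquiv k).symm i).2 = 0 then c ((pairEquiv k).symm i).1 else 0,
      fun h => hj ?_, ?_⟩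
    · simpa using congrFun h (pairEquiv k (j, 0))
    · funext i
      rw [Matrix.mulVec, dotProduct, ← (pairEquiv k).sum_comp, Fintype.sum_prod_type]
      simp only [Equiv.symm_apply_apply, Fin.sum_univ_two, Matrix.of_apply,
        conjPairs_pairEquiv_zero]
      have := congrArg (fun f : Cn n →ₗ[ℂ] ℂ => f (v i)) hc
      simp only [LinearMap.sum_apply, LinearMap.smul_apply, smul_eq_mul, LinearMap.zero_apply]
        at this
      simp [mul_comm, this]
  rw [hdet]
  simp

-- On the frame (e_j, i e_j) the matrix of the list (a_j, ā_j) is the product of n copies of the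
-- block (1, 1; i, -i) with the block diagonal matrix of A and its conjugate. Its determinant is
-- (-2i)^n |det A|², and the prefactor i^n turns (-2i)^n into 2^n.
open scoped Kronecker in
theorem topCoeff_elementaryPositive (a : Fin n → (Cn n →ₗ[ℂ] ℂ)) :
    topCoeff (elementaryPositive n a) =
      ((2 ^ n * Complex.normSq (Matrix.of fun i j => a j (Pi.single i 1)).det : ℝ) : ℂ) := by
  set A : Matrix (Fin n) (Fin n) ℂ := Matrix.of fun i j => a j (Pi.single i 1) with hA
  rw [topCoeff, elementaryPositive_eq_alternatization, AlternatingMap.smul_apply,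
    alternatization_prodForm_apply, ← Matrix.det_submatrix_equiv_self (pairEquiv n)]
  have key : (Matrix.of fun j i => conjPairs a i (orientedFrame n j) : Matrix _ _ ℂ).submatrix
      (pairEquiv n) (pairEquiv n) =
      ((1 : Matrix (Fin n) (Fin n) ℂ) ⊗ₖ !![1, 1; Complex.I, -Complex.I]) *
        Matrix.blockDiagonal ![A, A.map conj] := by
    ext ⟨j, t⟩ ⟨i, u⟩
    have hfr : ∀ t : Fin 2, orientedFrame n (pairEquiv n (j, t)) =
        (![1, Complex.I] t : ℂ) • (Pi.single j (1 : ℂ) : Cn n) := by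
      intro t
      have h : (pairEquiv n (j, t)).1 = t.1 + 2 * j.1 := rfl
      have h2 : (⟨(t.1 + 2 * j.1) / 2, by omega⟩ : Fin n) = j :=
        Fin.ext (show (t.1 + 2 * j.1) / 2 = j.1 by omega)
      rw [orientedFrame]
      simp only [h, h2]
      rw [← Pi.single_smul]
      fin_cases t
      · simp
      · have h3 : ¬ ((1 + 2 * j.1) % 2 = 0) := by omega
        simp
    simp only [Matrix.submatrix_apply, Matrix.of_apply, Matrix.mul_apply, Fintype.sum_prod_type,
      Matrix.kronecker_apply, Matrix.blockDiagonal_apply, Matrix.one_apply]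
    fin_cases u
    · simp only [Fin.zero_eta, conjPairs_pairEquiv_zero, hfr]
      fin_cases t <;> simp [hA]
    · simp only [Fin.mk_one, conjPairs_pairEquiv_one, hfr]
      fin_cases t <;> simp [hA]
  rw [key, Matrix.det_mul, Matrix.det_kronecker, Matrix.det_blockDiagonal]
  have hconj : (A.map conj).det = conj A.det := (RingHom.map_det (starRingEnd ℂ) A).symm
  simp only [Matrix.det_one, one_pow, one_mul, Matrix.det_fin_two_of, Fin.prod_univ_two,
    Matrix.cons_val_zero, Matrix.cons_val_one, hconj, Fintype.card_fin, Complex.mul_conj,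
    smul_eq_mul, ← mul_assoc, ← mul_pow]
  have : Complex.I * (-Complex.I - Complex.I) = 2 := by
    linear_combination (-2 : ℂ) * Complex.I_mul_I
  simp [this]

/-- Multinomial expansion. The sum runs over all maps J, repetitions included; the terms with
dependent covectors are removed later by `elementaryPositive_eq_zero`. -/
theorem wedgePow_sum_elementaryTwoForm {ι : Type*} [Fintype ι] (a : ι → (Cn n →ₗ[ℂ] ℂ)) (k : ℕ) :
    wedgePow (∑ j, elementaryTwoForm (a j)) k =
      ∑ J : Fin k → ι, elementaryPositive k (a ∘ J) := by
  induction k with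
  | zero => simp [wedgePow, elementaryPositive]
  | succ k ih =>
    rw [wedgePow, ih, wedge_sum_right, ← (Fin.snocEquiv fun _ => ι).sum_comp,
      Fintype.sum_prod_type]
    refine Finset.sum_congr rfl fun j _ => ?_
    rw [wedge_sum_left]
    refine Finset.sum_congr rfl fun J _ => ?_
    rw [elementaryPositive_succ]
    simp [Fin.snocEquiv, Function.comp_def]

end Positivity

end HermiteEinstein

namespace HermiteEinstein

/-! ### Forms of type (1,1) and positivity of α ∧ ω^{m-1} ∧ Ω -/

section Positivity

variable {n : ℕ}

theorem twoForm_ext {W : Type*} [AddCommGroup W] [Module ℝ W] {α β : W [⋀^Fin 2]→ₗ[ℝ] ℂ}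
    (h : ∀ v w, α ![v, w] = β ![v, w]) : α = β := by
  ext u
  have : u = ![u 0, u 1] := by
    funext i; fin_cases i <;> rfl
  rw [this]
  exact h _ _

theorem twoForm_add_left {W : Type*} [AddCommGroup W] [Module ℝ W] (α : W [⋀^Fin 2]→ₗ[ℝ] ℂ)
    (u v w : W) : α ![u + v, w] = α ![u, w] + α ![v, w] :=
  α.map_vecCons_add ![w] u v

theorem twoForm_swap {W : Type*} [AddCommGroup W] [Module ℝ W] (α : W [⋀^Fin 2]→ₗ[ℝ] ℂ)
    (v w : W) : α ![v, w] = -α ![w, v] := by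
  have h := α.map_swap ![w, v] (show (0 : Fin 2) ≠ 1 by decide)
  rw [← h]
  congr 1
  funext i
  fin_cases i <;> simp

theorem twoForm_add_right {W : Type*} [AddCommGroup W] [Module ℝ W] (α : W [⋀^Fin 2]→ₗ[ℝ] ℂ)
    (u v w : W) : α ![w, u + v] = α ![w, u] + α ![w, v] := by
  rw [twoForm_swap, twoForm_add_left, twoForm_swap α u, twoForm_swap α v]; ring

theorem twoForm_smul_left {W : Type*} [AddCommGroup W] [Module ℝ W] (α : W [⋀^Fin 2]→ₗ[ℝ] ℂ)
    (c : ℝ) (v w : W) : α ![c • v, w] = c * α ![v, w] := by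
  have := α.map_vecCons_smul ![w] c v
  rw [Complex.real_smul] at this
  exact this

theorem twoForm_smul_right {W : Type*} [AddCommGroup W] [Module ℝ W] (α : W [⋀^Fin 2]→ₗ[ℝ] ℂ)
    (c : ℝ) (v w : W) : α ![v, c • w] = c * α ![v, w] := by
  rw [twoForm_swap, twoForm_smul_left, twoForm_swap α w]; ring

theorem IsOfType.apply_I_smul {ω : Cn n [⋀^Fin 2]→ₗ[ℝ] ℂ} (h : IsOfType 1 1 ω) (v w : Cn n) :
    ω ![Complex.I • v, Complex.I • w] = ω ![v, w] := by
  have := h.2 Complex.I ![v, w]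
  have h2 : (fun j => Complex.I • ![v, w] j) = ![Complex.I • v, Complex.I • w] := by
    funext i; fin_cases i <;> rfl
  rw [h2] at this
  rw [this]
  simp

theorem IsOfType.apply_I_smul_left {ω : Cn n [⋀^Fin 2]→ₗ[ℝ] ℂ} (h : IsOfType 1 1 ω)
    (v w : Cn n) : ω ![Complex.I • v, w] = -ω ![v, Complex.I • w] := by
  rw [← h.apply_I_smul v (Complex.I • w), smul_smul, Complex.I_mul_I, neg_one_smul]
  have := twoForm_smul_right ω (-1) (Complex.I • v) w
  rw [neg_one_smul] at this
  rw [this]; simp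

/-- The sesquilinear form attached to a form of type `(1,1)`. -/
def sesqForm (ω : Cn n [⋀^Fin 2]→ₗ[ℝ] ℂ) (v w : Cn n) : ℂ :=
  (1 / 2) * (ω ![v, Complex.I • w] + Complex.I * ω ![v, w])

theorem complex_smul_eq (c : ℂ) (v : Cn n) : c • v = c.re • v + c.im • (Complex.I • v) := by
  conv_lhs => rw [← Complex.re_add_im c]
  rw [add_smul, mul_smul]
  simp only [Complex.coe_smul]

/-- Recovers the (1,1)-form from its sesquilinear form, so that a diagonalization of the latter
yields a decomposition of the former. -/
theorem sesqForm_sub {ω : Cn n [⋀^Fin 2]→ₗ[ℝ] ℂ} (h : IsOfType 1 1 ω) (v w : Cn n) :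
    Complex.I * (sesqForm ω w v - sesqForm ω v w) = ω ![v, w] := by
  have h1 : ω ![w, Complex.I • v] = ω ![v, Complex.I • w] := by
    rw [twoForm_swap, h.apply_I_smul_left]; ring
  rw [sesqForm, sesqForm, h1, twoForm_swap ω w v]
  linear_combination (-ω ![v, w]) * Complex.I_mul_I

/-- The sesquilinear form attached to a form of type `(1,1)`, as a bundled map. -/
def sesqLin {ω : Cn n [⋀^Fin 2]→ₗ[ℝ] ℂ} (h : IsOfType 1 1 ω) : Cn n →ₗ⋆[ℂ] Cn n →ₗ[ℂ] ℂ :=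
  LinearMap.mk₂'ₛₗ (starRingEnd ℂ) (RingHom.id ℂ) (sesqForm ω)
    (fun u v w => by simp only [sesqForm, twoForm_add_left]; ring)
    (fun c v w => by
      have hI : ω ![Complex.I • v, w] = -ω ![v, Complex.I • w] := h.apply_I_smul_left v w
      simp only [sesqForm, complex_smul_eq c, twoForm_add_left, twoForm_smul_left,
        h.apply_I_smul, hI, smul_eq_mul]
      have hc : conj c = c.re - c.im * Complex.I := by
        conv_lhs => rw [← Complex.re_add_im c]
        simp only [map_add, map_mul, Complex.conj_ofReal, Complex.conj_I]; ring
      rw [hc]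
      linear_combination ((1 / 2) * (c.im : ℂ) * (ω ![v, w])) * Complex.I_mul_I)
    (fun u v w => by simp only [sesqForm, smul_add, twoForm_add_right]; ring)
    (fun c v w => by
      have h1 : ω ![v, Complex.I • Complex.I • w] = -ω ![v, w] := by
        rw [smul_smul, Complex.I_mul_I]
        have := twoForm_smul_right ω (-1) v w
        rw [neg_one_smul] at this
        rw [neg_one_smul, this]; simp
      have hc := (Complex.re_add_im c).symm
      have h2 : ω ![v, c • w] = c.re * ω ![v, w] + c.im * ω ![v, Complex.I • w] := by
        rw [complex_smul_eq, twoForm_add_right, twoForm_smul_right, twoForm_smul_right]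
      have h3 : ω ![v, Complex.I • c • w] = c.re * ω ![v, Complex.I • w] - c.im * ω ![v, w] := by
        rw [smul_comm, complex_smul_eq, twoForm_add_right, twoForm_smul_right, twoForm_smul_right,
          h1]
        ring
      simp only [sesqForm, h2, h3, smul_eq_mul, RingHom.id_apply]
      conv_rhs => rw [hc]
      linear_combination (-(1 / 2) * (c.im : ℂ) * (ω ![v, w])) * Complex.I_mul_I)

open scoped ComplexOrder Matrix MatrixOrder in
/-- A positive definite matrix is of the form `Rᴴ * R` with `R` invertible. -/
theorem posDef_exists_conjTranspose_mul_self {k : ℕ} {M : Matrix (Fin k) (Fin k) ℂ}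
    (hM : M.PosDef) : ∃ R : Matrix (Fin k) (Fin k) ℂ, IsUnit R.det ∧ M = Rᴴ * R := by
  obtain ⟨R, hR⟩ := CStarAlgebra.nonneg_iff_eq_star_mul_self.mp hM.posSemidef.nonneg
  refine ⟨R, ?_, hR⟩
  have h1 := hM.isUnit
  rw [Matrix.isUnit_iff_isUnit_det, hR, Matrix.det_mul] at h1
  exact (IsUnit.mul_iff.1 h1).2

open scoped ComplexOrder Matrix in
/-- A positive form of type `(1,1)` is a sum of elementary forms. -/
theorem exists_diagonalization {ω : Cn n [⋀^Fin 2]→ₗ[ℝ] ℂ} (hreal : IsRealForm ω)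
    (htype : IsOfType 1 1 ω) (hpos : ∀ v : Cn n, v ≠ 0 → 0 < (ω ![v, Complex.I • v]).re) :
    ∃ a : Fin n → (Cn n →ₗ[ℂ] ℂ), LinearIndependent ℂ a ∧
      IsUnit (Matrix.of fun i j => a j (Pi.single i 1)).det ∧
      ω = ∑ j, elementaryTwoForm (a j) := by
  set h := sesqLin htype with hh
  have happ : ∀ v w, h v w = sesqForm ω v w := fun v w => rfl
  set M : Matrix (Fin n) (Fin n) ℂ := Matrix.of fun i j => h (Pi.single i 1) (Pi.single j 1)
    with hM
  have hexp : ∀ v w, h v w = star v ⬝ᵥ (M *ᵥ w) := by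
    intro v w
    conv_lhs => rw [pi_eq_sum_univ' v, pi_eq_sum_univ' w]
    simp only [map_sum, LinearMap.map_smulₛₗ, LinearMap.sum_apply, LinearMap.smul_apply,
      smul_eq_mul, dotProduct, Matrix.mulVec, hM, Matrix.of_apply, Finset.mul_sum,
      Pi.star_apply, RingHom.id_apply]
    rw [Finset.sum_comm]
    refine Finset.sum_congr rfl fun i _ => Finset.sum_congr rfl fun j _ => ?_
    simp only [starRingEnd_apply]
    ring
  have hsymm : ∀ v w, conj (h v w) = h w v := by
    intro v w
    have h1 : ω ![w, Complex.I • v] = ω ![v, Complex.I • w] := by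
      rw [twoForm_swap, htype.apply_I_smul_left]; ring
    rw [happ, happ, sesqForm, sesqForm, h1, twoForm_swap ω w v]
    simp only [map_mul, map_add, hreal _, Complex.conj_I, map_div₀, map_one, Complex.conj_ofNat]
    ring
  have hMpos : M.PosDef := by
    refine Matrix.PosDef.of_dotProduct_mulVec_pos ?_ ?_
    · ext i j
      rw [Matrix.conjTranspose_apply, hM, Matrix.of_apply, Matrix.of_apply, ← starRingEnd_apply,
        hsymm]
    · intro v hv
      rw [← hexp, Complex.pos_iff]
      refine ⟨?_, ?_⟩
      -- On the diagonal only the term ω(v, iv)/2 of the sesquilinear form survives.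
      · have h0 : ω ![v, v] = 0 := ω.map_eq_zero_of_eq ![v, v] (i := 0) (j := 1) rfl (by decide)
        have := hpos v hv
        rw [happ, sesqForm, h0]
        simpa using this
      · exact (Complex.conj_eq_iff_im.1 (hsymm v v)).symm
  obtain ⟨R, hRu, hR⟩ := posDef_exists_conjTranspose_mul_self hMpos
  have happR : ∀ j i, Matrix.mulVecLin R (Pi.single i 1) j = R j i := by
    intro j i; simp
  -- With M = Rᴴ R the covectors are the rows of R, and h(v, w) is the sum of the products of the
  -- conjugates of (R v)_j with (R w)_j.
  refine ⟨fun j => (LinearMap.proj j).comp (Matrix.mulVecLin R), ?_, ?_, ?_⟩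
  · rw [Fintype.linearIndependent_iff]
    intro c hc j
    have h1 : c ᵥ* R = 0 := by
      funext i
      have := congrArg (fun f : Cn n →ₗ[ℂ] ℂ => f (Pi.single i 1)) hc
      simpa [Matrix.vecMul, dotProduct] using this
    have h2 := Matrix.eq_zero_of_vecMul_eq_zero hRu.ne_zero h1
    exact congrFun h2 j
  · have : (Matrix.of fun i j => ((LinearMap.proj j).comp (Matrix.mulVecLin R) : Cn n →ₗ[ℂ] ℂ)
        (Pi.single i 1)) = Rᵀ := by
      ext i j; simp
    rw [this, Matrix.det_transpose]
    exact hRu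
  · refine twoForm_ext fun v w => ?_
    have key : ∀ v w, sesqForm ω v w = ∑ j, conj ((R *ᵥ v) j) * (R *ᵥ w) j := by
      intro v w
      rw [← happ, hexp, hR, ← Matrix.mulVec_mulVec, Matrix.dotProduct_mulVec,
        ← Matrix.star_mulVec]
      rfl
    rw [← sesqForm_sub htype, key, key, form_sum_apply, ← Finset.sum_sub_distrib,
      Finset.mul_sum]
    refine Finset.sum_congr rfl fun j _ => ?_
    rw [elementaryTwoForm_apply]
    simp only [Matrix.cons_val_zero, Matrix.cons_val_one, LinearMap.comp_apply,
      LinearMap.proj_apply, Matrix.mulVecLin_apply]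
    ring

theorem topCoeff_add (α β : Cn n [⋀^Fin (2 * n)]→ₗ[ℝ] ℂ) :
    topCoeff (α + β) = topCoeff α + topCoeff β := rfl

theorem topCoeff_smul (c : ℂ) (α : Cn n [⋀^Fin (2 * n)]→ₗ[ℝ] ℂ) :
    topCoeff (c • α) = c * topCoeff α := rfl

theorem topCoeff_sum {ι : Type*} (s : Finset ι) (α : ι → Cn n [⋀^Fin (2 * n)]→ₗ[ℝ] ℂ) :
    topCoeff (∑ i ∈ s, α i) = ∑ i ∈ s, topCoeff (α i) := by
  exact form_sum_apply s α _

/-- The volume form of a positive `(1,1)`-form is positive. -/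
theorem topCoeff_volumeForm_pos {ω : Cn n [⋀^Fin 2]→ₗ[ℝ] ℂ} (hreal : IsRealForm ω)
    (htype : IsOfType 1 1 ω) (hpos : ∀ v : Cn n, v ≠ 0 → 0 < (ω ![v, Complex.I • v]).re) :
    ∃ t : ℝ, 0 < t ∧ topCoeff (volumeForm ω) = (t : ℂ) := by
  obtain ⟨a, -, hu, rfl⟩ := exists_diagonalization hreal htype hpos
  refine ⟨(n.factorial : ℝ)⁻¹ * ∑ J : Fin n → Fin n, 2 ^ n *
    Complex.normSq (Matrix.of fun i j => (a ∘ J) j (Pi.single i 1)).det, ?_, ?_⟩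
  -- All summands are nonnegative, and the one of `J = id` is positive because the a_j are
  -- independent.
  · refine mul_pos (by positivity) (Finset.sum_pos' (fun J _ => ?_) ⟨id, Finset.mem_univ _, ?_⟩)
    · exact mul_nonneg (by positivity) (Complex.normSq_nonneg _)
    · exact mul_pos (by positivity) (Complex.normSq_pos.2 hu.ne_zero)
  · rw [volumeForm, wedgePow_sum_elementaryTwoForm, topCoeff_smul, topCoeff_sum]
    simp only [topCoeff_elementaryPositive]
    push_cast
    rfl

theorem topProduct_add {m : ℕ} (hm : 1 ≤ m) (hmn : m ≤ n) (ω : Cn n [⋀^Fin 2]→ₗ[ℝ] ℂ)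
    (Ω : Cn n [⋀^Fin (2 * (n - m))]→ₗ[ℝ] ℂ) (α β : Cn n [⋀^Fin 2]→ₗ[ℝ] ℂ) :
    topProduct hm hmn ω Ω (α + β) = topProduct hm hmn ω Ω α + topProduct hm hmn ω Ω β := by
  simp only [topProduct, wedge_add_left, AlternatingMap.domDomCongr_add]

theorem topProduct_smul {m : ℕ} (hm : 1 ≤ m) (hmn : m ≤ n) (ω : Cn n [⋀^Fin 2]→ₗ[ℝ] ℂ)
    (Ω : Cn n [⋀^Fin (2 * (n - m))]→ₗ[ℝ] ℂ) (c : ℂ) (α : Cn n [⋀^Fin 2]→ₗ[ℝ] ℂ) :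
    topProduct hm hmn ω Ω (c • α) = c • topProduct hm hmn ω Ω α := by
  simp only [topProduct, wedge_smul_left, AlternatingMap.domDomCongr_smul]

/-- The linear map `α ↦ α ∧ ω^{m-1} ∧ Ω`. -/
def topProductLin {m : ℕ} (hm : 1 ≤ m) (hmn : m ≤ n) (ω : Cn n [⋀^Fin 2]→ₗ[ℝ] ℂ)
    (Ω : Cn n [⋀^Fin (2 * (n - m))]→ₗ[ℝ] ℂ) :
    (Cn n [⋀^Fin 2]→ₗ[ℝ] ℂ) →ₗ[ℂ] (Cn n [⋀^Fin (2 * n)]→ₗ[ℝ] ℂ) where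
  toFun := topProduct hm hmn ω Ω
  map_add' := topProduct_add hm hmn ω Ω
  map_smul' := topProduct_smul hm hmn ω Ω

theorem topProduct_sum {m : ℕ} (hm : 1 ≤ m) (hmn : m ≤ n) (ω : Cn n [⋀^Fin 2]→ₗ[ℝ] ℂ)
    (Ω : Cn n [⋀^Fin (2 * (n - m))]→ₗ[ℝ] ℂ) {ι : Type*} (s : Finset ι)
    (α : ι → Cn n [⋀^Fin 2]→ₗ[ℝ] ℂ) :
    topProduct hm hmn ω Ω (∑ i ∈ s, α i) = ∑ i ∈ s, topProduct hm hmn ω Ω (α i) :=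
  map_sum (topProductLin hm hmn ω Ω) α s

/-- All factors have even degree and commute; this is the order in which weak positivity is
formulated. -/
theorem topProduct_eq_wedge_wedge {k : ℕ} (hm : 1 ≤ k + 1) (hmn : k + 1 ≤ n)
    (ω : Cn n [⋀^Fin 2]→ₗ[ℝ] ℂ) (Ω : Cn n [⋀^Fin (2 * (n - (k + 1)))]→ₗ[ℝ] ℂ)
    (α : Cn n [⋀^Fin 2]→ₗ[ℝ] ℂ) :
    topProduct hm hmn ω Ω α =
      castDeg (show 2 * (n - (k + 1)) + 2 * (k + 1) = 2 * n by omega)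
        (wedge Ω (wedge (wedgePow ω k) α)) := by
  rw [wedge_comm_of_even (even_two_mul _) Ω, wedge_comm_of_even (even_two_mul _) (wedgePow ω k)]
  erw [wedge_castDeg_left]
  rfl

open scoped Classical in
/-- Any nonzero vector can be completed by members of a basis. -/
theorem exists_linearIndependent_snoc {k : ℕ} (hk : k + 1 ≤ n) {a : Fin n → (Cn n →ₗ[ℂ] ℂ)}
    (ha : LinearIndependent ℂ a) {b : Cn n →ₗ[ℂ] ℂ} (hb : b ≠ 0) :
    ∃ J : Fin k → Fin n, LinearIndependent ℂ (Fin.snoc (α := fun _ => Cn n →ₗ[ℂ] ℂ) (a ∘ J) b) := by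
  have hcard : Fintype.card (Fin n) = Module.finrank ℂ (Cn n →ₗ[ℂ] ℂ) := by
    simp
  have : Nonempty (Fin n) := ⟨⟨0, by omega⟩⟩
  let B := basisOfLinearIndependentOfCardEqFinrank ha hcard
  have hB : ∀ i, B i = a i := fun i => by simp [B]
  -- The members to be chosen avoid a coordinate j₀ in which b is nonzero: their span lies in the
  -- kernel of that coordinate function, and b does not.
  obtain ⟨j₀, hj₀⟩ : ∃ j, B.repr b j ≠ 0 := by
    by_contra hcon
    push Not at hcon
    exact hb (B.repr.map_eq_zero_iff.1 (Finsupp.ext hcon))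
  have hJ : Nonempty (Fin k ↪ {j : Fin n // j ≠ j₀}) := by
    apply Function.Embedding.nonempty_of_card_le
    simp
    omega
  obtain ⟨J⟩ := hJ
  refine ⟨fun i => (J i).1, ?_⟩
  rw [linearIndependent_finSnoc]
  refine ⟨ha.comp _ fun i j h => J.injective (Subtype.ext h), fun hmem => hj₀ ?_⟩
  have hle : Submodule.span ℂ (Set.range (a ∘ fun i => (J i).1)) ≤
      LinearMap.ker (B.coord j₀) := by
    rw [Submodule.span_le]
    rintro _ ⟨i, rfl⟩
    simp only [Function.comp_apply, SetLike.mem_coe, LinearMap.mem_ker, ← hB, Module.Basis.coord_apply,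
      Module.Basis.repr_self]
    exact Finsupp.single_eq_of_ne (J i).2.symm
  exact hle hmem

/-- Positivity of `i b ∧ conj b ∧ ω^{m-1} ∧ Ω`. -/
theorem topProduct_elementaryTwoForm {m : ℕ} (hm : 1 ≤ m) (hmn : m ≤ n)
    {ω : Cn n [⋀^Fin 2]→ₗ[ℝ] ℂ} (hreal : IsRealForm ω)
    (htype : IsOfType 1 1 ω) (hpos : ∀ v : Cn n, v ≠ 0 → 0 < (ω ![v, Complex.I • v]).re)
    {Ω : Cn n [⋀^Fin (2 * (n - m))]→ₗ[ℝ] ℂ} (hΩ : IsWeaklyPositive hmn Ω) (b : Cn n →ₗ[ℂ] ℂ) :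
    ∃ t : ℝ, 0 ≤ t ∧ (t = 0 → b = 0) ∧
      topCoeff (topProduct hm hmn ω Ω (elementaryTwoForm b)) = (t : ℂ) := by
  obtain ⟨k, rfl⟩ : ∃ k, m = k + 1 := ⟨m - 1, by omega⟩
  obtain ⟨a, ha, -, rfl⟩ := exists_diagonalization hreal htype hpos
  -- Expanding ω^k and appending b gives one family of k + 1 = m covectors for every J; weak
  -- positivity applies to the independent ones, and the others contribute 0.
  set F : (Fin k → Fin n) → (Fin (k + 1) → (Cn n →ₗ[ℂ] ℂ)) := fun J =>
    Fin.snoc (α := fun _ => Cn n →ₗ[ℂ] ℂ) (a ∘ J) b with hF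
  have hval : topCoeff (topProduct hm hmn (∑ j, elementaryTwoForm (a j)) Ω (elementaryTwoForm b)) =
      ∑ J, topCoeff ((wedge Ω (elementaryPositive (k + 1) (F J))).domDomCongr
        (finCongr (show 2 * (n - (k + 1)) + 2 * (k + 1) = 2 * n by omega))) := by
    have h1 : ∀ J, elementaryPositive (k + 1) (F J) =
        wedge (elementaryPositive k (a ∘ J)) (elementaryTwoForm b) := by
      intro J
      rw [elementaryPositive_succ]
      simp [hF, Function.comp_def]
    rw [topProduct_eq_wedge_wedge, wedgePow_sum_elementaryTwoForm, wedge_sum_left]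
    simp only [h1]
    erw [wedge_sum_right]
    exact form_sum_apply _ _ _
  have hterm : ∀ J, ∃ t : ℝ, 0 ≤ t ∧ (t = 0 → ¬ LinearIndependent ℂ (F J)) ∧
      topCoeff ((wedge Ω (elementaryPositive (k + 1) (F J))).domDomCongr
        (finCongr (show 2 * (n - (k + 1)) + 2 * (k + 1) = 2 * n by omega))) = (t : ℂ) := by
    intro J
    by_cases hJ : LinearIndependent ℂ (F J)
    · obtain ⟨t, ht, htJ⟩ := hΩ (F J) hJ
      exact ⟨t, ht.le, fun h => absurd h ht.ne', htJ⟩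
    · refine ⟨0, le_rfl, fun _ => hJ, ?_⟩
      rw [elementaryPositive_eq_zero _ hJ, wedge_zero_right]
      simp [topCoeff]
  choose t ht0 ht hteq using hterm
  refine ⟨∑ J, t J, Finset.sum_nonneg fun J _ => ht0 J, fun h => ?_, ?_⟩
  -- For b ≠ 0 some J gives an independent family, whose term is strictly positive and forbids a
  -- zero sum.
  · by_contra hb
    obtain ⟨J, hJ⟩ := exists_linearIndependent_snoc hmn ha hb
    exact ht J ((Finset.sum_eq_zero_iff_of_nonneg fun J _ => ht0 J).1 h J (Finset.mem_univ _)) hJ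
  · rw [hval, Finset.sum_congr rfl fun J _ => hteq J]
    push_cast
    rfl

end Positivity

end HermiteEinstein

namespace HermiteEinstein

/-! ### Wirtinger derivatives of functions -/

section Wirtinger

variable {n : ℕ}

/-- The value `∂f(v)` of the `(1,0)`-part of the differential of a function. -/
def dl (f : Cn n → ℂ) (v z : Cn n) : ℂ :=
  (1 / 2) * (fderiv ℝ f z v - Complex.I * fderiv ℝ f z (Complex.I • v))

/-- The value `∂̄f(v)` of the `(0,1)`-part of the differential of a function. -/
def dlb (f : Cn n → ℂ) (v z : Cn n) : ℂ :=
  (1 / 2) * (fderiv ℝ f z v + Complex.I * fderiv ℝ f z (Complex.I • v))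

/-- `f` is smooth in a neighbourhood of `z`. -/
def SmoothNear (f : Cn n → ℂ) (z : Cn n) : Prop :=
  ∀ᶠ y in 𝓝 z, ContDiffAt ℝ smoothOrder f y

/-- `f` is holomorphic in a neighbourhood of `z`. -/
def HolNear (f : Cn n → ℂ) (z : Cn n) : Prop :=
  ∀ᶠ y in 𝓝 z, ContDiffAt ℂ smoothOrder f y

theorem smoothOrder_ne_zero : smoothOrder ≠ 0 := by
  simp [smoothOrder]

theorem dl_add_dlb (f : Cn n → ℂ) (v z : Cn n) : dl f v z + dlb f v z = fderiv ℝ f z v := by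
  rw [dl, dlb]; ring

theorem SmoothNear.contDiffAt {f : Cn n → ℂ} {z : Cn n} (h : SmoothNear f z) :
    ContDiffAt ℝ smoothOrder f z := h.self_of_nhds

theorem SmoothNear.differentiableAt {f : Cn n → ℂ} {z : Cn n} (h : SmoothNear f z) :
    DifferentiableAt ℝ f z := h.contDiffAt.differentiableAt smoothOrder_ne_zero

/-- Smoothness is required on a neighbourhood so that it passes to nearby points, where identities
can be established and then differentiated. -/
theorem SmoothNear.eventually {f : Cn n → ℂ} {z : Cn n} (h : SmoothNear f z) :
    ∀ᶠ y in 𝓝 z, SmoothNear f y := eventually_eventually_nhds.2 h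

theorem HolNear.eventually {f : Cn n → ℂ} {z : Cn n} (h : HolNear f z) :
    ∀ᶠ y in 𝓝 z, HolNear f y := eventually_eventually_nhds.2 h

theorem HolNear.contDiffAt {f : Cn n → ℂ} {z : Cn n} (h : HolNear f z) :
    ContDiffAt ℂ smoothOrder f z := h.self_of_nhds

theorem HolNear.smoothNear {f : Cn n → ℂ} {z : Cn n} (h : HolNear f z) : SmoothNear f z :=
  h.mono fun _ hy => hy.restrict_scalars ℝ

theorem SmoothNear.congr {f g : Cn n → ℂ} {z : Cn n} (h : SmoothNear f z) (hfg : g =ᶠ[𝓝 z] f) :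
    SmoothNear g z := by
  filter_upwards [h, hfg.eventuallyEq_nhds] with y hy hy' using hy.congr_of_eventuallyEq hy'

theorem SmoothNear.add {f g : Cn n → ℂ} {z : Cn n} (hf : SmoothNear f z) (hg : SmoothNear g z) :
    SmoothNear (fun y => f y + g y) z := by
  filter_upwards [hf, hg] with y h1 h2 using h1.add h2

theorem SmoothNear.sub {f g : Cn n → ℂ} {z : Cn n} (hf : SmoothNear f z) (hg : SmoothNear g z) :
    SmoothNear (fun y => f y - g y) z := by
  filter_upwards [hf, hg] with y h1 h2 using h1.sub h2

theorem SmoothNear.mul {f g : Cn n → ℂ} {z : Cn n} (hf : SmoothNear f z) (hg : SmoothNear g z) :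
    SmoothNear (fun y => f y * g y) z := by
  filter_upwards [hf, hg] with y h1 h2 using h1.mul h2

theorem SmoothNear.const (c : ℂ) (z : Cn n) : SmoothNear (fun _ : Cn n => c) z :=
  Filter.Eventually.of_forall fun _ => contDiffAt_const

theorem SmoothNear.sum {ι : Type*} {s : Finset ι} {f : ι → Cn n → ℂ} {z : Cn n}
    (h : ∀ i ∈ s, SmoothNear (f i) z) : SmoothNear (fun y => ∑ i ∈ s, f i y) z := by
  filter_upwards [(Finset.eventually_all s).2 h] with y hy using ContDiffAt.sum hy

theorem SmoothNear.prod {ι : Type*} {s : Finset ι} {f : ι → Cn n → ℂ} {z : Cn n}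
    (h : ∀ i ∈ s, SmoothNear (f i) z) : SmoothNear (fun y => ∏ i ∈ s, f i y) z := by
  filter_upwards [(Finset.eventually_all s).2 h] with y hy using contDiffAt_prod hy

theorem SmoothNear.inv {f : Cn n → ℂ} {z : Cn n} (hf : SmoothNear f z) (h0 : f z ≠ 0) :
    SmoothNear (fun y => (f y)⁻¹) z := by
  filter_upwards [hf, hf.contDiffAt.continuousAt.eventually_ne h0] with y h1 h2
  exact h1.inv h2

theorem SmoothNear.conj {f : Cn n → ℂ} {z : Cn n} (hf : SmoothNear f z) :
    SmoothNear (fun y => conj (f y)) z := by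
  filter_upwards [hf] with y h1
  exact Complex.conjCLE.contDiff.contDiffAt.comp y h1

theorem HolNear.const (c : ℂ) (z : Cn n) : HolNear (fun _ : Cn n => c) z :=
  Filter.Eventually.of_forall fun _ => contDiffAt_const

theorem SmoothNear.fderiv_apply {f : Cn n → ℂ} {z : Cn n} (hf : SmoothNear f z) (v : Cn n) :
    SmoothNear (fun y => fderiv ℝ f y v) z := by
  filter_upwards [hf] with y hy
  exact (hy.fderiv_right (m := smoothOrder) (by simp [smoothOrder])).clm_apply contDiffAt_const

theorem SmoothNear.dl {f : Cn n → ℂ} {z : Cn n} (hf : SmoothNear f z) (v : Cn n) :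
    SmoothNear (dl f v) z :=
  (SmoothNear.const _ z).mul
    ((hf.fderiv_apply v).sub ((SmoothNear.const _ z).mul (hf.fderiv_apply _)))

theorem SmoothNear.dlb {f : Cn n → ℂ} {z : Cn n} (hf : SmoothNear f z) (v : Cn n) :
    SmoothNear (dlb f v) z :=
  (SmoothNear.const _ z).mul
    ((hf.fderiv_apply v).add ((SmoothNear.const _ z).mul (hf.fderiv_apply _)))

theorem dl_congr {f g : Cn n → ℂ} {z : Cn n} (h : f =ᶠ[𝓝 z] g) (v : Cn n) :
    dl f v z = dl g v z := by
  rw [dl, dl, h.fderiv_eq]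

theorem dlb_congr {f g : Cn n → ℂ} {z : Cn n} (h : f =ᶠ[𝓝 z] g) (v : Cn n) :
    dlb f v z = dlb g v z := by
  rw [dlb, dlb, h.fderiv_eq]

@[simp]
theorem dl_const (c : ℂ) (v z : Cn n) : dl (fun _ => c) v z = 0 := by simp [dl]

@[simp]
theorem dlb_const (c : ℂ) (v z : Cn n) : dlb (fun _ => c) v z = 0 := by simp [dlb]

theorem dlb_add {f g : Cn n → ℂ} {z : Cn n} (hf : SmoothNear f z) (hg : SmoothNear g z)
    (v : Cn n) : dlb (fun y => f y + g y) v z = dlb f v z + dlb g v z := by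
  rw [dlb, dlb, dlb, fderiv_fun_add hf.differentiableAt hg.differentiableAt]
  simp only [add_apply]; ring

theorem dl_mul {f g : Cn n → ℂ} {z : Cn n} (hf : SmoothNear f z) (hg : SmoothNear g z)
    (v : Cn n) : dl (fun y => f y * g y) v z = dl f v z * g z + f z * dl g v z := by
  rw [dl, dl, dl, fderiv_fun_mul hf.differentiableAt hg.differentiableAt]
  simp only [add_apply, smul_apply, smul_eq_mul]
  ring

theorem dlb_mul {f g : Cn n → ℂ} {z : Cn n} (hf : SmoothNear f z) (hg : SmoothNear g z)
    (v : Cn n) : dlb (fun y => f y * g y) v z = dlb f v z * g z + f z * dlb g v z := by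
  rw [dlb, dlb, dlb, fderiv_fun_mul hf.differentiableAt hg.differentiableAt]
  simp only [add_apply, smul_apply, smul_eq_mul]
  ring

theorem dl_sum {ι : Type*} {s : Finset ι} {f : ι → Cn n → ℂ} {z : Cn n}
    (h : ∀ i ∈ s, SmoothNear (f i) z) (v : Cn n) :
    dl (fun y => ∑ i ∈ s, f i y) v z = ∑ i ∈ s, dl (f i) v z := by
  simp only [dl]
  rw [fderiv_fun_sum fun i hi => (h i hi).differentiableAt]
  simp only [sum_apply, Finset.mul_sum, ← Finset.sum_sub_distrib]

theorem dlb_sum {ι : Type*} {s : Finset ι} {f : ι → Cn n → ℂ} {z : Cn n}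
    (h : ∀ i ∈ s, SmoothNear (f i) z) (v : Cn n) :
    dlb (fun y => ∑ i ∈ s, f i y) v z = ∑ i ∈ s, dlb (f i) v z := by
  simp only [dlb]
  rw [fderiv_fun_sum fun i hi => (h i hi).differentiableAt]
  simp only [sum_apply, Finset.mul_sum, ← Finset.sum_add_distrib]

theorem fderiv_conj {f : Cn n → ℂ} {z : Cn n} (hf : SmoothNear f z) (v : Cn n) :
    fderiv ℝ (fun y => conj (f y)) z v = conj (fderiv ℝ f z v) := by
  have := (Complex.conjCLE.toContinuousLinearMap.hasFDerivAt.comp z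
    hf.differentiableAt.hasFDerivAt).fderiv
  exact congrArg (fun L => L v) this

theorem dl_conj {f : Cn n → ℂ} {z : Cn n} (hf : SmoothNear f z) (v : Cn n) :
    dl (fun y => conj (f y)) v z = conj (dlb f v z) := by
  simp only [dl, dlb, fderiv_conj hf, map_mul, map_add, Complex.conj_I, map_div₀, map_one,
    Complex.conj_ofNat]
  ring

theorem dlb_conj {f : Cn n → ℂ} {z : Cn n} (hf : SmoothNear f z) (v : Cn n) :
    dlb (fun y => conj (f y)) v z = conj (dl f v z) := by
  simp only [dl, dlb, fderiv_conj hf, map_mul, map_sub, Complex.conj_I, map_div₀, map_one,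
    Complex.conj_ofNat]
  ring

theorem dl_I_smul (f : Cn n → ℂ) (v z : Cn n) : dl f (Complex.I • v) z = Complex.I * dl f v z := by
  rw [dl, dl, smul_smul, Complex.I_mul_I, neg_one_smul, map_neg]
  linear_combination (1 / 2 * fderiv ℝ f z (Complex.I • v)) * Complex.I_mul_I

/-- `∂f` is complex-linear in its vector argument. -/
def dlLin (f : Cn n → ℂ) (z : Cn n) : Cn n →ₗ[ℂ] ℂ where
  toFun v := dl f v z
  map_add' u v := by simp only [dl, smul_add, map_add]; ring
  map_smul' c v := by
    have hr : ∀ (r : ℝ) (w : Cn n), dl f (r • w) z = r * dl f w z := by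
      intro r w
      simp only [dl, smul_comm _ r, map_smul, Complex.real_smul]
      ring
    have ha : ∀ u w : Cn n, dl f (u + w) z = dl f u z + dl f w z := by
      intro u w
      simp only [dl, smul_add, map_add]; ring
    rw [complex_smul_eq, ha, hr, hr, dl_I_smul, RingHom.id_apply, smul_eq_mul]
    conv_rhs => rw [← Complex.re_add_im c]
    ring

theorem dlLin_apply (f : Cn n → ℂ) (v z : Cn n) : dlLin f z v = dl f v z := rfl

theorem HolNear.fderiv_eq {f : Cn n → ℂ} {z : Cn n} (hf : HolNear f z) (v : Cn n) :
    fderiv ℝ f z v = fderiv ℂ f z v := by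
  rw [(hf.contDiffAt.differentiableAt smoothOrder_ne_zero).fderiv_restrictScalars ℝ]
  rfl

theorem HolNear.dlb_eq {f : Cn n → ℂ} {z : Cn n} (hf : HolNear f z) (v : Cn n) :
    HermiteEinstein.dlb f v z = 0 := by
  rw [HermiteEinstein.dlb, hf.fderiv_eq, hf.fderiv_eq, map_smul, smul_eq_mul, ← mul_assoc,
    Complex.I_mul_I]
  ring

theorem HolNear.dl_eq {f : Cn n → ℂ} {z : Cn n} (hf : HolNear f z) (v : Cn n) :
    HermiteEinstein.dl f v z = fderiv ℂ f z v := by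
  have := dl_add_dlb f v z
  rw [hf.dlb_eq, add_zero, hf.fderiv_eq] at this
  exact this

/-- On a holomorphic function ∂ is the complex derivative, so holomorphy is preserved. -/
theorem HolNear.dl {f : Cn n → ℂ} {z : Cn n} (hf : HolNear f z) (v : Cn n) :
    HolNear (dl f v) z := by
  filter_upwards [hf, hf.eventually.eventually_nhds] with y hy hy'
  have h1 : ContDiffAt ℂ smoothOrder (fun y => fderiv ℂ f y v) y :=
    (hy.fderiv_right (m := smoothOrder) (by simp [smoothOrder])).clm_apply contDiffAt_const
  exact h1.congr_of_eventuallyEq (hy'.mono fun w hw => hw.dl_eq v)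

theorem fderiv_fderiv_comm {f : Cn n → ℂ} {z : Cn n} (hf : SmoothNear f z) (v w : Cn n) :
    fderiv ℝ (fun y => fderiv ℝ f y w) z v = fderiv ℝ (fun y => fderiv ℝ f y v) z w := by
  have hd : DifferentiableAt ℝ (fderiv ℝ f) z :=
    (hf.contDiffAt.fderiv_right (m := smoothOrder) (by simp [smoothOrder])).differentiableAt
      smoothOrder_ne_zero
  have hs := hf.contDiffAt.isSymmSndFDerivAt (by simp [smoothOrder]; exact WithTop.coe_le_coe.2 le_top)
  rw [fderiv_clm_apply hd (differentiableAt_const _),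
    fderiv_clm_apply hd (differentiableAt_const _)]
  simpa using hs.eq v w

theorem fderiv_const_mul_apply {f : Cn n → ℂ} {z : Cn n} (hf : SmoothNear f z) (c : ℂ)
    (v : Cn n) : fderiv ℝ (fun y => c * f y) z v = c * fderiv ℝ f z v := by
  rw [fderiv_const_mul hf.differentiableAt]
  rfl

theorem fderiv_dl {f : Cn n → ℂ} {z : Cn n} (hf : SmoothNear f z) (v w : Cn n) :
    fderiv ℝ (dl f w) z v = (1 / 2) * (fderiv ℝ (fun y => fderiv ℝ f y w) z v -
      Complex.I * fderiv ℝ (fun y => fderiv ℝ f y (Complex.I • w)) z v) := by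
  have h1 := hf.fderiv_apply w
  have h2 := (SmoothNear.const Complex.I z).mul (hf.fderiv_apply (Complex.I • w))
  have : dl f w = fun y => (1 / 2) * (fderiv ℝ f y w -
      Complex.I * fderiv ℝ f y (Complex.I • w)) := rfl
  rw [this, fderiv_const_mul_apply (h1.sub h2), fderiv_fun_sub h1.differentiableAt
    h2.differentiableAt, sub_apply, fderiv_const_mul_apply (hf.fderiv_apply _)]

/-- Symmetry of the second derivative, in other words ∂² = 0. It removes the (2,0)-part of the
curvature. -/
theorem dl_dl_comm {f : Cn n → ℂ} {z : Cn n} (hf : SmoothNear f z) (v w : Cn n) :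
    dl (dl f w) v z = dl (dl f v) w z := by
  rw [dl, dl, fderiv_dl hf, fderiv_dl hf, fderiv_dl hf, fderiv_dl hf,
    fderiv_fderiv_comm hf w v, fderiv_fderiv_comm hf w (Complex.I • v),
    fderiv_fderiv_comm hf (Complex.I • w) v,
    fderiv_fderiv_comm hf (Complex.I • w) (Complex.I • v)]
  ring

theorem fderiv_dlb {f : Cn n → ℂ} {z : Cn n} (hf : SmoothNear f z) (v w : Cn n) :
    fderiv ℝ (dlb f w) z v = (1 / 2) * (fderiv ℝ (fun y => fderiv ℝ f y w) z v +
      Complex.I * fderiv ℝ (fun y => fderiv ℝ f y (Complex.I • w)) z v) := by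
  have h1 := hf.fderiv_apply w
  have h2 := (SmoothNear.const Complex.I z).mul (hf.fderiv_apply (Complex.I • w))
  have : dlb f w = fun y => (1 / 2) * (fderiv ℝ f y w +
      Complex.I * fderiv ℝ f y (Complex.I • w)) := rfl
  rw [this, fderiv_const_mul_apply (h1.add h2), fderiv_fun_add h1.differentiableAt
    h2.differentiableAt, add_apply, fderiv_const_mul_apply (hf.fderiv_apply _)]

end Wirtinger

/-! ### Wirtinger calculus for matrix-valued functions -/

section MatrixWirtinger

variable {n : ℕ} {a b c : Type*}

/-- Entrywise `∂` of a matrix-valued function. -/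
def mdl (M : Cn n → Matrix a b ℂ) (v z : Cn n) : Matrix a b ℂ :=
  Matrix.of fun i j => dl (fun y => M y i j) v z

/-- Entrywise `∂̄` of a matrix-valued function. -/
def mdlb (M : Cn n → Matrix a b ℂ) (v z : Cn n) : Matrix a b ℂ :=
  Matrix.of fun i j => dlb (fun y => M y i j) v z

/-- The entries of `M` are smooth near `z`. -/
def MatSmooth (M : Cn n → Matrix a b ℂ) (z : Cn n) : Prop :=
  ∀ i j, SmoothNear (fun y => M y i j) z

/-- The entries of `M` are holomorphic near `z`. -/
def MatHol (M : Cn n → Matrix a b ℂ) (z : Cn n) : Prop :=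
  ∀ i j, HolNear (fun y => M y i j) z

theorem MatSmooth.eventually [Finite a] [Finite b] {M : Cn n → Matrix a b ℂ} {z : Cn n} (h : MatSmooth M z) :
    ∀ᶠ y in 𝓝 z, MatSmooth M y := by
  have : ∀ᶠ y in 𝓝 z, ∀ i j, SmoothNear (fun y => M y i j) y :=
    Filter.eventually_all.2 fun i => Filter.eventually_all.2 fun j => (h i j).eventually
  exact this

theorem MatHol.eventually [Finite a] [Finite b] {M : Cn n → Matrix a b ℂ} {z : Cn n} (h : MatHol M z) :
    ∀ᶠ y in 𝓝 z, MatHol M y := by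
  have : ∀ᶠ y in 𝓝 z, ∀ i j, HolNear (fun y => M y i j) y :=
    Filter.eventually_all.2 fun i => Filter.eventually_all.2 fun j => (h i j).eventually
  exact this

theorem MatHol.matSmooth {M : Cn n → Matrix a b ℂ} {z : Cn n} (h : MatHol M z) : MatSmooth M z :=
  fun i j => (h i j).smoothNear

theorem MatSmooth.congr {M N : Cn n → Matrix a b ℂ} {z : Cn n} (h : MatSmooth M z)
    (hMN : N =ᶠ[𝓝 z] M) : MatSmooth N z :=
  fun i j => (h i j).congr (hMN.mono fun y hy => by simp only [hy])

theorem MatSmooth.mul [Fintype b] {M : Cn n → Matrix a b ℂ} {N : Cn n → Matrix b c ℂ} {z : Cn n}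
    (hM : MatSmooth M z) (hN : MatSmooth N z) : MatSmooth (fun y => M y * N y) z :=
  fun i j => by
    simp only [Matrix.mul_apply]
    exact SmoothNear.sum fun k _ => (hM i k).mul (hN k j)

open scoped Matrix in
theorem MatSmooth.conjTranspose {M : Cn n → Matrix a b ℂ} {z : Cn n} (hM : MatSmooth M z) :
    MatSmooth (fun y => (M y)ᴴ) z :=
  fun i j => (hM j i).conj

theorem MatSmooth.mdl {M : Cn n → Matrix a b ℂ} {z : Cn n} (hM : MatSmooth M z) (v : Cn n) :
    MatSmooth (mdl M v) z := fun i j => (hM i j).dl v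

theorem MatHol.mdl {M : Cn n → Matrix a b ℂ} {z : Cn n} (hM : MatHol M z) (v : Cn n) :
    MatHol (mdl M v) z := fun i j => (hM i j).dl v

theorem MatHol.mdlb_eq {M : Cn n → Matrix a b ℂ} {z : Cn n} (hM : MatHol M z) (v : Cn n) :
    HermiteEinstein.mdlb M v z = 0 := by
  ext i j; exact (hM i j).dlb_eq v

theorem mdl_congr {M N : Cn n → Matrix a b ℂ} {z : Cn n} (h : M =ᶠ[𝓝 z] N) (v : Cn n) :
    mdl M v z = mdl N v z := by
  ext i j; exact dl_congr (h.mono fun y hy => by simp only [hy]) v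

theorem mdlb_congr {M N : Cn n → Matrix a b ℂ} {z : Cn n} (h : M =ᶠ[𝓝 z] N) (v : Cn n) :
    mdlb M v z = mdlb N v z := by
  ext i j; exact dlb_congr (h.mono fun y hy => by simp only [hy]) v

theorem mdlb_add {M N : Cn n → Matrix a b ℂ} {z : Cn n} (hM : MatSmooth M z)
    (hN : MatSmooth N z) (v : Cn n) :
    mdlb (fun y => M y + N y) v z = mdlb M v z + mdlb N v z := by
  ext i j; exact dlb_add (hM i j) (hN i j) v

theorem mdl_mul [Fintype b] {M : Cn n → Matrix a b ℂ} {N : Cn n → Matrix b c ℂ} {z : Cn n}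
    (hM : MatSmooth M z) (hN : MatSmooth N z) (v : Cn n) :
    mdl (fun y => M y * N y) v z = mdl M v z * N z + M z * mdl N v z := by
  ext i j
  simp only [mdl, Matrix.of_apply, Matrix.add_apply, Matrix.mul_apply]
  rw [dl_sum fun k _ => (hM i k).mul (hN k j), ← Finset.sum_add_distrib]
  exact Finset.sum_congr rfl fun k _ => dl_mul (hM i k) (hN k j) v

theorem mdlb_mul [Fintype b] {M : Cn n → Matrix a b ℂ} {N : Cn n → Matrix b c ℂ} {z : Cn n}
    (hM : MatSmooth M z) (hN : MatSmooth N z) (v : Cn n) :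
    mdlb (fun y => M y * N y) v z = mdlb M v z * N z + M z * mdlb N v z := by
  ext i j
  simp only [mdlb, Matrix.of_apply, Matrix.add_apply, Matrix.mul_apply]
  rw [dlb_sum fun k _ => (hM i k).mul (hN k j), ← Finset.sum_add_distrib]
  exact Finset.sum_congr rfl fun k _ => dlb_mul (hM i k) (hN k j) v

open scoped Matrix in
theorem mdl_conjTranspose {M : Cn n → Matrix a b ℂ} {z : Cn n} (hM : MatSmooth M z) (v : Cn n) :
    mdl (fun y => (M y)ᴴ) v z = (mdlb M v z)ᴴ := by
  ext i j; exact dl_conj (hM j i) v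

open scoped Matrix in
theorem mdlb_conjTranspose {M : Cn n → Matrix a b ℂ} {z : Cn n} (hM : MatSmooth M z) (v : Cn n) :
    mdlb (fun y => (M y)ᴴ) v z = (mdl M v z)ᴴ := by
  ext i j; exact dlb_conj (hM j i) v

@[simp]
theorem mdl_const (M : Matrix a b ℂ) (v z : Cn n) : mdl (fun _ => M) v z = 0 := by
  ext i j; exact dl_const _ v z

@[simp]
theorem mdlb_const (M : Matrix a b ℂ) (v z : Cn n) : mdlb (fun _ => M) v z = 0 := by
  ext i j; exact dlb_const _ v z

variable [Fintype a] [DecidableEq a]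

theorem MatSmooth.det {M : Cn n → Matrix a a ℂ} {z : Cn n} (hM : MatSmooth M z) :
    SmoothNear (fun y => (M y).det) z := by
  simp only [Matrix.det_apply']
  exact SmoothNear.sum fun σ _ => (SmoothNear.const _ z).mul
    (SmoothNear.prod fun i _ => hM (σ i) i)

theorem MatSmooth.inv {M : Cn n → Matrix a a ℂ} {z : Cn n} (hM : MatSmooth M z)
    (h0 : (M z).det ≠ 0) : MatSmooth (fun y => (M y)⁻¹) z := fun i j => by
  simp only [Matrix.inv_def, Matrix.smul_apply, smul_eq_mul, Ring.inverse_eq_inv',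
    Matrix.adjugate_apply]
  refine (hM.det.inv h0).mul (MatSmooth.det fun k l => ?_)
  by_cases hk : k = j
  · subst hk
    simp only [Matrix.updateRow_self]
    exact SmoothNear.const _ z
  · simp only [Matrix.updateRow_ne hk]
    exact hM k l

theorem MatSmooth.eventually_det_ne_zero {M : Cn n → Matrix a a ℂ} {z : Cn n}
    (hM : MatSmooth M z) (h0 : (M z).det ≠ 0) : ∀ᶠ y in 𝓝 z, (M y).det ≠ 0 :=
  hM.det.contDiffAt.continuousAt.eventually_ne h0

theorem mdl_inv {M : Cn n → Matrix a a ℂ} {z : Cn n} (hM : MatSmooth M z)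
    (h0 : (M z).det ≠ 0) (v : Cn n) :
    mdl (fun y => (M y)⁻¹) v z = -((M z)⁻¹ * mdl M v z * (M z)⁻¹) := by
  -- Differentiate M⁻¹ M = 1, which holds near z because invertibility is an open condition.
  have h1 : (fun y => (M y)⁻¹ * M y) =ᶠ[𝓝 z] fun _ => 1 :=
    (hM.eventually_det_ne_zero h0).mono fun y hy => Matrix.nonsing_inv_mul _ hy.isUnit
  have h2 := mdl_congr h1 v
  rw [mdl_mul (hM.inv h0) hM, mdl_const] at h2
  have h3 := congrArg (· * (M z)⁻¹) h2
  simp only [add_mul, Matrix.mul_assoc, Matrix.mul_nonsing_inv _ h0.isUnit, Matrix.mul_one,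
    Matrix.zero_mul] at h3
  rw [Matrix.mul_assoc]
  exact eq_neg_of_add_eq_zero_left h3

theorem mdlb_inv {M : Cn n → Matrix a a ℂ} {z : Cn n} (hM : MatSmooth M z)
    (h0 : (M z).det ≠ 0) (v : Cn n) :
    mdlb (fun y => (M y)⁻¹) v z = -((M z)⁻¹ * mdlb M v z * (M z)⁻¹) := by
  have h1 : (fun y => (M y)⁻¹ * M y) =ᶠ[𝓝 z] fun _ => 1 :=
    (hM.eventually_det_ne_zero h0).mono fun y hy => Matrix.nonsing_inv_mul _ hy.isUnit
  have h2 := mdlb_congr h1 v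
  rw [mdlb_mul (hM.inv h0) hM, mdlb_const] at h2
  have h3 := congrArg (· * (M z)⁻¹) h2
  simp only [add_mul, Matrix.mul_assoc, Matrix.mul_nonsing_inv _ h0.isUnit, Matrix.mul_one,
    Matrix.zero_mul] at h3
  rw [Matrix.mul_assoc]
  exact eq_neg_of_add_eq_zero_left h3

theorem dl_prod {ι : Type*} [DecidableEq ι] {s : Finset ι} {f : ι → Cn n → ℂ} {z : Cn n}
    (h : ∀ i ∈ s, SmoothNear (f i) z) (v : Cn n) :
    dl (fun y => ∏ i ∈ s, f i y) v z = ∑ i ∈ s, (∏ j ∈ s.erase i, f j z) * dl (f i) v z := by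
  simp only [dl]
  rw [show fderiv ℝ (fun y => ∏ i ∈ s, f i y) z = ∑ i ∈ s, (∏ j ∈ s.erase i, f j z) •
    fderiv ℝ (f i) z from
      fderiv_finsetProd fun i hi => (h i hi).differentiableAt]
  simp only [sum_apply, smul_apply, smul_eq_mul, Finset.mul_sum, ← Finset.sum_sub_distrib]
  exact Finset.sum_congr rfl fun i _ => by ring

/-- Jacobi's formula. -/
theorem dl_det {M : Cn n → Matrix a a ℂ} {z : Cn n} (hM : MatSmooth M z)
    (h0 : (M z).det ≠ 0) (v : Cn n) :
    dl (fun y => (M y).det) v z = (M z).det * ((M z)⁻¹ * mdl M v z).trace := by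
  -- The product rule differentiates one column at a time; Cramer's rule identifies the determinant
  -- with a replaced column as an entry of the adjugate applied to that column.
  have h1 : dl (fun y => (M y).det) v z =
      ∑ i, ((M z).updateCol i (fun k => mdl M v z k i)).det := by
    simp only [Matrix.det_apply']
    rw [dl_sum fun σ _ => (SmoothNear.const _ z).mul (SmoothNear.prod fun i _ => hM (σ i) i),
      Finset.sum_comm]
    refine Finset.sum_congr rfl fun σ _ => ?_
    rw [dl_mul (SmoothNear.const _ z) (SmoothNear.prod fun i _ => hM (σ i) i), dl_const, zero_mul,
      zero_add, dl_prod fun i _ => hM (σ i) i, Finset.mul_sum]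
    refine Finset.sum_congr rfl fun i _ => ?_
    rw [← Finset.prod_erase_mul _ _ (Finset.mem_univ i), Matrix.updateCol_self]
    congr 2
    refine Finset.prod_congr rfl fun j hj => ?_
    rw [Matrix.updateCol_ne (Finset.ne_of_mem_erase hj)]
  have h2 : (M z).det • (M z)⁻¹ = (M z).adjugate := by
    rw [Matrix.inv_def, smul_smul, Ring.inverse_eq_inv', mul_inv_cancel₀ h0, one_smul]
  rw [h1, ← smul_eq_mul, ← Matrix.trace_smul, ← Matrix.smul_mul, h2, Matrix.trace]
  refine Finset.sum_congr rfl fun i _ => ?_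
  rw [← Matrix.cramer_apply, Matrix.cramer_eq_adjugate_mulVec]
  rfl

end MatrixWirtinger

end HermiteEinstein

namespace HermiteEinstein

/-! ### The Chern curvature in terms of the Gram matrix -/

section ChernFormula

variable {n : ℕ}

theorem half_smul_sub_smul {F : Type*} [AddCommGroup F] [Module ℂ F] (c : ℂ) (x y : F) :
    (1 / 2 : ℂ) • (x - c • y) = (1 / 2 : ℂ) • (x + -c • y) := by
  rw [neg_smul, ← sub_eq_add_neg]

/-- Treats `del` and `delbar` at once, as the cases c = -i and c = i. -/
theorem contDiffAt_wirtinger {F G : Type*} [NormedAddCommGroup F] [NormedSpace ℝ F]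
    [NormedSpace ℂ F] [IsScalarTower ℝ ℂ F] [NormedAddCommGroup G] [NormedSpace ℝ G] (c : ℂ)
    (A : (Cn n →L[ℝ] F) →L[ℝ] G) {η : Cn n → F} {z : Cn n} (h : ContDiffAt ℝ smoothOrder η z) :
    ContDiffAt ℝ smoothOrder
      (fun y => A ((1 / 2 : ℂ) • (fderiv ℝ η y + c • (fderiv ℝ η y).comp (mulI n)))) z := by
  have h1 : ContDiffAt ℝ smoothOrder (fderiv ℝ η) z :=
    h.fderiv_right (m := smoothOrder) (by simp [smoothOrder])
  have h2 : ContDiffAt ℝ smoothOrder (fun y => (fderiv ℝ η y).comp (mulI n)) z :=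
    h1.clm_comp contDiffAt_const
  exact A.contDiff.contDiffAt.comp z ((h1.add (h2.const_smul c)).const_smul (1 / 2 : ℂ))

theorem contDiffAt_delbar {k : ℕ} {η : Cn n → Cn n [⋀^Fin k]→L[ℝ] ℂ} {z : Cn n}
    (h : ContDiffAt ℝ smoothOrder η z) : ContDiffAt ℝ smoothOrder (delbar η) z :=
  contDiffAt_wirtinger Complex.I
    (ContinuousAlternatingMap.alternatizeUncurryFinCLM (n := k) ℝ (Cn n) ℂ) h

theorem contDiffAt_del {k : ℕ} {η : Cn n → Cn n [⋀^Fin k]→L[ℝ] ℂ} {z : Cn n}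
    (h : ContDiffAt ℝ smoothOrder η z) : ContDiffAt ℝ smoothOrder (del η) z := by
  refine (contDiffAt_wirtinger (-Complex.I)
    (ContinuousAlternatingMap.alternatizeUncurryFinCLM (n := k) ℝ (Cn n) ℂ)
    h).congr_of_eventuallyEq (Filter.Eventually.of_forall fun y => ?_)
  exact congrArg ContinuousAlternatingMap.alternatizeUncurryFin
    (half_smul_sub_smul Complex.I (fderiv ℝ η y) _)

theorem del_apply {k : ℕ} {η : Cn n → Cn n [⋀^Fin k]→L[ℝ] ℂ} {z : Cn n}
    (h : DifferentiableAt ℝ η z) (v : Fin (k + 1) → Cn n) :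
    del η z v = ∑ i, (-1) ^ i.val • dl (fun y => η y (i.removeNth v)) (v i) z := by
  simp only [del, ContinuousAlternatingMap.alternatizeUncurryFin_apply, dl,
    fderiv_continuousAlternatingMap_apply_const_apply h]
  rfl

theorem delbar_apply {k : ℕ} {η : Cn n → Cn n [⋀^Fin k]→L[ℝ] ℂ} {z : Cn n}
    (h : DifferentiableAt ℝ η z) (v : Fin (k + 1) → Cn n) :
    delbar η z v = ∑ i, (-1) ^ i.val • dlb (fun y => η y (i.removeNth v)) (v i) z := by
  simp only [delbar, ContinuousAlternatingMap.alternatizeUncurryFin_apply, dlb,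
    fderiv_continuousAlternatingMap_apply_const_apply h]
  rfl

/-- A function seen as a form of degree `0`. -/
abbrev zeroForm (f : Cn n → ℂ) : Cn n → Cn n [⋀^Fin 0]→L[ℝ] ℂ :=
  fun y => ContinuousAlternatingMap.constOfIsEmpty ℝ (Cn n) (Fin 0) (f y)

theorem contDiffAt_zeroForm {f : Cn n → ℂ} {z : Cn n} (h : ContDiffAt ℝ smoothOrder f z) :
    ContDiffAt ℝ smoothOrder (zeroForm f) z :=
  (ContinuousAlternatingMap.constOfIsEmptyLIE ℝ (Cn n) ℂ (Fin 0)).contDiff.contDiffAt.comp z h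

theorem del_zeroForm_apply {f : Cn n → ℂ} {z : Cn n} (h : ContDiffAt ℝ smoothOrder f z)
    (v : Fin 1 → Cn n) : del (zeroForm f) z v = dl f (v 0) z := by
  rw [del_apply ((contDiffAt_zeroForm h).differentiableAt smoothOrder_ne_zero)]
  simp [ContinuousAlternatingMap.constOfIsEmpty]
  rfl

theorem contDiffAt_complex_smul {F : Type*} [NormedAddCommGroup F] [NormedSpace ℝ F]
    [NormedSpace ℂ F] [IsScalarTower ℝ ℂ F] {c : Cn n → ℂ} {g : Cn n → F} {z : Cn n}
    (hc : ContDiffAt ℝ smoothOrder c z) (hg : ContDiffAt ℝ smoothOrder g z) :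
    ContDiffAt ℝ smoothOrder (fun y => c y • g y) z :=
  hc.smul hg

variable {r : ℕ} {H : Cn n → Matrix (Fin r) (Fin r) ℂ} {z : Cn n}

theorem contDiffAt_chernConnection (hH : MatSmooth H z) (h0 : (H z).det ≠ 0) (i j : Fin r) :
    ContDiffAt ℝ smoothOrder (chernConnection H i j) z :=
  ContDiffAt.sum fun k _ => contDiffAt_complex_smul ((hH.inv h0) i k).contDiffAt
    (contDiffAt_del (contDiffAt_zeroForm (hH k j).contDiffAt))

theorem chernConnection_apply (hH : MatSmooth H z) (i j : Fin r) (v : Fin 1 → Cn n) :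
    chernConnection H i j z v = ((H z)⁻¹ * mdl H (v 0) z) i j := by
  rw [chernConnection, ContinuousAlternatingMap.sum_apply, Matrix.mul_apply]
  refine Finset.sum_congr rfl fun k _ => ?_
  rw [ContinuousAlternatingMap.smul_apply, del_zeroForm_apply (hH k j).contDiffAt]
  rfl

/-- The expression `∂̄_v ∂_w H - (∂̄_v H) H⁻¹ (∂_w H)`. -/
def curvaturePiece {a : Type*} [Fintype a] [DecidableEq a] (H : Cn n → Matrix a a ℂ)
    (v w z : Cn n) : Matrix a a ℂ :=
  mdlb (mdl H w) v z - mdlb H v z * (H z)⁻¹ * mdl H w z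

theorem matrix_fderiv_eq {a b : Type*} {M : Cn n → Matrix a b ℂ} (v : Cn n) (i : a) (j : b) :
    fderiv ℝ (fun y => M y i j) z v = mdl M v z i j + mdlb M v z i j :=
  (dl_add_dlb _ _ _).symm

/-- Expand d(H⁻¹∂H). The second ∂-derivatives of H cancel by symmetry, and the terms -H⁻¹∂H H⁻¹∂H
cancel against θ ∧ θ. What remains is H⁻¹(∂̄∂H - ∂̄H H⁻¹ ∂H), antisymmetrized. -/
theorem chernCurvature_apply (hH : MatSmooth H z) (h0 : (H z).det ≠ 0) (i j : Fin r)
    (v w : Cn n) : chernCurvature H i j z ![v, w] =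
      ((H z)⁻¹ * (curvaturePiece H v w z - curvaturePiece H w v z)) i j := by
  have hθ : ∀ u : Cn n, (fun y => chernConnection H i j y ![u]) =ᶠ[𝓝 z]
      fun y => ((H y)⁻¹ * mdl H u y) i j := fun u =>
    hH.eventually.mono fun y hy => chernConnection_apply hy i j ![u]
  have hd : ∀ u v : Cn n, fderiv ℝ (fun y => chernConnection H i j y ![u]) z v =
      (-((H z)⁻¹ * mdl H v z * (H z)⁻¹) * mdl H u z + (H z)⁻¹ * mdl (mdl H u) v z +
        (-((H z)⁻¹ * mdlb H v z * (H z)⁻¹) * mdl H u z + (H z)⁻¹ * mdlb (mdl H u) v z)) i j := by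
    intro u v
    rw [(hθ u).fderiv_eq, matrix_fderiv_eq (M := fun y => (H y)⁻¹ * mdl H u y),
      mdl_mul (hH.inv h0) (hH.mdl u), mdlb_mul (hH.inv h0) (hH.mdl u), mdl_inv hH h0,
      mdlb_inv hH h0]
    rfl
  have h1 : extDeriv (chernConnection H i j) z ![v, w] =
      fderiv ℝ (fun y => chernConnection H i j y ![w]) z v -
        fderiv ℝ (fun y => chernConnection H i j y ![v]) z w := by
    rw [extDeriv_apply ((contDiffAt_chernConnection hH h0 i j).differentiableAt
      smoothOrder_ne_zero)]
    rw [Fin.sum_univ_two]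
    have e0 : (0 : Fin 2).removeNth ![v, w] = ![w] := by
      funext k; fin_cases k; rfl
    have e1 : (1 : Fin 2).removeNth ![v, w] = ![v] := by
      funext k; fin_cases k; rfl
    rw [e0, e1]
    simp [sub_eq_add_neg]
  have h2 : ∀ k, wedge (chernConnection H i k z).toAlternatingMap
      (chernConnection H k j z).toAlternatingMap ![v, w] =
      ((H z)⁻¹ * mdl H v z) i k * ((H z)⁻¹ * mdl H w z) k j -
        ((H z)⁻¹ * mdl H w z) i k * ((H z)⁻¹ * mdl H v z) k j := by
    intro k
    have h3 : ∀ (α β : Cn n [⋀^Fin 1]→ₗ[ℝ] ℂ), wedge α β ![v, w] =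
        α ![v] * β ![w] - α ![w] * β ![v] := by
      intro α β
      obtain ⟨l, rfl⟩ := (AlternatingMap.ofSubsingleton ℝ (Cn n) ℂ (0 : Fin 1)).surjective α
      obtain ⟨l', rfl⟩ := (AlternatingMap.ofSubsingleton ℝ (Cn n) ℂ (0 : Fin 1)).surjective β
      exact wedge_oneForm_apply l l' ![v, w]
    rw [h3]
    have h4 : ∀ (i j : Fin r) (u : Cn n), (chernConnection H i j z).toAlternatingMap ![u] =
        ((H z)⁻¹ * mdl H u z) i j := fun i j u => chernConnection_apply hH i j ![u]
    simp only [h4]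
  rw [chernCurvature, AlternatingMap.add_apply, form_sum_apply]
  simp only [h2, Finset.sum_sub_distrib, ← Matrix.mul_apply]
  change extDeriv (chernConnection H i j) z ![v, w] + _ = _
  have hcomm : mdl (mdl H w) v z = mdl (mdl H v) w z := by
    ext k l; exact dl_dl_comm (hH k l) v w
  rw [h1, hd, hd, ← Matrix.sub_apply, ← Matrix.sub_apply, ← Matrix.add_apply, hcomm]
  refine congrFun (congrFun ?_ i) j
  simp only [curvaturePiece]
  noncomm_ring

end ChernFormula

/-! ### The Gauss equation for a holomorphic subbundle -/

section Subbundle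

open scoped Matrix ComplexOrder

variable {n : ℕ} {a b : Type*} [Fintype a] [DecidableEq a] [Fintype b] [DecidableEq b]

/-- The matrix of `D'F`. -/
def covDeriv (H : Cn n → Matrix a a ℂ) (F : Cn n → Matrix a b ℂ) (w z : Cn n) : Matrix a b ℂ :=
  mdl F w z + (H z)⁻¹ * mdl H w z * F z

/-- The matrix of the orthogonal projection on the image of `F`. -/
def orthProj (H : Cn n → Matrix a a ℂ) (K : Cn n → Matrix b b ℂ) (F : Cn n → Matrix a b ℂ)
    (z : Cn n) : Matrix b a ℂ :=
  (K z)⁻¹ * (F z)ᴴ * H z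

/-- The second fundamental form of a subbundle. -/
def secondFundamental (H : Cn n → Matrix a a ℂ) (K : Cn n → Matrix b b ℂ)
    (F : Cn n → Matrix a b ℂ) (w z : Cn n) : Matrix a b ℂ :=
  (1 - F z * orthProj H K F z) * covDeriv H F w z

variable {H : Cn n → Matrix a a ℂ} {K : Cn n → Matrix b b ℂ} {F : Cn n → Matrix a b ℂ} {z : Cn n}

/-- The data of a metric `H`, a holomorphic injection `F` and the induced metric `K`. -/
structure IsInducedGram (H : Cn n → Matrix a a ℂ) (K : Cn n → Matrix b b ℂ)
    (F : Cn n → Matrix a b ℂ) (z : Cn n) : Prop where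
  smooth : MatSmooth H z
  hol : MatHol F z
  herm : ∀ᶠ y in 𝓝 z, (H y)ᴴ = H y
  induced : ∀ᶠ y in 𝓝 z, K y = (F y)ᴴ * H y * F y
  det_ne : (H z).det ≠ 0
  det_ne' : (K z).det ≠ 0

theorem IsInducedGram.smooth' (h : IsInducedGram H K F z) : MatSmooth K z :=
  ((h.hol.matSmooth.conjTranspose.mul h.smooth).mul h.hol.matSmooth).congr h.induced

theorem mdlb_eq_conjTranspose {a : Type*} {H : Cn n → Matrix a a ℂ} (hs : MatSmooth H z) (hh : ∀ᶠ y in 𝓝 z, (H y)ᴴ = H y) (v : Cn n) :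
    mdlb H v z = (mdl H v z)ᴴ := by
  rw [← mdlb_conjTranspose hs]
  exact mdlb_congr (hh.mono fun y hy => hy.symm) v

/-- Only two terms appear in the product rule because Fᴴ is antiholomorphic. -/
theorem IsInducedGram.mdl_eq (h : IsInducedGram H K F z) (w : Cn n) :
    mdl K w z = (F z)ᴴ * mdl H w z * F z + (F z)ᴴ * H z * mdl F w z := by
  rw [mdl_congr h.induced, mdl_mul (h.hol.matSmooth.conjTranspose.mul h.smooth) h.hol.matSmooth,
    mdl_mul h.hol.matSmooth.conjTranspose h.smooth, mdl_conjTranspose h.hol.matSmooth,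
    h.hol.mdlb_eq, Matrix.conjTranspose_zero, Matrix.zero_mul, zero_add]

/-- The conditions are open, so that the first-order identities hold near z and can be
differentiated once more. -/
theorem IsInducedGram.eventually (h : IsInducedGram H K F z) :
    ∀ᶠ y in 𝓝 z, IsInducedGram H K F y := by
  filter_upwards [h.smooth.eventually, h.hol.eventually, h.herm.eventually_nhds,
    h.induced.eventually_nhds, h.smooth.eventually_det_ne_zero h.det_ne,
    h.smooth'.eventually_det_ne_zero h.det_ne'] with y h1 h2 h3 h4 h5 h6
  exact ⟨h1, h2, h3, h4, h5, h6⟩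

theorem IsInducedGram.herm' (h : IsInducedGram H K F z) : (K z)ᴴ = K z := by
  rw [h.induced.self_of_nhds, Matrix.conjTranspose_mul, Matrix.conjTranspose_mul,
    Matrix.conjTranspose_conjTranspose, h.herm.self_of_nhds, Matrix.mul_assoc]

theorem IsInducedGram.mdlb_eq (h : IsInducedGram H K F z) (v : Cn n) :
    mdlb K v z = (mdl F v z)ᴴ * H z * F z + (F z)ᴴ * mdlb H v z * F z := by
  rw [mdlb_congr h.induced, mdlb_mul (h.hol.matSmooth.conjTranspose.mul h.smooth) h.hol.matSmooth,
    mdlb_mul h.hol.matSmooth.conjTranspose h.smooth, mdlb_conjTranspose h.hol.matSmooth,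
    h.hol.mdlb_eq, Matrix.mul_zero, add_zero, Matrix.add_mul]

theorem IsInducedGram.mdlb_mdl_eq (h : IsInducedGram H K F z) (v w : Cn n) :
    mdlb (mdl K w) v z = (mdl F v z)ᴴ * (mdl H w z * F z + H z * mdl F w z) +
      (F z)ᴴ * (mdlb (mdl H w) v z * F z + mdlb H v z * mdl F w z) := by
  have hF := h.hol.matSmooth
  rw [mdlb_congr (h.eventually.mono fun y hy => hy.mdl_eq w),
    mdlb_add ((hF.conjTranspose.mul (h.smooth.mdl w)).mul hF)
      ((hF.conjTranspose.mul h.smooth).mul (hF.mdl w)),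
    mdlb_mul (hF.conjTranspose.mul (h.smooth.mdl w)) hF,
    mdlb_mul (hF.conjTranspose.mul h.smooth) (hF.mdl w),
    mdlb_mul hF.conjTranspose (h.smooth.mdl w), mdlb_mul hF.conjTranspose h.smooth,
    mdlb_conjTranspose hF, h.hol.mdlb_eq, (h.hol.mdl w).mdlb_eq]
  simp only [Matrix.mul_add, Matrix.add_mul, Matrix.mul_sub, Matrix.sub_mul, Matrix.mul_assoc,
    Matrix.mul_one, Matrix.one_mul, Matrix.neg_mul, Matrix.mul_neg, Matrix.mul_zero,
    Matrix.zero_mul]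
  abel

theorem IsInducedGram.covDeriv_conjTranspose (h : IsInducedGram H K F z) (v : Cn n) :
    (covDeriv H F v z)ᴴ = (mdl F v z)ᴴ + (F z)ᴴ * mdlb H v z * (H z)⁻¹ := by
  rw [covDeriv, Matrix.conjTranspose_add, Matrix.conjTranspose_mul, Matrix.conjTranspose_mul,
    Matrix.conjTranspose_nonsing_inv, h.herm.self_of_nhds, mdlb_eq_conjTranspose h.smooth h.herm,
    Matrix.mul_assoc]

/-- The projection on the orthogonal complement is self-adjoint for the metric H. -/
theorem IsInducedGram.proj_conjTranspose (h : IsInducedGram H K F z) :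
    (1 - F z * orthProj H K F z)ᴴ * H z = H z * (1 - F z * orthProj H K F z) := by
  simp only [orthProj, Matrix.conjTranspose_sub, Matrix.conjTranspose_one,
    Matrix.conjTranspose_mul, Matrix.conjTranspose_nonsing_inv, h.herm.self_of_nhds, h.herm',
    Matrix.conjTranspose_conjTranspose]
  simp only [Matrix.mul_add, Matrix.add_mul, Matrix.mul_sub, Matrix.sub_mul, Matrix.mul_assoc,
    Matrix.mul_one, Matrix.one_mul, Matrix.neg_mul, Matrix.mul_neg, Matrix.mul_zero,
    Matrix.zero_mul]

theorem IsInducedGram.orthProj_mul (h : IsInducedGram H K F z) :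
    orthProj H K F z * F z = 1 := by
  rw [orthProj, Matrix.mul_assoc, Matrix.mul_assoc, ← Matrix.mul_assoc (F z)ᴴ,
    ← h.induced.self_of_nhds, Matrix.nonsing_inv_mul _ h.det_ne'.isUnit]

/-- The complementary projection is self-adjoint and idempotent, so one copy of it suffices. -/
theorem IsInducedGram.secondFundamental_mul (h : IsInducedGram H K F z) (v w : Cn n) :
    (secondFundamental H K F v z)ᴴ * H z * secondFundamental H K F w z =
      (covDeriv H F v z)ᴴ * H z * (1 - F z * orthProj H K F z) * covDeriv H F w z := by
  have hid : (1 - F z * orthProj H K F z) * (1 - F z * orthProj H K F z) =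
      1 - F z * orthProj H K F z := by
    have : F z * orthProj H K F z * (F z * orthProj H K F z) = F z * orthProj H K F z := by
      rw [Matrix.mul_assoc, ← Matrix.mul_assoc (orthProj H K F z), h.orthProj_mul, Matrix.one_mul]
    rw [Matrix.sub_mul, Matrix.one_mul, Matrix.mul_sub, Matrix.mul_one, this, sub_self, sub_zero]
  rw [secondFundamental, secondFundamental, Matrix.conjTranspose_mul,
    Matrix.mul_assoc (covDeriv H F v z)ᴴ, h.proj_conjTranspose]
  simp only [Matrix.mul_assoc]
  rw [← Matrix.mul_assoc (1 - F z * orthProj H K F z), hid]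

/-- The Gauss equation for a holomorphic subbundle. -/
theorem IsInducedGram.curvaturePiece_eq (h : IsInducedGram H K F z) (v w : Cn n) :
    curvaturePiece K v w z = (F z)ᴴ * curvaturePiece H v w z * F z +
      (secondFundamental H K F v z)ᴴ * H z * secondFundamental H K F w z := by
  have hHi : (H z)⁻¹ * H z = 1 := Matrix.nonsing_inv_mul _ h.det_ne.isUnit
  have hHi' : H z * (H z)⁻¹ = 1 := Matrix.mul_nonsing_inv _ h.det_ne.isUnit
  have e1 : (covDeriv H F v z)ᴴ * H z = (mdl F v z)ᴴ * H z + (F z)ᴴ * mdlb H v z := by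
    rw [h.covDeriv_conjTranspose, Matrix.add_mul, Matrix.mul_assoc _ (H z)⁻¹, hHi, Matrix.mul_one]
  have e2 : H z * covDeriv H F w z = H z * mdl F w z + mdl H w z * F z := by
    rw [covDeriv, Matrix.mul_add, ← Matrix.mul_assoc, ← Matrix.mul_assoc, hHi', Matrix.one_mul]
  have e3 : (covDeriv H F v z)ᴴ * H z * (1 - F z * orthProj H K F z) * covDeriv H F w z =
      (covDeriv H F v z)ᴴ * (H z * covDeriv H F w z) -
        ((covDeriv H F v z)ᴴ * H z) * F z * (K z)⁻¹ * ((F z)ᴴ * (H z * covDeriv H F w z)) := by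
    rw [orthProj]
    simp only [Matrix.mul_add, Matrix.add_mul, Matrix.mul_sub, Matrix.sub_mul, Matrix.mul_assoc,
      Matrix.mul_one, Matrix.one_mul, Matrix.neg_mul, Matrix.mul_neg, Matrix.mul_zero,
      Matrix.zero_mul]
  -- Metric compatibility: the derivatives of K are pairings of D'F with F. Hence the term ∂̄K K⁻¹
  -- ∂K in the curvature of K is exactly the projection term in `e3`.
  have e4 : mdlb K v z = ((covDeriv H F v z)ᴴ * H z) * F z := by
    rw [e1, h.mdlb_eq, Matrix.add_mul]
  have e5 : mdl K w z = (F z)ᴴ * (H z * covDeriv H F w z) := by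
    rw [e2, h.mdl_eq]
    simp only [Matrix.mul_add, Matrix.add_mul, Matrix.mul_sub, Matrix.sub_mul, Matrix.mul_assoc,
      Matrix.mul_one, Matrix.one_mul, Matrix.neg_mul, Matrix.mul_neg, Matrix.mul_zero,
      Matrix.zero_mul]
    abel
  have e6 : (covDeriv H F v z)ᴴ * (H z * covDeriv H F w z) =
      (mdl F v z)ᴴ * (mdl H w z * F z + H z * mdl F w z) + (F z)ᴴ * mdlb H v z * mdl F w z +
        (F z)ᴴ * mdlb H v z * (H z)⁻¹ * mdl H w z * F z := by
    rw [← Matrix.mul_assoc, e1, covDeriv]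
    simp only [Matrix.mul_add, Matrix.add_mul, ← Matrix.mul_assoc]
    rw [Matrix.mul_assoc _ (H z) (H z)⁻¹, hHi', Matrix.mul_one]
    abel
  rw [h.secondFundamental_mul, e3, ← e4, ← e5, e6, curvaturePiece, curvaturePiece, h.mdlb_mdl_eq]
  simp only [Matrix.mul_add, Matrix.add_mul, Matrix.mul_sub, Matrix.sub_mul, Matrix.mul_assoc,
    Matrix.mul_one, Matrix.one_mul, Matrix.neg_mul, Matrix.mul_neg, Matrix.mul_zero,
    Matrix.zero_mul]
  abel

theorem IsInducedGram.smooth_orthProj (h : IsInducedGram H K F z) :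
    MatSmooth (orthProj H K F) z :=
  ((h.smooth'.inv h.det_ne').mul h.hol.matSmooth.conjTranspose).mul h.smooth

/-- The derivative ∂̄P is the adjoint of the second fundamental form. This is the link between B = 0
and the holomorphy of the orthogonal splitting. -/
theorem IsInducedGram.mdlb_orthProj (h : IsInducedGram H K F z) (v : Cn n) :
    mdlb (orthProj H K F) v z = (K z)⁻¹ * (secondFundamental H K F v z)ᴴ * H z := by
  have hF := h.hol.matSmooth.conjTranspose
  have hHi : (H z)⁻¹ * H z = 1 := Matrix.nonsing_inv_mul _ h.det_ne.isUnit
  have e1 : (covDeriv H F v z)ᴴ * H z = (mdl F v z)ᴴ * H z + (F z)ᴴ * mdlb H v z := by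
    rw [h.covDeriv_conjTranspose, Matrix.add_mul, Matrix.mul_assoc _ (H z)⁻¹, hHi, Matrix.mul_one]
  have e4 : mdlb K v z = ((covDeriv H F v z)ᴴ * H z) * F z := by
    rw [e1, h.mdlb_eq, Matrix.add_mul]
  have e0 : orthProj H K F = fun y => (K y)⁻¹ * (F y)ᴴ * H y := rfl
  rw [secondFundamental, Matrix.conjTranspose_mul, Matrix.mul_assoc, Matrix.mul_assoc,
    h.proj_conjTranspose, ← Matrix.mul_assoc (covDeriv H F v z)ᴴ]
  conv_lhs => rw [e0]
  rw [mdlb_mul ((h.smooth'.inv h.det_ne').mul hF) h.smooth,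
    mdlb_mul (h.smooth'.inv h.det_ne') hF, mdlb_inv h.smooth' h.det_ne',
    mdlb_conjTranspose h.hol.matSmooth, e4, Matrix.mul_sub, Matrix.mul_one, Matrix.mul_sub]
  conv_rhs => rw [e1]
  rw [e1, orthProj]
  simp only [Matrix.mul_add, Matrix.add_mul, Matrix.mul_sub, Matrix.sub_mul, Matrix.mul_assoc,
    Matrix.mul_one, Matrix.one_mul, Matrix.neg_mul, Matrix.mul_neg, Matrix.mul_zero,
    Matrix.zero_mul]
  abel

end Subbundle

end HermiteEinstein

namespace HermiteEinstein

/-! ### Curvature of subbundles of Hermite–Einstein bundles -/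

section SubbundleCurvature

open scoped Matrix ComplexOrder

variable {n r s : ℕ} {H : Cn n → Matrix (Fin r) (Fin r) ℂ} {K : Cn n → Matrix (Fin s) (Fin s) ℂ}
  {F : Cn n → Matrix (Fin r) (Fin s) ℂ} {z : Cn n}

/-- Since K⁻¹ Fᴴ = P H⁻¹, the Gauss equation passes from Hermitian forms to endomorphisms. -/
theorem IsInducedGram.inv_mul_curvaturePiece (h : IsInducedGram H K F z) (v w : Cn n) :
    (K z)⁻¹ * (curvaturePiece K v w z - curvaturePiece K w v z) =
      orthProj H K F z * ((H z)⁻¹ * (curvaturePiece H v w z - curvaturePiece H w v z)) * F z +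
        (K z)⁻¹ * ((secondFundamental H K F v z)ᴴ * H z * secondFundamental H K F w z -
          (secondFundamental H K F w z)ᴴ * H z * secondFundamental H K F v z) := by
  have hHi' : H z * (H z)⁻¹ = 1 := Matrix.mul_nonsing_inv _ h.det_ne.isUnit
  have e : ∀ Y : Matrix (Fin r) (Fin r) ℂ, (K z)⁻¹ * (F z)ᴴ * H z * ((H z)⁻¹ * Y) =
      (K z)⁻¹ * (F z)ᴴ * Y := fun Y => by
    rw [Matrix.mul_assoc _ (H z), ← Matrix.mul_assoc (H z), hHi', Matrix.one_mul]
  rw [h.curvaturePiece_eq v w, h.curvaturePiece_eq w v, orthProj, e]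
  simp only [Matrix.mul_add, Matrix.add_mul, Matrix.mul_sub, Matrix.sub_mul, Matrix.mul_assoc]
  abel

theorem IsInducedGram.chernCurvature_eq_of_secondFundamental_eq_zero (h : IsInducedGram H K F z)
    (hB : ∀ v, secondFundamental H K F v z = 0) (i j : Fin s) :
    chernCurvature K i j z =
      ∑ k, ∑ l, (orthProj H K F z i k * F z l j) • chernCurvature H k l z := by
  refine twoForm_ext fun v w => ?_
  rw [chernCurvature_apply h.smooth' h.det_ne', h.inv_mul_curvaturePiece, hB v, hB w]
  simp only [form_sum_apply, AlternatingMap.smul_apply, chernCurvature_apply h.smooth h.det_ne,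
    Matrix.mul_zero, sub_zero, add_zero, Matrix.mul_apply (M := _ * _) (N := F z),
    Matrix.mul_apply (M := orthProj H K F z), Finset.sum_mul, smul_eq_mul]
  rw [Finset.sum_comm]
  exact Finset.sum_congr rfl fun k _ => Finset.sum_congr rfl fun l _ => by ring

/-- The entries of `R B Q`, where `B` is the second fundamental form. -/
def secondFundamentalLin (H : Cn n → Matrix (Fin r) (Fin r) ℂ) (K : Cn n → Matrix (Fin s) (Fin s) ℂ)
    (F : Cn n → Matrix (Fin r) (Fin s) ℂ) (z : Cn n) (R : Matrix (Fin r) (Fin r) ℂ)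
    (Q : Matrix (Fin s) (Fin s) ℂ) (i : Fin r) (j : Fin s) : Cn n →ₗ[ℂ] ℂ where
  toFun v := (R * secondFundamental H K F v z * Q) i j
  map_add' u v := by
    have h1 : ∀ {a b : ℕ} (M : Cn n → Matrix (Fin a) (Fin b) ℂ),
        mdl M (u + v) z = mdl M u z + mdl M v z := fun M => by
      ext i j; exact (dlLin (fun y => M y i j) z).map_add u v
    simp only [secondFundamental, covDeriv, h1, Matrix.mul_add, Matrix.add_mul, Matrix.add_apply]
    ring
  map_smul' c v := by
    have h1 : ∀ {a b : ℕ} (M : Cn n → Matrix (Fin a) (Fin b) ℂ),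
        mdl M (c • v) z = c • mdl M v z := fun M => by
      ext i j; exact (dlLin (fun y => M y i j) z).map_smul c v
    simp only [secondFundamental, covDeriv, h1, Matrix.mul_add, Matrix.add_mul, Matrix.add_apply,
      Matrix.mul_smul, Matrix.smul_mul, Matrix.smul_apply, RingHom.id_apply, smul_add]

/-- With H = Rᴴ R and K⁻¹ = Q Qᴴ, the trace of K⁻¹ B_vᴴ H B_w is the Hilbert–Schmidt product of R
B_v Q and R B_w Q. The correction term is therefore a sum of elementary (1,1)-forms, one for each
entry of R B Q. -/
theorem IsInducedGram.sum_chernCurvature (h : IsInducedGram H K F z)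
    {R : Matrix (Fin r) (Fin r) ℂ} {Q : Matrix (Fin s) (Fin s) ℂ} (hR : H z = Rᴴ * R)
    (hQ : (K z)⁻¹ = Q * Qᴴ) :
    ∑ i, chernCurvature K i i z =
      ∑ k, ∑ l, (F z * orthProj H K F z) l k • chernCurvature H k l z +
        Complex.I • ∑ i, ∑ j, elementaryTwoForm (secondFundamentalLin H K F z R Q i j) := by
  refine twoForm_ext fun v w => ?_
  have htr : ∀ v w : Cn n, ((K z)⁻¹ * ((secondFundamental H K F v z)ᴴ * H z *
      secondFundamental H K F w z)).trace = ∑ i, ∑ j,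
        conj (secondFundamentalLin H K F z R Q i j v) *
          secondFundamentalLin H K F z R Q i j w := by
    intro v w
    have e : ((K z)⁻¹ * ((secondFundamental H K F v z)ᴴ * H z *
        secondFundamental H K F w z)).trace =
        ((R * secondFundamental H K F v z * Q)ᴴ * (R * secondFundamental H K F w z * Q)).trace := by
      rw [hQ, hR, Matrix.mul_assoc, Matrix.trace_mul_comm]
      simp only [Matrix.conjTranspose_mul, Matrix.mul_assoc]
    rw [e, Finset.sum_comm]
    simp only [Matrix.trace, Matrix.diag, Matrix.mul_apply (M := (_)ᴴ), Matrix.conjTranspose_apply]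
    rfl
  have hlhs : (∑ i, chernCurvature K i i z) ![v, w] =
      ((K z)⁻¹ * (curvaturePiece K v w z - curvaturePiece K w v z)).trace := by
    rw [form_sum_apply]
    exact Finset.sum_congr rfl fun i _ => chernCurvature_apply h.smooth' h.det_ne' i i v w
  have h1 : (orthProj H K F z * ((H z)⁻¹ * (curvaturePiece H v w z - curvaturePiece H w v z)) *
      F z).trace = ∑ k, ∑ l, (F z * orthProj H K F z) l k * chernCurvature H k l z ![v, w] := by
    rw [Matrix.trace_mul_comm, ← Matrix.mul_assoc, Finset.sum_comm]
    refine Finset.sum_congr rfl fun l _ => ?_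
    rw [Matrix.diag_apply, Matrix.mul_apply]
    exact Finset.sum_congr rfl fun k _ => by rw [chernCurvature_apply h.smooth h.det_ne]
  rw [hlhs, h.inv_mul_curvaturePiece, Matrix.trace_add, h1, Matrix.mul_sub, Matrix.trace_sub, htr,
    htr]
  simp only [AlternatingMap.add_apply, AlternatingMap.smul_apply, form_sum_apply,
    elementaryTwoForm_apply, smul_eq_mul]
  congr 1
  rw [← Finset.sum_sub_distrib, Finset.mul_sum]
  refine Finset.sum_congr rfl fun i _ => ?_
  rw [← Finset.sum_sub_distrib, Finset.mul_sum]
  refine Finset.sum_congr rfl fun j _ => ?_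
  simp only [Matrix.cons_val_zero, Matrix.cons_val_one]
  linear_combination (-(secondFundamentalLin H K F z R Q i j v *
    conj (secondFundamentalLin H K F z R Q i j w)) + secondFundamentalLin H K F z R Q i j w *
    conj (secondFundamentalLin H K F z R Q i j v)) * Complex.I_mul_I

/-- The trace of the curvature of a subbundle of a Hermite–Einstein bundle. -/
theorem IsInducedGram.trace_curvature (h : IsInducedGram H K F z) (hH : (H z).PosDef)
    (hK : (K z).PosDef) (T : (Cn n [⋀^Fin 2]→ₗ[ℝ] ℂ) →ₗ[ℂ] ℂ)
    (hT : ∀ b : Cn n →ₗ[ℂ] ℂ, ∃ t : ℝ, 0 ≤ t ∧ (t = 0 → b = 0) ∧ T (elementaryTwoForm b) = t)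
    {c : ℂ} (hHE : ∀ i j, T (Complex.I • chernCurvature H i j z) =
      c * (1 : Matrix (Fin r) (Fin r) ℂ) i j) :
    ∃ t : ℝ, 0 ≤ t ∧ (t = 0 ↔ ∀ v, secondFundamental H K F v z = 0) ∧
      T (Complex.I • ∑ i, chernCurvature K i i z) = s * c - t := by
  -- The factors make the quadratic term in B a sum over the entries of R B Q'ᴴ; being invertible,
  -- they lose no information about B.
  obtain ⟨R, hRu, hR⟩ := posDef_exists_conjTranspose_mul_self hH
  obtain ⟨Q', hQu, hQ'⟩ := posDef_exists_conjTranspose_mul_self hK.inv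
  choose t ht0 ht1 ht2 using hT
  have hQ : (K z)⁻¹ = Q'ᴴ * Q'ᴴᴴ := by rw [Matrix.conjTranspose_conjTranspose, hQ']
  have hb : ∀ b, t b = 0 ↔ b = 0 := fun b => ⟨ht1 b, fun hb => by
    have := ht2 b
    rw [hb, show elementaryTwoForm (0 : Cn n →ₗ[ℂ] ℂ) = 0 from by
      ext v; simp [elementaryTwoForm_apply], map_zero] at this
    rw [hb]; exact_mod_cast this.symm⟩
  refine ⟨∑ i, ∑ j, t (secondFundamentalLin H K F z R Q'ᴴ i j), Finset.sum_nonneg fun i _ =>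
    Finset.sum_nonneg fun j _ => ht0 _, ?_, ?_⟩
  · rw [Finset.sum_eq_zero_iff_of_nonneg fun i _ => Finset.sum_nonneg fun j _ => ht0 _]
    constructor
    · intro h0 v
      have h1 : R * secondFundamental H K F v z * Q'ᴴ = 0 := by
        ext i j
        have := (Finset.sum_eq_zero_iff_of_nonneg fun j _ => ht0 _).1 (h0 i (Finset.mem_univ i)) j
          (Finset.mem_univ j)
        rw [hb] at this
        exact congrArg (fun L => L v) this
      have hQu' : IsUnit (Q'ᴴ).det := by
        rw [Matrix.det_conjTranspose]; exact hQu.star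
      have h2 : R⁻¹ * (R * secondFundamental H K F v z * Q'ᴴ) * (Q'ᴴ)⁻¹ =
          secondFundamental H K F v z := by
        rw [← Matrix.mul_assoc, ← Matrix.mul_assoc, Matrix.nonsing_inv_mul _ hRu, Matrix.one_mul,
          Matrix.mul_assoc, Matrix.mul_nonsing_inv _ hQu', Matrix.mul_one]
      rw [← h2, h1, Matrix.mul_zero, Matrix.zero_mul]
    · intro h0 i _
      refine Finset.sum_eq_zero fun j _ => (hb _).2 ?_
      refine LinearMap.ext fun v => ?_
      change (R * secondFundamental H K F _ z * Q'ᴴ) i j = 0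
      rw [h0, Matrix.mul_zero, Matrix.zero_mul, Matrix.zero_apply]
  · rw [h.sum_chernCurvature hR hQ, smul_add, smul_smul, Complex.I_mul_I, map_add, neg_one_smul,
      map_neg, ← sub_eq_add_neg]
    congr 1
    -- The Einstein equation leaves c times the trace of the projection F P, and that trace is s
    -- because P F = 1.
    · have hFP : (F z * orthProj H K F z).trace = s := by
        rw [Matrix.trace_mul_comm, h.orthProj_mul]; simp
      rw [← hFP, Finset.smul_sum, map_sum, Matrix.trace, Finset.sum_mul]
      refine Finset.sum_congr rfl fun k _ => ?_
      rw [Finset.smul_sum, map_sum, Finset.sum_eq_single k]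
      · rw [smul_comm, map_smul, hHE]; simp
      · intro l _ hl
        rw [smul_comm, map_smul, hHE, Matrix.one_apply_ne (Ne.symm hl)]; simp
      · simp
    · simp only [map_sum, ht2]
      push_cast
      rfl

/-- A holomorphic orthogonal summand of a Hermite–Einstein bundle is Hermite–Einstein. -/
theorem IsInducedGram.hermiteEinstein (h : IsInducedGram H K F z)
    (hB : ∀ v, secondFundamental H K F v z = 0) {V : Type*} [AddCommGroup V] [Module ℂ V]
    (T : (Cn n [⋀^Fin 2]→ₗ[ℝ] ℂ) →ₗ[ℂ] V) {c : ℂ} {vol : V}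
    (hHE : ∀ i j, T (Complex.I • chernCurvature H i j z) =
      (c * (1 : Matrix (Fin r) (Fin r) ℂ) i j) • vol) (i j : Fin s) :
    T (Complex.I • chernCurvature K i j z) = (c * (1 : Matrix (Fin s) (Fin s) ℂ) i j) • vol := by
  -- Without second fundamental form the curvature is P Θ F. The Einstein equation replaces Θ by c,
  -- and P F = 1; writing the identity as P F lets the two sides be compared termwise.
  rw [h.chernCurvature_eq_of_secondFundamental_eq_zero hB, ← h.orthProj_mul, Matrix.mul_apply,
    Finset.mul_sum, Finset.sum_smul, Finset.smul_sum, map_sum]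
  refine Finset.sum_congr rfl fun k _ => ?_
  rw [Finset.smul_sum, map_sum, Finset.sum_eq_single k]
  · rw [smul_comm, map_smul, hHE, smul_smul]
    congr 1; simp; ring
  · intro l _ hl
    rw [smul_comm, map_smul, hHE, Matrix.one_apply_ne (Ne.symm hl)]; simp
  · simp

end SubbundleCurvature

/-! ### The dual metric -/

section Dual

open scoped Matrix ComplexOrder

variable {n r : ℕ} {H : Cn n → Matrix (Fin r) (Fin r) ℂ} {z : Cn n}

/-- The Gram matrix of the dual metric in the dual frame. -/
def dualGram {a : Type*} [Fintype a] [DecidableEq a] (H : Cn n → Matrix a a ℂ) (y : Cn n) :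
    Matrix a a ℂ := ((H y)⁻¹)ᵀ

theorem MatSmooth.dualGram (hH : MatSmooth H z) (h0 : (H z).det ≠ 0) :
    MatSmooth (dualGram H) z := fun i j => hH.inv h0 j i

theorem dualGram_det_ne (h0 : (H z).det ≠ 0) : (dualGram H z).det ≠ 0 := by
  rw [dualGram, Matrix.det_transpose, Matrix.det_nonsing_inv, Ring.inverse_eq_inv']
  exact inv_ne_zero h0

theorem dualGram_inv (h0 : (H z).det ≠ 0) : (dualGram H z)⁻¹ = (H z)ᵀ := by
  rw [dualGram, ← Matrix.transpose_nonsing_inv, Matrix.nonsing_inv_nonsing_inv _ h0.isUnit]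

/-- Differentiating H⁻¹ twice gives three terms. One of them cancels against ∂̄(H⁻¹) H ∂(H⁻¹), and
the rest is minus the transpose of the expression for H. -/
theorem inv_mul_curvaturePiece_dualGram (hH : MatSmooth H z) (h0 : (H z).det ≠ 0) (v w : Cn n) :
    (dualGram H z)⁻¹ * curvaturePiece (dualGram H) v w z =
      ((H z)⁻¹ * mdlb H v z * (H z)⁻¹ * mdl H w z -
        (H z)⁻¹ * mdlb (mdl H w) v z)ᵀ := by
  have hT : ∀ (M : Cn n → Matrix (Fin r) (Fin r) ℂ) (u y : Cn n),
      mdl (fun y => (M y)ᵀ) u y = (mdl M u y)ᵀ := fun _ _ _ => rfl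
  have hT' : ∀ (M : Cn n → Matrix (Fin r) (Fin r) ℂ) (u y : Cn n),
      mdlb (fun y => (M y)ᵀ) u y = (mdlb M u y)ᵀ := fun _ _ _ => rfl
  have hd : dualGram H = fun y => ((H y)⁻¹)ᵀ := rfl
  have hHi' : H z * (H z)⁻¹ = 1 := Matrix.mul_nonsing_inv _ h0.isUnit
  have hHi : (H z)⁻¹ * H z = 1 := Matrix.nonsing_inv_mul _ h0.isUnit
  have e1 : mdl (dualGram H) w =ᶠ[𝓝 z]
      fun y => (-((H y)⁻¹ * mdl H w y * (H y)⁻¹))ᵀ := by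
    filter_upwards [hH.eventually, hH.eventually_det_ne_zero h0] with y hy hy0
    rw [hd, hT, mdl_inv hy hy0]
  have hneg : ∀ (M : Cn n → Matrix (Fin r) (Fin r) ℂ), mdlb (fun y => -M y) v z = -mdlb M v z := by
    intro M
    ext i j
    simp only [mdlb, Matrix.of_apply, Matrix.neg_apply, dlb, fderiv_fun_neg, neg_apply]
    ring
  rw [curvaturePiece, mdlb_congr e1, hT', hneg,
    mdlb_mul ((hH.inv h0).mul (hH.mdl w)) (hH.inv h0), mdlb_mul (hH.inv h0) (hH.mdl w),
    dualGram_inv h0, hd, hT, hT', mdl_inv hH h0, mdlb_inv hH h0]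
  rw [← Matrix.transpose_mul, ← Matrix.transpose_mul, ← Matrix.transpose_sub,
    ← Matrix.transpose_mul]
  congr 1
  simp only [Matrix.mul_add, Matrix.add_mul, Matrix.mul_sub, Matrix.sub_mul, Matrix.mul_assoc,
    Matrix.neg_mul, Matrix.mul_neg, hHi, Matrix.mul_one]
  simp only [← Matrix.mul_assoc (H z) (H z)⁻¹, hHi', Matrix.one_mul]
  abel

/-- The curvature of the dual metric. -/
theorem chernCurvature_dualGram (hH : MatSmooth H z) (h0 : (H z).det ≠ 0) (i j : Fin r) :
    chernCurvature (dualGram H) i j z = -chernCurvature H j i z := by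
  refine twoForm_ext fun v w => ?_
  rw [AlternatingMap.neg_apply, chernCurvature_apply (hH.dualGram h0) (dualGram_det_ne h0),
    chernCurvature_apply hH h0, Matrix.mul_sub, inv_mul_curvaturePiece_dualGram hH h0,
    inv_mul_curvaturePiece_dualGram hH h0]
  rw [← Matrix.transpose_sub, Matrix.transpose_apply, ← Matrix.neg_apply]
  refine congrFun (congrFun ?_ j) i
  simp only [curvaturePiece, Matrix.mul_sub, Matrix.mul_assoc]
  abel

end Dual

/-! ### Curvature of line bundles and of determinants -/

section Trace

variable {n : ℕ}

/-- The curvature `-∂∂̄ log u` of a metric on a line bundle. -/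
def lineCurvature (u : Cn n → ℂ) (z : Cn n) : Cn n [⋀^Fin 2]→ₗ[ℝ] ℂ :=
  chernCurvature (r := 1) (fun y => Matrix.of fun _ _ => u y) 0 0 z

/-- The Levi form of the logarithm. -/
def logLevi (u : Cn n → ℂ) (v w z : Cn n) : ℂ := dlb (fun y => (u y)⁻¹ * dl u w y) v z

theorem dlb_inv {u : Cn n → ℂ} {z : Cn n} (hu : SmoothNear u z) (h0 : u z ≠ 0) (v : Cn n) :
    dlb (fun y => (u y)⁻¹) v z = -((u z)⁻¹ * dlb u v z * (u z)⁻¹) := by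
  have h1 : (fun y => (u y)⁻¹ * u y) =ᶠ[𝓝 z] fun _ => 1 :=
    (hu.contDiffAt.continuousAt.eventually_ne h0).mono fun y hy => inv_mul_cancel₀ hy
  have h2 := dlb_congr h1 v
  rw [dlb_mul (hu.inv h0) hu, dlb_const] at h2
  field_simp
  field_simp at h2
  linear_combination h2

/-- For a 1 × 1 matrix, H⁻¹(∂̄∂H - ∂̄H H⁻¹ ∂H) is the quotient rule for ∂̄(u⁻¹∂u). -/
theorem lineCurvature_apply {u : Cn n → ℂ} {z : Cn n} (hu : SmoothNear u z) (h0 : u z ≠ 0)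
    (v w : Cn n) : lineCurvature u z ![v, w] = logLevi u v w z - logLevi u w v z := by
  have hs : MatSmooth (fun y => (Matrix.of fun _ _ => u y : Matrix (Fin 1) (Fin 1) ℂ)) z :=
    fun _ _ => hu
  have hdet : ((Matrix.of fun _ _ => u z : Matrix (Fin 1) (Fin 1) ℂ)).det ≠ 0 := by simpa using h0
  have hinv : ((Matrix.of fun _ _ => u z : Matrix (Fin 1) (Fin 1) ℂ))⁻¹ =
      Matrix.of fun _ _ => (u z)⁻¹ := by
    refine Matrix.inv_eq_left_inv ?_
    ext i j
    rw [Subsingleton.elim i j]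
    simp [Matrix.mul_apply, h0]
  have hp : ∀ v w, logLevi u v w z = ((Matrix.of fun _ _ => u z : Matrix (Fin 1) (Fin 1) ℂ)⁻¹ *
      curvaturePiece (fun y => (Matrix.of fun _ _ => u y : Matrix (Fin 1) (Fin 1) ℂ)) v w z) 0 0 :=
    by
    intro v w
    rw [logLevi, dlb_mul (hu.inv h0) (hu.dl w), dlb_inv hu h0]
    simp only [hinv, curvaturePiece, Matrix.mul_sub, Matrix.sub_apply, Matrix.mul_apply,
      Finset.univ_unique, Fin.default_eq_zero, Finset.sum_singleton, Matrix.of_apply]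
    have e1 : mdlb (mdl (fun y => (Matrix.of fun _ _ => u y : Matrix (Fin 1) (Fin 1) ℂ)) w) v z 0 0
      = dlb (dl u w) v z := rfl
    have e2 : mdlb (fun y => (Matrix.of fun _ _ => u y : Matrix (Fin 1) (Fin 1) ℂ)) v z 0 0
      = dlb u v z := rfl
    have e3 : mdl (fun y => (Matrix.of fun _ _ => u y : Matrix (Fin 1) (Fin 1) ℂ)) w z 0 0
      = dl u w z := rfl
    rw [e1, e2, e3]
    ring
  rw [lineCurvature, chernCurvature_apply hs hdet, Matrix.mul_sub, Matrix.sub_apply, ← hp, ← hp]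

/-- By Jacobi's formula ∂ log det H = tr(H⁻¹ ∂H); apply ∂̄ to both sides. -/
theorem sum_chernCurvature_eq_lineCurvature {r : ℕ} {H : Cn n → Matrix (Fin r) (Fin r) ℂ}
    {z : Cn n} (hH : MatSmooth H z) (h0 : (H z).det ≠ 0) :
    ∑ i, chernCurvature H i i z = lineCurvature (fun y => (H y).det) z := by
  refine twoForm_ext fun v w => ?_
  have hp : ∀ v w, logLevi (fun y => (H y).det) v w z =
      ((H z)⁻¹ * curvaturePiece H v w z).trace := by
    intro v w
    have e : (fun y => ((H y).det)⁻¹ * dl (fun y => (H y).det) w y) =ᶠ[𝓝 z]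
        fun y => ∑ i, ((H y)⁻¹ * mdl H w y) i i := by
      filter_upwards [hH.eventually, hH.eventually_det_ne_zero h0] with y hy hy0
      rw [dl_det hy hy0, inv_mul_cancel_left₀ hy0]
      rfl
    have hs := (hH.inv h0).mul (hH.mdl w)
    rw [logLevi, dlb_congr e, dlb_sum fun i _ => hs i i, Matrix.trace]
    refine Finset.sum_congr rfl fun i _ => ?_
    change mdlb (fun y => (H y)⁻¹ * mdl H w y) v z i i = _
    rw [mdlb_mul (hH.inv h0) (hH.mdl w), mdlb_inv hH h0, curvaturePiece, Matrix.diag_apply]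
    refine congrFun (congrFun ?_ i) i
    noncomm_ring
  rw [lineCurvature_apply hH.det h0, hp, hp, ← Matrix.trace_sub, ← Matrix.mul_sub, form_sum_apply]
  exact Finset.sum_congr rfl fun i _ => chernCurvature_apply hH h0 i i v w

/-- The curvature depends only on the germ of the metric, so frames and trivializations matter only
near the point. -/
theorem lineCurvature_congr {u u' : Cn n → ℂ} {z : Cn n} (h : u =ᶠ[𝓝 z] u') (hu : SmoothNear u z)
    (h0 : u z ≠ 0) : lineCurvature u z = lineCurvature u' z := by
  have hu' := hu.congr h.symm
  have h0' : u' z ≠ 0 := by rw [← h.self_of_nhds]; exact h0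
  have e : ∀ w, (fun y => (u y)⁻¹ * dl u w y) =ᶠ[𝓝 z] fun y => (u' y)⁻¹ * dl u' w y := fun w => by
    filter_upwards [h, h.eventuallyEq_nhds] with y hy hy'
    rw [hy, dl_congr hy']
  refine twoForm_ext fun v w => ?_
  rw [lineCurvature_apply hu h0, lineCurvature_apply hu' h0', logLevi, logLevi, dlb_congr (e w),
    dlb_congr (e v)]
  rfl

theorem logLevi_mul {u u' : Cn n → ℂ} {z : Cn n} (hu : SmoothNear u z) (h0 : u z ≠ 0)
    (hu' : SmoothNear u' z) (h0' : u' z ≠ 0) (v w : Cn n) :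
    logLevi (fun y => u y * u' y) v w z = logLevi u v w z + logLevi u' v w z := by
  have e : (fun y => (u y * u' y)⁻¹ * dl (fun y => u y * u' y) w y) =ᶠ[𝓝 z]
      fun y => (u y)⁻¹ * dl u w y + (u' y)⁻¹ * dl u' w y := by
    filter_upwards [hu.eventually, hu'.eventually, hu.contDiffAt.continuousAt.eventually_ne h0,
      hu'.contDiffAt.continuousAt.eventually_ne h0'] with y h1 h2 h3 h4
    rw [dl_mul h1 h2]
    field_simp
  rw [logLevi, dlb_congr e, dlb_add ((hu.inv h0).mul (hu.dl w)) ((hu'.inv h0').mul (hu'.dl w))]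
  rfl

theorem lineCurvature_mul {u u' : Cn n → ℂ} {z : Cn n} (hu : SmoothNear u z) (h0 : u z ≠ 0)
    (hu' : SmoothNear u' z) (h0' : u' z ≠ 0) :
    lineCurvature (fun y => u y * u' y) z = lineCurvature u z + lineCurvature u' z := by
  refine twoForm_ext fun v w => ?_
  rw [AlternatingMap.add_apply, lineCurvature_apply hu h0, lineCurvature_apply hu' h0',
    lineCurvature_apply (hu.mul hu') (mul_ne_zero h0 h0'), logLevi_mul hu h0 hu' h0',
    logLevi_mul hu h0 hu' h0']
  ring

/-- The function log |τ|² is pluriharmonic: both log-derivatives are (anti)holomorphic. Hence a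
change of holomorphic frame does not affect the curvature. -/
theorem lineCurvature_normSq {τ : Cn n → ℂ} {z : Cn n} (hτ : HolNear τ z) (h0 : τ z ≠ 0) :
    lineCurvature (fun y => conj (τ y) * τ y) z = 0 := by
  have h0' : conj (τ z) ≠ 0 := by simpa using h0
  have hs := hτ.smoothNear
  refine twoForm_ext fun v w => ?_
  have h1 : ∀ v w, logLevi (fun y => conj (τ y) * τ y) v w z = 0 := by
    intro v w
    rw [logLevi_mul hs.conj h0' hs h0]
    have e : (fun y => (conj (τ y))⁻¹ * dl (fun y => conj (τ y)) w y) =ᶠ[𝓝 z] fun _ => 0 := by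
      filter_upwards [hτ.eventually] with y hy
      rw [dl_conj hy.smoothNear, hy.dlb_eq, map_zero, mul_zero]
    have e2 : logLevi τ v w z = 0 := by
      rw [logLevi, dlb_mul (hs.inv h0) (hs.dl w), dlb_inv hs h0, hτ.dlb_eq, (hτ.dl w).dlb_eq]
      simp
    rw [e2, logLevi, dlb_congr e, dlb_const, add_zero]
  rw [lineCurvature_apply (hs.conj.mul hs) (mul_ne_zero h0' h0), h1, h1, sub_zero]
  rfl

end Trace

end HermiteEinstein

namespace HermiteEinstein

/-! ### The Cauchy–Riemann equations -/

section Holomorphy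

variable {n : ℕ}

theorem differentiableAt_complex_of_dlb_eq_zero {f : Cn n → ℂ} {z : Cn n}
    (hf : DifferentiableAt ℝ f z) (h : ∀ v, dlb f v z = 0) : DifferentiableAt ℂ f z := by
  have hI : ∀ v, fderiv ℝ f z (Complex.I • v) = Complex.I * fderiv ℝ f z v := by
    intro v
    have h1 := h v
    rw [dlb] at h1
    linear_combination (-2 * Complex.I) * h1 + fderiv ℝ f z (Complex.I • v) * Complex.I_mul_I
  have hc : ∀ (c : ℂ) (v : Cn n), fderiv ℝ f z (c • v) = c • fderiv ℝ f z v := by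
    intro c v
    rw [complex_smul_eq, map_add, map_smul, map_smul, hI]
    conv_rhs => rw [← Complex.re_add_im c]
    simp only [Complex.real_smul, smul_eq_mul]
    ring
  refine (differentiableAt_iff_restrictScalars ℝ hf).2 ⟨⟨⟨⟨fderiv ℝ f z, map_add _⟩, hc⟩,
    (fderiv ℝ f z).continuous⟩, ?_⟩
  ext v
  rfl

/-- Induction on the order. The complex derivative is v ↦ ∂_v f, and ∂_v f is again smooth with
∂̄∂_v f = ∂_v∂̄f = 0. Real smoothness is given, so no integral formula is involved. -/
theorem contDiffAt_complex_of_dlb_eq_zero (k : ℕ) : ∀ {f : Cn n → ℂ} {z : Cn n},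
    SmoothNear f z → (∀ᶠ y in 𝓝 z, ∀ v, dlb f v y = 0) → ContDiffAt ℂ k f z := by
  induction k with
  | zero =>
    intro f z hf _
    exact contDiffAt_zero.2 ⟨{y | ContDiffAt ℝ smoothOrder f y}, hf, fun y hy => by
      have hy' : ContDiffAt ℝ smoothOrder f y := hy
      exact hy'.continuousAt.continuousWithinAt⟩
  | succ k ih =>
    intro f z hf h
    refine contDiffAt_succ_iff_hasFDerivAt.2 ⟨fderiv ℂ f, ?_, ?_⟩
    · refine ⟨_, Filter.inter_mem hf h, fun y hy => ?_⟩
      have hy' : ContDiffAt ℝ smoothOrder f y := hy.1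
      exact (differentiableAt_complex_of_dlb_eq_zero
        (hy'.differentiableAt smoothOrder_ne_zero) hy.2).hasFDerivAt
    · have h1 : ∀ v, ContDiffAt ℂ k (fun y => fderiv ℂ f y v) z := by
        intro v
        have e : (fun y => fderiv ℂ f y v) =ᶠ[𝓝 z] dl f v := by
          filter_upwards [hf, h] with y hy hy'
          have hd := differentiableAt_complex_of_dlb_eq_zero
            (hy.differentiableAt smoothOrder_ne_zero) hy'
          have h3 := dl_add_dlb f v y
          rw [hy', add_zero, hd.fderiv_restrictScalars ℝ] at h3
          exact h3.symm
        refine (ih (hf.dl v) ?_).congr_of_eventuallyEq e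
        filter_upwards [hf.eventually, h.eventually_nhds] with y hy hy' w
        have hcomm : dlb (dl f v) w y = dl (dlb f w) v y := by
          rw [dl, dlb, fderiv_dl hy, fderiv_dl hy, fderiv_dlb hy, fderiv_dlb hy,
            fderiv_fderiv_comm hy v w, fderiv_fderiv_comm hy v (Complex.I • w),
            fderiv_fderiv_comm hy (Complex.I • v) w,
            fderiv_fderiv_comm hy (Complex.I • v) (Complex.I • w)]
          ring
        have e2 : dlb f w =ᶠ[𝓝 y] fun _ => 0 := hy'.mono fun u hu => hu w
        rw [hcomm, dl_congr e2, dl_const]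
      have e : fderiv ℂ f = fun y => ∑ i, (fderiv ℂ f y (Pi.single i 1)) •
          (ContinuousLinearMap.proj i : Cn n →L[ℂ] ℂ) := by
        funext y
        ext v
        have hv : v = ∑ i, v i • (Pi.single i (1 : ℂ) : Cn n) := pi_eq_sum_univ' v
        conv_lhs => rw [hv]
        simp [mul_comm]
      rw [e]
      exact ContDiffAt.sum fun i _ => (h1 _).smul contDiffAt_const

theorem SmoothNear.holNear {f : Cn n → ℂ} {z : Cn n} (hf : SmoothNear f z)
    (h : ∀ᶠ y in 𝓝 z, ∀ v, HermiteEinstein.dlb f v y = 0) : HolNear f z := by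
  filter_upwards [hf.eventually, h.eventually_nhds] with y hy hy'
  exact contDiffAt_infty.2 fun k => contDiffAt_complex_of_dlb_eq_zero k hy hy'

theorem MatSmooth.matHol {a b : Type*} {M : Cn n → Matrix a b ℂ} {z : Cn n} (hM : MatSmooth M z)
    (h : ∀ᶠ y in 𝓝 z, ∀ v, HermiteEinstein.mdlb M v y = 0) : MatHol M z := fun i j =>
  (hM i j).holNear (h.mono fun _ hy v => congrFun (congrFun (hy v) i) j)

end Holomorphy

/-! ### Reading functions on X in charts -/

section Charts

variable {n : ℕ} {X : Type*} [TopologicalSpace X] [ChartedSpace (Cn n) X]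

theorem isManifold_real [IsManifold 𝓘(ℂ, Cn n) smoothOrder X] :
    IsManifold 𝓘(ℝ, Cn n) smoothOrder X := by
  refine isManifold_of_contDiffOn _ _ _ fun e e' he he' => ?_
  have h := HasGroupoid.compatible (G := contDiffGroupoid smoothOrder 𝓘(ℂ, Cn n)) he he'
  rw [contDiffGroupoid, mem_groupoid_of_pregroupoid] at h
  exact h.1.restrict_scalars ℝ

/-- Stated over a general field, because metrics are smooth over ℝ while transition data are smooth
over ℂ. -/
theorem contDiffAt_comp_chart_symm {𝕜 : Type*} [NontriviallyNormedField 𝕜] [NormedSpace 𝕜 (Cn n)]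
    {G : Type*} [NormedAddCommGroup G] [NormedSpace 𝕜 G] [IsManifold 𝓘(𝕜, Cn n) smoothOrder X]
    {g : X → G} {U : Set X} (hU : IsOpen U) (hg : ContMDiffOn 𝓘(𝕜, Cn n) 𝓘(𝕜, G) smoothOrder g U)
    {p x : X} (hx : x ∈ U) (hp : x ∈ (chartAt (Cn n) p).source) :
    ∀ᶠ y in 𝓝 (chartAt (Cn n) p x),
      ContDiffAt 𝕜 smoothOrder (fun y => g ((chartAt (Cn n) p).symm y)) y := by
  have ht := (chartAt (Cn n) p).map_source hp
  have h1 : ∀ᶠ y in 𝓝 (chartAt (Cn n) p x), (chartAt (Cn n) p).symm y ∈ U := by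
    refine ((chartAt (Cn n) p).continuousAt_symm ht).eventually_mem (hU.mem_nhds ?_)
    rwa [(chartAt (Cn n) p).left_inv hp]
  filter_upwards [h1, (chartAt (Cn n) p).open_target.mem_nhds ht] with y hy hy'
  rw [← contMDiffAt_iff_contDiffAt]
  exact (hg.contMDiffAt (hU.mem_nhds hy)).comp y
    ((contMDiffOn_chart_symm (I := 𝓘(𝕜, Cn n))).contMDiffAt
      ((chartAt (Cn n) p).open_target.mem_nhds hy'))

end Charts

/-! ### Matrices of bundle homomorphisms in local frames -/

section LocalMatrix

variable {n a b c : ℕ} {X : Type*} [TopologicalSpace X]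
  {A : X → Type*} [∀ x, AddCommGroup (A x)] [∀ x, Module ℂ (A x)]
  [TopologicalSpace (TotalSpace (Fin a → ℂ) A)] [∀ x, TopologicalSpace (A x)]
  [FiberBundle (Fin a → ℂ) A] [VectorBundle ℂ (Fin a → ℂ) A]
  {B : X → Type*} [∀ x, AddCommGroup (B x)] [∀ x, Module ℂ (B x)]
  [TopologicalSpace (TotalSpace (Fin b → ℂ) B)] [∀ x, TopologicalSpace (B x)]
  [FiberBundle (Fin b → ℂ) B] [VectorBundle ℂ (Fin b → ℂ) B]
  {C : X → Type*} [∀ x, AddCommGroup (C x)] [∀ x, Module ℂ (C x)]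
  [TopologicalSpace (TotalSpace (Fin c → ℂ) C)] [∀ x, TopologicalSpace (C x)]
  [FiberBundle (Fin c → ℂ) C] [VectorBundle ℂ (Fin c → ℂ) C]
  (f : ∀ x, A x →ₗ[ℂ] B x) (f' : ∀ x, B x →ₗ[ℂ] C x)
  (e : Trivialization (Fin a → ℂ) (π (Fin a → ℂ) A)) [MemTrivializationAtlas e]
  (e' : Trivialization (Fin b → ℂ) (π (Fin b → ℂ) B)) [MemTrivializationAtlas e']
  (e'' : Trivialization (Fin c → ℂ) (π (Fin c → ℂ) C)) [MemTrivializationAtlas e'']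

/-- The matrix of a homomorphism of vector bundles in local trivializations. -/
def localMatrix (x : X) : Matrix (Fin b) (Fin a) ℂ :=
  LinearMap.toMatrix' (e'.linearMapAt ℂ x ∘ₗ f x ∘ₗ e.symmₗ ℂ x)

variable {e e'}

theorem localMatrix_mulVec {x : X} (hx : x ∈ e.baseSet) (v : Fin a → ℂ) :
    (localMatrix f e e' x).mulVec v = e'.linearMapAt ℂ x (f x (e.symm x v)) := by
  rw [localMatrix, LinearMap.toMatrix'_mulVec]
  simp only [LinearMap.comp_apply, e.symmₗ_apply hx]

theorem apply_symm_eq {x : X} (hx : x ∈ e.baseSet) (hx' : x ∈ e'.baseSet) (v : Fin a → ℂ) :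
    f x (e.symm x v) = e'.symm x ((localMatrix f e e' x).mulVec v) := by
  rw [localMatrix_mulVec f hx, Trivialization.symm_linearMapAt e' hx']

theorem localMatrix_comp {x : X} (hx' : x ∈ e'.baseSet) :
    localMatrix (fun x => f' x ∘ₗ f x) e e'' x = localMatrix f' e' e'' x * localMatrix f e e' x := by
  rw [localMatrix, localMatrix, localMatrix, ← LinearMap.toMatrix'_comp]
  congr 1
  refine LinearMap.ext fun v => ?_
  simp only [LinearMap.comp_apply, e'.symmₗ_apply hx', Trivialization.symm_linearMapAt e' hx']

theorem localMatrix_id {x : X} (hx : x ∈ e.baseSet) :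
    localMatrix (fun x => (LinearMap.id : A x →ₗ[ℂ] A x)) e e x = 1 := by
  rw [← LinearMap.toMatrix'_id, localMatrix]
  congr 1
  refine LinearMap.ext fun v => ?_
  simp only [LinearMap.comp_apply, e.symmₗ_apply hx, LinearMap.id_apply,
    Trivialization.linearMapAt_symm e hx]

variable [ChartedSpace (Cn n) X]

-- Two homomorphisms are allowed: f = k gives the induced metric, and one of them the identity gives
-- the relation that defines an adjoint.
open scoped Matrix in
theorem gram_localMatrix {C : X → Type*} [∀ x, AddCommGroup (C x)] [∀ x, Module ℂ (C x)]
    [TopologicalSpace (TotalSpace (Fin c → ℂ) C)] [∀ x, TopologicalSpace (C x)]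
    [FiberBundle (Fin c → ℂ) C] [VectorBundle ℂ (Fin c → ℂ) C]
    {e'' : Trivialization (Fin c → ℂ) (π (Fin c → ℂ) C)} [MemTrivializationAtlas e'']
    (h : HermitianMetric n b B) (k : ∀ x, C x →ₗ[ℂ] B x)
    {x : X} (hx : x ∈ e.baseSet) (hx' : x ∈ e'.baseSet) (hx'' : x ∈ e''.baseSet) :
    Matrix.of (fun i j => h.inner x (f x (frame e i x)) (k x (frame e'' j x))) =
      (localMatrix f e e' x)ᴴ * h.gram e' x * localMatrix k e'' e' x := by
  ext i j
  rw [Matrix.of_apply, frame, frame, apply_symm_eq f hx hx', apply_symm_eq k hx'' hx',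
    h.inner_symm_symm e' x hx', Matrix.mul_assoc, Matrix.mul_apply]
  simp [Matrix.mulVec, dotProduct, Matrix.mul_apply, Pi.single_apply]

end LocalMatrix

/-! ### Holomorphic homomorphisms and holomorphic matrices -/

section HolomorphicHom

variable {n a b : ℕ} {X : Type*} [TopologicalSpace X] [ChartedSpace (Cn n) X]
  [IsManifold 𝓘(ℂ, Cn n) smoothOrder X]
  {A : X → Type*} [∀ x, AddCommGroup (A x)] [∀ x, Module ℂ (A x)]
  [TopologicalSpace (TotalSpace (Fin a → ℂ) A)] [∀ x, TopologicalSpace (A x)]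
  [FiberBundle (Fin a → ℂ) A] [VectorBundle ℂ (Fin a → ℂ) A]
  [ContMDiffVectorBundle smoothOrder (Fin a → ℂ) A 𝓘(ℂ, Cn n)]
  {B : X → Type*} [∀ x, AddCommGroup (B x)] [∀ x, Module ℂ (B x)]
  [TopologicalSpace (TotalSpace (Fin b → ℂ) B)] [∀ x, TopologicalSpace (B x)]
  [FiberBundle (Fin b → ℂ) B] [VectorBundle ℂ (Fin b → ℂ) B]
  [ContMDiffVectorBundle smoothOrder (Fin b → ℂ) B 𝓘(ℂ, Cn n)]
  {f : ∀ x, A x →ₗ[ℂ] B x}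
  {e : Trivialization (Fin a → ℂ) (π (Fin a → ℂ) A)} [MemTrivializationAtlas e]
  {e' : Trivialization (Fin b → ℂ) (π (Fin b → ℂ) B)} [MemTrivializationAtlas e']

/-- The j-th column is the image of the j-th frame section, which is holomorphic since its local
expression is constant. -/
theorem IsHolomorphicHom.matHol (hf : IsHolomorphicHom n a b f) {p x : X}
    (hp : x ∈ (chartAt (Cn n) p).source) (hx : x ∈ e.baseSet) (hx' : x ∈ e'.baseSet) :
    MatHol (fun y => localMatrix f e e' ((chartAt (Cn n) p).symm y)) (chartAt (Cn n) p x) := by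
  intro i j
  refine contDiffAt_comp_chart_symm (g := fun x => localMatrix f e e' x i j)
    (e.open_baseSet.inter e'.open_baseSet) ?_ ⟨hx, hx'⟩ hp
  intro y hy
  refine ContMDiffAt.contMDiffWithinAt ?_
  have h1 : ContMDiffAt 𝓘(ℂ, Cn n) (𝓘(ℂ, Cn n).prod 𝓘(ℂ, Fin a → ℂ)) smoothOrder
      (fun x => (⟨x, e.symm x (Pi.single j 1)⟩ : TotalSpace (Fin a → ℂ) A)) y := by
    refine (e.contMDiffAt_section_iff hy.1).2 ?_
    refine contMDiffAt_const (c := (Pi.single j (1 : ℂ) : Fin a → ℂ)).congr_of_eventuallyEq ?_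
    filter_upwards [e.open_baseSet.mem_nhds hy.1] with x hx
    rw [e.apply_mk_symm hx]
  have h2 := (hf.contMDiffAt (x := ⟨y, e.symm y (Pi.single j 1)⟩)).comp y h1
  have h3 := ((e'.contMDiffAt_iff (by rw [e'.mem_source]; exact hy.2)).1 h2).2
  have h4 := contMDiffAt_pi_space.1 h3 i
  refine h4.congr_of_eventuallyEq ?_
  filter_upwards [e.open_baseSet.mem_nhds hy.1, e'.open_baseSet.mem_nhds hy.2] with x hx hx'
  have := congrFun (localMatrix_mulVec f (e' := e') hx (Pi.single j 1)) i
  rw [Matrix.mulVec_single_one, Trivialization.linearMapAt_apply, if_pos hx'] at this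
  exact this

/-- In trivializations the map is (y, v) ↦ M(y) v. It suffices to look at the preferred frames near
the centre of each chart. -/
theorem isHolomorphicHom_of_matHol
    (h : ∀ x : X, MatHol (fun y => localMatrix f (trivializationAt (Fin a → ℂ) A x)
      (trivializationAt (Fin b → ℂ) B x) ((chartAt (Cn n) x).symm y)) (chartAt (Cn n) x x)) :
    IsHolomorphicHom n a b f := by
  rintro ⟨x, v⟩
  set e := trivializationAt (Fin a → ℂ) A x
  set e' := trivializationAt (Fin b → ℂ) B x
  have hx : x ∈ e.baseSet := FiberBundle.mem_baseSet_trivializationAt' x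
  have hx' : x ∈ e'.baseSet := FiberBundle.mem_baseSet_trivializationAt' x
  have hproj : ContMDiffAt (𝓘(ℂ, Cn n).prod 𝓘(ℂ, Fin a → ℂ)) 𝓘(ℂ, Cn n) smoothOrder
      (fun w : TotalSpace (Fin a → ℂ) A => w.proj) ⟨x, v⟩ := contMDiffAt_proj A
  refine (e'.contMDiffAt_iff (by rw [e'.mem_source]; exact hx')).2 ⟨hproj, ?_⟩
  have hM : ∀ i j, ContMDiffAt 𝓘(ℂ, Cn n) 𝓘(ℂ, ℂ) smoothOrder
      (fun y => localMatrix f e e' y i j) x := by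
    intro i j
    have h1 : ContMDiffAt 𝓘(ℂ, Cn n) 𝓘(ℂ, ℂ) smoothOrder _ (chartAt (Cn n) x x) :=
      contMDiffAt_iff_contDiffAt.2 (h x i j).contDiffAt
    have h2 := h1.comp x ((contMDiffOn_chart (I := 𝓘(ℂ, Cn n)) (x := x)).contMDiffAt
      (chart_source_mem_nhds (Cn n) x))
    refine h2.congr_of_eventuallyEq ?_
    filter_upwards [chart_source_mem_nhds (Cn n) x] with y hy
    simp only [Function.comp, (chartAt (Cn n) x).left_inv hy]
    rfl
  have hv : ContMDiffAt (𝓘(ℂ, Cn n).prod 𝓘(ℂ, Fin a → ℂ)) 𝓘(ℂ, Fin a → ℂ) smoothOrder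
      (fun w : TotalSpace (Fin a → ℂ) A => (e w).2) ⟨x, v⟩ :=
    ((e.contMDiffAt_iff (f := id) (by rw [e.mem_source]; exact hx)).1 contMDiffAt_id).2
  have hmem : ∀ᶠ w : TotalSpace (Fin a → ℂ) A in 𝓝 ⟨x, v⟩, w.proj ∈ e.baseSet ∩ e'.baseSet :=
    hproj.continuousAt.eventually_mem ((e.open_baseSet.inter e'.open_baseSet).mem_nhds ⟨hx, hx'⟩)
  refine contMDiffAt_pi_space.2 fun i => ?_
  have hsum : ContMDiffAt (𝓘(ℂ, Cn n).prod 𝓘(ℂ, Fin a → ℂ)) 𝓘(ℂ, ℂ) smoothOrder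
      (fun w : TotalSpace (Fin a → ℂ) A => ∑ j, localMatrix f e e' w.proj i j * (e w).2 j)
      ⟨x, v⟩ :=
    ContMDiffAt.sum fun j _ => by
      have h1 : ContMDiffAt (𝓘(ℂ, Cn n).prod 𝓘(ℂ, Fin a → ℂ)) 𝓘(ℂ, ℂ) smoothOrder
          (fun w : TotalSpace (Fin a → ℂ) A => localMatrix f e e' w.proj i j) ⟨x, v⟩ :=
        (hM i j).comp (⟨x, v⟩ : TotalSpace (Fin a → ℂ) A) hproj
      exact h1.mul (contMDiffAt_pi_space.1 hv j)
  refine hsum.congr_of_eventuallyEq ?_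
  filter_upwards [hmem] with w hw
  have h1 := congrFun (localMatrix_mulVec f (e' := e') hw.1 (e w).2) i
  rw [Trivialization.linearMapAt_apply, if_pos hw.2] at h1
  have h2 : e.symm w.proj (e w).2 = w.2 := e.symm_apply_apply_mk hw.1 w.2
  rw [h2] at h1
  exact h1.symm

end HolomorphicHom

end HermiteEinstein

namespace HermiteEinstein

open scoped Matrix ComplexOrder

/-! ### Local Gram matrices and the determinant metric -/

section Local

variable {n r : ℕ} {X : Type*} [TopologicalSpace X] [ChartedSpace (Cn n) X]
  {E : X → Type*} [∀ x, AddCommGroup (E x)] [∀ x, Module ℂ (E x)]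
  [TopologicalSpace (TotalSpace (Fin r → ℂ) E)] [∀ x, TopologicalSpace (E x)]
  [FiberBundle (Fin r → ℂ) E]

theorem eventually_chart_symm_mem {p x : X} (hp : x ∈ (chartAt (Cn n) p).source) {U : Set X}
    (hU : IsOpen U) (hx : x ∈ U) :
    ∀ᶠ y in 𝓝 (chartAt (Cn n) p x), (chartAt (Cn n) p).symm y ∈ U := by
  refine ((chartAt (Cn n) p).continuousAt_symm
    ((chartAt (Cn n) p).map_source hp)).eventually_mem (hU.mem_nhds ?_)
  rwa [(chartAt (Cn n) p).left_inv hp]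

/-- The Gram matrix in the preferred frame and chart at `p`. -/
def HermitianMetric.localGram (h : HermitianMetric n r E) (p : X) (y : Cn n) :
    Matrix (Fin r) (Fin r) ℂ :=
  h.gram (trivializationAt (Fin r → ℂ) E p) ((chartAt (Cn n) p).symm y)

theorem HermitianMetric.curvature_eq (h : HermitianMetric n r E) (x : X) (i j : Fin r) :
    h.curvature x i j = chernCurvature (h.localGram x) i j (chartAt (Cn n) x x) := rfl

theorem HermitianMetric.matSmooth_gram [IsManifold 𝓘(ℂ, Cn n) smoothOrder X]
    (h : HermitianMetric n r E) (e : Trivialization (Fin r → ℂ) (π (Fin r → ℂ) E))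
    [MemTrivializationAtlas e] {p x : X} (hp : x ∈ (chartAt (Cn n) p).source)
    (hx : x ∈ e.baseSet) :
    MatSmooth (fun y => h.gram e ((chartAt (Cn n) p).symm y)) (chartAt (Cn n) p x) := by
  have := isManifold_real (n := n) (X := X)
  intro i j
  exact contDiffAt_comp_chart_symm e.open_baseSet (h.smooth e i j) hx hp

variable [VectorBundle ℂ (Fin r → ℂ) E]

theorem HermitianMetric.matSmooth_localGram [IsManifold 𝓘(ℂ, Cn n) smoothOrder X]
    (h : HermitianMetric n r E) (x : X) : MatSmooth (h.localGram x) (chartAt (Cn n) x x) :=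
  h.matSmooth_gram _ (mem_chart_source (Cn n) x) (FiberBundle.mem_baseSet_trivializationAt' x)

theorem HermitianMetric.eventually_posDef (h : HermitianMetric n r E) (x : X) :
    ∀ᶠ y in 𝓝 (chartAt (Cn n) x x), (h.localGram x y).PosDef :=
  (eventually_chart_symm_mem (mem_chart_source (Cn n) x)
    (trivializationAt (Fin r → ℂ) E x).open_baseSet
    (FiberBundle.mem_baseSet_trivializationAt' x)).mono fun _ hy => h.gram_posDef _ _ hy

theorem HermitianMetric.posDef_localGram (h : HermitianMetric n r E) (x : X) :
    (h.localGram x (chartAt (Cn n) x x)).PosDef := (h.eventually_posDef x).self_of_nhds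

theorem HermitianMetric.det_localGram_ne (h : HermitianMetric n r E) (x : X) :
    (h.localGram x (chartAt (Cn n) x x)).det ≠ 0 := (h.posDef_localGram x).det_pos.ne'

/-- The fibre of det E at x is read in the frame indexed by x. The frame indexed by p appears there
multiplied by the transition determinant, which is exactly the factor in `det_gram_change`. -/
theorem HermitianMetric.gram_det (h : HermitianMetric n r E) (p : X) {x : X}
    (hx : x ∈ (trivializationAt (Fin r → ℂ) E p).baseSet) (i j : Fin 1) :
    h.det.gram (trivializationAt (Fin 1 → ℂ) (DetBundle r E) p) x i j =
      (h.gram (trivializationAt (Fin r → ℂ) E p) x).det := by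
  have hfr : ∀ k : Fin 1, frame ((detCore r E).localTriv p) k x =
      (fun _ => detTransition r E p x x : Fin 1 → ℂ) := by
    intro k
    refine ((detCore r E).localTriv_symm_apply p hx _).trans ?_
    change detTransition r E p x x • (Pi.single k (1 : ℂ) : Fin 1 → ℂ) = _
    funext l
    simp [Subsingleton.elim l k]
  change h.det.inner x (frame ((detCore r E).localTriv p) i x)
    (frame ((detCore r E).localTriv p) j x) = _
  rw [hfr i, hfr j, h.det_gram_change p x hx]
  rfl

/-- The curvature of the determinant is the trace of the curvature. -/
theorem HermitianMetric.curvature_det [IsManifold 𝓘(ℂ, Cn n) smoothOrder X]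
    (h : HermitianMetric n r E) (x : X) : h.det.curvature x 0 0 = ∑ i, h.curvature x i i := by
  have e : (fun y => (h.localGram x y).det) =ᶠ[𝓝 (chartAt (Cn n) x x)]
      fun y => h.det.localGram x y 0 0 :=
    (eventually_chart_symm_mem (mem_chart_source (Cn n) x)
      (trivializationAt (Fin r → ℂ) E x).open_baseSet
      (FiberBundle.mem_baseSet_trivializationAt' x)).mono fun y hy => (h.gram_det x hy 0 0).symm
  refine Eq.trans ?_ (sum_chernCurvature_eq_lineCurvature (h.matSmooth_localGram x)
    (h.det_localGram_ne x)).symm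
  rw [lineCurvature_congr e (h.matSmooth_localGram x).det (h.det_localGram_ne x),
    h.det.curvature_eq, lineCurvature]
  congr 1
  funext y
  ext i j
  rw [Subsingleton.elim i 0, Subsingleton.elim j 0, Matrix.of_apply]

end Local

/-! ### The degree functional on 2-forms -/

section Functional

variable {n m : ℕ} (hm : 1 ≤ m) (hmn : m ≤ n) (ω : Cn n [⋀^Fin 2]→ₗ[ℝ] ℂ)
  (Ω : Cn n [⋀^Fin (2 * (n - m))]→ₗ[ℝ] ℂ)

/-- The functional `α ↦ α ∧ ω^{m-1} ∧ Ω / (ωⁿ/n!)`. -/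
def degreeLin : (Cn n [⋀^Fin 2]→ₗ[ℝ] ℂ) →ₗ[ℂ] ℂ :=
  (topCoeff (volumeForm ω))⁻¹ • (evalForm (orientedFrame n) ∘ₗ topProductLin hm hmn ω Ω)

theorem degreeLin_apply (α : Cn n [⋀^Fin 2]→ₗ[ℝ] ℂ) : degreeLin hm hmn ω Ω α =
    topCoeff (topProduct hm hmn ω Ω α) / topCoeff (volumeForm ω) := by
  rw [div_eq_inv_mul]; rfl

end Functional

/-! ### Pointwise degrees -/

section Pointwise

variable {n m : ℕ} {hm : 1 ≤ m} {hmn : m ≤ n} {X : Type*} [TopologicalSpace X]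
  [ChartedSpace (Cn n) X] {ω : DiffForm n X 2} {Ω : DiffForm n X (2 * (n - m))}

theorem IsKahlerForm.topCoeff_volumeForm_pos (hω : IsKahlerForm ω) (x : X) :
    ∃ t : ℝ, 0 < t ∧ topCoeff (volumeForm (ω x).toAlternatingMap) = (t : ℂ) :=
  HermiteEinstein.topCoeff_volumeForm_pos (hω.real x) (hω.type_one_one x) (hω.pos x)

/-- Positivity of i b ∧ b̄ ∧ ω^{m-1} ∧ Ω, divided by the positive volume, in the form needed by
`IsInducedGram.trace_curvature`. -/
theorem degreeLin_elementaryTwoForm (hm : 1 ≤ m) (hω : IsKahlerForm ω)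
    (hΩ : IsAdmissibleForm hmn Ω) (x : X) (b : Cn n →ₗ[ℂ] ℂ) :
    ∃ t : ℝ, 0 ≤ t ∧ (t = 0 → b = 0) ∧
      degreeLin hm hmn (ω x).toAlternatingMap (Ω x).toAlternatingMap (elementaryTwoForm b) = t := by
  obtain ⟨c, hc, hc'⟩ := hω.topCoeff_volumeForm_pos x
  obtain ⟨t, ht, ht0, ht'⟩ := topProduct_elementaryTwoForm hm hmn (hω.real x) (hω.type_one_one x)
    (hω.pos x) (hΩ.weakly_positive x) b
  refine ⟨t / c, by positivity, fun h => ht0 ?_, ?_⟩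
  · rcases div_eq_zero_iff.1 h with h | h
    · exact h
    · exact absurd h hc.ne'
  · rw [degreeLin_apply, ht', hc']; push_cast; rfl

section Bundle

variable {r : ℕ} {E : X → Type*} [∀ x, AddCommGroup (E x)] [∀ x, Module ℂ (E x)]
  [TopologicalSpace (TotalSpace (Fin r → ℂ) E)] [∀ x, TopologicalSpace (E x)]
  [FiberBundle (Fin r → ℂ) E] [VectorBundle ℂ (Fin r → ℂ) E]

theorem degreeFunction_eq [IsManifold 𝓘(ℂ, Cn n) smoothOrder X] (h : HermitianMetric n r E)
    (x : X) : degreeFunction hm hmn ω Ω h x =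
      (degreeLin hm hmn (ω x).toAlternatingMap (Ω x).toAlternatingMap
        (Complex.I • ∑ i, chernCurvature (h.localGram x) i i (chartAt (Cn n) x x))).re := by
  rw [degreeFunction, lineDegreeFunction, h.curvature_det, degreeLin_apply]
  rfl

theorem IsHermiteEinstein.degreeLin_eq {h : HermitianMetric n r E} {lam : ℝ}
    (hHE : IsHermiteEinstein hm hmn ω Ω h lam) (hω : IsKahlerForm ω) (x : X) (i j : Fin r) :
    degreeLin hm hmn (ω x).toAlternatingMap (Ω x).toAlternatingMap
      (Complex.I • chernCurvature (h.localGram x) i j (chartAt (Cn n) x x)) =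
        (lam : ℂ) * (1 : Matrix (Fin r) (Fin r) ℂ) i j := by
  obtain ⟨c, hc, hc'⟩ := hω.topCoeff_volumeForm_pos x
  have h1 := hHE x i j
  rw [h.curvature_eq] at h1
  rw [degreeLin_apply, h1, topCoeff_smul, mul_div_assoc, div_self, mul_one]
  rw [hc']
  exact_mod_cast hc.ne'

theorem IsHermiteEinstein.degreeFunction_eq [IsManifold 𝓘(ℂ, Cn n) smoothOrder X]
    {h : HermitianMetric n r E} {lam : ℝ}
    (hHE : IsHermiteEinstein hm hmn ω Ω h lam) (hω : IsKahlerForm ω) (x : X) :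
    degreeFunction hm hmn ω Ω h x = r * lam := by
  rw [HermiteEinstein.degreeFunction_eq, Finset.smul_sum, map_sum]
  simp [hHE.degreeLin_eq hω]

end Bundle

end Pointwise

/-! ### The degree of a subbundle -/

section Sub

variable {n m s r : ℕ} {hm : 1 ≤ m} {hmn : m ≤ n} {X : Type*} [TopologicalSpace X]
  [ChartedSpace (Cn n) X] [IsManifold 𝓘(ℂ, Cn n) smoothOrder X]
  {ω : DiffForm n X 2} {Ω : DiffForm n X (2 * (n - m))}
  {S : X → Type*} [∀ x, AddCommGroup (S x)] [∀ x, Module ℂ (S x)]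
  [TopologicalSpace (TotalSpace (Fin s → ℂ) S)] [∀ x, TopologicalSpace (S x)]
  [FiberBundle (Fin s → ℂ) S] [VectorBundle ℂ (Fin s → ℂ) S]
  [ContMDiffVectorBundle smoothOrder (Fin s → ℂ) S 𝓘(ℂ, Cn n)]
  {E : X → Type*} [∀ x, AddCommGroup (E x)] [∀ x, Module ℂ (E x)]
  [TopologicalSpace (TotalSpace (Fin r → ℂ) E)] [∀ x, TopologicalSpace (E x)]
  [FiberBundle (Fin r → ℂ) E] [VectorBundle ℂ (Fin r → ℂ) E]
  [ContMDiffVectorBundle smoothOrder (Fin r → ℂ) E 𝓘(ℂ, Cn n)]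

variable (n) in
/-- The matrix of a bundle homomorphism in the preferred frames and chart at `p`. -/
def homMatrix (a b : ℕ) {A : X → Type*} [∀ x, AddCommGroup (A x)] [∀ x, Module ℂ (A x)]
    [TopologicalSpace (TotalSpace (Fin a → ℂ) A)] [∀ x, TopologicalSpace (A x)]
    [FiberBundle (Fin a → ℂ) A] [VectorBundle ℂ (Fin a → ℂ) A]
    {B : X → Type*} [∀ x, AddCommGroup (B x)] [∀ x, Module ℂ (B x)]
    [TopologicalSpace (TotalSpace (Fin b → ℂ) B)] [∀ x, TopologicalSpace (B x)]
    [FiberBundle (Fin b → ℂ) B] [VectorBundle ℂ (Fin b → ℂ) B]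
    (f : ∀ x, A x →ₗ[ℂ] B x) (p : X) (y : Cn n) : Matrix (Fin b) (Fin a) ℂ :=
  localMatrix f (trivializationAt (Fin a → ℂ) A p) (trivializationAt (Fin b → ℂ) B p)
    ((chartAt (Cn n) p).symm y)

theorem IsHolomorphicHom.matHol_homMatrix {f : ∀ x, S x →ₗ[ℂ] E x}
    (hf : IsHolomorphicHom n s r f) (x : X) : MatHol (homMatrix n s r f x) (chartAt (Cn n) x x) :=
  hf.matHol (mem_chart_source (Cn n) x) (FiberBundle.mem_baseSet_trivializationAt' x)
    (FiberBundle.mem_baseSet_trivializationAt' x)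

theorem eventually_mem_baseSet (E : X → Type*) [∀ x, AddCommGroup (E x)] [∀ x, Module ℂ (E x)]
    [TopologicalSpace (TotalSpace (Fin r → ℂ) E)] [∀ x, TopologicalSpace (E x)]
    [FiberBundle (Fin r → ℂ) E] (x : X) :
    ∀ᶠ y in 𝓝 (chartAt (Cn n) x x), (chartAt (Cn n) x).symm y ∈
      (trivializationAt (Fin r → ℂ) E x).baseSet :=
  eventually_chart_symm_mem (mem_chart_source (Cn n) x)
    (trivializationAt (Fin r → ℂ) E x).open_baseSet (FiberBundle.mem_baseSet_trivializationAt' x)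

variable {f : ∀ x, S x →ₗ[ℂ] E x} {hS : HermitianMetric n s S} {hE : HermitianMetric n r E}

/-- Passage from the bundles to the matrix data of the Gauss equation, in the preferred frames and
chart at x. -/
theorem IsInducedMetric.isInducedGram (h : IsInducedMetric f hS hE)
    (hf : IsHolomorphicHom n s r f) (x : X) :
    IsInducedGram (hE.localGram x) (hS.localGram x) (homMatrix n s r f x) (chartAt (Cn n) x x) where
  smooth := hE.matSmooth_localGram x
  hol := hf.matHol_homMatrix x
  herm := (hE.eventually_posDef x).mono fun y hy => hy.isHermitian
  induced := by
    filter_upwards [eventually_mem_baseSet (n := n) (r := s) S x,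
      eventually_mem_baseSet (n := n) (r := r) E x] with y hy hy'
    have := gram_localMatrix f hE f hy hy' hy
    rw [homMatrix, HermitianMetric.localGram, HermitianMetric.localGram, ← this]
    ext i j
    exact h _ _ _
  det_ne := hE.det_localGram_ne x
  det_ne' := hS.det_localGram_ne x

/-- The degree of a subbundle of a Hermite–Einstein bundle. -/
theorem IsInducedMetric.exists_degreeFunction_eq (h : IsInducedMetric f hS hE)
    (hf : IsHolomorphicHom n s r f) (hω : IsKahlerForm ω) (hΩ : IsAdmissibleForm hmn Ω) {lam : ℝ}
    (hHE : IsHermiteEinstein hm hmn ω Ω hE lam) (x : X) :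
    ∃ t : ℝ, 0 ≤ t ∧ (t = 0 ↔ ∀ v, secondFundamental (hE.localGram x) (hS.localGram x)
      (homMatrix n s r f x) v (chartAt (Cn n) x x) = 0) ∧
      degreeFunction hm hmn ω Ω hS x = s * lam - t := by
  obtain ⟨t, ht, ht0, ht'⟩ := (h.isInducedGram hf x).trace_curvature (hE.posDef_localGram x)
    (hS.posDef_localGram x) (degreeLin hm hmn (ω x).toAlternatingMap (Ω x).toAlternatingMap)
    (degreeLin_elementaryTwoForm hm hω hΩ x) (fun i j => hHE.degreeLin_eq hω x i j)
  refine ⟨t, ht, ht0, ?_⟩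
  rw [degreeFunction_eq, ht']
  simp

end Sub

/-! ### The orthogonal splitting and the degree of a quotient -/

section Quotient

variable {n m q r : ℕ} {hm : 1 ≤ m} {hmn : m ≤ n} {X : Type*} [TopologicalSpace X]
  [ChartedSpace (Cn n) X] [IsManifold 𝓘(ℂ, Cn n) smoothOrder X]
  {ω : DiffForm n X 2} {Ω : DiffForm n X (2 * (n - m))}
  {E : X → Type*} [∀ x, AddCommGroup (E x)] [∀ x, Module ℂ (E x)]
  [TopologicalSpace (TotalSpace (Fin r → ℂ) E)] [∀ x, TopologicalSpace (E x)]
  [FiberBundle (Fin r → ℂ) E] [VectorBundle ℂ (Fin r → ℂ) E]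
  [ContMDiffVectorBundle smoothOrder (Fin r → ℂ) E 𝓘(ℂ, Cn n)]
  {Q : X → Type*} [∀ x, AddCommGroup (Q x)] [∀ x, Module ℂ (Q x)]
  [TopologicalSpace (TotalSpace (Fin q → ℂ) Q)] [∀ x, TopologicalSpace (Q x)]
  [FiberBundle (Fin q → ℂ) Q] [VectorBundle ℂ (Fin q → ℂ) Q]
  [ContMDiffVectorBundle smoothOrder (Fin q → ℂ) Q 𝓘(ℂ, Cn n)]
  {g : ∀ x, E x →ₗ[ℂ] Q x} {hE : HermitianMetric n r E} {hQ : HermitianMetric n q Q}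

theorem HermitianMetric.ext_left (h : HermitianMetric n r E) {x : X} {u : E x}
    (hu : h.inner x u u = 0) : u = 0 := by
  by_contra h0
  have := h.pos x u h0
  rw [hu] at this
  exact lt_irrefl _ this

/-- The adjoint of a bundle homomorphism. -/
theorem exists_adjoint (g : ∀ x, E x →ₗ[ℂ] Q x) (hE : HermitianMetric n r E)
    (hQ : HermitianMetric n q Q) : ∃ σ : ∀ x, Q x →ₗ[ℂ] E x,
      ∀ x u w, hE.inner x u (σ x w) = hQ.inner x (g x u) w := by
  -- In frames with Gram matrices H and K, the adjoint of a matrix G is H⁻¹ Gᴴ K.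
  refine ⟨fun x => (trivializationAt (Fin r → ℂ) E x).symmₗ ℂ x ∘ₗ
    Matrix.toLin' ((hE.gram (trivializationAt (Fin r → ℂ) E x) x)⁻¹ *
      (localMatrix g (trivializationAt (Fin r → ℂ) E x) (trivializationAt (Fin q → ℂ) Q x) x)ᴴ *
      hQ.gram (trivializationAt (Fin q → ℂ) Q x) x) ∘ₗ
    (trivializationAt (Fin q → ℂ) Q x).linearMapAt ℂ x, fun x u w => ?_⟩
  simp only [LinearMap.comp_apply, Matrix.toLin'_apply]
  set e := trivializationAt (Fin r → ℂ) E x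
  set e' := trivializationAt (Fin q → ℂ) Q x
  have hx : x ∈ e.baseSet := FiberBundle.mem_baseSet_trivializationAt' x
  have hx' : x ∈ e'.baseSet := FiberBundle.mem_baseSet_trivializationAt' x
  have hu : u = e.symm x (e.linearMapAt ℂ x u) := (Trivialization.symm_linearMapAt e hx u).symm
  have hw : w = e'.symm x (e'.linearMapAt ℂ x w) := (Trivialization.symm_linearMapAt e' hx' w).symm
  have hH : hE.gram e x * (hE.gram e x)⁻¹ = 1 :=
    Matrix.mul_nonsing_inv _ (hE.gram_posDef e x hx).det_pos.ne'.isUnit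
  rw [e.symmₗ_apply hx]
  conv_lhs => rw [hu]
  conv_rhs => rw [hu, hw]
  rw [hE.inner_symm_symm e x hx, apply_symm_eq g hx hx', hQ.inner_symm_symm e' x hx',
    Matrix.mulVec_mulVec, ← Matrix.mul_assoc, ← Matrix.mul_assoc, hH, Matrix.one_mul,
    Matrix.star_mulVec, ← Matrix.dotProduct_mulVec, Matrix.mulVec_mulVec]

variable {σ : ∀ x, Q x →ₗ[ℂ] E x}

/-- The image of σ is orthogonal to ker g, so the quotient metric and adjointness give hQ(gσw, gσw')
= hQ(gσw, w'). Thus d = gσw - w is orthogonal to the image of gσ. Then |σd|² = hQ(gσd, d) = 0, so σd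
= 0. By adjointness d is orthogonal to the image of g, which is everything. -/
theorem IsQuotientMetric.apply_adjoint (h : IsQuotientMetric g hE hQ)
    (hg : ∀ x, Function.Surjective (g x))
    (hσ : ∀ x u w, hE.inner x u (σ x w) = hQ.inner x (g x u) w) (x : X) (w : Q x) :
    g x (σ x w) = w := by
  have horth : ∀ w, ∀ v ∈ LinearMap.ker (g x), hE.inner x v (σ x w) = 0 := fun w v hv => by
    rw [hσ, LinearMap.mem_ker.1 hv, map_zero, LinearMap.zero_apply]
  have h1 : ∀ w w', hQ.inner x (g x (σ x w)) (g x (σ x w') - w') = 0 := fun w w' => by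
    rw [map_sub, h x _ _ (horth w) (horth w'), hσ, sub_self]
  set d := g x (σ x w) - w with hd
  have h2 : hE.inner x (σ x d) (σ x d) = 0 := by
    rw [hσ]; exact h1 d w
  have h3 : σ x d = 0 := hE.ext_left h2
  obtain ⟨u, hu⟩ := hg x d
  have h4 : hQ.inner x d d = 0 := by
    have h5 : hQ.inner x (g x u) d = 0 := by rw [← hσ, h3, map_zero]
    rwa [hu] at h5
  exact sub_eq_zero.1 (hQ.ext_left h4)

theorem homMatrix_adjoint (hσ : ∀ x u w, hE.inner x u (σ x w) = hQ.inner x (g x u) w) (p : X)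
    {y : Cn n} (hy : (chartAt (Cn n) p).symm y ∈ (trivializationAt (Fin r → ℂ) E p).baseSet)
    (hy' : (chartAt (Cn n) p).symm y ∈ (trivializationAt (Fin q → ℂ) Q p).baseSet) :
    homMatrix n q r σ p y = (hE.localGram p y)⁻¹ * (homMatrix n r q g p y)ᴴ * hQ.localGram p y := by
  have h1 := gram_localMatrix (fun x => (LinearMap.id : E x →ₗ[ℂ] E x)) hE σ hy hy hy'
  have h2 := gram_localMatrix g hQ (fun x => (LinearMap.id : Q x →ₗ[ℂ] Q x)) hy hy' hy'
  have h3 : hE.localGram p y * homMatrix n q r σ p y =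
      (homMatrix n r q g p y)ᴴ * hQ.localGram p y := by
    rw [localMatrix_id hy, Matrix.conjTranspose_one, Matrix.one_mul] at h1
    rw [localMatrix_id hy', Matrix.mul_one] at h2
    refine h1.symm.trans (Eq.trans ?_ h2)
    ext i j
    exact hσ _ _ _
  rw [Matrix.mul_assoc, ← h3, ← Matrix.mul_assoc, Matrix.nonsing_inv_mul, Matrix.one_mul]
  exact (hE.gram_posDef _ _ hy).det_pos.ne'.isUnit

theorem eventually_homMatrix_adjoint
    (hσ : ∀ x u w, hE.inner x u (σ x w) = hQ.inner x (g x u) w) (x : X) :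
    homMatrix n q r σ x =ᶠ[𝓝 (chartAt (Cn n) x x)] fun y =>
      (hE.localGram x y)⁻¹ * (homMatrix n r q g x y)ᴴ * hQ.localGram x y := by
  filter_upwards [eventually_mem_baseSet (n := n) (r := q) Q x,
    eventually_mem_baseSet (n := n) (r := r) E x] with y hy hy'
  exact homMatrix_adjoint hσ x hy' hy

theorem eventually_homMatrix_mul (hgσ : ∀ x w, g x (σ x w) = w) (x : X) :
    ∀ᶠ y in 𝓝 (chartAt (Cn n) x x), homMatrix n r q g x y * homMatrix n q r σ x y = 1 := by
  filter_upwards [eventually_mem_baseSet (n := n) (r := q) Q x,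
    eventually_mem_baseSet (n := n) (r := r) E x] with y hy hy'
  rw [homMatrix, homMatrix, ← localMatrix_comp σ g _ hy', ← localMatrix_id (A := Q) hy]
  congr 1
  funext x
  exact LinearMap.ext (hgσ x)

/-- The dual of the quotient is a subbundle of the dual. -/
theorem isInducedGram_dualGram (hg : IsHolomorphicHom n r q g)
    (hσ : ∀ x u w, hE.inner x u (σ x w) = hQ.inner x (g x u) w) (hgσ : ∀ x w, g x (σ x w) = w)
    (x : X) : IsInducedGram (dualGram (hE.localGram x)) (dualGram (hQ.localGram x))
      (fun y => (homMatrix n r q g x y)ᵀ) (chartAt (Cn n) x x) where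
  smooth := (hE.matSmooth_localGram x).dualGram (hE.det_localGram_ne x)
  hol := fun i j => hg.matHol_homMatrix x j i
  herm := (hE.eventually_posDef x).mono fun y hy => hy.inv.isHermitian.transpose
  induced := by
    filter_upwards [eventually_homMatrix_mul (q := q) (r := r) hgσ x, eventually_homMatrix_adjoint hσ x] with y h1 h2
    -- From G σ = 1 and σ = H⁻¹ Gᴴ K one reads off K⁻¹ = G H⁻¹ Gᴴ, whose transpose says that the
    -- dual metric on Q* is induced from E*.
    rw [h2, ← Matrix.mul_assoc, ← Matrix.mul_assoc] at h1
    rw [dualGram, dualGram, Matrix.inv_eq_left_inv h1, Matrix.transpose_mul, Matrix.transpose_mul,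
      Matrix.mul_assoc]
    rfl
  det_ne := dualGram_det_ne (hE.det_localGram_ne x)
  det_ne' := dualGram_det_ne (hQ.det_localGram_ne x)

/-- The orthogonal splitting σ is the transpose of the orthogonal projection E* → Q*. Hence ∂̄σ is
governed by the second fundamental form of Q* in E*. -/
theorem eventually_homMatrix_eq_orthProj
    (hσ : ∀ x u w, hE.inner x u (σ x w) = hQ.inner x (g x u) w) (x : X) :
    homMatrix n q r σ x =ᶠ[𝓝 (chartAt (Cn n) x x)] fun y =>
      (orthProj (dualGram (hE.localGram x)) (dualGram (hQ.localGram x))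
        (fun y => (homMatrix n r q g x y)ᵀ) y)ᵀ := by
  filter_upwards [eventually_homMatrix_adjoint hσ x, hQ.eventually_posDef x] with y hy hy'
  rw [hy, orthProj, dualGram_inv hy'.det_pos.ne', dualGram, Matrix.transpose_mul,
    Matrix.transpose_mul, Matrix.transpose_transpose, Matrix.transpose_transpose, Matrix.mul_assoc]
  rfl

theorem IsInducedGram.mdlb_orthProj_eq_zero_iff {a b : Type*} [Fintype a] [DecidableEq a]
    [Fintype b] [DecidableEq b] {H : Cn n → Matrix a a ℂ} {K : Cn n → Matrix b b ℂ}
    {F : Cn n → Matrix a b ℂ} {z : Cn n} (h : IsInducedGram H K F z) (v : Cn n) :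
    mdlb (orthProj H K F) v z = 0 ↔ secondFundamental H K F v z = 0 := by
  rw [h.mdlb_orthProj]
  constructor
  · intro h0
    have h1 : K z * ((K z)⁻¹ * (secondFundamental H K F v z)ᴴ * H z) * (H z)⁻¹ =
        (secondFundamental H K F v z)ᴴ := by
      rw [← Matrix.mul_assoc, ← Matrix.mul_assoc, Matrix.mul_nonsing_inv _ h.det_ne'.isUnit,
        Matrix.one_mul, Matrix.mul_assoc, Matrix.mul_nonsing_inv _ h.det_ne.isUnit, Matrix.mul_one]
    rw [h0, Matrix.mul_zero, Matrix.zero_mul] at h1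
    exact Matrix.conjTranspose_eq_zero.1 h1.symm
  · intro h0
    rw [h0]; simp

theorem mdlb_homMatrix_eq_zero_iff (hg : IsHolomorphicHom n r q g)
    (hσ : ∀ x u w, hE.inner x u (σ x w) = hQ.inner x (g x u) w) (hgσ : ∀ x w, g x (σ x w) = w)
    (x : X) (v : Cn n) : mdlb (homMatrix n q r σ x) v (chartAt (Cn n) x x) = 0 ↔
      secondFundamental (dualGram (hE.localGram x)) (dualGram (hQ.localGram x))
        (fun y => (homMatrix n r q g x y)ᵀ) v (chartAt (Cn n) x x) = 0 := by
  rw [← (isInducedGram_dualGram hg hσ hgσ x).mdlb_orthProj_eq_zero_iff,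
    mdlb_congr (eventually_homMatrix_eq_orthProj hσ x)]
  exact Matrix.transpose_eq_zero

theorem neg_mul_one_apply {r : ℕ} (c : ℂ) (i j : Fin r) :
    -c * (1 : Matrix (Fin r) (Fin r) ℂ) i j = -(c * (1 : Matrix (Fin r) (Fin r) ℂ) j i) := by
  rw [neg_mul, ← Matrix.transpose_apply (1 : Matrix (Fin r) (Fin r) ℂ), Matrix.transpose_one]

/-- The degree of a quotient of a Hermite–Einstein bundle. -/
theorem exists_degreeFunction_quotient_eq (hg : IsHolomorphicHom n r q g)
    (hσ : ∀ x u w, hE.inner x u (σ x w) = hQ.inner x (g x u) w) (hgσ : ∀ x w, g x (σ x w) = w)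
    (hω : IsKahlerForm ω) (hΩ : IsAdmissibleForm hmn Ω) {lam : ℝ}
    (hHE : IsHermiteEinstein hm hmn ω Ω hE lam) (x : X) :
    ∃ t : ℝ, 0 ≤ t ∧ (t = 0 ↔ ∀ v, mdlb (homMatrix n q r σ x) v (chartAt (Cn n) x x) = 0) ∧
      degreeFunction hm hmn ω Ω hQ x = q * lam + t := by
  have hI := isInducedGram_dualGram hg hσ hgσ x
  -- The dual of E satisfies the Einstein equation with factor -λ, so Q* has degree -q λ - t; the
  -- degree of Q is its negative.
  obtain ⟨t, ht, ht0, ht'⟩ := hI.trace_curvature (hE.posDef_localGram x).inv.transpose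
    (hQ.posDef_localGram x).inv.transpose
    (degreeLin hm hmn (ω x).toAlternatingMap (Ω x).toAlternatingMap)
    (degreeLin_elementaryTwoForm hm hω hΩ x) (c := -(lam : ℂ)) (fun i j => by
      rw [chernCurvature_dualGram (hE.matSmooth_localGram x) (hE.det_localGram_ne x), smul_neg,
        map_neg, hHE.degreeLin_eq hω x j i, neg_mul_one_apply])
  refine ⟨t, ht, ?_, ?_⟩
  · rw [ht0]
    exact forall_congr' fun v => (mdlb_homMatrix_eq_zero_iff hg hσ hgσ x v).symm
  · have h1 : ∑ i, chernCurvature (dualGram (hQ.localGram x)) i i (chartAt (Cn n) x x) =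
        -∑ i, chernCurvature (hQ.localGram x) i i (chartAt (Cn n) x x) := by
      rw [← Finset.sum_neg_distrib]
      exact Finset.sum_congr rfl fun i _ => chernCurvature_dualGram (hQ.matSmooth_localGram x)
        (hQ.det_localGram_ne x) i i
    rw [h1, smul_neg, map_neg] at ht'
    rw [degreeFunction_eq, ← neg_neg (degreeLin _ _ _ _ _), ht']
    simp
    ring

/-- A quotient of a Hermite–Einstein bundle which splits holomorphically and orthogonally is
Hermite–Einstein. -/
theorem hermiteEinstein_quotient (hg : IsHolomorphicHom n r q g)
    (hσ : ∀ x u w, hE.inner x u (σ x w) = hQ.inner x (g x u) w) (hgσ : ∀ x w, g x (σ x w) = w)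
    {lam : ℝ} (hHE : IsHermiteEinstein hm hmn ω Ω hE lam)
    (h0 : ∀ x v, mdlb (homMatrix n q r σ x) v (chartAt (Cn n) x x) = 0) :
    IsHermiteEinstein hm hmn ω Ω hQ lam := by
  intro x i j
  have hI := isInducedGram_dualGram hg hσ hgσ x
  have h1 := hI.hermiteEinstein (fun v => (mdlb_homMatrix_eq_zero_iff hg hσ hgσ x v).1 (h0 x v))
    (topProductLin hm hmn (ω x).toAlternatingMap (Ω x).toAlternatingMap) (c := -(lam : ℂ))
    (vol := volumeForm (ω x).toAlternatingMap) (fun i j => by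
      rw [chernCurvature_dualGram (hE.matSmooth_localGram x) (hE.det_localGram_ne x), smul_neg,
        map_neg, neg_mul_one_apply, neg_smul, ← hHE x j i]
      rfl) j i
  rw [chernCurvature_dualGram (hQ.matSmooth_localGram x) (hQ.det_localGram_ne x), smul_neg,
    map_neg, neg_mul_one_apply, neg_smul, neg_inj] at h1
  exact h1

end Quotient

end HermiteEinstein

namespace HermiteEinstein

open scoped Matrix ComplexOrder

/-! ### Wirtinger derivatives under holomorphic maps -/

section ChainRule

variable {n : ℕ}

theorem fderiv_comp_holomorphic {f : Cn n → ℂ} {τ : Cn n → Cn n} {z : Cn n}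
    (hτ : DifferentiableAt ℂ τ z) (hf : DifferentiableAt ℝ f (τ z)) (v : Cn n) :
    fderiv ℝ (fun y => f (τ y)) z v = fderiv ℝ f (τ z) (fderiv ℂ τ z v) := by
  have h := (hf.hasFDerivAt.comp z (hτ.hasFDerivAt.restrictScalars ℝ)).fderiv
  exact congrArg (fun L => L v) h

theorem dl_comp {f : Cn n → ℂ} {τ : Cn n → Cn n} {z : Cn n}
    (hτ : DifferentiableAt ℂ τ z) (hf : DifferentiableAt ℝ f (τ z)) (v : Cn n) :
    dl (fun y => f (τ y)) v z = dl f (fderiv ℂ τ z v) (τ z) := by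
  rw [dl, dl, fderiv_comp_holomorphic hτ hf, fderiv_comp_holomorphic hτ hf, map_smul]

theorem dlb_comp {f : Cn n → ℂ} {τ : Cn n → Cn n} {z : Cn n}
    (hτ : DifferentiableAt ℂ τ z) (hf : DifferentiableAt ℝ f (τ z)) (v : Cn n) :
    dlb (fun y => f (τ y)) v z = dlb f (fderiv ℂ τ z v) (τ z) := by
  rw [dlb, dlb, fderiv_comp_holomorphic hτ hf, fderiv_comp_holomorphic hτ hf, map_smul]

theorem SmoothNear.comp {f : Cn n → ℂ} {τ : Cn n → Cn n} {z : Cn n} (hf : SmoothNear f (τ z))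
    (hτ : ∀ᶠ y in 𝓝 z, ContDiffAt ℂ smoothOrder τ y) : SmoothNear (fun y => f (τ y)) z := by
  have hc := (hτ.self_of_nhds.continuousAt).eventually hf
  filter_upwards [hτ, hc] with y h1 h2
  exact h2.comp y (h1.restrict_scalars ℝ)

theorem MatSmooth.comp {a b : Type*} {M : Cn n → Matrix a b ℂ} {τ : Cn n → Cn n} {z : Cn n}
    (hM : MatSmooth M (τ z)) (hτ : ∀ᶠ y in 𝓝 z, ContDiffAt ℂ smoothOrder τ y) :
    MatSmooth (fun y => M (τ y)) z := fun i j => (hM i j).comp hτ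

theorem mdlb_comp {a b : Type*} {M : Cn n → Matrix a b ℂ} {τ : Cn n → Cn n} {z : Cn n}
    (hM : MatSmooth M (τ z)) (hτ : ∀ᶠ y in 𝓝 z, ContDiffAt ℂ smoothOrder τ y) (v : Cn n) :
    mdlb (fun y => M (τ y)) v z = mdlb M (fderiv ℂ τ z v) (τ z) := by
  ext i j
  exact dlb_comp (hτ.self_of_nhds.differentiableAt smoothOrder_ne_zero) (hM i j).differentiableAt v

end ChainRule

/-! ### Changes of charts -/

section Transition

variable {n : ℕ} {X : Type*} [TopologicalSpace X] [ChartedSpace (Cn n) X]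

variable (n) in
/-- The change of coordinates between preferred charts. -/
def chartTransition (p p' : X) (y : Cn n) : Cn n := chartAt (Cn n) p' ((chartAt (Cn n) p).symm y)

theorem contDiffAt_chartTransition [IsManifold 𝓘(ℂ, Cn n) smoothOrder X] {p p' x : X}
    (hp : x ∈ (chartAt (Cn n) p).source) (hp' : x ∈ (chartAt (Cn n) p').source) :
    ∀ᶠ y in 𝓝 (chartAt (Cn n) p x), ContDiffAt ℂ smoothOrder (chartTransition n p p') y :=
  contDiffAt_comp_chart_symm (chartAt (Cn n) p').open_source
    (contMDiffOn_chart (I := 𝓘(ℂ, Cn n))) hp' hp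

theorem eventually_chart_symm_chartTransition {p p' x : X} (hp : x ∈ (chartAt (Cn n) p).source)
    (hp' : x ∈ (chartAt (Cn n) p').source) : ∀ᶠ y in 𝓝 (chartAt (Cn n) p x),
      (chartAt (Cn n) p').symm (chartTransition n p p' y) = (chartAt (Cn n) p).symm y :=
  (eventually_chart_symm_mem hp (chartAt (Cn n) p').open_source hp').mono fun _ hy =>
    (chartAt (Cn n) p').left_inv hy

end Transition

/-! ### A criterion for holomorphy of bundle homomorphisms -/

section HolomorphicCriterion

variable {n a b : ℕ} {X : Type*} [TopologicalSpace X] [ChartedSpace (Cn n) X]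
  [IsManifold 𝓘(ℂ, Cn n) smoothOrder X]
  {A : X → Type*} [∀ x, AddCommGroup (A x)] [∀ x, Module ℂ (A x)]
  [TopologicalSpace (TotalSpace (Fin a → ℂ) A)] [∀ x, TopologicalSpace (A x)]
  [FiberBundle (Fin a → ℂ) A] [VectorBundle ℂ (Fin a → ℂ) A]
  [ContMDiffVectorBundle smoothOrder (Fin a → ℂ) A 𝓘(ℂ, Cn n)]
  {B : X → Type*} [∀ x, AddCommGroup (B x)] [∀ x, Module ℂ (B x)]
  [TopologicalSpace (TotalSpace (Fin b → ℂ) B)] [∀ x, TopologicalSpace (B x)]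
  [FiberBundle (Fin b → ℂ) B] [VectorBundle ℂ (Fin b → ℂ) B]
  [ContMDiffVectorBundle smoothOrder (Fin b → ℂ) B 𝓘(ℂ, Cn n)]

variable (n A) in
theorem isHolomorphicHom_id :
    IsHolomorphicHom n a a (fun x => (LinearMap.id : A x →ₗ[ℂ] A x)) := contMDiff_id

variable (n a A) in
/-- The change of frame between preferred frames. -/
def frameChange (p p' : X) (y : Cn n) : Matrix (Fin a) (Fin a) ℂ :=
  localMatrix (fun x => (LinearMap.id : A x →ₗ[ℂ] A x)) (trivializationAt (Fin a → ℂ) A p')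
    (trivializationAt (Fin a → ℂ) A p) ((chartAt (Cn n) p).symm y)

theorem matHol_frameChange {p p' x : X} (hp : x ∈ (chartAt (Cn n) p).source)
    (h : x ∈ (trivializationAt (Fin a → ℂ) A p).baseSet)
    (h' : x ∈ (trivializationAt (Fin a → ℂ) A p').baseSet) :
    MatHol (frameChange n a A p p') (chartAt (Cn n) p x) :=
  (isHolomorphicHom_id n A).matHol hp h' h

/-- A smooth homomorphism of holomorphic bundles is holomorphic if it satisfies the
Cauchy–Riemann equations at the centre of each chart. -/
theorem isHolomorphicHom_of_mdlb_eq_zero {f : ∀ x, A x →ₗ[ℂ] B x}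
    (hs : ∀ x, MatSmooth (homMatrix n a b f x) (chartAt (Cn n) x x))
    (h : ∀ x v, mdlb (homMatrix n a b f x) v (chartAt (Cn n) x x) = 0) :
    IsHolomorphicHom n a b f := by
  -- The hypothesis gives ∂̄ = 0 only at the centre of each chart, while holomorphy needs a
  -- neighbourhood. At a nearby point x' the matrix is rewritten through the chart and frames at x';
  -- the frame changes and the coordinate change are holomorphic, so ∂̄ falls only on the matrix at
  -- the centre x'.
  refine isHolomorphicHom_of_matHol fun x => (hs x).matHol ?_
  filter_upwards [eventually_mem_baseSet (n := n) (r := a) A x,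
    eventually_mem_baseSet (n := n) (r := b) B x,
    (chartAt (Cn n) x).open_target.mem_nhds (mem_chart_target (Cn n) x)] with y hA hB hy v
  set x' := (chartAt (Cn n) x).symm y with hx'
  have hsrc : x' ∈ (chartAt (Cn n) x).source := (chartAt (Cn n) x).map_target hy
  have hsrc' := mem_chart_source (Cn n) x'
  have hyx : chartAt (Cn n) x x' = y := (chartAt (Cn n) x).right_inv hy
  have hA' : x' ∈ (trivializationAt (Fin a → ℂ) A x').baseSet :=
    FiberBundle.mem_baseSet_trivializationAt' x'
  have hB' : x' ∈ (trivializationAt (Fin b → ℂ) B x').baseSet :=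
    FiberBundle.mem_baseSet_trivializationAt' x'
  have hτ := contDiffAt_chartTransition (n := n) hsrc hsrc'
  have hTB := matHol_frameChange (n := n) (a := b) hsrc hB hB'
  have hTA := (isHolomorphicHom_id n A).matHol (e := trivializationAt (Fin a → ℂ) A x)
    (e' := trivializationAt (Fin a → ℂ) A x') hsrc hA hA'
  have hτ0 : chartTransition n x x' (chartAt (Cn n) x x') = chartAt (Cn n) x' x' := by
    rw [chartTransition, (chartAt (Cn n) x).left_inv hsrc]
  have e : homMatrix n a b f x =ᶠ[𝓝 (chartAt (Cn n) x x')] fun u =>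
      frameChange n b B x x' u * homMatrix n a b f x' (chartTransition n x x' u) *
        localMatrix (fun x => (LinearMap.id : A x →ₗ[ℂ] A x)) (trivializationAt (Fin a → ℂ) A x)
          (trivializationAt (Fin a → ℂ) A x') ((chartAt (Cn n) x).symm u) := by
    filter_upwards [eventually_chart_symm_chartTransition hsrc hsrc',
      eventually_chart_symm_mem hsrc (trivializationAt (Fin a → ℂ) A x').open_baseSet hA',
      eventually_chart_symm_mem hsrc (trivializationAt (Fin b → ℂ) B x').open_baseSet hB']
      with u h1 h2 h3
    rw [homMatrix, homMatrix, h1, frameChange, ← localMatrix_comp f _ _ h3,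
      ← localMatrix_comp _ _ _ h2]
    rfl
  have hs' : MatSmooth (homMatrix n a b f x') (chartTransition n x x' (chartAt (Cn n) x x')) := by
    rw [hτ0]; exact hs x'
  change mdlb (homMatrix n a b f x) v y = 0
  rw [← hyx, mdlb_congr e, mdlb_mul (hTB.matSmooth.mul (hs'.comp hτ)) hTA.matSmooth,
    mdlb_mul hTB.matSmooth (hs'.comp hτ), hTA.mdlb_eq, hTB.mdlb_eq, mdlb_comp hs' hτ, hτ0, h]
  simp

end HolomorphicCriterion

/-! ### Equality cases for an exact sequence -/

section Exact

variable {n m s r q : ℕ} {hm : 1 ≤ m} {hmn : m ≤ n} {X : Type*} [TopologicalSpace X]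
  [ChartedSpace (Cn n) X] [IsManifold 𝓘(ℂ, Cn n) smoothOrder X]
  {ω : DiffForm n X 2} {Ω : DiffForm n X (2 * (n - m))}
  {S : X → Type*} [∀ x, AddCommGroup (S x)] [∀ x, Module ℂ (S x)]
  [TopologicalSpace (TotalSpace (Fin s → ℂ) S)] [∀ x, TopologicalSpace (S x)]
  [FiberBundle (Fin s → ℂ) S] [VectorBundle ℂ (Fin s → ℂ) S]
  [ContMDiffVectorBundle smoothOrder (Fin s → ℂ) S 𝓘(ℂ, Cn n)]
  {E : X → Type*} [∀ x, AddCommGroup (E x)] [∀ x, Module ℂ (E x)]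
  [TopologicalSpace (TotalSpace (Fin r → ℂ) E)] [∀ x, TopologicalSpace (E x)]
  [FiberBundle (Fin r → ℂ) E] [VectorBundle ℂ (Fin r → ℂ) E]
  [ContMDiffVectorBundle smoothOrder (Fin r → ℂ) E 𝓘(ℂ, Cn n)]
  {Q : X → Type*} [∀ x, AddCommGroup (Q x)] [∀ x, Module ℂ (Q x)]
  [TopologicalSpace (TotalSpace (Fin q → ℂ) Q)] [∀ x, TopologicalSpace (Q x)]
  [FiberBundle (Fin q → ℂ) Q] [VectorBundle ℂ (Fin q → ℂ) Q]
  [ContMDiffVectorBundle smoothOrder (Fin q → ℂ) Q 𝓘(ℂ, Cn n)]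
  {f : ∀ x, S x →ₗ[ℂ] E x} {g : ∀ x, E x →ₗ[ℂ] Q x}
  {hE : HermitianMetric n r E} {hS : HermitianMetric n s S} {hQ : HermitianMetric n q Q}
  {σ : ∀ x, Q x →ₗ[ℂ] E x}

theorem matSmooth_adjoint (hg : IsHolomorphicHom n r q g)
    (hσ : ∀ x u w, hE.inner x u (σ x w) = hQ.inner x (g x u) w) (x : X) :
    MatSmooth (homMatrix n q r σ x) (chartAt (Cn n) x x) :=
  ((((hE.matSmooth_localGram x).inv (hE.det_localGram_ne x)).mul
    (IsHolomorphicHom.matHol_homMatrix hg x).matSmooth.conjTranspose).mul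
      (hQ.matSmooth_localGram x)).congr (eventually_homMatrix_adjoint hσ x)

/-- The sum of the orthogonal projections on `S` and on its complement. -/
theorem eventually_orthProj_add (hfg : IsShortExact n s r q f g)
    (hS_ind : IsInducedMetric f hS hE)
    (hσ : ∀ x u w, hE.inner x u (σ x w) = hQ.inner x (g x u) w)
    (hgσ : ∀ x w, g x (σ x w) = w) (x : X) : ∀ᶠ y in 𝓝 (chartAt (Cn n) x x),
      homMatrix n s r f x y * orthProj (hE.localGram x) (hS.localGram x) (homMatrix n s r f x) y +
        homMatrix n q r σ x y * homMatrix n r q g x y = 1 := by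
  filter_upwards [eventually_mem_baseSet (n := n) (r := s) S x,
    eventually_mem_baseSet (n := n) (r := r) E x, eventually_mem_baseSet (n := n) (r := q) Q x,
    (hS_ind.isInducedGram hfg.holomorphic_left x).eventually,
    eventually_homMatrix_mul (q := q) (r := r) hgσ x, hE.eventually_posDef x]
    with y yS yE yQ hI hGT hpos
  set x' := (chartAt (Cn n) x).symm y with hx'
  set F := homMatrix n s r f x y with hF
  set G := homMatrix n r q g x y with hG
  set T := homMatrix n q r σ x y with hT'
  set P := orthProj (hE.localGram x) (hS.localGram x) (homMatrix n s r f x) y with hP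
  have hPF : P * F = 1 := hI.orthProj_mul
  have hGF : G * F = 0 := by
    rw [hG, hF, homMatrix, homMatrix, ← localMatrix_comp f g _ yE]
    have : ∀ x, g x ∘ₗ f x = 0 := fun x => LinearMap.ext fun v => by
      have : f x v ∈ LinearMap.ker (g x) := hfg.exact x ▸ LinearMap.mem_range_self _ v
      exact this
    simp only [this, localMatrix, LinearMap.zero_comp, LinearMap.comp_zero, map_zero]
  -- The image of σ is orthogonal to that of f: P T reduces to K_S⁻¹ (G F)ᴴ K_Q, and G F = 0 by
  -- exactness.
  have hPT : P * T = 0 := by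
    have h1 : T = _ := homMatrix_adjoint hσ x yE yQ
    have h2 : hE.localGram x y * (hE.localGram x y)⁻¹ = 1 :=
      Matrix.mul_nonsing_inv _ hpos.det_pos.ne'.isUnit
    rw [h1, hP, orthProj, Matrix.mul_assoc, ← Matrix.mul_assoc (hE.localGram x y),
      ← Matrix.mul_assoc (hE.localGram x y), h2, Matrix.one_mul, Matrix.mul_assoc,
      ← Matrix.mul_assoc _ (homMatrix n r q g x y)ᴴ, ← Matrix.conjTranspose_mul]
    change _ * ((G * F)ᴴ * _) = _
    rw [hGF]; simp
  have hex : ∀ v : Fin r → ℂ, G.mulVec v = 0 → ∃ c : Fin s → ℂ, v = F.mulVec c := by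
    intro v hv
    have h1 : g x' ((trivializationAt (Fin r → ℂ) E x).symm x' v) = 0 := by
      rw [apply_symm_eq g yE yQ]
      change (trivializationAt (Fin q → ℂ) Q x).symm x' (G.mulVec v) = 0
      rw [hv, ← Trivialization.symmₗ_apply (R := ℂ) _ yQ, map_zero]
    have h2 : (trivializationAt (Fin r → ℂ) E x).symm x' v ∈ LinearMap.range (f x') := by
      rw [hfg.exact]; exact h1
    obtain ⟨w, hw⟩ := h2
    refine ⟨(trivializationAt (Fin s → ℂ) S x).linearMapAt ℂ x' w, ?_⟩
    change v = (localMatrix f _ _ x').mulVec _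
    rw [localMatrix_mulVec f yS, Trivialization.symm_linearMapAt _ yS, hw,
      Trivialization.linearMapAt_symm _ yE]
  -- The vector (1 - T G) v lies in ker G, hence equals F c by exactness. Applying P, with P F = 1
  -- and P T = 0, gives c = P v.
  have hA : ∀ v : Fin r → ℂ, (1 - T * G).mulVec v = (F * P).mulVec v := by
    intro v
    obtain ⟨c, hc⟩ := hex ((1 - T * G).mulVec v) (by
      rw [Matrix.mulVec_mulVec, Matrix.mul_sub, Matrix.mul_one, ← Matrix.mul_assoc, hGT,
        Matrix.one_mul, sub_self, Matrix.zero_mulVec])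
    have h3 : P.mulVec ((1 - T * G).mulVec v) = P.mulVec v := by
      rw [Matrix.mulVec_mulVec, Matrix.mul_sub, Matrix.mul_one, ← Matrix.mul_assoc, hPT,
        Matrix.zero_mul, sub_zero]
    rw [hc, Matrix.mulVec_mulVec, hPF, Matrix.one_mulVec] at h3
    rw [hc, h3, Matrix.mulVec_mulVec]
  have hA' : 1 - T * G = F * P := by
    ext i j
    have := congrFun (hA (Pi.single j 1)) i
    rwa [Matrix.mulVec_single_one, Matrix.mulVec_single_one] at this
  rw [← hA', sub_add_cancel]

/-- Apply ∂̄ to F P + T G = 1 with F and G holomorphic: F ∂̄P + ∂̄T G = 0. Multiplying by T on the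
right, or by P on the left, shows that ∂̄P and ∂̄T vanish together. -/
theorem secondFundamental_eq_zero_iff (hfg : IsShortExact n s r q f g)
    (hS_ind : IsInducedMetric f hS hE)
    (hσ : ∀ x u w, hE.inner x u (σ x w) = hQ.inner x (g x u) w)
    (hgσ : ∀ x w, g x (σ x w) = w) (x : X) (v : Cn n) :
    secondFundamental (hE.localGram x) (hS.localGram x) (homMatrix n s r f x) v
      (chartAt (Cn n) x x) = 0 ↔ mdlb (homMatrix n q r σ x) v (chartAt (Cn n) x x) = 0 := by
  have hI := hS_ind.isInducedGram hfg.holomorphic_left x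
  have hF := IsHolomorphicHom.matHol_homMatrix hfg.holomorphic_left x
  have hG := IsHolomorphicHom.matHol_homMatrix hfg.holomorphic_right x
  have hT := matSmooth_adjoint hfg.holomorphic_right hσ x
  have h1 := mdlb_congr (eventually_orthProj_add hfg hS_ind hσ hgσ x) v
  rw [mdlb_add (hF.matSmooth.mul hI.smooth_orthProj) (hT.mul hG.matSmooth), mdlb_const,
    mdlb_mul hF.matSmooth hI.smooth_orthProj, mdlb_mul hT hG.matSmooth, hF.mdlb_eq, hG.mdlb_eq,
    Matrix.zero_mul, zero_add, Matrix.mul_zero, add_zero] at h1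
  rw [← hI.mdlb_orthProj_eq_zero_iff]
  have hGT := (eventually_homMatrix_mul (q := q) (r := r) (n := n) hgσ x).self_of_nhds
  constructor
  · intro h0
    rw [h0, Matrix.mul_zero, zero_add] at h1
    have h2 := congrArg (fun M => M * homMatrix n q r σ x (chartAt (Cn n) x x)) h1
    simpa only [Matrix.mul_assoc, hGT, Matrix.mul_one, Matrix.zero_mul] using h2
  · intro h0
    rw [h0, Matrix.zero_mul, add_zero] at h1
    have h2 := congrArg (fun M => orthProj (hE.localGram x) (hS.localGram x)
      (homMatrix n s r f x) (chartAt (Cn n) x x) * M) h1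
    simpa only [← Matrix.mul_assoc, hI.orthProj_mul, Matrix.one_mul, Matrix.mul_zero] using h2

/-- A right inverse of g with image orthogonal to ker g is unique, so an orthogonal holomorphic
splitting can only be the adjoint σ. -/
theorem splitsOrthogonally_iff (hg : IsHolomorphicHom n r q g)
    (hσ : ∀ x u w, hE.inner x u (σ x w) = hQ.inner x (g x u) w)
    (hgσ : ∀ x w, g x (σ x w) = w) :
    SplitsOrthogonally q g hE ↔ ∀ x v, mdlb (homMatrix n q r σ x) v (chartAt (Cn n) x x) = 0 := by
  have horth : ∀ x w, ∀ v ∈ LinearMap.ker (g x), hE.inner x v (σ x w) = 0 := fun x w v hv => by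
    rw [hσ, LinearMap.mem_ker.1 hv, map_zero, LinearMap.zero_apply]
  constructor
  · rintro ⟨σ', hσ', hgσ', horth'⟩ x v
    have h1 : σ' = σ := by
      funext x
      refine LinearMap.ext fun w => ?_
      have hk : σ' x w - σ x w ∈ LinearMap.ker (g x) := by
        rw [LinearMap.mem_ker, map_sub, hgσ', hgσ, sub_self]
      refine sub_eq_zero.1 (hE.ext_left ?_)
      rw [map_sub, horth' x w _ hk, horth x w _ hk, sub_self]
    subst h1
    exact (IsHolomorphicHom.matHol_homMatrix hσ' x).mdlb_eq v
  · intro h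
    exact ⟨σ, isHolomorphicHom_of_mdlb_eq_zero (matSmooth_adjoint hg hσ) h, hgσ, horth⟩

/-- The degrees of a subbundle and of the corresponding quotient of a Hermite–Einstein bundle. -/
theorem exists_degreeFunction_sub_eq (hfg : IsShortExact n s r q f g)
    (hS_ind : IsInducedMetric f hS hE)
    (hσ : ∀ x u w, hE.inner x u (σ x w) = hQ.inner x (g x u) w)
    (hgσ : ∀ x w, g x (σ x w) = w) (hω : IsKahlerForm ω) (hΩ : IsAdmissibleForm hmn Ω) {lam : ℝ}
    (hHE : IsHermiteEinstein hm hmn ω Ω hE lam) (x : X) :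
    ∃ t : ℝ, 0 ≤ t ∧ (t = 0 ↔ ∀ v, mdlb (homMatrix n q r σ x) v (chartAt (Cn n) x x) = 0) ∧
      degreeFunction hm hmn ω Ω hS x = s * lam - t := by
  obtain ⟨t, ht, ht0, ht'⟩ := hS_ind.exists_degreeFunction_eq hfg.holomorphic_left hω hΩ hHE x
  refine ⟨t, ht, ?_, ht'⟩
  rw [ht0]
  exact forall_congr' fun v => secondFundamental_eq_zero_iff hfg hS_ind hσ hgσ x v

theorem hermiteEinstein_sub (hfg : IsShortExact n s r q f g)
    (hS_ind : IsInducedMetric f hS hE)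
    (hσ : ∀ x u w, hE.inner x u (σ x w) = hQ.inner x (g x u) w)
    (hgσ : ∀ x w, g x (σ x w) = w) {lam : ℝ} (hHE : IsHermiteEinstein hm hmn ω Ω hE lam)
    (h0 : ∀ x v, mdlb (homMatrix n q r σ x) v (chartAt (Cn n) x x) = 0) :
    IsHermiteEinstein hm hmn ω Ω hS lam := fun x i j =>
  (hS_ind.isInducedGram hfg.holomorphic_left x).hermiteEinstein
    (fun v => (secondFundamental_eq_zero_iff hfg hS_ind hσ hgσ x v).2 (h0 x v))
    (topProductLin hm hmn (ω x).toAlternatingMap (Ω x).toAlternatingMap) (hHE x) i j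

end Exact

end HermiteEinstein

namespace HermiteEinstein

/-! ### The operators ∂ and ∂̄ treated uniformly -/

section Wirtinger

variable {n : ℕ}

/-- The operators `∂` (for `c = -i`) and `∂̄` (for `c = i`) on functions. -/
def wirt (c : ℂ) (f : Cn n → ℂ) (v z : Cn n) : ℂ :=
  (1 / 2) * (fderiv ℝ f z v + c * fderiv ℝ f z (Complex.I • v))

theorem wirt_neg_I (f : Cn n → ℂ) (v z : Cn n) : wirt (-Complex.I) f v z = dl f v z := by
  rw [wirt, dl]; ring

theorem wirt_I (f : Cn n → ℂ) (v z : Cn n) : wirt Complex.I f v z = dlb f v z := rfl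

theorem wirt_congr (c : ℂ) {f g : Cn n → ℂ} {z : Cn n} (h : f =ᶠ[𝓝 z] g) (v : Cn n) :
    wirt c f v z = wirt c g v z := by
  rw [wirt, wirt, h.fderiv_eq]

theorem wirt_mul (c : ℂ) {f g : Cn n → ℂ} {z : Cn n} (hf : SmoothNear f z) (hg : SmoothNear g z)
    (v : Cn n) : wirt c (fun y => f y * g y) v z = wirt c f v z * g z + f z * wirt c g v z := by
  rw [wirt, wirt, wirt, fderiv_fun_mul hf.differentiableAt hg.differentiableAt]
  simp only [add_apply, smul_apply, smul_eq_mul]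
  ring

theorem wirt_sum (c : ℂ) {ι : Type*} {s : Finset ι} {f : ι → Cn n → ℂ} {z : Cn n}
    (h : ∀ i ∈ s, SmoothNear (f i) z) (v : Cn n) :
    wirt c (fun y => ∑ i ∈ s, f i y) v z = ∑ i ∈ s, wirt c (f i) v z := by
  simp only [wirt]
  rw [fderiv_fun_sum fun i hi => (h i hi).differentiableAt]
  simp only [sum_apply, Finset.mul_sum, ← Finset.sum_add_distrib]

theorem wirt_mul_const (c : ℂ) {f : Cn n → ℂ} {z : Cn n} (hf : SmoothNear f z) (a : ℂ)
    (v : Cn n) : wirt c (fun y => f y * a) v z = wirt c f v z * a := by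
  rw [wirt_mul c hf (SmoothNear.const a z)]
  simp [wirt]

theorem SmoothNear.wirt (c : ℂ) {f : Cn n → ℂ} {z : Cn n} (hf : SmoothNear f z) (v : Cn n) :
    SmoothNear (wirt c f v) z :=
  (SmoothNear.const _ z).mul
    ((hf.fderiv_apply v).add ((SmoothNear.const _ z).mul (hf.fderiv_apply _)))

/-- The one-form `∂f` or `∂̄f`. -/
def wirtLin (c : ℂ) (f : Cn n → ℂ) (z : Cn n) : Cn n →ₗ[ℝ] ℂ where
  toFun v := wirt c f v z
  map_add' u v := by simp only [wirt, smul_add, map_add]; ring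
  map_smul' a v := by
    simp only [wirt, smul_comm Complex.I a, map_smul, RingHom.id_apply, Complex.real_smul]
    ring

theorem wirtLin_apply (c : ℂ) (f : Cn n → ℂ) (z v : Cn n) : wirtLin c f z v = wirt c f v z := rfl

end Wirtinger

/-! ### Forms in real coordinates -/

section Expansion

variable {n : ℕ}

theorem castDeg_smul {W : Type*} [AddCommGroup W] [Module ℝ W] {p q : ℕ} (h : p = q) (c : ℂ)
    (α : W [⋀^Fin p]→ₗ[ℝ] ℂ) : castDeg h (c • α) = c • castDeg h α := rfl

theorem castDeg_sum {W : Type*} [AddCommGroup W] [Module ℝ W] {p q : ℕ} (h : p = q) {ι : Type*}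
    (s : Finset ι) (α : ι → W [⋀^Fin p]→ₗ[ℝ] ℂ) :
    castDeg h (∑ i ∈ s, α i) = ∑ i ∈ s, castDeg h (α i) := by
  subst h; rfl

/-- A real coordinate function, with values in `ℂ`. -/
def realCoord (n : ℕ) (j : Fin (Module.finrank ℝ (Cn n))) : Cn n →ₗ[ℝ] ℂ :=
  Complex.ofRealCLM.toLinearMap ∘ₗ (Module.finBasis ℝ (Cn n)).coord j

/-- The monomial forms in real coordinates, normalized by `1/k!`. -/
def coordForm {k : ℕ} (J : Fin k → Fin (Module.finrank ℝ (Cn n))) : Cn n [⋀^Fin k]→ₗ[ℝ] ℂ :=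
  ((k.factorial : ℂ)⁻¹) • MultilinearMap.alternatization (prodForm fun i => realCoord n (J i))

/-- The coefficients of a form in real coordinates. -/
def coeff {k : ℕ} (α : Cn n [⋀^Fin k]→ₗ[ℝ] ℂ) (J : Fin k → Fin (Module.finrank ℝ (Cn n))) : ℂ :=
  α fun i => Module.finBasis ℝ (Cn n) (J i)

theorem form_apply_eq_sum {k : ℕ} (α : Cn n [⋀^Fin k]→ₗ[ℝ] ℂ) (v : Fin k → Cn n) :
    α v = ∑ J, coeff α J * ∏ i, realCoord n (J i) (v i) := by
  have hv : v = fun i => ∑ j, (Module.finBasis ℝ (Cn n)).repr (v i) j •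
      Module.finBasis ℝ (Cn n) j := by
    funext i; exact ((Module.finBasis ℝ (Cn n)).sum_repr (v i)).symm
  conv_lhs => rw [hv]
  refine (α.toMultilinearMap.map_sum _).trans (Finset.sum_congr rfl fun J _ => ?_)
  refine (α.toMultilinearMap.map_smul_univ _ _).trans ?_
  rw [Complex.real_smul, Complex.ofReal_prod, mul_comm]
  rfl

/-- The sum runs over all multi-indices rather than increasing ones; the overcounting by k! is
absorbed in the normalization of `coordForm`. -/
theorem sum_coeff_smul_coordForm {k : ℕ} (α : Cn n [⋀^Fin k]→ₗ[ℝ] ℂ) :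
    ∑ J, coeff α J • coordForm J = α := by
  ext v
  rw [form_sum_apply]
  have h1 : ∀ σ : Equiv.Perm (Fin k), ∑ J, coeff α J * ∏ i, realCoord n (J i) (v (σ i)) =
      Equiv.Perm.sign σ • α v := fun σ => by
    rw [← form_apply_eq_sum α fun i => v (σ i)]
    exact α.map_perm v σ
  calc ∑ J, (coeff α J • coordForm J) v
      = ∑ J, (k.factorial : ℂ)⁻¹ * ∑ σ : Equiv.Perm (Fin k), Equiv.Perm.sign σ •
          (coeff α J * ∏ i, realCoord n (J i) (v (σ i))) := by
        refine Finset.sum_congr rfl fun J _ => ?_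
        rw [AlternatingMap.smul_apply, coordForm, AlternatingMap.smul_apply,
          MultilinearMap.alternatization_apply, smul_eq_mul, smul_eq_mul, mul_left_comm,
          Finset.mul_sum]
        congr 1
        refine Finset.sum_congr rfl fun σ _ => ?_
        rw [MultilinearMap.domDomCongr_apply, prodForm_apply, mul_smul_comm]
    _ = (k.factorial : ℂ)⁻¹ * ∑ σ : Equiv.Perm (Fin k), α v := by
        rw [← Finset.mul_sum, Finset.sum_comm]
        congr 1
        refine Finset.sum_congr rfl fun σ _ => ?_
        rw [← Finset.smul_sum, h1, smul_smul, Int.units_mul_self, one_smul]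
    _ = α v := by
        rw [Finset.sum_const, Finset.card_univ, Fintype.card_perm, Fintype.card_fin, nsmul_eq_mul,
          inv_mul_cancel_left₀ (by exact_mod_cast k.factorial_ne_zero)]

theorem castDeg_alternatization_prodForm {p q : ℕ} (h : p = q) (L : Fin p → (Cn n →ₗ[ℝ] ℂ)) :
    castDeg h (MultilinearMap.alternatization (prodForm L)) =
      MultilinearMap.alternatization (prodForm fun i => L (Fin.cast h.symm i)) := by
  subst h; rfl

/-- Laplace expansion along the first column of the determinant that represents the wedge. -/
theorem castDeg_wedge_oneForm_alternatization_apply {k : ℕ} (l : Cn n →ₗ[ℝ] ℂ)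
    (L : Fin k → (Cn n →ₗ[ℝ] ℂ)) (v : Fin (k + 1) → Cn n) :
    castDeg (add_comm 1 k) (wedge (oneForm l) (MultilinearMap.alternatization (prodForm L))) v =
      ∑ i : Fin (k + 1), (-1) ^ i.val *
        (l (v i) * MultilinearMap.alternatization (prodForm L) (i.removeNth v)) := by
  rw [oneForm_eq_alternatization, wedge_alternatization, multilinearProd_prodForm,
    castDeg_alternatization_prodForm, alternatization_prodForm_apply, Matrix.det_succ_column_zero]
  refine Finset.sum_congr rfl fun i _ => ?_
  rw [alternatization_prodForm_apply, mul_assoc]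
  congr 2
  congr 1
  ext a b
  have h : Fin.cast (add_comm 1 k).symm b.succ = Fin.natAdd 1 b := by
    ext; simp [add_comm]
  simp only [Matrix.submatrix_apply, Matrix.of_apply, h, Fin.append_right]
  rfl

theorem castDeg_wedge_oneForm_coordForm_apply {k : ℕ} (l : Cn n →ₗ[ℝ] ℂ)
    (J : Fin k → Fin (Module.finrank ℝ (Cn n))) (v : Fin (k + 1) → Cn n) :
    castDeg (add_comm 1 k) (wedge (oneForm l) (coordForm J)) v =
      ∑ i : Fin (k + 1), (-1) ^ i.val * (l (v i) * coordForm J (i.removeNth v)) := by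
  rw [coordForm, wedge_smul_right, castDeg_smul, AlternatingMap.smul_apply,
    castDeg_wedge_oneForm_alternatization_apply, smul_eq_mul, Finset.mul_sum]
  refine Finset.sum_congr rfl fun i _ => ?_
  rw [AlternatingMap.smul_apply, smul_eq_mul]
  ring

end Expansion

/-! ### The operators ∂ and ∂̄ on forms, with Leibniz rules -/

section FormDeriv

variable {n : ℕ}

/-- The coefficients of a family of forms are smooth. -/
def FormSmooth {k : ℕ} (η : Cn n → Cn n [⋀^Fin k]→ₗ[ℝ] ℂ) (z : Cn n) : Prop :=
  ∀ v, SmoothNear (fun y => η y v) z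

theorem FormSmooth.coeff {k : ℕ} {η : Cn n → Cn n [⋀^Fin k]→ₗ[ℝ] ℂ} {z : Cn n}
    (h : FormSmooth η z) (J : Fin k → Fin (Module.finrank ℝ (Cn n))) :
    SmoothNear (fun y => HermiteEinstein.coeff (η y) J) z := h _

theorem FormSmooth.const {k : ℕ} (γ : Cn n [⋀^Fin k]→ₗ[ℝ] ℂ) (z : Cn n) :
    FormSmooth (fun _ => γ) z := fun _ => SmoothNear.const _ z

theorem FormSmooth.congr {k : ℕ} {η η' : Cn n → Cn n [⋀^Fin k]→ₗ[ℝ] ℂ} {z : Cn n}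
    (h : FormSmooth η z) (he : η' =ᶠ[𝓝 z] η) : FormSmooth η' z := fun v =>
  (h v).congr (he.mono fun y hy => by simp only [hy])

theorem FormSmooth.sum {k : ℕ} {ι : Type*} {s : Finset ι} {η : ι → Cn n → Cn n [⋀^Fin k]→ₗ[ℝ] ℂ}
    {z : Cn n} (h : ∀ i ∈ s, FormSmooth (η i) z) : FormSmooth (fun y => ∑ i ∈ s, η i y) z :=
  fun v => by
    simp only [form_sum_apply]
    exact SmoothNear.sum fun i hi => h i hi v

theorem FormSmooth.smul {k : ℕ} {f : Cn n → ℂ} {η : Cn n → Cn n [⋀^Fin k]→ₗ[ℝ] ℂ} {z : Cn n}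
    (hf : SmoothNear f z) (h : FormSmooth η z) : FormSmooth (fun y => f y • η y) z := fun v =>
  hf.mul (h v)

theorem FormSmooth.wedge {p q : ℕ} {α : Cn n → Cn n [⋀^Fin p]→ₗ[ℝ] ℂ}
    {β : Cn n → Cn n [⋀^Fin q]→ₗ[ℝ] ℂ} {z : Cn n} (hα : FormSmooth α z) (hβ : FormSmooth β z) :
    FormSmooth (fun y => HermiteEinstein.wedge (α y) (β y)) z := fun v => by
  simp only [wedge_apply, Complex.real_smul]
  refine (SmoothNear.const _ z).mul (SmoothNear.sum fun σ _ => ?_)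
  have h := (SmoothNear.const ((Equiv.Perm.sign σ : ℤ) : ℂ) z).mul
    ((hα fun i => v (σ (Fin.castAdd q i))).mul (hβ fun j => v (σ (Fin.natAdd p j))))
  refine h.congr (Filter.Eventually.of_forall fun y => ?_)
  simp only [Units.smul_def, zsmul_eq_mul]

theorem FormSmooth.castDeg {p q : ℕ} (h : p = q) {α : Cn n → Cn n [⋀^Fin p]→ₗ[ℝ] ℂ} {z : Cn n}
    (hα : FormSmooth α z) : FormSmooth (fun y => HermiteEinstein.castDeg h (α y)) z := fun _ =>
  hα _

theorem FormSmooth.wedgePow {ω : Cn n → Cn n [⋀^Fin 2]→ₗ[ℝ] ℂ} {z : Cn n} (h : FormSmooth ω z) :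
    ∀ k, FormSmooth (fun y => HermiteEinstein.wedgePow (ω y) k) z
  | 0 => FormSmooth.const _ z
  | k + 1 => (h.wedgePow k).wedge h

theorem FormSmooth.oneForm_wirtLin (c : ℂ) {f : Cn n → ℂ} {z : Cn n} (hf : SmoothNear f z) :
    FormSmooth (fun y => oneForm (wirtLin c f y)) z := fun v => hf.wirt c (v 0)

/-- The operators `∂` (for `c = -i`) and `∂̄` (for `c = i`) on forms. -/
def formDeriv (c : ℂ) {k : ℕ} (η : Cn n → Cn n [⋀^Fin k]→ₗ[ℝ] ℂ) (z : Cn n) :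
    Cn n [⋀^Fin (1 + k)]→ₗ[ℝ] ℂ :=
  ∑ J, wedge (oneForm (wirtLin c (fun y => coeff (η y) J) z)) (coordForm J)

variable {c : ℂ} {k : ℕ} {η : Cn n → Cn n [⋀^Fin k]→ₗ[ℝ] ℂ} {z : Cn n}

theorem FormSmooth.formDeriv (h : FormSmooth η z) : FormSmooth (formDeriv c η) z :=
  FormSmooth.sum fun _ _ => (FormSmooth.oneForm_wirtLin c (h.coeff _)).wedge (FormSmooth.const _ z)

theorem formDeriv_congr {η' : Cn n → Cn n [⋀^Fin k]→ₗ[ℝ] ℂ} (h : η =ᶠ[𝓝 z] η') :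
    formDeriv c η z = formDeriv c η' z := by
  refine Finset.sum_congr rfl fun J _ => ?_
  congr 2
  exact LinearMap.ext fun v => wirt_congr c (h.mono fun y hy => by simp only [hy]) v

theorem formDeriv_castDeg {k' : ℕ} (h : k = k') : formDeriv c (fun y => castDeg h (η y)) z =
    castDeg (congrArg (1 + ·) h) (formDeriv c η z) := by
  subst h; rfl

theorem oneForm_add (l l' : Cn n →ₗ[ℝ] ℂ) : oneForm (l + l') = oneForm l + oneForm l' := rfl

theorem oneForm_smul (a : ℂ) (l : Cn n →ₗ[ℝ] ℂ) : oneForm (a • l) = a • oneForm l := rfl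

theorem oneForm_sum {ι : Type*} (s : Finset ι) (l : ι → Cn n →ₗ[ℝ] ℂ) :
    oneForm (∑ i ∈ s, l i) = ∑ i ∈ s, oneForm (l i) := by
  ext v
  rw [form_sum_apply]
  exact LinearMap.sum_apply _ _ _

/-- The operator can be computed from any expression of the form with constant forms γ_i, not just
the coordinate expansion in its definition. The Leibniz rules rest on this. -/
theorem formDeriv_sum_smul_const {ι : Type*} {s : Finset ι} {f : ι → Cn n → ℂ}
    (γ : ι → Cn n [⋀^Fin k]→ₗ[ℝ] ℂ) (hf : ∀ i ∈ s, SmoothNear (f i) z) :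
    formDeriv c (fun y => ∑ i ∈ s, f i y • γ i) z =
      ∑ i ∈ s, wedge (oneForm (wirtLin c (f i) z)) (γ i) := by
  have h1 : ∀ J, wirtLin c (fun y => coeff (∑ i ∈ s, f i y • γ i) J) z =
      ∑ i ∈ s, coeff (γ i) J • wirtLin c (f i) z := by
    intro J
    refine LinearMap.ext fun v => ?_
    simp only [coeff, form_sum_apply, AlternatingMap.smul_apply, smul_eq_mul, wirtLin_apply,
      LinearMap.sum_apply, LinearMap.smul_apply]
    rw [wirt_sum c fun i hi => (hf i hi).mul (SmoothNear.const _ z)]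
    refine Finset.sum_congr rfl fun i hi => ?_
    rw [wirt_mul_const c (hf i hi), mul_comm]
  simp only [formDeriv, h1, oneForm_sum, oneForm_smul, wedge_sum_left, wedge_smul_left]
  rw [Finset.sum_comm]
  refine Finset.sum_congr rfl fun i _ => ?_
  conv_rhs => rw [← sum_coeff_smul_coordForm (γ i)]
  simp only [wedge_sum_right, wedge_smul_right]

/-- Identifies the operator with the alternated derivative, the shape in which `del` and `delbar`
are defined. -/
theorem formDeriv_apply (h : FormSmooth η z) (v : Fin (k + 1) → Cn n) :
    castDeg (add_comm 1 k) (formDeriv c η z) v =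
      ∑ i : Fin (k + 1), (-1) ^ i.val * wirt c (fun y => η y (i.removeNth v)) (v i) z := by
  have h1 : ∀ w u, wirt c (fun y => η y w) u z =
      ∑ J, wirt c (fun y => coeff (η y) J) u z * coordForm J w := by
    intro w u
    have e : (fun y => η y w) = fun y => ∑ J, coeff (η y) J * coordForm J w := by
      funext y
      conv_lhs => rw [← sum_coeff_smul_coordForm (η y)]
      rw [form_sum_apply]
      rfl
    rw [e, wirt_sum c fun J _ => (h.coeff J).mul (SmoothNear.const _ z)]
    exact Finset.sum_congr rfl fun J _ => wirt_mul_const c (h.coeff J) _ _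
  rw [formDeriv, castDeg_sum, form_sum_apply]
  simp only [castDeg_wedge_oneForm_coordForm_apply, h1, Finset.mul_sum, wirtLin_apply]
  exact Finset.sum_comm

theorem wedge_oneForm_wedge {p q : ℕ} (l : Cn n →ₗ[ℝ] ℂ) (α : Cn n [⋀^Fin p]→ₗ[ℝ] ℂ)
    (β : Cn n [⋀^Fin q]→ₗ[ℝ] ℂ) : wedge (oneForm l) (wedge α β) =
      (-1 : ℂ) ^ p • castDeg (show p + (1 + q) = 1 + (p + q) by omega)
        (wedge α (wedge (oneForm l) β)) := by
  have h1 : wedge (oneForm l) (wedge α β) =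
      castDeg (add_assoc 1 p q) (wedge (wedge (oneForm l) α) β) := by
    rw [wedge_assoc, castDeg_castDeg, castDeg_rfl]
  rw [h1, wedge_comm (oneForm l) α, one_mul, wedge_smul_left, wedge_castDeg_left, wedge_assoc]
  rfl

/-- Expand both forms in coordinates: the product rule holds for the coefficients, and the sign
arises from moving the one-form past the p-form. -/
theorem formDeriv_wedge {p q : ℕ} {α : Cn n → Cn n [⋀^Fin p]→ₗ[ℝ] ℂ}
    {β : Cn n → Cn n [⋀^Fin q]→ₗ[ℝ] ℂ} (hα : FormSmooth α z) (hβ : FormSmooth β z) :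
    formDeriv c (fun y => wedge (α y) (β y)) z =
      castDeg (add_assoc 1 p q) (wedge (formDeriv c α z) (β z)) +
        (-1 : ℂ) ^ p • castDeg (show p + (1 + q) = 1 + (p + q) by omega)
          (wedge (α z) (formDeriv c β z)) := by
  have e : (fun y => wedge (α y) (β y)) = fun y => ∑ x ∈ Finset.univ ×ˢ Finset.univ,
      (coeff (α y) x.1 * coeff (β y) x.2) • wedge (coordForm x.1) (coordForm x.2) := by
    funext y
    conv_lhs => rw [← sum_coeff_smul_coordForm (α y), ← sum_coeff_smul_coordForm (β y)]
    rw [Finset.sum_product]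
    simp only [wedge_sum_left, wedge_sum_right, wedge_smul_left, wedge_smul_right,
      Finset.smul_sum, smul_smul]
    first
      | rfl
      | (rw [Finset.sum_comm]
         exact Finset.sum_congr rfl fun J _ => Finset.sum_congr rfl fun K _ => by rw [mul_comm])
  have hl : ∀ (J : Fin p → Fin (Module.finrank ℝ (Cn n)))
      (K : Fin q → Fin (Module.finrank ℝ (Cn n))),
      wirtLin c (fun y => coeff (α y) J * coeff (β y) K) z =
        coeff (β z) K • wirtLin c (fun y => coeff (α y) J) z +
          coeff (α z) J • wirtLin c (fun y => coeff (β y) K) z := fun J K =>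
    LinearMap.ext fun v => by
      simp only [wirtLin_apply, LinearMap.add_apply, LinearMap.smul_apply, smul_eq_mul]
      rw [wirt_mul c (hα.coeff _) (hβ.coeff _)]
      ring
  rw [e, formDeriv_sum_smul_const _ fun x _ => (hα.coeff _).mul (hβ.coeff _), Finset.sum_product]
  simp only [hl, oneForm_add, oneForm_smul, wedge_add_left, wedge_smul_left,
    Finset.sum_add_distrib]
  congr 1
  · conv_rhs => rw [← sum_coeff_smul_coordForm (β z)]
    simp only [formDeriv, wedge_sum_left, wedge_sum_right, wedge_smul_right, castDeg_sum,
      castDeg_smul, wedge_assoc, castDeg_castDeg, castDeg_rfl, Finset.smul_sum]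
    exact Finset.sum_comm
  · conv_rhs => rw [← sum_coeff_smul_coordForm (α z)]
    simp only [formDeriv, wedge_sum_left, wedge_sum_right, wedge_smul_left, castDeg_sum,
      castDeg_smul, Finset.smul_sum, wedge_oneForm_wedge]
    rw [Finset.sum_comm]
    refine Finset.sum_congr rfl fun J _ => Finset.sum_congr rfl fun K _ => ?_
    rw [smul_comm]

theorem formDeriv_smul {f : Cn n → ℂ} (hf : SmoothNear f z) (hη : FormSmooth η z) :
    formDeriv c (fun y => f y • η y) z =
      wedge (oneForm (wirtLin c f z)) (η z) + f z • formDeriv c η z := by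
  have e : (fun y => f y • η y) = fun y => ∑ J, (f y * coeff (η y) J) • coordForm J := by
    funext y
    conv_lhs => rw [← sum_coeff_smul_coordForm (η y)]
    simp only [Finset.smul_sum, smul_smul]
  have hl : ∀ J : Fin k → Fin (Module.finrank ℝ (Cn n)),
      wirtLin c (fun y => f y * coeff (η y) J) z =
        coeff (η z) J • wirtLin c f z + f z • wirtLin c (fun y => coeff (η y) J) z := fun J =>
    LinearMap.ext fun v => by
      simp only [wirtLin_apply, LinearMap.add_apply, LinearMap.smul_apply, smul_eq_mul]
      rw [wirt_mul c hf (hη.coeff _)]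
      ring
  rw [e, formDeriv_sum_smul_const _ fun x _ => hf.mul (hη.coeff _)]
  simp only [hl, oneForm_add, oneForm_smul, wedge_add_left, wedge_smul_left,
    Finset.sum_add_distrib]
  congr 1
  · conv_rhs => rw [← sum_coeff_smul_coordForm (η z)]
    simp only [wedge_sum_right, wedge_smul_right]
  · simp only [formDeriv, Finset.smul_sum]

end FormDeriv

end HermiteEinstein

namespace HermiteEinstein

/-! ### Products with closed forms -/

section Closed

variable {n : ℕ} {c : ℂ} {z : Cn n}

theorem formDeriv_const {k : ℕ} (γ : Cn n [⋀^Fin k]→ₗ[ℝ] ℂ) :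
    formDeriv c (fun _ => γ) z = 0 := by
  refine Finset.sum_eq_zero fun J _ => ?_
  have h : wirtLin c (fun _ : Cn n => coeff γ J) z = 0 := LinearMap.ext fun v => by
    simp [wirtLin_apply, wirt]
  have h0 : oneForm (0 : Cn n →ₗ[ℝ] ℂ) = 0 := rfl
  rw [h, h0, wedge_zero_left]

theorem formDeriv_eq_zero {k : ℕ} {η : Cn n → Cn n [⋀^Fin k]→ₗ[ℝ] ℂ}
    (h : ∀ᶠ y in 𝓝 z, η y = 0) : formDeriv c η z = 0 :=
  (formDeriv_congr (η' := fun _ => 0) h).trans (formDeriv_const 0)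

theorem castDeg_zero {W : Type*} [AddCommGroup W] [Module ℝ W] {p q : ℕ} (h : p = q) :
    castDeg h (0 : W [⋀^Fin p]→ₗ[ℝ] ℂ) = 0 := rfl

theorem castDeg_injective {W : Type*} [AddCommGroup W] [Module ℝ W] {p q : ℕ} (h : p = q) :
    Function.Injective (castDeg (W := W) h) := by
  subst h; exact fun _ _ h => h

theorem formDeriv_wedgePow {ω : Cn n → Cn n [⋀^Fin 2]→ₗ[ℝ] ℂ} (hω : FormSmooth ω z)
    (h : formDeriv c ω z = 0) : ∀ k, formDeriv c (fun y => wedgePow (ω y) k) z = 0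
  | 0 => formDeriv_const _
  | k + 1 => by
    refine (formDeriv_wedge (hω.wedgePow k) hω).trans ?_
    rw [formDeriv_wedgePow hω h k, h, wedge_zero_left, wedge_zero_right, castDeg_zero, castDeg_zero,
      smul_zero, add_zero]

theorem FormSmooth.eventually {k : ℕ} {η : Cn n → Cn n [⋀^Fin k]→ₗ[ℝ] ℂ}
    (h : FormSmooth η z) : ∀ᶠ y in 𝓝 z, FormSmooth η y := by
  have h1 : ∀ᶠ y in 𝓝 z, ∀ J, SmoothNear (fun y => HermiteEinstein.coeff (η y) J) y :=
    Filter.eventually_all.2 fun J => (h.coeff J).eventually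
  filter_upwards [h1] with y hy v
  simp only [form_apply_eq_sum _ v]
  exact SmoothNear.sum fun J _ => (hy J).mul (SmoothNear.const _ y)

theorem formDeriv_wedge_of_closed {p q : ℕ} (hp : Even p) {α : Cn n → Cn n [⋀^Fin p]→ₗ[ℝ] ℂ}
    {β : Cn n → Cn n [⋀^Fin q]→ₗ[ℝ] ℂ} (hα : FormSmooth α z) (hβ : FormSmooth β z)
    (h : formDeriv c α z = 0) :
    formDeriv c (fun y => wedge (α y) (β y)) z =
      castDeg (show p + (1 + q) = 1 + (p + q) by omega) (wedge (α z) (formDeriv c β z)) := by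
  rw [formDeriv_wedge hα hβ, h, wedge_zero_left, castDeg_zero, zero_add, hp.neg_one_pow, one_smul]

/-- A closed form of even degree passes through both operators without a sign. In the application α
is ω^{m-1} and β is Ω. -/
theorem formDeriv_formDeriv_wedge_eq_zero {c' : ℂ} {p q : ℕ} (hp : Even p)
    {α : Cn n → Cn n [⋀^Fin p]→ₗ[ℝ] ℂ} {β : Cn n → Cn n [⋀^Fin q]→ₗ[ℝ] ℂ}
    (hα : FormSmooth α z) (hβ : FormSmooth β z) (h : ∀ᶠ y in 𝓝 z, formDeriv c α y = 0)
    (h' : formDeriv c' α z = 0) (h2 : formDeriv c' (formDeriv c β) z = 0) :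
    formDeriv c' (formDeriv c fun y => wedge (α y) (β y)) z = 0 := by
  have e : (formDeriv c fun y => wedge (α y) (β y)) =ᶠ[𝓝 z] fun y =>
      castDeg (show p + (1 + q) = 1 + (p + q) by omega) (wedge (α y) (formDeriv c β y)) := by
    filter_upwards [hα.eventually, hβ.eventually, h] with y h1 h2 h3
    exact formDeriv_wedge_of_closed hp h1 h2 h3
  rw [formDeriv_congr e, formDeriv_castDeg, formDeriv_wedge_of_closed hp hα hβ.formDeriv h', h2,
    wedge_zero_right, castDeg_zero, castDeg_zero]

end Closed

/-! ### Comparison with the operators of the statement -/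

section Comparison

variable {n k : ℕ} {η : Cn n → Cn n [⋀^Fin k]→L[ℝ] ℂ} {z : Cn n}

theorem formSmooth_of_contDiffAt (h : ∀ᶠ y in 𝓝 z, ContDiffAt ℝ smoothOrder η y) :
    FormSmooth (fun y => (η y).toAlternatingMap) z := fun v =>
  h.mono fun _ hy =>
    (ContinuousAlternatingMap.apply ℝ (Cn n) ℂ v).contDiff.contDiffAt.comp _ hy

theorem delbar_eq_formDeriv (h : ∀ᶠ y in 𝓝 z, ContDiffAt ℝ smoothOrder η y) :
    (delbar η z).toAlternatingMap = castDeg (add_comm 1 k)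
      (formDeriv Complex.I (fun y => (η y).toAlternatingMap) z) := by
  ext v
  rw [formDeriv_apply (formSmooth_of_contDiffAt h)]
  refine (delbar_apply (h.self_of_nhds.differentiableAt smoothOrder_ne_zero) v).trans ?_
  refine Finset.sum_congr rfl fun i _ => ?_
  rw [wirt_I, zsmul_eq_mul]
  push_cast
  rfl

theorem del_eq_formDeriv (h : ∀ᶠ y in 𝓝 z, ContDiffAt ℝ smoothOrder η y) :
    (del η z).toAlternatingMap = castDeg (add_comm 1 k)
      (formDeriv (-Complex.I) (fun y => (η y).toAlternatingMap) z) := by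
  ext v
  rw [formDeriv_apply (formSmooth_of_contDiffAt h)]
  refine (del_apply (h.self_of_nhds.differentiableAt smoothOrder_ne_zero) v).trans ?_
  refine Finset.sum_congr rfl fun i _ => ?_
  rw [wirt_neg_I, zsmul_eq_mul]
  push_cast
  rfl

theorem formDeriv_formDeriv_eq_zero (h : ∀ᶠ y in 𝓝 z, ContDiffAt ℝ smoothOrder η y)
    (h0 : del (delbar η) z = 0) :
    formDeriv (-Complex.I) (formDeriv Complex.I fun y => (η y).toAlternatingMap) z = 0 := by
  have h1 := del_eq_formDeriv (h.mono fun _ hy => contDiffAt_delbar hy)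
  rw [h0, formDeriv_congr (h.eventually_nhds.mono fun _ hy => delbar_eq_formDeriv hy),
    formDeriv_castDeg] at h1
  exact castDeg_injective _ (castDeg_injective _ h1.symm)

theorem dlb_I_smul (f : Cn n → ℂ) (v z : Cn n) :
    dlb f (Complex.I • v) z = -(Complex.I * dlb f v z) := by
  rw [dlb, dlb, smul_smul, Complex.I_mul_I, neg_one_smul, map_neg]
  linear_combination (fderiv ℝ f z (Complex.I • v)) / 2 * Complex.I_mul_I

/-- A closed form of type `(1,1)` is both `∂`- and `∂̄`-closed. -/
theorem formDeriv_eq_zero_of_extDeriv (h : ∀ᶠ y in 𝓝 z, ContDiffAt ℝ smoothOrder η y)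
    (h0 : extDeriv η z = 0) (hI : ∀ᶠ y in 𝓝 z, ∀ v, η y (fun j => Complex.I • v j) = η y v) :
    formDeriv (-Complex.I) (fun y => (η y).toAlternatingMap) z = 0 ∧
      formDeriv Complex.I (fun y => (η y).toAlternatingMap) z = 0 := by
  have hd := h.self_of_nhds.differentiableAt smoothOrder_ne_zero
  have hsum : ∀ v, del η z v + delbar η z v = 0 := by
    intro v
    have h1 : extDeriv η z v = 0 := by rw [h0]; rfl
    rw [extDeriv_apply hd] at h1
    rw [del_apply hd, delbar_apply hd, ← Finset.sum_add_distrib, ← h1]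
    refine Finset.sum_congr rfl fun i _ => ?_
    rw [← smul_add]
    congr 1
    rw [dl, dlb]
    ring
  have hcongr : ∀ (v : Fin (k + 1) → Cn n) (i : Fin (k + 1)),
      (fun y => η y (i.removeNth fun j => Complex.I • v j)) =ᶠ[𝓝 z]
        fun y => η y (i.removeNth v) := fun v i => hI.mono fun y hy => hy _
  -- Types are separated by multiplying all vectors by i: since η is invariant, ∂η is multiplied by
  -- i and ∂̄η by -i. Their sum dη is zero, so both vanish.
  have ha : ∀ v, del η z (fun j => Complex.I • v j) = Complex.I * del η z v := by
    intro v
    rw [del_apply hd, del_apply hd, Finset.mul_sum]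
    refine Finset.sum_congr rfl fun i _ => ?_
    rw [dl_congr (hcongr v i), dl_I_smul, mul_smul_comm]
  have hb : ∀ v, delbar η z (fun j => Complex.I • v j) = -(Complex.I * delbar η z v) := by
    intro v
    rw [delbar_apply hd, delbar_apply hd, Finset.mul_sum, ← Finset.sum_neg_distrib]
    refine Finset.sum_congr rfl fun i _ => ?_
    rw [dlb_congr (hcongr v i), dlb_I_smul, mul_smul_comm, smul_neg]
  have hdel : ∀ v, del η z v = 0 := by
    intro v
    have h1 := hsum v
    have h2 := hsum fun j => Complex.I • v j
    rw [ha, hb] at h2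
    have h3 : Complex.I * del η z v = 0 := by linear_combination h2 / 2 + Complex.I * h1 / 2
    exact (mul_eq_zero.1 h3).resolve_left Complex.I_ne_zero
  refine ⟨castDeg_injective (add_comm 1 k) ?_, castDeg_injective (add_comm 1 k) ?_⟩
  · rw [← del_eq_formDeriv h]
    exact AlternatingMap.ext hdel
  · rw [← delbar_eq_formDeriv h]
    refine AlternatingMap.ext fun v => ?_
    have := hsum v
    rw [hdel, zero_add] at this
    exact this

end Comparison

/-! ### Stokes' theorem for ∂̄∂ψ ∧ W -/

section Stokes

open MeasureTheory

variable {n : ℕ}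

theorem integral_wirt (c : ℂ) {f : Cn n → ℂ} (hf : ∀ z, SmoothNear f z)
    (hc : HasCompactSupport f) (v : Cn n) : ∫ z, wirt c f v z = 0 := by
  have hcd : ContDiff ℝ smoothOrder f := contDiff_iff_contDiffAt.2 fun z => (hf z).contDiffAt
  have hd : Differentiable ℝ f := hcd.differentiable smoothOrder_ne_zero
  have hint : ∀ v : Cn n, Integrable fun z => fderiv ℝ f z v := fun v =>
    ((hcd.continuous_fderiv smoothOrder_ne_zero).clm_apply
      continuous_const).integrable_of_hasCompactSupport (hc.fderiv_apply ℝ v)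
  have h0 : ∀ v : Cn n, ∫ z, fderiv ℝ f z v = 0 := by
    intro v
    -- Integration by parts against the constant function 1.
    have := integral_mul_fderiv_eq_neg_fderiv_mul_of_integrable (μ := volume)
      (f := fun _ : Cn n => (1 : ℂ)) (g := f) (v := v) (by simp) (by simpa using hint v)
      (by simpa using hcd.continuous.integrable_of_hasCompactSupport hc)
      (fun _ _ => by fun_prop) fun _ _ => hd _
    simpa using this
  simp only [wirt]
  rw [integral_const_mul, integral_add (hint v) ((hint _).const_mul c), integral_const_mul, h0, h0]
  simp

theorem integral_formDeriv (c : ℂ) {k : ℕ} {β : Cn n → Cn n [⋀^Fin k]→ₗ[ℝ] ℂ}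
    (hβ : ∀ z, FormSmooth β z) {K : Set (Cn n)} (hK : IsCompact K) (h0 : ∀ y, y ∉ K → β y = 0)
    (v : Fin (k + 1) → Cn n) :
    Integrable (fun z => castDeg (add_comm 1 k) (formDeriv c β z) v) ∧
      ∫ z, castDeg (add_comm 1 k) (formDeriv c β z) v = 0 := by
  simp only [formDeriv_apply (hβ _)]
  have hc : ∀ w, HasCompactSupport fun y => β y w := fun w =>
    HasCompactSupport.intro hK fun y hy => by rw [h0 y hy]; rfl
  have hi : ∀ i : Fin (k + 1), Integrable
      fun z => (-1 : ℂ) ^ i.val * wirt c (fun y => β y (i.removeNth v)) (v i) z := by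
    intro i
    refine (Continuous.integrable_of_hasCompactSupport ?_ (HasCompactSupport.intro hK ?_)).const_mul _
    · exact continuous_iff_continuousAt.2 fun z =>
        ((hβ z _).wirt c (v i)).contDiffAt.continuousAt
    · intro y hy
      have h1 : (fun y => β y (i.removeNth v)) =ᶠ[𝓝 y] fun _ => 0 := by
        filter_upwards [hK.isClosed.isOpen_compl.mem_nhds hy] with x hx
        rw [h0 x hx]; rfl
      rw [wirt_congr c h1]
      simp [wirt]
  refine ⟨integrable_finsetSum _ fun i _ => hi i, ?_⟩
  rw [integral_finsetSum _ fun i _ => hi i]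
  refine Finset.sum_eq_zero fun i _ => ?_
  rw [integral_const_mul, integral_wirt c (fun z => hβ z _) (hc _), mul_zero]

/-- The form `∂̄∂ψ`. -/
def dbard (ψ : Cn n → ℂ) (z : Cn n) : Cn n [⋀^Fin 2]→ₗ[ℝ] ℂ :=
  formDeriv Complex.I (fun y => oneForm (wirtLin (-Complex.I) ψ y)) z

/-- The form is ∂̄(∂ψ ∧ W) + ∂(ψ ∂̄W): the terms ∂ψ ∧ ∂̄W cancel, and ψ ∂∂̄W is zero. Only ∂∂̄W = 0
is needed, not closedness of W. -/
theorem wedge_dbard {k : ℕ} {ψ : Cn n → ℂ} {W : Cn n → Cn n [⋀^Fin k]→ₗ[ℝ] ℂ} {z : Cn n}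
    (hψ : SmoothNear ψ z) (hW : FormSmooth W z)
    (h : formDeriv (-Complex.I) (formDeriv Complex.I W) z = 0) :
    castDeg (add_assoc 1 1 k) (wedge (dbard ψ z) (W z)) =
      formDeriv Complex.I (fun y => wedge (oneForm (wirtLin (-Complex.I) ψ y)) (W y)) z +
        formDeriv (-Complex.I) (fun y => ψ y • formDeriv Complex.I W y) z := by
  rw [formDeriv_wedge (FormSmooth.oneForm_wirtLin _ hψ) hW, formDeriv_smul hψ hW.formDeriv, h,
    smul_zero, add_zero, castDeg_rfl, pow_one, neg_one_smul, neg_add_cancel_right]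
  rfl

/-- Stokes' theorem: `∫ ∂̄∂ψ ∧ W = 0` if `∂∂̄W = 0` and `ψ` has compact support. -/
theorem integral_wedge_dbard {k : ℕ} {ψ : Cn n → ℂ} {W : Cn n → Cn n [⋀^Fin k]→ₗ[ℝ] ℂ}
    {K : Set (Cn n)} (hK : IsCompact K) (hψ : ∀ z ∈ K, SmoothNear ψ z)
    (hψ0 : ∀ y, y ∉ K → ψ y = 0) (hW : ∀ z ∈ K, FormSmooth W z)
    (h : ∀ z ∈ K, formDeriv (-Complex.I) (formDeriv Complex.I W) z = 0) {l : ℕ} (hl : 2 + k = l)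
    (v : Fin l → Cn n) : ∫ z, castDeg hl (wedge (dbard ψ z) (W z)) v = 0 := by
  subst hl
  have hnear : ∀ y, y ∉ K → ∀ᶠ x in 𝓝 y, ψ x = 0 := fun y hy =>
    Filter.mem_of_superset (hK.isClosed.isOpen_compl.mem_nhds hy) hψ0
  have hA0 : ∀ y, y ∉ K → oneForm (wirtLin (-Complex.I) ψ y) = 0 := by
    intro y hy
    have h1 : wirtLin (-Complex.I) ψ y = 0 := LinearMap.ext fun w => by
      rw [wirtLin_apply, wirt_congr _ (g := fun _ => 0) (hnear y hy)]
      simp [wirt]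
    rw [h1]; rfl
  have hout : ∀ {p : ℕ} {β : Cn n → Cn n [⋀^Fin p]→ₗ[ℝ] ℂ}, (∀ y, y ∉ K → β y = 0) →
      ∀ z, z ∉ K → ∀ᶠ y in 𝓝 z, β y = 0 := fun hβ z hz =>
    Filter.mem_of_superset (hK.isClosed.isOpen_compl.mem_nhds hz) hβ
  have h1 : ∀ y, y ∉ K → wedge (oneForm (wirtLin (-Complex.I) ψ y)) (W y) = 0 := fun y hy => by
    rw [hA0 y hy, wedge_zero_left]
  have h2 : ∀ y, y ∉ K → ψ y • formDeriv Complex.I W y = 0 := fun y hy => by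
    rw [hψ0 y hy, zero_smul]
  -- A form vanishing off the compact set K is zero near every point outside K, so smoothness needs
  -- to be known on K only.
  have hs : ∀ {p : ℕ} {β : Cn n → Cn n [⋀^Fin p]→ₗ[ℝ] ℂ}, (∀ y, y ∉ K → β y = 0) →
      (∀ z ∈ K, FormSmooth β z) → ∀ z, FormSmooth β z := by
    intro p β hβ hβ' z
    by_cases hz : z ∈ K
    · exact hβ' z hz
    · exact (FormSmooth.const 0 z).congr (hout hβ z hz)
  have i1 := integral_formDeriv Complex.I (hs h1 fun z hz =>
    (FormSmooth.oneForm_wirtLin _ (hψ z hz)).wedge (hW z hz)) hK h1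
    fun i => v (Fin.cast (by omega) i)
  have i2 := integral_formDeriv (-Complex.I) (hs h2 fun z hz =>
    (FormSmooth.smul (hψ z hz) (hW z hz).formDeriv)) hK h2 fun i => v (Fin.cast (by omega) i)
  have e : ∀ z, castDeg (add_assoc 1 1 k) (wedge (dbard ψ z) (W z)) =
      formDeriv Complex.I (fun y => wedge (oneForm (wirtLin (-Complex.I) ψ y)) (W y)) z +
        formDeriv (-Complex.I) (fun y => ψ y • formDeriv Complex.I W y) z := by
    intro z
    by_cases hz : z ∈ K
    · exact wedge_dbard (hψ z hz) (hW z hz) (h z hz)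
    · rw [dbard, formDeriv_eq_zero (hout hA0 z hz), formDeriv_eq_zero (hout h1 z hz),
        formDeriv_eq_zero (hout h2 z hz), wedge_zero_left, castDeg_zero, add_zero]
  have e' : ∀ z, castDeg rfl (wedge (dbard ψ z) (W z)) v =
      castDeg (add_comm 1 (1 + k)) (formDeriv Complex.I
        (fun y => wedge (oneForm (wirtLin (-Complex.I) ψ y)) (W y)) z)
          (fun i => v (Fin.cast (by omega) i)) +
        castDeg (add_comm 1 (1 + k)) (formDeriv (-Complex.I)
          (fun y => ψ y • formDeriv Complex.I W y) z) (fun i => v (Fin.cast (by omega) i)) :=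
    fun z => congrArg (fun α => castDeg (add_comm 1 (1 + k)) α
      fun i => v (Fin.cast (by omega) i)) (e z)
  simp only [e']
  rw [integral_add i1.1 i2.1, i1.2, i2.2, add_zero]

end Stokes

/-! ### Naturality of the curvature of a line bundle -/

section LineCurvature

variable {n : ℕ}

theorem dbard_apply {ψ : Cn n → ℂ} {z : Cn n} (hψ : SmoothNear ψ z) (v w : Cn n) :
    dbard ψ z ![v, w] = dlb (dl ψ w) v z - dlb (dl ψ v) w z := by
  have h := formDeriv_apply (c := Complex.I)
    (FormSmooth.oneForm_wirtLin (-Complex.I) hψ) ![v, w]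
  refine Eq.trans ?_ (h.trans ?_)
  · rfl
  · have e : ∀ u : Fin 1 → Cn n, (fun y => oneForm (wirtLin (-Complex.I) ψ y) u) = dl ψ (u 0) :=
      fun u => funext fun y => wirt_neg_I ψ (u 0) y
    simp only [e, wirt_I]
    simp [Fin.removeNth, sub_eq_add_neg]

/-- The logarithmic derivative of exp ψ is ∂ψ. Through this lemma facts about curvature carry over
to ∂̄∂ψ. -/
theorem lineCurvature_exp {ψ : Cn n → ℂ} {z : Cn n} (hψ : SmoothNear ψ z) :
    lineCurvature (fun y => Complex.exp (ψ y)) z = dbard ψ z := by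
  have hs : SmoothNear (fun y => Complex.exp (ψ y)) z := hψ.mono fun y hy => hy.cexp
  refine twoForm_ext fun v w => ?_
  rw [lineCurvature_apply hs (Complex.exp_ne_zero _), dbard_apply hψ]
  have e : ∀ w, (fun y => (Complex.exp (ψ y))⁻¹ * dl (fun y => Complex.exp (ψ y)) w y) =ᶠ[𝓝 z]
      dl ψ w := by
    intro w
    filter_upwards [hψ.eventually] with y hy
    have := (hy.differentiableAt.hasFDerivAt.cexp).fderiv
    have h0 := Complex.exp_ne_zero (ψ y)
    rw [dl, dl, this]
    simp only [smul_apply, smul_eq_mul]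
    generalize fderiv ℝ ψ y w = a, fderiv ℝ ψ y (Complex.I • w) = b
    field_simp
  rw [logLevi, logLevi, dlb_congr (e w), dlb_congr (e v)]

theorem dl_eq_sum (f : Cn n → ℂ) (w z : Cn n) :
    dl f w z = ∑ j, w j * dl f (Pi.single j 1) z := by
  have := (dlLin f z).pi_apply_eq_sum_univ w
  simp only [dlLin_apply, smul_eq_mul] at this
  rw [this]
  refine Finset.sum_congr rfl fun j _ => ?_
  congr 2
  funext i
  simp [Pi.single_apply, eq_comm]

/-- The derivative of a holomorphic map is holomorphic, so ∂̄ does not see the varying argument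
fderiv τ y w, on which A depends complex-linearly. -/
theorem dlb_comp_linear {A : Cn n → Cn n → ℂ} {τ : Cn n → Cn n} {z : Cn n}
    (hA : ∀ w y, A w y = ∑ j, w j * A (Pi.single j 1) y) (hs : ∀ w, SmoothNear (A w) (τ z))
    (hτ : ∀ᶠ y in 𝓝 z, ContDiffAt ℂ smoothOrder τ y) (v w : Cn n) :
    dlb (fun y => A (fderiv ℂ τ y w) (τ y)) v z =
      dlb (A (fderiv ℂ τ z w)) (fderiv ℂ τ z v) (τ z) := by
  have hd : DifferentiableAt ℂ τ z := hτ.self_of_nhds.differentiableAt smoothOrder_ne_zero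
  have hhol : ∀ j, HolNear (fun y => fderiv ℂ τ y w j) z := fun j => by
    filter_upwards [hτ] with y hy
    have h1 : ContDiffAt ℂ smoothOrder (fun y => fderiv ℂ τ y w) y :=
      (hy.fderiv_right (m := smoothOrder) (by simp [smoothOrder])).clm_apply contDiffAt_const
    exact contDiffAt_pi.1 h1 j
  have e1 : (fun y => A (fderiv ℂ τ y w) (τ y)) =
      fun y => ∑ j, fderiv ℂ τ y w j * A (Pi.single j 1) (τ y) := funext fun y => hA _ _
  have e2 : A (fderiv ℂ τ z w) = fun y => ∑ j, fderiv ℂ τ z w j * A (Pi.single j 1) y :=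
    funext fun y => hA _ _
  rw [e1, e2, dlb_sum fun j _ => (HolNear.smoothNear (hhol j)).mul ((hs _).comp hτ),
    dlb_sum fun j _ => (SmoothNear.const _ _).mul (hs _)]
  refine Finset.sum_congr rfl fun j _ => ?_
  rw [dlb_mul (HolNear.smoothNear (hhol j)) ((hs _).comp hτ), dlb_mul (SmoothNear.const _ _) (hs _),
    HolNear.dlb_eq (hhol j), dlb_const, zero_mul, dlb_comp hd (hs _).differentiableAt]

/-- The curvature of a line bundle is natural under holomorphic maps. -/
theorem lineCurvature_comp {u : Cn n → ℂ} {τ : Cn n → Cn n} {z : Cn n} (hu : SmoothNear u (τ z))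
    (h0 : u (τ z) ≠ 0) (hτ : ∀ᶠ y in 𝓝 z, ContDiffAt ℂ smoothOrder τ y) :
    lineCurvature (fun y => u (τ y)) z =
      (lineCurvature u (τ z)).compLinearMap ((fderiv ℂ τ z).restrictScalars ℝ).toLinearMap := by
  have hcont : ContinuousAt τ z := hτ.self_of_nhds.continuousAt
  have key : ∀ v w, logLevi (fun y => u (τ y)) v w z =
      logLevi u (fderiv ℂ τ z v) (fderiv ℂ τ z w) (τ z) := by
    intro v w
    rw [logLevi, logLevi, ← dlb_comp_linear (A := fun w y => (u y)⁻¹ * dl u w y) ?_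
      (fun w => (hu.inv h0).mul (hu.dl w)) hτ]
    · refine dlb_congr ?_ v
      filter_upwards [hτ, hcont.eventually hu.eventually] with y hy hy'
      rw [dl_comp (hy.differentiableAt smoothOrder_ne_zero) hy'.differentiableAt]
    · intro w y
      rw [dl_eq_sum, Finset.mul_sum]
      exact Finset.sum_congr rfl fun j _ => by ring
  refine twoForm_ext fun v w => ?_
  rw [lineCurvature_apply (hu.comp hτ) h0, key, key, ← lineCurvature_apply hu h0,
    AlternatingMap.compLinearMap_apply]
  congr 1
  funext i
  fin_cases i <;> rfl

end LineCurvature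

end HermiteEinstein

namespace HermiteEinstein

/-! ### Top-degree forms and determinants -/

section Determinant

variable {n : ℕ}

/-- A real top-degree form is a multiple of the determinant in a basis; the real and imaginary parts
are treated separately. -/
theorem topForm_compLinearMap_apply (η : Cn n [⋀^Fin (2 * n)]→ₗ[ℝ] ℂ) (L : Cn n →ₗ[ℝ] Cn n)
    (v : Fin (2 * n) → Cn n) : η (fun i => L (v i)) = ((LinearMap.det L : ℝ) : ℂ) * η v := by
  have hfin : Module.finrank ℝ (Cn n) = 2 * n := by
    rw [← Module.finrank_mul_finrank ℝ ℂ (Cn n), Complex.finrank_real_complex]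
    simp
  let e : Module.Basis (Fin (2 * n)) ℝ (Cn n) := Module.finBasisOfFinrankEq ℝ (Cn n) hfin
  have key : ∀ r : ℂ →ₗ[ℝ] ℝ, r (η fun i => L (v i)) = LinearMap.det L * r (η v) := by
    intro r
    have h1 := (r.compAlternatingMap η).eq_smul_basis_det e
    have h2 : ∀ w, r (η w) = r (η e) * e.det w := fun w => congrArg (fun f => f w) h1
    rw [h2, h2 v]
    have := e.det_comp L v
    rw [show (fun i => L (v i)) = L ∘ v from rfl, this]
    ring
  apply Complex.ext
  · rw [Complex.re_ofReal_mul]; exact key Complex.reLm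
  · rw [Complex.im_ofReal_mul]; exact key Complex.imLm

theorem topCoeff_compLinearMap (η : Cn n [⋀^Fin (2 * n)]→ₗ[ℝ] ℂ) (L : Cn n →ₗ[ℝ] Cn n) :
    topCoeff (η.compLinearMap L) = ((LinearMap.det L : ℝ) : ℂ) * topCoeff η :=
  topForm_compLinearMap_apply η L _

/-- The real determinant of a complex-linear map is |det_ℂ|². This is the complex orientation. -/
theorem det_restrictScalars_pos {L M : Cn n →L[ℂ] Cn n} (h : L.comp M = ContinuousLinearMap.id ℂ _) :
    0 < LinearMap.det (L.restrictScalars ℝ).toLinearMap := by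
  have h0 : LinearMap.det L.toLinearMap ≠ 0 := by
    intro h0
    have h1 : LinearMap.det (L.toLinearMap ∘ₗ M.toLinearMap) = 1 := by
      have : L.toLinearMap ∘ₗ M.toLinearMap = LinearMap.id :=
        congrArg ContinuousLinearMap.toLinearMap h
      rw [this, LinearMap.det_id]
    rw [LinearMap.det_comp, h0, zero_mul] at h1
    exact zero_ne_one h1
  have h2 : LinearMap.det (L.restrictScalars ℝ).toLinearMap =
      Algebra.norm ℝ (LinearMap.det L.toLinearMap) := LinearMap.det_restrictScalars (f := L.toLinearMap)
  rw [h2, Algebra.norm_complex_apply]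
  exact Complex.normSq_pos.2 h0

theorem wedgePow_compLinearMap {V W : Type*} [AddCommGroup V] [Module ℝ V] [AddCommGroup W]
    [Module ℝ W] (α : W [⋀^Fin 2]→ₗ[ℝ] ℂ) (L : V →ₗ[ℝ] W) :
    ∀ k, wedgePow (α.compLinearMap L) k = (wedgePow α k).compLinearMap L
  | 0 => rfl
  | k + 1 => by
    rw [wedgePow, wedgePow_compLinearMap α L k, wedge_compLinearMap]
    rfl

theorem topProduct_compLinearMap {m : ℕ} (hm : 1 ≤ m) (hmn : m ≤ n) (ω : Cn n [⋀^Fin 2]→ₗ[ℝ] ℂ)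
    (Ω : Cn n [⋀^Fin (2 * (n - m))]→ₗ[ℝ] ℂ) (α : Cn n [⋀^Fin 2]→ₗ[ℝ] ℂ) (L : Cn n →ₗ[ℝ] Cn n) :
    (topProduct hm hmn ω Ω α).compLinearMap L =
      topProduct hm hmn (ω.compLinearMap L) (Ω.compLinearMap L) (α.compLinearMap L) := by
  rw [topProduct, topProduct, wedgePow_compLinearMap, wedge_compLinearMap, wedge_compLinearMap]
  rfl

theorem topProduct_eq_castDeg {m : ℕ} (hm : 1 ≤ m) (hmn : m ≤ n) (ω : Cn n [⋀^Fin 2]→ₗ[ℝ] ℂ)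
    (Ω : Cn n [⋀^Fin (2 * (n - m))]→ₗ[ℝ] ℂ) (α : Cn n [⋀^Fin 2]→ₗ[ℝ] ℂ) :
    topProduct hm hmn ω Ω α =
      castDeg (show 2 + (2 * (m - 1) + 2 * (n - m)) = 2 * n by omega)
        (wedge α (wedge (wedgePow ω (m - 1)) Ω)) := by
  change castDeg _ (wedge (wedge α (wedgePow ω (m - 1))) Ω) = _
  rw [wedge_assoc]
  rfl

end Determinant

/-! ### Derivatives of charts and transformation of coefficients -/

section ChartDerivative

variable {n : ℕ} {X : Type*} [TopologicalSpace X] [ChartedSpace (Cn n) X]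
  [IsManifold 𝓘(ℂ, Cn n) smoothOrder X]

/-- The tangent space at x is read in the preferred chart at x, so the derivative of an inverse
chart is that of a transition map whose target chart depends on the point. In particular it is
complex-linear. -/
theorem chartSymmDeriv_eq (p : X) {z : Cn n} (hz : z ∈ (chartAt (Cn n) p).target) :
    chartSymmDeriv p z = (fderiv ℂ (chartTransition n p ((chartAt (Cn n) p).symm z)) z).restrictScalars
      ℝ := by
  have := isManifold_real (n := n) (X := X)
  have : IsManifold 𝓘(ℝ, Cn n) 1 X := IsManifold.of_le (n := smoothOrder) (by simp [smoothOrder])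
  have h1 : MDifferentiableAt 𝓘(ℝ, Cn n) 𝓘(ℝ, Cn n) (chartAt (Cn n) p).symm z :=
    mdifferentiableAt_atlas_symm (chart_mem_atlas _ _) hz
  have hs := (chartAt (Cn n) p).map_target hz
  have hτ := contDiffAt_chartTransition (n := n) hs (mem_chart_source (Cn n) _)
  rw [(chartAt (Cn n) p).right_inv hz] at hτ
  rw [chartSymmDeriv, h1.mfderiv]
  simp only [mfld_simps, fderivWithin_univ]
  have h2 := (hτ.self_of_nhds.differentiableAt smoothOrder_ne_zero).fderiv_restrictScalars ℝ
  exact h2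

/-- The chain rule for the inverses of the charts. -/
theorem chartSymmDeriv_transition {p p' x : X} (hp : x ∈ (chartAt (Cn n) p).source)
    (hp' : x ∈ (chartAt (Cn n) p').source) :
    chartSymmDeriv p (chartAt (Cn n) p x) = (chartSymmDeriv p' (chartAt (Cn n) p' x)).comp
      ((fderiv ℂ (chartTransition n p p') (chartAt (Cn n) p x)).restrictScalars ℝ) := by
  have ht := (chartAt (Cn n) p).map_source hp
  have ht' := (chartAt (Cn n) p').map_source hp'
  have hx := mem_chart_source (Cn n) x
  rw [chartSymmDeriv_eq p ht, chartSymmDeriv_eq p' ht', (chartAt (Cn n) p).left_inv hp,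
    (chartAt (Cn n) p').left_inv hp']
  have e0 : chartTransition n p p' (chartAt (Cn n) p x) = chartAt (Cn n) p' x := by
    rw [chartTransition, (chartAt (Cn n) p).left_inv hp]
  have e : chartTransition n p x =ᶠ[𝓝 (chartAt (Cn n) p x)]
      fun y => chartTransition n p' x (chartTransition n p p' y) :=
    (eventually_chart_symm_chartTransition hp hp').mono fun y hy => by
      simp only [chartTransition] at hy ⊢
      rw [hy]
  have h1 := (contDiffAt_chartTransition (n := n) hp hp').self_of_nhds.differentiableAt
    smoothOrder_ne_zero
  have h2 := (contDiffAt_chartTransition (n := n) hp' hx).self_of_nhds.differentiableAt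
    smoothOrder_ne_zero
  rw [← e0] at h2
  rw [e.fderiv_eq, ← e0]
  have h3 := (h2.hasFDerivAt.comp _ h1.hasFDerivAt).fderiv
  exact congrArg (ContinuousLinearMap.restrictScalars ℝ) h3

theorem fderiv_chartTransition_comp {p p' x : X} (hp : x ∈ (chartAt (Cn n) p).source)
    (hp' : x ∈ (chartAt (Cn n) p').source) :
    (fderiv ℂ (chartTransition n p p') (chartAt (Cn n) p x)).comp
      (fderiv ℂ (chartTransition n p' p) (chartAt (Cn n) p' x)) = ContinuousLinearMap.id ℂ _ := by
  have e0 : chartTransition n p' p (chartAt (Cn n) p' x) = chartAt (Cn n) p x := by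
    rw [chartTransition, (chartAt (Cn n) p').left_inv hp']
  have e : (fun y => chartTransition n p p' (chartTransition n p' p y))
      =ᶠ[𝓝 (chartAt (Cn n) p' x)] id := by
    filter_upwards [eventually_chart_symm_chartTransition hp' hp,
      (chartAt (Cn n) p').open_target.mem_nhds ((chartAt (Cn n) p').map_source hp')] with y hy hy'
    rw [chartTransition, hy, (chartAt (Cn n) p').right_inv hy', id]
  have h1 := (contDiffAt_chartTransition (n := n) hp hp').self_of_nhds.differentiableAt
    smoothOrder_ne_zero
  have h2 := (contDiffAt_chartTransition (n := n) hp' hp).self_of_nhds.differentiableAt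
    smoothOrder_ne_zero
  rw [← e0] at h1 ⊢
  have h3 := (h1.hasFDerivAt.comp _ h2.hasFDerivAt).fderiv
  rw [← h3]
  exact e.fderiv_eq.trans fderiv_id

theorem chartSymmDeriv_I_smul (p : X) {z : Cn n} (hz : z ∈ (chartAt (Cn n) p).target) (v : Cn n) :
    chartSymmDeriv p z (Complex.I • v) = Complex.I • chartSymmDeriv p z v := by
  rw [chartSymmDeriv_eq p hz]
  exact map_smul (fderiv ℂ (chartTransition n p ((chartAt (Cn n) p).symm z)) z) _ _

/-- The coefficient of a form of top degree in a chart. -/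
def chartCoeff (p : X) (η : X → Cn n [⋀^Fin (2 * n)]→ₗ[ℝ] ℂ) (z : Cn n) : ℂ :=
  topCoeff ((η ((chartAt (Cn n) p).symm z)).compLinearMap
    (chartSymmDeriv p z : Cn n →ₗ[ℝ] Cn n))

/-- Top-degree forms transform with the Jacobian and densities with its absolute value; holomorphic
transitions have positive Jacobian, so the two agree. -/
theorem chartCoeff_transition (η : X → Cn n [⋀^Fin (2 * n)]→ₗ[ℝ] ℂ) {p p' x : X}
    (hp : x ∈ (chartAt (Cn n) p).source) (hp' : x ∈ (chartAt (Cn n) p').source) :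
    chartCoeff p η (chartAt (Cn n) p x) =
      |((fderiv ℂ (chartTransition n p p') (chartAt (Cn n) p x)).restrictScalars ℝ).det| •
        chartCoeff p' η (chartAt (Cn n) p' x) := by
  have hpos : 0 < ((fderiv ℂ (chartTransition n p p') (chartAt (Cn n) p x)).restrictScalars ℝ).det :=
    det_restrictScalars_pos (fderiv_chartTransition_comp hp hp')
  rw [abs_of_pos hpos, chartCoeff, chartCoeff, (chartAt (Cn n) p).left_inv hp,
    (chartAt (Cn n) p').left_inv hp', chartSymmDeriv_transition hp hp', Complex.real_smul]
  exact topCoeff_compLinearMap ((η x).compLinearMap (chartSymmDeriv p' (chartAt (Cn n) p' x)).toLinearMap)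
    ((fderiv ℂ (chartTransition n p p') (chartAt (Cn n) p x)).restrictScalars ℝ).toLinearMap

theorem chartCoeff_eq_mul_topCoeff {p x : X}
    (hp : x ∈ (chartAt (Cn n) p).source) :
    ∃ d : ℝ, 0 < d ∧ ∀ η : X → Cn n [⋀^Fin (2 * n)]→ₗ[ℝ] ℂ,
      chartCoeff p η (chartAt (Cn n) p x) = d * topCoeff (η x) := by
  have hx := mem_chart_source (Cn n) x
  refine ⟨LinearMap.det (chartSymmDeriv p (chartAt (Cn n) p x)).toLinearMap, ?_, fun η => ?_⟩
  · rw [chartSymmDeriv_eq p ((chartAt (Cn n) p).map_source hp), (chartAt (Cn n) p).left_inv hp]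
    exact det_restrictScalars_pos (fderiv_chartTransition_comp hp hx)
  · rw [chartCoeff, (chartAt (Cn n) p).left_inv hp, topCoeff_compLinearMap]

end ChartDerivative

/-! ### Change of variables between charts -/

section Integral

open MeasureTheory Set

variable {n : ℕ} {X : Type*} [TopologicalSpace X] [ChartedSpace (Cn n) X]
  [IsManifold 𝓘(ℂ, Cn n) smoothOrder X]

theorem setIntegral_chart_inter {F : X → Cn n → ℂ} {p p' : X}
    (hF : ∀ x, x ∈ (chartAt (Cn n) p).source → x ∈ (chartAt (Cn n) p').source →
      F p (chartAt (Cn n) p x) =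
        |((fderiv ℂ (chartTransition n p p') (chartAt (Cn n) p x)).restrictScalars ℝ).det| •
          F p' (chartAt (Cn n) p' x)) :
    ∫ z in chartAt (Cn n) p '' ((chartAt (Cn n) p).source ∩ (chartAt (Cn n) p').source), F p z =
      ∫ z in chartAt (Cn n) p' '' ((chartAt (Cn n) p).source ∩ (chartAt (Cn n) p').source),
        F p' z := by
  set φ := chartAt (Cn n) p with hφ
  set φ' := chartAt (Cn n) p' with hφ'
  set A := φ '' (φ.source ∩ φ'.source) with hA
  have hAo : IsOpen A := φ.isOpen_image_of_subset_source
    (φ.open_source.inter φ'.open_source) inter_subset_left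
  have himg : φ' '' (φ.source ∩ φ'.source) = chartTransition n p p' '' A := by
    rw [hA, image_image]
    refine image_congr fun x hx => ?_
    rw [chartTransition, ← hφ, φ.left_inv hx.1]
  have hinj : InjOn (chartTransition n p p') A := by
    rintro _ ⟨x, hx, rfl⟩ _ ⟨y, hy, rfl⟩ hxy
    simp only [chartTransition, ← hφ, ← hφ', φ.left_inv hx.1, φ.left_inv hy.1] at hxy
    rw [φ'.injOn hx.2 hy.2 hxy]
  have hder : ∀ z ∈ A, HasFDerivWithinAt (chartTransition n p p')
      ((fderiv ℂ (chartTransition n p p') z).restrictScalars ℝ) A z := by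
    rintro _ ⟨x, hx, rfl⟩
    exact ((contDiffAt_chartTransition (n := n) hx.1 hx.2).self_of_nhds.differentiableAt
      smoothOrder_ne_zero).hasFDerivAt.restrictScalars ℝ |>.hasFDerivWithinAt
  rw [himg, integral_image_eq_integral_abs_det_fderiv_smul volume hAo.measurableSet hder hinj]
  refine setIntegral_congr_fun hAo.measurableSet ?_
  rintro _ ⟨x, hx, rfl⟩
  have := hF x hx.1 hx.2
  simp only [chartTransition, ← hφ, ← hφ', φ.left_inv hx.1] at this ⊢
  exact this

theorem integrableOn_of_compact_support {E : Type*} [NormedAddCommGroup E] {f : Cn n → E}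
    {U K : Set (Cn n)} (hU : IsOpen U) (hf : ContinuousOn f U) (hK : IsCompact K) (hKU : K ⊆ U)
    (h0 : ∀ z ∈ U, z ∉ K → f z = 0) : IntegrableOn f U :=
  ((hf.mono hKU).integrableOn_compact hK).of_forall_sdiff_eq_zero hU.measurableSet
    fun z hz => h0 z hz.1 hz.2

end Integral

end HermiteEinstein

namespace HermiteEinstein

/-! ### The integral of top-degree forms -/

section IntegralTop

open MeasureTheory Set

variable {n : ℕ} {X : Type*} [TopologicalSpace X] [ChartedSpace (Cn n) X]

/-- The coefficients of a form of top degree in the charts are continuous. -/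
def HasContinuousCoeff (η : X → Cn n [⋀^Fin (2 * n)]→ₗ[ℝ] ℂ) : Prop :=
  ∀ p, ContinuousOn (chartCoeff p η) (chartAt (Cn n) p).target

theorem chartCoeff_add (p : X) (η η' : X → Cn n [⋀^Fin (2 * n)]→ₗ[ℝ] ℂ) (z : Cn n) :
    chartCoeff p (fun x => η x + η' x) z = chartCoeff p η z + chartCoeff p η' z := rfl

theorem HasContinuousCoeff.add {η η' : X → Cn n [⋀^Fin (2 * n)]→ₗ[ℝ] ℂ}
    (h : HasContinuousCoeff η) (h' : HasContinuousCoeff η') :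
    HasContinuousCoeff fun x => η x + η' x := fun p => (h p).add (h' p)

theorem HasContinuousCoeff.sum {ι : Type*} {s : Finset ι}
    {η : ι → X → Cn n [⋀^Fin (2 * n)]→ₗ[ℝ] ℂ} (h : ∀ i ∈ s, HasContinuousCoeff (η i)) :
    HasContinuousCoeff fun x => ∑ i ∈ s, η i x := by
  classical
  induction s using Finset.induction_on with
  | empty => intro p; exact continuousOn_const.congr fun z _ => rfl
  | insert a s ha ih =>
    simp only [Finset.sum_insert ha]
    exact (h a (Finset.mem_insert_self a s)).add
      (ih fun i hi => h i (Finset.mem_insert_of_mem hi))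

variable [CompactSpace X] [T2Space X]

theorem exists_finset_chartPartition : ∃ S : Finset X,
    ∀ p, p ∉ S → ∀ x, chartPartition (n := n) (X := X) p x = 0 := by
  have hf := (chartPartition (n := n) (X := X)).locallyFinite.finite_nonempty_of_compact
  refine ⟨hf.toFinset, fun p hp x => ?_⟩
  by_contra hx
  exact hp (hf.mem_toFinset.2 ⟨x, hx⟩)

theorem sum_chartPartition {S : Finset X}
    (hS : ∀ p, p ∉ S → ∀ x, chartPartition (n := n) (X := X) p x = 0) (x : X) :
    ∑ p ∈ S, chartPartition (n := n) (X := X) p x = 1 := by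
  rw [← (chartPartition (n := n) (X := X)).sum_eq_one (mem_univ x),
    finsum_eq_sum_of_support_subset]
  intro p hp
  by_contra hpS
  exact hp (hS p hpS x)

theorem integralTop_eq_sum {S : Finset X}
    (hS : ∀ p, p ∉ S → ∀ x, chartPartition (n := n) (X := X) p x = 0)
    (η : X → Cn n [⋀^Fin (2 * n)]→ₗ[ℝ] ℂ) :
    integralTop η = ∑ p ∈ S, ∫ z in (chartAt (Cn n) p).target,
      ((chartPartition (n := n) (X := X) p ((chartAt (Cn n) p).symm z) : ℝ) : ℂ) *
        chartCoeff p η z := by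
  refine finsum_eq_sum_of_support_subset _ fun p hp => ?_
  by_contra hpS
  refine hp ?_
  simp only [hS p hpS, Complex.ofReal_zero, zero_mul, integral_zero]

theorem continuousOn_chartPartition_comp (p q : X) : ContinuousOn
    (fun z => ((chartPartition (n := n) (X := X) q ((chartAt (Cn n) p).symm z) : ℝ) : ℂ))
    (chartAt (Cn n) p).target :=
  Complex.continuous_ofReal.comp_continuousOn
    ((chartPartition (n := n) (X := X) q).continuous.comp_continuousOn
      (chartAt (Cn n) p).continuousOn_symm)

theorem isCompact_image_chart {K : Set X} (hK : IsCompact K) {p : X}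
    (h : K ⊆ (chartAt (Cn n) p).source) : IsCompact (chartAt (Cn n) p '' K) :=
  hK.image_of_continuousOn ((chartAt (Cn n) p).continuousOn.mono h)

theorem HasContinuousCoeff.integrableOn {η : X → Cn n [⋀^Fin (2 * n)]→ₗ[ℝ] ℂ}
    (h : HasContinuousCoeff η) (p : X) : IntegrableOn (fun z =>
      ((chartPartition (n := n) (X := X) p ((chartAt (Cn n) p).symm z) : ℝ) : ℂ) *
        chartCoeff p η z) (chartAt (Cn n) p).target := by
  have hsub := chartPartition_isSubordinate (n := n) (X := X) p
  refine integrableOn_of_compact_support (chartAt (Cn n) p).open_target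
    ((continuousOn_chartPartition_comp p p).mul (h p))
    (isCompact_image_chart (isClosed_tsupport _).isCompact hsub)
    ((image_mono hsub).trans (chartAt (Cn n) p).image_source_eq_target.subset) fun z hz hzK => ?_
  have h0 : chartPartition (n := n) (X := X) p ((chartAt (Cn n) p).symm z) = 0 :=
    image_eq_zero_of_notMem_tsupport fun hmem =>
      hzK ⟨_, hmem, (chartAt (Cn n) p).right_inv hz⟩
  rw [h0, Complex.ofReal_zero, zero_mul]

theorem integralTop_add {η η' : X → Cn n [⋀^Fin (2 * n)]→ₗ[ℝ] ℂ}
    (h : HasContinuousCoeff η) (h' : HasContinuousCoeff η') :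
    integralTop (fun x => η x + η' x) = integralTop η + integralTop η' := by
  obtain ⟨S, hS⟩ := exists_finset_chartPartition (n := n) (X := X)
  rw [integralTop_eq_sum hS, integralTop_eq_sum hS, integralTop_eq_sum hS,
    ← Finset.sum_add_distrib]
  refine Finset.sum_congr rfl fun p _ => ?_
  rw [← integral_add (h.integrableOn p) (h'.integrableOn p)]
  simp only [chartCoeff_add, mul_add]

theorem integralTop_zero : integralTop (fun _ : X => (0 : Cn n [⋀^Fin (2 * n)]→ₗ[ℝ] ℂ)) = 0 := by
  have h : HasContinuousCoeff (fun _ : X => (0 : Cn n [⋀^Fin (2 * n)]→ₗ[ℝ] ℂ)) :=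
    fun p => continuousOn_const.congr fun z _ => rfl
  have := integralTop_add h h
  simpa using this

theorem integralTop_sum {ι : Type*} {s : Finset ι} {η : ι → X → Cn n [⋀^Fin (2 * n)]→ₗ[ℝ] ℂ}
    (h : ∀ i ∈ s, HasContinuousCoeff (η i)) :
    integralTop (fun x => ∑ i ∈ s, η i x) = ∑ i ∈ s, integralTop (η i) := by
  classical
  induction s using Finset.induction_on with
  | empty => simpa using integralTop_zero
  | insert a s ha ih =>
    have hs := fun i hi => h i (Finset.mem_insert_of_mem hi)
    simp only [Finset.sum_insert ha]
    rw [integralTop_add (h a (Finset.mem_insert_self a s)) (HasContinuousCoeff.sum hs), ih hs]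

/-- Every piece of the partition has a nonnegative continuous integrand. If the total is zero, each
integrand vanishes almost everywhere, hence everywhere, and at each point some member of the
partition is nonzero. -/
theorem integralTop_re_nonneg {η : X → Cn n [⋀^Fin (2 * n)]→ₗ[ℝ] ℂ}
    [IsManifold 𝓘(ℂ, Cn n) smoothOrder X]
    (h : HasContinuousCoeff η) (h0 : ∀ x, 0 ≤ (topCoeff (η x)).re) :
    0 ≤ (integralTop η).re ∧ ((integralTop η).re = 0 → ∀ x, (topCoeff (η x)).re = 0) := by
  obtain ⟨S, hS⟩ := exists_finset_chartPartition (n := n) (X := X)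
  have hcoeff : ∀ p, ∀ z ∈ (chartAt (Cn n) p).target, 0 ≤ (chartCoeff p η z).re := by
    intro p z hz
    obtain ⟨d, hd, hd'⟩ := chartCoeff_eq_mul_topCoeff ((chartAt (Cn n) p).map_target hz)
    rw [(chartAt (Cn n) p).right_inv hz] at hd'
    rw [hd', Complex.re_ofReal_mul]
    exact mul_nonneg hd.le (h0 _)
  have hre : ∀ p, (∫ z in (chartAt (Cn n) p).target,
      ((chartPartition (n := n) (X := X) p ((chartAt (Cn n) p).symm z) : ℝ) : ℂ) *
        chartCoeff p η z).re = ∫ z in (chartAt (Cn n) p).target,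
          (chartPartition (n := n) (X := X) p ((chartAt (Cn n) p).symm z) : ℝ) *
            (chartCoeff p η z).re := by
    intro p
    have := integral_re (h.integrableOn p)
    simp only [RCLike.re_to_complex, Complex.re_ofReal_mul] at this
    exact this.symm
  have hnn : ∀ p, ∀ z ∈ (chartAt (Cn n) p).target,
      0 ≤ (chartPartition (n := n) (X := X) p ((chartAt (Cn n) p).symm z) : ℝ) *
            (chartCoeff p η z).re := fun p z hz =>
    mul_nonneg ((chartPartition (n := n) (X := X)).nonneg p _) (hcoeff p z hz)
  have hint : ∀ p, IntegrableOn (fun z =>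
      (chartPartition (n := n) (X := X) p ((chartAt (Cn n) p).symm z) : ℝ) *
            (chartCoeff p η z).re) (chartAt (Cn n) p).target := by
    intro p
    have := (h.integrableOn p).re
    simp only [RCLike.re_to_complex, Complex.re_ofReal_mul] at this
    exact this
  have hpart : ∀ p, 0 ≤ ∫ z in (chartAt (Cn n) p).target,
      (chartPartition (n := n) (X := X) p ((chartAt (Cn n) p).symm z) : ℝ) *
            (chartCoeff p η z).re := fun p =>
    setIntegral_nonneg (chartAt (Cn n) p).open_target.measurableSet (hnn p)
  rw [integralTop_eq_sum hS, Complex.re_sum]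
  simp only [hre]
  refine ⟨Finset.sum_nonneg fun p _ => hpart p, fun hzero x => ?_⟩
  have hz := (Finset.sum_eq_zero_iff_of_nonneg fun p _ => hpart p).1 hzero
  obtain ⟨p, hpS, hpx⟩ : ∃ p ∈ S, chartPartition (n := n) (X := X) p x ≠ 0 := by
    by_contra! hcon
    have := sum_chartPartition hS x
    rw [Finset.sum_eq_zero hcon] at this
    exact zero_ne_one this
  have hxs : x ∈ (chartAt (Cn n) p).source :=
    chartPartition_isSubordinate (n := n) (X := X) p (subset_tsupport _ hpx)
  have hopen := (chartAt (Cn n) p).open_target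
  have hcont : ContinuousOn (fun z =>
      (chartPartition (n := n) (X := X) p ((chartAt (Cn n) p).symm z) : ℝ) *
            (chartCoeff p η z).re) (chartAt (Cn n) p).target :=
    ((chartPartition (n := n) (X := X) p).continuous.comp_continuousOn
      (chartAt (Cn n) p).continuousOn_symm).mul (Complex.continuous_re.comp_continuousOn (h p))
  have hae := (setIntegral_eq_zero_iff_of_nonneg_ae
    ((ae_restrict_iff' hopen.measurableSet).2 (Filter.Eventually.of_forall (hnn p))) (hint p)).1
    (hz p hpS)
  have heq := Measure.eqOn_open_of_ae_eq hae hopen hcont continuousOn_const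
    ((chartAt (Cn n) p).map_source hxs)
  simp only [(chartAt (Cn n) p).left_inv hxs] at heq
  obtain ⟨d, hd, hd'⟩ := chartCoeff_eq_mul_topCoeff hxs
  rw [hd', Complex.re_ofReal_mul] at heq
  exact ((mul_eq_zero.1 ((mul_eq_zero.1 heq).resolve_left hpx)).resolve_left hd.ne')

/-- The integral of a form supported in a chart is computed in this chart. -/
theorem integralTop_eq_setIntegral [IsManifold 𝓘(ℂ, Cn n) smoothOrder X]
    {η : X → Cn n [⋀^Fin (2 * n)]→ₗ[ℝ] ℂ} (h : HasContinuousCoeff η) {p₀ : X} {K : Set X}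
    (hK : IsCompact K) (hKs : K ⊆ (chartAt (Cn n) p₀).source) (h0 : ∀ x, x ∉ K → η x = 0) :
    integralTop η = ∫ z in (chartAt (Cn n) p₀).target, chartCoeff p₀ η z := by
  obtain ⟨S, hS⟩ := exists_finset_chartPartition (n := n) (X := X)
  have hη : ∀ (p : X) (z : Cn n), (chartAt (Cn n) p).symm z ∉ K → chartCoeff p η z = 0 := by
    intro p z hz
    rw [chartCoeff, h0 _ hz]; rfl
  have hint : ∀ q, IntegrableOn (fun z =>
      ((chartPartition (n := n) (X := X) q ((chartAt (Cn n) p₀).symm z) : ℝ) : ℂ) *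
        chartCoeff p₀ η z) (chartAt (Cn n) p₀).target := fun q =>
    integrableOn_of_compact_support (chartAt (Cn n) p₀).open_target
      ((continuousOn_chartPartition_comp p₀ q).mul (h p₀)) (isCompact_image_chart hK hKs)
      ((image_mono hKs).trans (chartAt (Cn n) p₀).image_source_eq_target.subset)
      fun z hz hzK => by
        rw [hη p₀ z fun hmem => hzK ⟨_, hmem, (chartAt (Cn n) p₀).right_inv hz⟩, mul_zero]
  -- Each piece is moved to the chart at p₀. Both integrals reduce to the overlap: in the chart at p
  -- because η vanishes off K, in the chart at p₀ because the partition function vanishes off the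
  -- source of the chart at p.
  have key : ∀ p, ∫ z in (chartAt (Cn n) p).target,
      ((chartPartition (n := n) (X := X) p ((chartAt (Cn n) p).symm z) : ℝ) : ℂ) *
        chartCoeff p η z = ∫ z in (chartAt (Cn n) p₀).target,
      ((chartPartition (n := n) (X := X) p ((chartAt (Cn n) p₀).symm z) : ℝ) : ℂ) *
        chartCoeff p₀ η z := by
    intro p
    have h1 := setIntegral_chart_inter (n := n) (p := p) (p' := p₀) (F := fun p' z =>
      ((chartPartition (n := n) (X := X) p ((chartAt (Cn n) p').symm z) : ℝ) : ℂ) *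
        chartCoeff p' η z) ?_
    · rw [setIntegral_eq_of_subset_of_forall_sdiff_eq_zero
          (chartAt (Cn n) p).open_target.measurableSet
          ((image_mono inter_subset_left).trans (chartAt (Cn n) p).image_source_eq_target.subset),
        setIntegral_eq_of_subset_of_forall_sdiff_eq_zero
          (chartAt (Cn n) p₀).open_target.measurableSet
          ((image_mono inter_subset_right).trans
            (chartAt (Cn n) p₀).image_source_eq_target.subset)]
      · exact h1
      · rintro z ⟨hz, hz'⟩
        have : chartPartition (n := n) (X := X) p ((chartAt (Cn n) p₀).symm z) = 0 := by
          by_contra hne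
          exact hz' ⟨_, ⟨chartPartition_isSubordinate (n := n) (X := X) p (subset_tsupport _ hne),
            (chartAt (Cn n) p₀).map_target hz⟩, (chartAt (Cn n) p₀).right_inv hz⟩
        simp only [this, Complex.ofReal_zero, zero_mul]
      · rintro z ⟨hz, hz'⟩
        have : (chartAt (Cn n) p).symm z ∉ K := fun hmem =>
          hz' ⟨_, ⟨(chartAt (Cn n) p).map_target hz, hKs hmem⟩, (chartAt (Cn n) p).right_inv hz⟩
        simp only [hη p z this, mul_zero]
    · intro x hx hx'
      simp only [(chartAt (Cn n) p).left_inv hx, (chartAt (Cn n) p₀).left_inv hx']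
      rw [chartCoeff_transition η hx hx', mul_smul_comm]
  rw [integralTop_eq_sum hS, Finset.sum_congr rfl fun p _ => key p,
    ← integral_finsetSum _ fun p _ => hint p]
  refine setIntegral_congr_fun (chartAt (Cn n) p₀).open_target.measurableSet fun z _ => ?_
  rw [← Finset.sum_mul, ← Complex.ofReal_sum, sum_chartPartition hS, Complex.ofReal_one, one_mul]

end IntegralTop

end HermiteEinstein

namespace HermiteEinstein

/-! ### Local properties of ∂̄∂ψ -/

section LocalLineCurvature

variable {n : ℕ}

theorem lineCurvature_one (z : Cn n) : lineCurvature (fun _ => 1) z = 0 := by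
  have := lineCurvature_normSq (HolNear.const (1 : ℂ) z) one_ne_zero
  simpa using this

theorem dbard_congr {ψ ψ' : Cn n → ℂ} {z : Cn n} (h : ψ =ᶠ[𝓝 z] ψ') (hψ : SmoothNear ψ z) :
    dbard ψ z = dbard ψ' z := by
  rw [← lineCurvature_exp hψ, ← lineCurvature_exp (hψ.congr h.symm)]
  refine lineCurvature_congr (h.mono fun y hy => by simp only [hy])
    (hψ.mono fun y hy => hy.cexp) (Complex.exp_ne_zero _)

theorem dbard_zero (z : Cn n) : dbard (fun _ => 0) z = 0 := by
  rw [← lineCurvature_exp (SmoothNear.const 0 z)]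
  simpa using lineCurvature_one z

theorem dbard_sum {ι : Type*} {s : Finset ι} {ψ : ι → Cn n → ℂ} {z : Cn n}
    (h : ∀ i ∈ s, SmoothNear (ψ i) z) :
    dbard (fun y => ∑ i ∈ s, ψ i y) z = ∑ i ∈ s, dbard (ψ i) z := by
  have e : ∀ w, dl (fun y => ∑ i ∈ s, ψ i y) w =ᶠ[𝓝 z] fun y => ∑ i ∈ s, dl (ψ i) w y := by
    intro w
    filter_upwards [(Finset.eventually_all s).2 fun i hi => (h i hi).eventually] with y hy
    exact dl_sum hy w
  refine twoForm_ext fun v w => ?_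
  rw [dbard_apply (SmoothNear.sum h), form_sum_apply, dlb_congr (e w), dlb_congr (e v),
    dlb_sum fun i hi => (h i hi).dl w, dlb_sum fun i hi => (h i hi).dl v,
    ← Finset.sum_sub_distrib]
  exact Finset.sum_congr rfl fun i hi => (dbard_apply (h i hi) v w).symm

theorem FormSmooth.lineCurvature {u : Cn n → ℂ} {z : Cn n} (hu : SmoothNear u z) (h0 : u z ≠ 0) :
    FormSmooth (HermiteEinstein.lineCurvature u) z := by
  intro v
  have hv : v = ![v 0, v 1] := by
    funext i; fin_cases i <;> rfl
  have hL : ∀ v w, SmoothNear (fun y => logLevi u v w y) z := fun v w =>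
    ((hu.inv h0).mul (hu.dl w)).dlb v
  refine ((hL (v 0) (v 1)).sub (hL (v 1) (v 0))).congr ?_
  filter_upwards [hu.eventually, hu.contDiffAt.continuousAt.eventually_ne h0] with y h1 h2
  rw [hv]
  exact lineCurvature_apply h1 h2 _ _

end LocalLineCurvature

/-! ### Metrics on line bundles in arbitrary charts and frames -/

section Charts

variable {n : ℕ} {X : Type*} [TopologicalSpace X] [ChartedSpace (Cn n) X]
  [IsManifold 𝓘(ℂ, Cn n) smoothOrder X]

/-- The curvature of a trivial line bundle with metric `U`, in a chart. -/
theorem lineCurvature_chart {U : X → ℂ} {p x : X} (hp : x ∈ (chartAt (Cn n) p).source)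
    (hs : SmoothNear (fun y => U ((chartAt (Cn n) x).symm y)) (chartAt (Cn n) x x))
    (h0 : U x ≠ 0) :
    (lineCurvature (fun y => U ((chartAt (Cn n) x).symm y)) (chartAt (Cn n) x x)).compLinearMap
      (chartSymmDeriv p (chartAt (Cn n) p x) : Cn n →ₗ[ℝ] Cn n) =
        lineCurvature (fun y => U ((chartAt (Cn n) p).symm y)) (chartAt (Cn n) p x) := by
  have hx := mem_chart_source (Cn n) x
  have e0 : chartTransition n p x (chartAt (Cn n) p x) = chartAt (Cn n) x x := by
    rw [chartTransition, (chartAt (Cn n) p).left_inv hp]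
  have hτ := contDiffAt_chartTransition (n := n) hp hx
  have e : (fun y => U ((chartAt (Cn n) x).symm (chartTransition n p x y)))
      =ᶠ[𝓝 (chartAt (Cn n) p x)] fun y => U ((chartAt (Cn n) p).symm y) :=
    (eventually_chart_symm_chartTransition hp hx).mono fun y hy => by simp only [hy]
  rw [← e0] at hs
  have h0' : U ((chartAt (Cn n) x).symm (chartTransition n p x (chartAt (Cn n) p x))) ≠ 0 := by
    rwa [e0, (chartAt (Cn n) x).left_inv hx]
  have hcomp := lineCurvature_comp (u := fun y => U ((chartAt (Cn n) x).symm y)) hs h0' hτ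
  rw [← lineCurvature_congr e (SmoothNear.comp (f := fun y => U ((chartAt (Cn n) x).symm y)) hs hτ)
    h0', hcomp, e0, chartSymmDeriv_eq p ((chartAt (Cn n) p).map_source hp),
    (chartAt (Cn n) p).left_inv hp]

variable {L : X → Type*} [∀ x, AddCommGroup (L x)] [∀ x, Module ℂ (L x)]
  [TopologicalSpace (TotalSpace (Fin 1 → ℂ) L)] [∀ x, TopologicalSpace (L x)]
  [FiberBundle (Fin 1 → ℂ) L] [VectorBundle ℂ (Fin 1 → ℂ) L]
  [ContMDiffVectorBundle smoothOrder (Fin 1 → ℂ) L 𝓘(ℂ, Cn n)]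

/-- The square norm of the frame of a line bundle. -/
def HermitianMetric.lineGram (k : HermitianMetric n 1 L)
    (e : Trivialization (Fin 1 → ℂ) (π (Fin 1 → ℂ) L)) (x : X) : ℂ :=
  k.inner x (frame e 0 x) (frame e 0 x)

theorem HermitianMetric.lineGram_pos (k : HermitianMetric n 1 L)
    (e : Trivialization (Fin 1 → ℂ) (π (Fin 1 → ℂ) L)) [MemTrivializationAtlas e] {x : X}
    (hx : x ∈ e.baseSet) : ∃ t : ℝ, 0 < t ∧ k.lineGram e x = t := by
  have h := (k.gram_posDef e x hx).det_pos
  rw [Matrix.det_fin_one, Complex.pos_iff] at h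
  exact ⟨_, h.1, Complex.ext rfl h.2.symm⟩

theorem HermitianMetric.lineGram_ne (k : HermitianMetric n 1 L)
    (e : Trivialization (Fin 1 → ℂ) (π (Fin 1 → ℂ) L)) [MemTrivializationAtlas e] {x : X}
    (hx : x ∈ e.baseSet) : k.lineGram e x ≠ 0 := by
  obtain ⟨t, ht, ht'⟩ := k.lineGram_pos e hx
  rw [ht']
  exact_mod_cast ht.ne'

theorem HermitianMetric.smoothNear_lineGram (k : HermitianMetric n 1 L)
    (e : Trivialization (Fin 1 → ℂ) (π (Fin 1 → ℂ) L)) [MemTrivializationAtlas e] {p x : X}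
    (hp : x ∈ (chartAt (Cn n) p).source) (hx : x ∈ e.baseSet) :
    SmoothNear (fun y => k.lineGram e ((chartAt (Cn n) p).symm y)) (chartAt (Cn n) p x) :=
  k.matSmooth_gram e hp hx 0 0

/-- The holomorphic transition function between two frames of a line bundle. -/
def lineChange (e e' : Trivialization (Fin 1 → ℂ) (π (Fin 1 → ℂ) L)) [MemTrivializationAtlas e]
    [MemTrivializationAtlas e'] (x : X) : ℂ :=
  localMatrix (fun x => (LinearMap.id : L x →ₗ[ℂ] L x)) e e' x 0 0

theorem HermitianMetric.lineGram_change (k : HermitianMetric n 1 L)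
    (e e' : Trivialization (Fin 1 → ℂ) (π (Fin 1 → ℂ) L)) [MemTrivializationAtlas e]
    [MemTrivializationAtlas e'] {x : X} (hx : x ∈ e.baseSet) (hx' : x ∈ e'.baseSet) :
    k.lineGram e x = conj (lineChange e e' x) * lineChange e e' x * k.lineGram e' x := by
  have h := gram_localMatrix (e := e) (e' := e') (e'' := e)
    (fun x => (LinearMap.id : L x →ₗ[ℂ] L x)) k (fun x => (LinearMap.id : L x →ₗ[ℂ] L x)) hx hx' hx
  have h' := congrFun (congrFun h 0) 0
  simp only [Matrix.mul_apply, Finset.univ_unique, Fin.default_eq_zero, Finset.sum_singleton,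
    Matrix.conjTranspose_apply] at h'
  refine Eq.trans ?_ (h'.trans ?_)
  · rfl
  · change conj (lineChange e e' x) * k.lineGram e' x * lineChange e e' x = _
    ring

theorem lineChange_ne (k : HermitianMetric n 1 L)
    (e e' : Trivialization (Fin 1 → ℂ) (π (Fin 1 → ℂ) L)) [MemTrivializationAtlas e]
    [MemTrivializationAtlas e'] {x : X} (hx : x ∈ e.baseSet) (hx' : x ∈ e'.baseSet) :
    lineChange e e' x ≠ 0 := fun h => by
  have := k.lineGram_change e e' hx hx'
  rw [h, mul_zero, zero_mul] at this
  exact k.lineGram_ne e hx this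

/-- Two holomorphic frames have square norms differing by |τ|² with τ holomorphic and nonvanishing,
and such a factor has zero curvature. -/
theorem HermitianMetric.lineCurvature_change (k : HermitianMetric n 1 L)
    (e e' : Trivialization (Fin 1 → ℂ) (π (Fin 1 → ℂ) L)) [MemTrivializationAtlas e]
    [MemTrivializationAtlas e'] {p x : X} (hp : x ∈ (chartAt (Cn n) p).source)
    (hx : x ∈ e.baseSet) (hx' : x ∈ e'.baseSet) :
    lineCurvature (fun y => k.lineGram e ((chartAt (Cn n) p).symm y)) (chartAt (Cn n) p x) =
      lineCurvature (fun y => k.lineGram e' ((chartAt (Cn n) p).symm y)) (chartAt (Cn n) p x) := by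
  have hxp := (chartAt (Cn n) p).left_inv hp
  have hhol : HolNear (fun y => lineChange e e' ((chartAt (Cn n) p).symm y))
      (chartAt (Cn n) p x) := (isHolomorphicHom_id n L).matHol hp hx hx' 0 0
  have hne : lineChange e e' ((chartAt (Cn n) p).symm (chartAt (Cn n) p x)) ≠ 0 := by
    rw [hxp]; exact lineChange_ne k e e' hx hx'
  have hne' : k.lineGram e' ((chartAt (Cn n) p).symm (chartAt (Cn n) p x)) ≠ 0 := by
    rw [hxp]; exact k.lineGram_ne e' hx'
  have hnee : k.lineGram e ((chartAt (Cn n) p).symm (chartAt (Cn n) p x)) ≠ 0 := by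
    rw [hxp]; exact k.lineGram_ne e hx
  have hev : (fun y => k.lineGram e ((chartAt (Cn n) p).symm y)) =ᶠ[𝓝 (chartAt (Cn n) p x)]
      fun y => (conj (lineChange e e' ((chartAt (Cn n) p).symm y)) *
        lineChange e e' ((chartAt (Cn n) p).symm y)) *
          k.lineGram e' ((chartAt (Cn n) p).symm y) := by
    filter_upwards [eventually_chart_symm_mem hp e.open_baseSet hx,
      eventually_chart_symm_mem hp e'.open_baseSet hx'] with y h1 h2
    exact k.lineGram_change e e' h1 h2
  have hs := HolNear.smoothNear hhol
  rw [lineCurvature_congr hev (k.smoothNear_lineGram e hp hx) hnee,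
    lineCurvature_mul (hs.conj.mul hs) (mul_ne_zero (by simpa using hne) hne)
      (k.smoothNear_lineGram e' hp hx') hne', lineCurvature_normSq hhol hne, zero_add]

theorem HermitianMetric.curvature_eq_lineCurvature (k : HermitianMetric n 1 L) (x : X) :
    k.curvature x 0 0 = lineCurvature (fun y => k.lineGram (trivializationAt (Fin 1 → ℂ) L x)
      ((chartAt (Cn n) x).symm y)) (chartAt (Cn n) x x) := by
  have e : (fun z => k.gram (trivializationAt (Fin 1 → ℂ) L x) ((chartAt (Cn n) x).symm z)) =
      fun y => Matrix.of fun _ _ => k.lineGram (trivializationAt (Fin 1 → ℂ) L x)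
        ((chartAt (Cn n) x).symm y) := by
    funext y
    ext i j
    rw [Subsingleton.elim i 0, Subsingleton.elim j 0]
    rfl
  rw [HermitianMetric.curvature, e]
  rfl

/-- The curvature of a line bundle in an arbitrary chart and frame. -/
theorem HermitianMetric.curvature_chart (k : HermitianMetric n 1 L)
    (e : Trivialization (Fin 1 → ℂ) (π (Fin 1 → ℂ) L)) [MemTrivializationAtlas e] {p x : X}
    (hp : x ∈ (chartAt (Cn n) p).source) (hx : x ∈ e.baseSet) :
    (k.curvature x 0 0).compLinearMap
      (chartSymmDeriv p (chartAt (Cn n) p x) : Cn n →ₗ[ℝ] Cn n) =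
        lineCurvature (fun y => k.lineGram e ((chartAt (Cn n) p).symm y)) (chartAt (Cn n) p x) := by
  have hx' := FiberBundle.mem_baseSet_trivializationAt (Fin 1 → ℂ) L x
  rw [k.lineCurvature_change e (trivializationAt (Fin 1 → ℂ) L x) hp hx hx',
    k.curvature_eq_lineCurvature]
  exact lineCurvature_chart hp (k.smoothNear_lineGram _ (mem_chart_source (Cn n) x) hx')
    (k.lineGram_ne _ hx')

/-- Two metrics on a line bundle differ by a positive function. -/
def HermitianMetric.logRatio (k k' : HermitianMetric n 1 L) (x : X) : ℂ :=
  (Real.log (k'.lineGram (trivializationAt (Fin 1 → ℂ) L x) x /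
    k.lineGram (trivializationAt (Fin 1 → ℂ) L x) x).re : ℝ)

/-- A change of frame multiplies both square norms by the same |τ|², which cancels in the quotient.
The ratio is thus a global function although each norm is local. -/
theorem HermitianMetric.logRatio_eq (k k' : HermitianMetric n 1 L)
    (e : Trivialization (Fin 1 → ℂ) (π (Fin 1 → ℂ) L)) [MemTrivializationAtlas e] {x : X}
    (hx : x ∈ e.baseSet) :
    k.logRatio k' x = (Real.log (k'.lineGram e x / k.lineGram e x).re : ℝ) := by
  have hx' := FiberBundle.mem_baseSet_trivializationAt (Fin 1 → ℂ) L x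
  have hne := lineChange_ne k e (trivializationAt (Fin 1 → ℂ) L x) hx hx'
  rw [logRatio, k.lineGram_change e _ hx hx', k'.lineGram_change e _ hx hx', mul_div_mul_left]
  exact mul_ne_zero (by simpa using hne) hne

theorem HermitianMetric.exp_logRatio (k k' : HermitianMetric n 1 L)
    (e : Trivialization (Fin 1 → ℂ) (π (Fin 1 → ℂ) L)) [MemTrivializationAtlas e] {x : X}
    (hx : x ∈ e.baseSet) :
    k.lineGram e x * Complex.exp (k.logRatio k' x) = k'.lineGram e x := by
  obtain ⟨t, ht, ht'⟩ := k.lineGram_pos e hx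
  obtain ⟨t', ht0, ht0'⟩ := k'.lineGram_pos e hx
  rw [k.logRatio_eq k' e hx, ht', ht0', ← Complex.ofReal_div, Complex.ofReal_re,
    ← Complex.ofReal_exp, Real.exp_log (div_pos ht0 ht), ← Complex.ofReal_mul,
    mul_div_cancel₀ _ ht.ne']

theorem HermitianMetric.smoothNear_logRatio (k k' : HermitianMetric n 1 L) {p x : X}
    (hp : x ∈ (chartAt (Cn n) p).source) :
    SmoothNear (fun y => k.logRatio k' ((chartAt (Cn n) p).symm y)) (chartAt (Cn n) p x) := by
  set e := trivializationAt (Fin 1 → ℂ) L x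
  have hx : x ∈ e.baseSet := FiberBundle.mem_baseSet_trivializationAt (Fin 1 → ℂ) L x
  have h1 := k.smoothNear_lineGram e hp hx
  have h2 := k'.smoothNear_lineGram e hp hx
  filter_upwards [h1.eventually, h2.eventually,
    (eventually_chart_symm_mem hp e.open_baseSet hx).eventually_nhds] with y hy hy' hyb
  have hyb' := hyb.self_of_nhds
  have hne := k.lineGram_ne e hyb'
  have hev : (fun y => k.logRatio k' ((chartAt (Cn n) p).symm y)) =ᶠ[𝓝 y] fun y =>
      (Real.log (k'.lineGram e ((chartAt (Cn n) p).symm y) *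
        (k.lineGram e ((chartAt (Cn n) p).symm y))⁻¹).re : ℂ) := hyb.mono fun w hw => by
    simp only [← div_eq_mul_inv]; exact k.logRatio_eq k' e hw
  have hd : ContDiffAt ℝ smoothOrder (fun y => k'.lineGram e ((chartAt (Cn n) p).symm y) *
        (k.lineGram e ((chartAt (Cn n) p).symm y))⁻¹) y := (hy'.mul (hy.inv hne)).contDiffAt
  obtain ⟨t, ht, ht'⟩ := k.lineGram_pos e hyb'
  obtain ⟨t', ht0, ht0'⟩ := k'.lineGram_pos e hyb'
  refine ContDiffAt.congr_of_eventuallyEq ?_ hev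
  refine Complex.ofRealCLM.contDiff.contDiffAt.comp y
    (ContDiffAt.log (Complex.reCLM.contDiff.contDiffAt.comp y hd) ?_)
  rw [ht', ht0', ← Complex.ofReal_inv, ← Complex.ofReal_mul]
  exact (mul_pos ht0 (inv_pos.2 ht)).ne'

end Charts

/-! ### Holomorphy of the determinant bundle -/

section Det

variable {n r : ℕ} {X : Type*} [TopologicalSpace X] [ChartedSpace (Cn n) X]
  [IsManifold 𝓘(ℂ, Cn n) smoothOrder X]
  {E : X → Type*} [∀ x, AddCommGroup (E x)] [∀ x, Module ℂ (E x)]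
  [TopologicalSpace (TotalSpace (Fin r → ℂ) E)] [∀ x, TopologicalSpace (E x)]
  [FiberBundle (Fin r → ℂ) E] [VectorBundle ℂ (Fin r → ℂ) E]
  [ContMDiffVectorBundle smoothOrder (Fin r → ℂ) E 𝓘(ℂ, Cn n)]

/-- The determinant bundle is holomorphic. -/
instance contMDiffVectorBundle_det :
    ContMDiffVectorBundle smoothOrder (Fin 1 → ℂ) (DetBundle r E) 𝓘(ℂ, Cn n) := by
  have : (detCore r E).IsContMDiff 𝓘(ℂ, Cn n) smoothOrder := by
    refine ⟨fun p q => ?_⟩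
    have hdet : ContDiff ℂ smoothOrder
        (fun A : (Fin r → ℂ) →L[ℂ] (Fin r → ℂ) => ContinuousLinearMap.det A) := by
      have e : (fun A : (Fin r → ℂ) →L[ℂ] (Fin r → ℂ) => ContinuousLinearMap.det A) =
          fun A => ∑ σ : Equiv.Perm (Fin r), Equiv.Perm.sign σ •
            ∏ i, A (Pi.single i 1) (σ i) := by
        funext A
        rw [ContinuousLinearMap.det, ← LinearMap.det_toMatrix', Matrix.det_apply]
        simp only [LinearMap.toMatrix'_apply]
        exact Finset.sum_congr rfl fun σ _ => by congr 1
      rw [e]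
      refine ContDiff.sum fun σ _ => ContDiff.const_smul _ (contDiff_prod fun i _ => ?_)
      exact contDiff_pi.1 (contDiff_id.clm_apply contDiff_const) _
    exact (hdet.contMDiff.comp_contMDiffOn (contMDiffOn_coordChangeL (IB := 𝓘(ℂ, Cn n))
      (n := smoothOrder) (trivializationAt (Fin r → ℂ) E p)
      (trivializationAt (Fin r → ℂ) E q))).smul contMDiffOn_const
  exact VectorBundleCore.instContMDiffVectorBundle (detCore r E)

end Det

end HermiteEinstein

namespace HermiteEinstein

/-! ### The weight ω^{m-1} ∧ Ω in charts -/

section InChart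

variable {n m : ℕ} {hmn : m ≤ n} {X : Type*} [TopologicalSpace X] [ChartedSpace (Cn n) X]
  [IsManifold 𝓘(ℂ, Cn n) smoothOrder X] {ω : DiffForm n X 2} {Ω : DiffForm n X (2 * (n - m))}

theorem DiffForm.IsSmooth.eventually {k : ℕ} {η : DiffForm n X k} (h : η.IsSmooth) (p : X)
    {z : Cn n} (hz : z ∈ (chartAt (Cn n) p).target) :
    ∀ᶠ y in 𝓝 z, ContDiffAt ℝ smoothOrder (η.inChart p) y :=
  ((chartAt (Cn n) p).open_target.eventually_mem hz).mono fun _ hy =>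
    (h p).contDiffAt ((chartAt (Cn n) p).open_target.mem_nhds hy)

theorem DiffForm.IsSmooth.formSmooth {k : ℕ} {η : DiffForm n X k} (h : η.IsSmooth) (p : X)
    {z : Cn n} (hz : z ∈ (chartAt (Cn n) p).target) :
    FormSmooth (fun y => (η.inChart p y).toAlternatingMap) z :=
  formSmooth_of_contDiffAt (h.eventually p hz)

/-- Inverse charts have complex-linear derivative, so ω stays invariant under multiplication by i in
a chart, and dω = 0 splits into ∂ω = 0 and ∂̄ω = 0. -/
theorem IsKahlerForm.formDeriv_inChart (hω : IsKahlerForm ω) (p : X) {z : Cn n}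
    (hz : z ∈ (chartAt (Cn n) p).target) :
    formDeriv (-Complex.I) (fun y => (ω.inChart p y).toAlternatingMap) z = 0 ∧
      formDeriv Complex.I (fun y => (ω.inChart p y).toAlternatingMap) z = 0 := by
  refine formDeriv_eq_zero_of_extDeriv (hω.smooth.eventually p hz) (hω.closed p z hz) ?_
  filter_upwards [(chartAt (Cn n) p).open_target.eventually_mem hz] with y hy v
  have h := (hω.type_one_one ((chartAt (Cn n) p).symm y)).2 Complex.I
    fun j => chartSymmDeriv p y (v j)
  simp only [pow_one, Complex.conj_I, mul_neg, Complex.I_mul_I, neg_neg, one_mul] at h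
  refine Eq.trans (congrArg (ω ((chartAt (Cn n) p).symm y)) (funext fun j => ?_)) h
  exact chartSymmDeriv_I_smul p hy (v j)

/-- The form `ω^{m-1} ∧ Ω` in a chart. -/
def weight (m : ℕ) (ω : DiffForm n X 2) (Ω : DiffForm n X (2 * (n - m))) (p : X) (z : Cn n) :
    Cn n [⋀^Fin (2 * (m - 1) + 2 * (n - m))]→ₗ[ℝ] ℂ :=
  wedge (wedgePow (ω.inChart p z).toAlternatingMap (m - 1)) (Ω.inChart p z).toAlternatingMap

theorem formSmooth_weight (hω : IsKahlerForm ω) (hΩ : IsAdmissibleForm hmn Ω) (p : X) {z : Cn n}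
    (hz : z ∈ (chartAt (Cn n) p).target) : FormSmooth (weight m ω Ω p) z :=
  ((hω.smooth.formSmooth p hz).wedgePow _).wedge (hΩ.smooth.formSmooth p hz)

/-- The powers of ω are closed under both operators, which leaves ω^{m-1} ∧ ∂∂̄Ω = 0. This is the
only use of the closedness assumptions. -/
theorem formDeriv_formDeriv_weight (hω : IsKahlerForm ω) (hΩ : IsAdmissibleForm hmn Ω) (p : X)
    {z : Cn n} (hz : z ∈ (chartAt (Cn n) p).target) :
    formDeriv (-Complex.I) (formDeriv Complex.I (weight m ω Ω p)) z = 0 := by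
  have hs := hω.smooth.formSmooth p hz
  refine formDeriv_formDeriv_wedge_eq_zero (even_two_mul _) (hs.wedgePow _)
    (hΩ.smooth.formSmooth p hz) ?_ (formDeriv_wedgePow hs (hω.formDeriv_inChart p hz).1 _)
    (formDeriv_formDeriv_eq_zero (hΩ.smooth.eventually p hz) (hΩ.ddbar_closed p z hz))
  filter_upwards [(chartAt (Cn n) p).open_target.eventually_mem hz] with y hy
  exact formDeriv_wedgePow (hω.smooth.formSmooth p hy) (hω.formDeriv_inChart p hy).2 _

/-- The expression of a form in a chart. -/
def pullChart {k : ℕ} (p : X) (α : X → Cn n [⋀^Fin k]→ₗ[ℝ] ℂ) (z : Cn n) : Cn n [⋀^Fin k]→ₗ[ℝ] ℂ :=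
  (α ((chartAt (Cn n) p).symm z)).compLinearMap (chartSymmDeriv p z : Cn n →ₗ[ℝ] Cn n)

/-- The coefficients of a form in the charts are smooth. -/
def SmoothForm {k : ℕ} (α : X → Cn n [⋀^Fin k]→ₗ[ℝ] ℂ) : Prop :=
  ∀ p, ∀ z ∈ (chartAt (Cn n) p).target, FormSmooth (pullChart p α) z

theorem chartCoeff_topProduct (hm : 1 ≤ m) (α : X → Cn n [⋀^Fin 2]→ₗ[ℝ] ℂ) (p : X) (z : Cn n) :
    chartCoeff p (fun x => topProduct hm hmn (ω x).toAlternatingMap (Ω x).toAlternatingMap (α x)) z =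
      castDeg (show 2 + (2 * (m - 1) + 2 * (n - m)) = 2 * n by omega)
        (wedge (pullChart p α z) (weight m ω Ω p z)) (orientedFrame n) := by
  rw [chartCoeff, topProduct_compLinearMap, topProduct_eq_castDeg]
  rfl

theorem SmoothForm.hasContinuousCoeff_topProduct (hm : 1 ≤ m) {α : X → Cn n [⋀^Fin 2]→ₗ[ℝ] ℂ}
    (hα : SmoothForm α) (hω : IsKahlerForm ω) (hΩ : IsAdmissibleForm hmn Ω) :
    HasContinuousCoeff
      fun x => topProduct hm hmn (ω x).toAlternatingMap (Ω x).toAlternatingMap (α x) := by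
  intro p z hz
  refine ContinuousAt.continuousWithinAt ?_
  have h := ((hα p z hz).wedge (formSmooth_weight hω hΩ p hz)).castDeg
    (show 2 + (2 * (m - 1) + 2 * (n - m)) = 2 * n by omega) (orientedFrame n)
  refine (h.contDiffAt.continuousAt).congr (Filter.Eventually.of_forall fun y => ?_)
  exact (chartCoeff_topProduct hm α p y).symm

end InChart

/-! ### Vanishing of ∫ ∂̄∂φ ∧ ω^{m-1} ∧ Ω -/

section Levi

variable {n m : ℕ} {hmn : m ≤ n} {X : Type*} [TopologicalSpace X] [ChartedSpace (Cn n) X]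
  [IsManifold 𝓘(ℂ, Cn n) smoothOrder X] {ω : DiffForm n X 2} {Ω : DiffForm n X (2 * (n - m))}

/-- The function is smooth in all charts. -/
def ChartSmooth (φ : X → ℂ) : Prop :=
  ∀ p, ∀ x ∈ (chartAt (Cn n) p).source,
    SmoothNear (fun y => φ ((chartAt (Cn n) p).symm y)) (chartAt (Cn n) p x)

/-- The form `∂̄∂φ`. -/
def levi (φ : X → ℂ) (x : X) : Cn n [⋀^Fin 2]→ₗ[ℝ] ℂ :=
  dbard (fun y => φ ((chartAt (Cn n) x).symm y)) (chartAt (Cn n) x x)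

/-- Independence of the chart, deduced from the naturality of the curvature of the metric exp φ. -/
theorem pullChart_levi {φ : X → ℂ} (hφ : ChartSmooth (n := n) φ) {p x : X}
    (hp : x ∈ (chartAt (Cn n) p).source) : pullChart p (levi φ) (chartAt (Cn n) p x) =
      dbard (fun y => φ ((chartAt (Cn n) p).symm y)) (chartAt (Cn n) p x) := by
  have hx := mem_chart_source (Cn n) x
  rw [pullChart, (chartAt (Cn n) p).left_inv hp, levi, ← lineCurvature_exp (hφ x x hx),
    ← lineCurvature_exp (hφ p x hp)]
  exact lineCurvature_chart (U := fun x => Complex.exp (φ x)) hp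
    ((hφ x x hx).mono fun y hy => hy.cexp) (Complex.exp_ne_zero _)

theorem smoothForm_levi {φ : X → ℂ} (hφ : ChartSmooth (n := n) φ) :
    SmoothForm (n := n) (levi φ) := by
  intro p z hz
  have hs := hφ p _ ((chartAt (Cn n) p).map_target hz)
  rw [(chartAt (Cn n) p).right_inv hz] at hs
  have hexp : SmoothNear (fun y => Complex.exp (φ ((chartAt (Cn n) p).symm y))) z :=
    hs.mono fun y hy => hy.cexp
  refine (FormSmooth.lineCurvature hexp (Complex.exp_ne_zero _)).congr ?_
  filter_upwards [(chartAt (Cn n) p).open_target.eventually_mem hz, hs.eventually] with y hy hsy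
  have h := pullChart_levi hφ ((chartAt (Cn n) p).map_target hy)
  rw [(chartAt (Cn n) p).right_inv hy] at h
  rw [h, lineCurvature_exp hsy]

theorem SmoothForm.smul_const {k : ℕ} {α : X → Cn n [⋀^Fin k]→ₗ[ℝ] ℂ} (h : SmoothForm α) (a : ℂ) :
    SmoothForm fun x => a • α x := fun p z hz => FormSmooth.smul (SmoothNear.const a z) (h p z hz)

variable [CompactSpace X] [T2Space X]

/-- `∫ ∂̄∂φ ∧ ω^{m-1} ∧ Ω = 0` for functions supported in a chart. -/
theorem integralTop_levi_of_support (hm : 1 ≤ m) (hω : IsKahlerForm ω)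
    (hΩ : IsAdmissibleForm hmn Ω) {φ : X → ℂ} (hφ : ChartSmooth (n := n) φ) {p : X}
    (hsupp : tsupport φ ⊆ (chartAt (Cn n) p).source) (a : ℂ) :
    integralTop (fun x => topProduct hm hmn (ω x).toAlternatingMap (Ω x).toAlternatingMap
      (a • levi φ x)) = 0 := by
  classical
  have hK : IsCompact (tsupport φ) := (isClosed_tsupport φ).isCompact
  have hK' := isCompact_image_chart hK hsupp
  have hlocal : ∀ {p' : X} {z : Cn n}, z ∈ (chartAt (Cn n) p').target →
      (chartAt (Cn n) p').symm z ∉ tsupport φ →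
        ∀ᶠ y in 𝓝 z, φ ((chartAt (Cn n) p').symm y) = 0 := by
    intro p' z hz h
    have h1 := ((chartAt (Cn n) p').continuousAt_symm hz).eventually_mem
      ((isClosed_tsupport φ).isOpen_compl.mem_nhds h)
    exact h1.mono fun y hy => image_eq_zero_of_notMem_tsupport hy
  have h0 : ∀ x, x ∉ tsupport φ →
      topProduct hm hmn (ω x).toAlternatingMap (Ω x).toAlternatingMap (a • levi φ x) = 0 := by
    intro x hx
    have h1 : levi (n := n) φ x = 0 := by
      have h2 : ∀ᶠ y in 𝓝 (chartAt (Cn n) x x), φ ((chartAt (Cn n) x).symm y) = 0 := by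
        refine hlocal (mem_chart_target (Cn n) x) ?_
        rwa [(chartAt (Cn n) x).left_inv (mem_chart_source (Cn n) x)]
      rw [levi, dbard_congr (ψ' := fun _ => 0) h2 (hφ x x (mem_chart_source (Cn n) x)), dbard_zero]
    rw [h1, smul_zero]
    exact map_zero (topProductLin hm hmn (ω x).toAlternatingMap (Ω x).toAlternatingMap)
  rw [integralTop_eq_setIntegral (((smoothForm_levi hφ).smul_const
    a).hasContinuousCoeff_topProduct hm hω hΩ) hK hsupp h0]
  set T := (chartAt (Cn n) p).target with hT
  -- Stokes is applied on all of ℂⁿ, so the function is extended by zero outside the target of the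
  -- chart, where the inverse chart has no meaning.
  set ψ : Cn n → ℂ := fun z => if z ∈ T then φ ((chartAt (Cn n) p).symm z) else 0 with hψ
  have hψT : ∀ z ∈ T, ψ =ᶠ[𝓝 z] fun y => φ ((chartAt (Cn n) p).symm y) := fun z hz =>
    ((chartAt (Cn n) p).open_target.eventually_mem hz).mono fun y hy => if_pos hy
  have hKT : chartAt (Cn n) p '' tsupport φ ⊆ T :=
    (Set.image_mono hsupp).trans (chartAt (Cn n) p).image_source_eq_target.subset
  have hψs : ∀ z ∈ T, SmoothNear ψ z := by
    intro z hz
    have := hφ p _ ((chartAt (Cn n) p).map_target hz)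
    rw [(chartAt (Cn n) p).right_inv hz] at this
    exact this.congr (hψT z hz)
  have hψ0 : ∀ y, y ∉ chartAt (Cn n) p '' tsupport φ → ψ y = 0 := by
    intro y hy
    by_cases hyT : y ∈ T
    · refine (if_pos hyT).trans (image_eq_zero_of_notMem_tsupport fun hmem => hy ⟨_, hmem, ?_⟩)
      exact (chartAt (Cn n) p).right_inv hyT
    · exact if_neg hyT
  have key := integral_wedge_dbard hK' (fun z hz => hψs z (hKT hz)) hψ0
    (fun z hz => formSmooth_weight hω hΩ p (hKT hz))
    (fun z hz => formDeriv_formDeriv_weight hω hΩ p (hKT hz))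
    (show 2 + (2 * (m - 1) + 2 * (n - m)) = 2 * n by omega) (orientedFrame n)
  rw [← MeasureTheory.setIntegral_eq_integral_of_forall_compl_eq_zero (s := T)] at key
  · have e : ∀ z ∈ T, chartCoeff p (fun x => topProduct hm hmn (ω x).toAlternatingMap
        (Ω x).toAlternatingMap (a • levi φ x)) z =
          a * castDeg (show 2 + (2 * (m - 1) + 2 * (n - m)) = 2 * n by omega)
            (wedge (dbard ψ z) (weight m ω Ω p z)) (orientedFrame n) := by
      intro z hz
      have h1 := pullChart_levi hφ ((chartAt (Cn n) p).map_target hz)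
      rw [(chartAt (Cn n) p).right_inv hz] at h1
      have h2 : pullChart p (fun x => a • levi φ x) z = a • dbard ψ z := by
        rw [dbard_congr (hψT z hz) (hψs z hz), ← h1]
        rfl
      rw [chartCoeff_topProduct, h2, wedge_smul_left]
      rfl
    rw [MeasureTheory.setIntegral_congr_fun (chartAt (Cn n) p).open_target.measurableSet e,
      MeasureTheory.integral_const_mul, key, mul_zero]
  · intro z hz
    have h1 : ∀ᶠ y in 𝓝 z, ψ y = 0 := Filter.mem_of_superset
      (hK'.isClosed.isOpen_compl.mem_nhds fun hzK => hz (hKT hzK)) hψ0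
    rw [dbard_congr (ψ := ψ) (ψ' := fun _ => 0) h1 ((SmoothNear.const 0 z).congr h1), dbard_zero,
      wedge_zero_left]
    rfl

theorem integralTop_levi (hm : 1 ≤ m) (hω : IsKahlerForm ω) (hΩ : IsAdmissibleForm hmn Ω)
    {φ : X → ℂ} (hφ : ChartSmooth (n := n) φ) (a : ℂ) :
    integralTop (fun x => topProduct hm hmn (ω x).toAlternatingMap (Ω x).toAlternatingMap
      (a • levi φ x)) = 0 := by
  have := isManifold_real (n := n) (X := X)
  -- The partition that defines the integral is only continuous; cutting φ into pieces supported in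
  -- charts requires a smooth one.
  obtain ⟨χ, hχ⟩ := SmoothPartitionOfUnity.exists_isSubordinate 𝓘(ℝ, Cn n) (isClosed_univ (X := X))
    (fun p : X => (chartAt (Cn n) p).source) (fun p => (chartAt (Cn n) p).open_source)
    fun x _ => Set.mem_iUnion.2 ⟨x, mem_chart_source (Cn n) x⟩
  have hf := χ.locallyFinite.finite_nonempty_of_compact
  set S := hf.toFinset with hS
  have hsum : ∀ x, ∑ p ∈ S, χ p x = 1 := by
    intro x
    rw [← χ.sum_eq_one (Set.mem_univ x), finsum_eq_sum_of_support_subset]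
    exact fun p hp => hf.mem_toFinset.2 ⟨x, hp⟩
  set φp : X → X → ℂ := fun p x => (χ p x : ℂ) * φ x with hφp
  have hsm : ∀ p, ChartSmooth (n := n) (φp p) := by
    intro p p' x hx
    have h1 : ∀ᶠ y in 𝓝 (chartAt (Cn n) p' x), ContDiffAt ℝ smoothOrder
        (fun y => χ p ((chartAt (Cn n) p').symm y)) y :=
      contDiffAt_comp_chart_symm isOpen_univ (χ p).contMDiff.contMDiffOn (Set.mem_univ x) hx
    have h2 : SmoothNear (fun y => (χ p ((chartAt (Cn n) p').symm y) : ℂ))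
        (chartAt (Cn n) p' x) :=
      h1.mono fun y hy => Complex.ofRealCLM.contDiff.contDiffAt.comp y hy
    exact h2.mul (hφ p' x hx)
  have hsub : ∀ p, tsupport (φp p) ⊆ (chartAt (Cn n) p).source := by
    intro p
    refine (closure_mono fun x hx => ?_).trans (hχ p)
    rw [Function.mem_support] at hx ⊢
    intro h0
    exact hx (by rw [hφp]; simp only [h0, Complex.ofReal_zero, zero_mul])
  have hlevi : ∀ x, a • levi (n := n) φ x = ∑ p ∈ S, a • levi (φp p) x := by
    intro x
    have h1 : (fun y => φ ((chartAt (Cn n) x).symm y)) =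
        fun y => ∑ p ∈ S, φp p ((chartAt (Cn n) x).symm y) := by
      funext y
      rw [hφp]
      simp only
      rw [← Finset.sum_mul, ← Complex.ofReal_sum, hsum, Complex.ofReal_one, one_mul]
    rw [levi, h1, dbard_sum fun p _ => hsm p x x (mem_chart_source (Cn n) x), Finset.smul_sum]
    rfl
  simp only [hlevi, topProduct_sum]
  rw [integralTop_sum fun p _ =>
    ((smoothForm_levi (hsm p)).smul_const a).hasContinuousCoeff_topProduct hm hω hΩ]
  exact Finset.sum_eq_zero fun p _ => integralTop_levi_of_support hm hω hΩ (hsm p) (hsub p) a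

end Levi

/-! ### Independence of the degree from the metric -/

section LineDegree

variable {n m : ℕ} {hmn : m ≤ n} {X : Type*} [TopologicalSpace X] [ChartedSpace (Cn n) X]
  [IsManifold 𝓘(ℂ, Cn n) smoothOrder X] {ω : DiffForm n X 2} {Ω : DiffForm n X (2 * (n - m))}
  {L : X → Type*} [∀ x, AddCommGroup (L x)] [∀ x, Module ℂ (L x)]
  [TopologicalSpace (TotalSpace (Fin 1 → ℂ) L)] [∀ x, TopologicalSpace (L x)]
  [FiberBundle (Fin 1 → ℂ) L] [VectorBundle ℂ (Fin 1 → ℂ) L]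
  [ContMDiffVectorBundle smoothOrder (Fin 1 → ℂ) L 𝓘(ℂ, Cn n)]

theorem HermitianMetric.smoothForm_curvature (k : HermitianMetric n 1 L) :
    SmoothForm (n := n) fun x => k.curvature x 0 0 := by
  intro p z hz
  set x := (chartAt (Cn n) p).symm z with hx
  have hp : x ∈ (chartAt (Cn n) p).source := (chartAt (Cn n) p).map_target hz
  have hzx : chartAt (Cn n) p x = z := (chartAt (Cn n) p).right_inv hz
  set e := trivializationAt (Fin 1 → ℂ) L x
  have hxe : x ∈ e.baseSet := FiberBundle.mem_baseSet_trivializationAt (Fin 1 → ℂ) L x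
  have hs := k.smoothNear_lineGram e hp hxe
  rw [← hzx]
  refine (FormSmooth.lineCurvature hs ?_).congr ?_
  · rw [(chartAt (Cn n) p).left_inv hp]
    exact k.lineGram_ne e hxe
  · filter_upwards [eventually_chart_symm_mem hp e.open_baseSet hxe,
      (chartAt (Cn n) p).open_target.eventually_mem ((chartAt (Cn n) p).map_source hp)] with y h1 h2
    have := k.curvature_chart e ((chartAt (Cn n) p).map_target h2) h1
    rw [(chartAt (Cn n) p).right_inv h2] at this
    exact this

theorem HermitianMetric.chartSmooth_logRatio (k k' : HermitianMetric n 1 L) :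
    ChartSmooth (n := n) (k.logRatio k') := fun _ _ hx => k.smoothNear_logRatio k' hx

/-- In a common frame k' = k exp φ, and the curvature is additive on products of metrics. -/
theorem HermitianMetric.curvature_eq_add_levi (k k' : HermitianMetric n 1 L) (x : X) :
    k'.curvature x 0 0 = k.curvature x 0 0 + levi (k.logRatio k') x := by
  set e := trivializationAt (Fin 1 → ℂ) L x
  have hxe : x ∈ e.baseSet := FiberBundle.mem_baseSet_trivializationAt (Fin 1 → ℂ) L x
  have hx := mem_chart_source (Cn n) x
  have hs := k.smoothNear_lineGram e hx hxe
  have hs' := k'.smoothNear_lineGram e hx hxe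
  have hl := k.smoothNear_logRatio k' hx
  have h0 : k.lineGram e ((chartAt (Cn n) x).symm (chartAt (Cn n) x x)) ≠ 0 := by
    rw [(chartAt (Cn n) x).left_inv hx]; exact k.lineGram_ne e hxe
  have h0' : k'.lineGram e ((chartAt (Cn n) x).symm (chartAt (Cn n) x x)) ≠ 0 := by
    rw [(chartAt (Cn n) x).left_inv hx]; exact k'.lineGram_ne e hxe
  have hev : (fun y => k'.lineGram e ((chartAt (Cn n) x).symm y)) =ᶠ[𝓝 (chartAt (Cn n) x x)]
      fun y => k.lineGram e ((chartAt (Cn n) x).symm y) *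
        Complex.exp (k.logRatio k' ((chartAt (Cn n) x).symm y)) :=
    (eventually_chart_symm_mem hx e.open_baseSet hxe).mono fun y hy =>
      (k.exp_logRatio k' e hy).symm
  have hexp : SmoothNear (fun y => Complex.exp (k.logRatio k' ((chartAt (Cn n) x).symm y)))
      (chartAt (Cn n) x x) := hl.mono fun y hy => hy.cexp
  rw [k.curvature_eq_lineCurvature, k'.curvature_eq_lineCurvature, lineCurvature_congr hev hs' h0',
    lineCurvature_mul hs h0 hexp (Complex.exp_ne_zero _), lineCurvature_exp hl]
  rfl

theorem HermitianMetric.hasContinuousCoeff (k : HermitianMetric n 1 L) (hm : 1 ≤ m)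
    (hω : IsKahlerForm ω) (hΩ : IsAdmissibleForm hmn Ω) : HasContinuousCoeff fun x =>
      topProduct hm hmn (ω x).toAlternatingMap (Ω x).toAlternatingMap
        (Complex.I • k.curvature x 0 0) :=
  (k.smoothForm_curvature.smul_const Complex.I).hasContinuousCoeff_topProduct hm hω hΩ

variable [CompactSpace X] [T2Space X]

/-- The degree of a line bundle does not depend on the metric. -/
theorem lineDegree_eq (hm : 1 ≤ m) (hω : IsKahlerForm ω) (hΩ : IsAdmissibleForm hmn Ω)
    (k k' : HermitianMetric n 1 L) : lineDegree hm hmn ω Ω k' = lineDegree hm hmn ω Ω k := by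
  have h1 : (fun x => topProduct hm hmn (ω x).toAlternatingMap (Ω x).toAlternatingMap
      (Complex.I • k'.curvature x 0 0)) = fun x =>
        topProduct hm hmn (ω x).toAlternatingMap (Ω x).toAlternatingMap
          (Complex.I • k.curvature x 0 0) +
        topProduct hm hmn (ω x).toAlternatingMap (Ω x).toAlternatingMap
          (Complex.I • levi (k.logRatio k') x) := by
    funext x
    rw [k.curvature_eq_add_levi k', smul_add, topProduct_add]
  rw [lineDegree, lineDegree, h1, integralTop_add (k.hasContinuousCoeff hm hω hΩ)
    (((smoothForm_levi (k.chartSmooth_logRatio k')).smul_const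
      Complex.I).hasContinuousCoeff_topProduct hm hω hΩ),
    integralTop_levi hm hω hΩ (k.chartSmooth_logRatio k'), add_zero]

end LineDegree

end HermiteEinstein

namespace HermiteEinstein

/-! ### From pointwise inequalities to degrees -/

section Comparison

variable {n m : ℕ} {hmn : m ≤ n} {X : Type*} [TopologicalSpace X] [ChartedSpace (Cn n) X]
  [IsManifold 𝓘(ℂ, Cn n) smoothOrder X] {ω : DiffForm n X 2} {Ω : DiffForm n X (2 * (n - m))}
  {L : X → Type*} [∀ x, AddCommGroup (L x)] [∀ x, Module ℂ (L x)]
  [TopologicalSpace (TotalSpace (Fin 1 → ℂ) L)] [∀ x, TopologicalSpace (L x)]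
  [FiberBundle (Fin 1 → ℂ) L] [VectorBundle ℂ (Fin 1 → ℂ) L]
  [ContMDiffVectorBundle smoothOrder (Fin 1 → ℂ) L 𝓘(ℂ, Cn n)]
  {L' : X → Type*} [∀ x, AddCommGroup (L' x)] [∀ x, Module ℂ (L' x)]
  [TopologicalSpace (TotalSpace (Fin 1 → ℂ) L')] [∀ x, TopologicalSpace (L' x)]
  [FiberBundle (Fin 1 → ℂ) L'] [VectorBundle ℂ (Fin 1 → ℂ) L']
  [ContMDiffVectorBundle smoothOrder (Fin 1 → ℂ) L' 𝓘(ℂ, Cn n)]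
  [CompactSpace X] [T2Space X]

theorem HasContinuousCoeff.smul {η : X → Cn n [⋀^Fin (2 * n)]→ₗ[ℝ] ℂ} (h : HasContinuousCoeff η)
    (a : ℂ) : HasContinuousCoeff fun x => a • η x := fun p => (h p).const_smul a

theorem integralTop_smul (a : ℂ) (η : X → Cn n [⋀^Fin (2 * n)]→ₗ[ℝ] ℂ) :
    integralTop (fun x => a • η x) = a * integralTop η := by
  obtain ⟨S, hS⟩ := exists_finset_chartPartition (n := n) (X := X)
  rw [integralTop_eq_sum hS, integralTop_eq_sum hS, Finset.mul_sum]
  refine Finset.sum_congr rfl fun p _ => ?_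
  rw [← MeasureTheory.integral_const_mul]
  refine congrArg _ (funext fun z => ?_)
  rw [← mul_left_comm]
  rfl

theorem topCoeff_re_eq (hm : 1 ≤ m) (hω : IsKahlerForm ω) (k : HermitianMetric n 1 L) (x : X) :
    (topCoeff (topProduct hm hmn (ω x).toAlternatingMap (Ω x).toAlternatingMap
      (Complex.I • k.curvature x 0 0))).re =
        lineDegreeFunction hm hmn ω Ω k x * (topCoeff (volumeForm (ω x).toAlternatingMap)).re := by
  obtain ⟨c, hc, hc'⟩ := hω.topCoeff_volumeForm_pos x
  rw [lineDegreeFunction, hc', Complex.div_ofReal_re, Complex.ofReal_re, div_mul_cancel₀ _ hc.ne']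

/-- A pointwise inequality between degree functions gives an inequality between degrees, with
equality only if the degree functions agree. -/
theorem lineDegree_le (hm : 1 ≤ m) (hω : IsKahlerForm ω) (hΩ : IsAdmissibleForm hmn Ω)
    (k : HermitianMetric n 1 L) (k' : HermitianMetric n 1 L') (a b : ℝ)
    (h : ∀ x, a * lineDegreeFunction hm hmn ω Ω k x ≤ b * lineDegreeFunction hm hmn ω Ω k' x) :
    a * lineDegree hm hmn ω Ω k ≤ b * lineDegree hm hmn ω Ω k' ∧
      (a * lineDegree hm hmn ω Ω k = b * lineDegree hm hmn ω Ω k' →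
        ∀ x, a * lineDegreeFunction hm hmn ω Ω k x = b * lineDegreeFunction hm hmn ω Ω k' x) := by
  have hk := (k.hasContinuousCoeff hm hω hΩ).smul ((-a : ℝ) : ℂ)
  have hk' := (k'.hasContinuousCoeff hm hω hΩ).smul (b : ℂ)
  have hre : ∀ x, (topCoeff (((b : ℝ) : ℂ) • topProduct hm hmn (ω x).toAlternatingMap
      (Ω x).toAlternatingMap (Complex.I • k'.curvature x 0 0) + ((-a : ℝ) : ℂ) •
        topProduct hm hmn (ω x).toAlternatingMap
          (Ω x).toAlternatingMap (Complex.I • k.curvature x 0 0))).re =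
      (b * lineDegreeFunction hm hmn ω Ω k' x - a * lineDegreeFunction hm hmn ω Ω k x) *
        (topCoeff (volumeForm (ω x).toAlternatingMap)).re := by
    intro x
    rw [topCoeff_add, topCoeff_smul, topCoeff_smul, Complex.add_re, Complex.re_ofReal_mul,
      Complex.re_ofReal_mul, topCoeff_re_eq hm hω, topCoeff_re_eq hm hω]
    ring
  have hpos : ∀ x, 0 < (topCoeff (volumeForm (ω x).toAlternatingMap)).re := by
    intro x
    obtain ⟨c, hc, hc'⟩ := hω.topCoeff_volumeForm_pos x
    rw [hc', Complex.ofReal_re]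
    exact hc
  -- The integrand is the difference of the two sides of the hypothesis times the positive volume
  -- density.
  have hint := integralTop_re_nonneg (hk'.add hk) fun x => by
    rw [hre]
    exact mul_nonneg (sub_nonneg.2 (h x)) (hpos x).le
  rw [integralTop_add hk' hk, integralTop_smul, integralTop_smul, Complex.add_re,
    Complex.re_ofReal_mul, Complex.re_ofReal_mul] at hint
  change 0 ≤ b * lineDegree hm hmn ω Ω k' + -a * lineDegree hm hmn ω Ω k ∧
    (b * lineDegree hm hmn ω Ω k' + -a * lineDegree hm hmn ω Ω k = 0 → _) at hint
  refine ⟨by linarith [hint.1], fun heq x => ?_⟩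
  have h0 := hint.2 (by linarith) x
  rw [hre] at h0
  have := (mul_eq_zero.1 h0).resolve_right (hpos x).ne'
  linarith

theorem lineDegree_congr (hm : 1 ≤ m) (hω : IsKahlerForm ω) (hΩ : IsAdmissibleForm hmn Ω)
    (k : HermitianMetric n 1 L) (k' : HermitianMetric n 1 L') (a b : ℝ)
    (h : ∀ x, a * lineDegreeFunction hm hmn ω Ω k x = b * lineDegreeFunction hm hmn ω Ω k' x) :
    a * lineDegree hm hmn ω Ω k = b * lineDegree hm hmn ω Ω k' :=
  le_antisymm (lineDegree_le hm hω hΩ k k' a b fun x => (h x).le).1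
    (lineDegree_le hm hω hΩ k' k b a fun x => (h x).ge).1

end Comparison

/-! ### Slopes and holomorphic splittings -/

section Slope

variable {n m r q : ℕ} {hmn : m ≤ n} {X : Type*} [TopologicalSpace X] [ChartedSpace (Cn n) X]
  [IsManifold 𝓘(ℂ, Cn n) smoothOrder X] {ω : DiffForm n X 2} {Ω : DiffForm n X (2 * (n - m))}
  {E : X → Type*} [∀ x, AddCommGroup (E x)] [∀ x, Module ℂ (E x)]
  [TopologicalSpace (TotalSpace (Fin r → ℂ) E)] [∀ x, TopologicalSpace (E x)]
  [FiberBundle (Fin r → ℂ) E] [VectorBundle ℂ (Fin r → ℂ) E]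
  [ContMDiffVectorBundle smoothOrder (Fin r → ℂ) E 𝓘(ℂ, Cn n)]
  {Q : X → Type*} [∀ x, AddCommGroup (Q x)] [∀ x, Module ℂ (Q x)]
  [TopologicalSpace (TotalSpace (Fin q → ℂ) Q)] [∀ x, TopologicalSpace (Q x)]
  [FiberBundle (Fin q → ℂ) Q] [VectorBundle ℂ (Fin q → ℂ) Q]
  [ContMDiffVectorBundle smoothOrder (Fin q → ℂ) Q 𝓘(ℂ, Cn n)]

/-- The slopes of two bundles compare as the degree functions of any two metrics. -/
theorem slope_le_and_eq_iff [CompactSpace X] [T2Space X] (hm : 1 ≤ m) (hω : IsKahlerForm ω)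
    (hΩ : IsAdmissibleForm hmn Ω) (hE : HermitianMetric n r E) (hQ : HermitianMetric n q Q)
    (h : ∀ x, degreeFunction hm hmn ω Ω hE x / r ≤ degreeFunction hm hmn ω Ω hQ x / q)
    (kE : HermitianMetric n 1 (DetBundle r E)) (kQ : HermitianMetric n 1 (DetBundle q Q)) :
    slope hm hmn ω Ω kE ≤ slope hm hmn ω Ω kQ ∧
      (slope hm hmn ω Ω kE = slope hm hmn ω Ω kQ ↔
        ∀ x, degreeFunction hm hmn ω Ω hE x / r = degreeFunction hm hmn ω Ω hQ x / q) := by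
  -- The comparison of degrees is used with weights 1/r and 1/q, after replacing the given metrics
  -- on the determinants by the induced ones.
  simp only [div_eq_inv_mul, slope, degreeFunction] at h ⊢
  rw [lineDegree_eq hm hω hΩ hE.det kE, lineDegree_eq hm hω hΩ hQ.det kQ]
  have h1 := lineDegree_le hm hω hΩ hE.det hQ.det _ _ h
  exact ⟨h1.1, h1.2, lineDegree_congr hm hω hΩ hE.det hQ.det _ _⟩

theorem contMDiffAt_of_smoothNear {f : X → ℂ} {x : X}
    (h : SmoothNear (fun y => f ((chartAt (Cn n) x).symm y)) (chartAt (Cn n) x x)) :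
    ContMDiffAt 𝓘(ℝ, Cn n) 𝓘(ℝ, ℂ) smoothOrder f x := by
  have := isManifold_real (n := n) (X := X)
  have h1 : ContMDiffAt 𝓘(ℝ, Cn n) 𝓘(ℝ, ℂ) smoothOrder _ (chartAt (Cn n) x x) :=
    contMDiffAt_iff_contDiffAt.2 h.contDiffAt
  have h2 := h1.comp x ((contMDiffOn_chart (I := 𝓘(ℝ, Cn n)) (x := x)).contMDiffAt
    (chart_source_mem_nhds (Cn n) x))
  refine h2.congr_of_eventuallyEq ?_
  filter_upwards [chart_source_mem_nhds (Cn n) x] with y hy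
  simp only [Function.comp, (chartAt (Cn n) x).left_inv hy]

/-- The metric induced by an injective holomorphic homomorphism. -/
theorem exists_inducedMetric {σ : ∀ x, Q x →ₗ[ℂ] E x} (hσ : IsHolomorphicHom n q r σ)
    (hinj : ∀ x, Function.Injective (σ x)) (hE : HermitianMetric n r E) :
    ∃ h : HermitianMetric n q Q, IsInducedMetric σ h hE := by
  refine ⟨{ inner := fun x => ((hE.inner x).comp (σ x)).compl₂ (σ x)
            conj_symm := fun x u v => hE.conj_symm x _ _
            pos := fun x u hu => hE.pos x _ ((map_ne_zero_iff (σ x) (hinj x)).2 hu)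
            smooth := fun e he i j x hx => ?_ }, fun x u v => rfl⟩
  refine ContMDiffAt.contMDiffWithinAt (contMDiffAt_of_smoothNear ?_)
  have hp := mem_chart_source (Cn n) x
  have hx' : x ∈ (trivializationAt (Fin r → ℂ) E x).baseSet :=
    FiberBundle.mem_baseSet_trivializationAt' x
  have hM := (hσ.matHol (e := e) (e' := trivializationAt (Fin r → ℂ) E x) hp hx hx').matSmooth
  have hG := hE.matSmooth_gram (trivializationAt (Fin r → ℂ) E x) hp hx'
  refine ((hM.conjTranspose.mul hG).mul hM i j).congr ?_
  filter_upwards [eventually_chart_symm_mem hp e.open_baseSet hx,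
    eventually_chart_symm_mem hp (trivializationAt (Fin r → ℂ) E x).open_baseSet hx'] with y h1 h2
  exact congrFun (congrFun (gram_localMatrix σ hE σ h1 h2 h1) i) j

/-- The rank of E is not assumed positive; this follows from the injection of a nonzero fibre, and
needs a point because X may be empty. -/
theorem rank_pos_of_injective {f : ∀ x, Q x →ₗ[ℂ] E x} (hf : ∀ x, Function.Injective (f x))
    (hq : 1 ≤ q) (x : X) : 0 < r := by
  let eQ := ((trivializationAt (Fin q → ℂ) Q x).continuousLinearEquivAt ℂ x
    (FiberBundle.mem_baseSet_trivializationAt' x)).toLinearEquiv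
  let eE := ((trivializationAt (Fin r → ℂ) E x).continuousLinearEquivAt ℂ x
    (FiberBundle.mem_baseSet_trivializationAt' x)).toLinearEquiv
  have h := LinearMap.finrank_le_finrank_of_injective
    (f := eE.toLinearMap ∘ₗ f x ∘ₗ eQ.symm.toLinearMap)
    (eE.injective.comp ((hf x).comp eQ.symm.injective))
  simp only [Module.finrank_fin_fun] at h
  omega

/-- On a compact manifold, a holomorphic splitting forces equality of the degree functions. -/
theorem degreeFunction_eq_of_splits [CompactSpace X] [T2Space X] (hm : 1 ≤ m)
    (hω : IsKahlerForm ω) (hΩ : IsAdmissibleForm hmn Ω) {g : ∀ x, E x →ₗ[ℂ] Q x}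
    {hE : HermitianMetric n r E} (hQ : HermitianMetric n q Q) {lam : ℝ}
    (hHE : IsHermiteEinstein hm hmn ω Ω hE lam)
    (hge : ∀ x, q * lam ≤ degreeFunction hm hmn ω Ω hQ x) (hs : SplitsHolomorphically n r q g)
    (x : X) : degreeFunction hm hmn ω Ω hQ x = q * lam := by
  obtain ⟨σ, hσ, hgσ⟩ := hs
  -- A holomorphic splitting embeds Q in E as a subbundle, which gives Q a second metric, with
  -- degree function at most q λ by the subbundle inequality.
  obtain ⟨h', hh'⟩ := exists_inducedMetric hσ
    (fun x => Function.LeftInverse.injective (hgσ x)) hE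
  have hle : ∀ x, degreeFunction hm hmn ω Ω h' x ≤ q * lam := by
    intro x
    obtain ⟨t, ht, -, ht'⟩ := hh'.exists_degreeFunction_eq hσ hω hΩ hHE x
    rw [ht']
    linarith
  have h1 := lineDegree_le hm hω hΩ h'.det hQ.det 1 1 fun x => by
    rw [one_mul, one_mul]; exact (hle x).trans (hge x)
  -- Both metrics live on the same bundle det Q, so the degrees agree and the pointwise inequality
  -- is an equality.
  have h2 := h1.2 (by rw [lineDegree_eq hm hω hΩ h'.det hQ.det]) x
  rw [one_mul, one_mul] at h2
  refine le_antisymm ?_ (hge x)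
  rw [degreeFunction, ← h2]
  exact hle x

end Slope

end HermiteEinstein

end

/-! ### The theorem -/

theorem proposition2p13 {n m s r q : ℕ} (hm : 1 ≤ m) (hmn : m ≤ n) (hs : 1 ≤ s) (hq : 1 ≤ q)
    {X : Type*} [TopologicalSpace X] [T2Space X] [ChartedSpace (Cn n) X]
    [IsManifold 𝓘(ℂ, Cn n) smoothOrder X]
    -- the Kähler form `ω` and the form `Ω`
    (ω : DiffForm n X 2) (hω : IsKahlerForm ω)
    (Ω : DiffForm n X (2 * (n - m))) (hΩ : IsAdmissibleForm hmn Ω)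
    -- the holomorphic vector bundles `S`, `E`, `Q` of ranks `s`, `r`, `q`
    {S : X → Type*} [∀ x, AddCommGroup (S x)] [∀ x, Module ℂ (S x)]
    [TopologicalSpace (TotalSpace (Fin s → ℂ) S)] [∀ x, TopologicalSpace (S x)]
    [FiberBundle (Fin s → ℂ) S] [VectorBundle ℂ (Fin s → ℂ) S]
    [ContMDiffVectorBundle smoothOrder (Fin s → ℂ) S 𝓘(ℂ, Cn n)]
    {E : X → Type*} [∀ x, AddCommGroup (E x)] [∀ x, Module ℂ (E x)]
    [TopologicalSpace (TotalSpace (Fin r → ℂ) E)] [∀ x, TopologicalSpace (E x)]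
    [FiberBundle (Fin r → ℂ) E] [VectorBundle ℂ (Fin r → ℂ) E]
    [ContMDiffVectorBundle smoothOrder (Fin r → ℂ) E 𝓘(ℂ, Cn n)]
    {Q : X → Type*} [∀ x, AddCommGroup (Q x)] [∀ x, Module ℂ (Q x)]
    [TopologicalSpace (TotalSpace (Fin q → ℂ) Q)] [∀ x, TopologicalSpace (Q x)]
    [FiberBundle (Fin q → ℂ) Q] [VectorBundle ℂ (Fin q → ℂ) Q]
    [ContMDiffVectorBundle smoothOrder (Fin q → ℂ) Q 𝓘(ℂ, Cn n)]
    -- the short exact sequence `0 → S → E → Q → 0`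
    (f : ∀ x, S x →ₗ[ℂ] E x) (g : ∀ x, E x →ₗ[ℂ] Q x) (hfg : IsShortExact n s r q f g)
    -- the metric on `E`, with the induced and the quotient metrics
    (hE : HermitianMetric n r E)
    (hS : HermitianMetric n s S) (hS_ind : IsInducedMetric f hS hE)
    (hQ : HermitianMetric n q Q) (hQ_quot : IsQuotientMetric g hE hQ)
    (lam : ℝ) (hHE : IsHermiteEinstein hm hmn ω Ω hE lam) :
    -- the pointwise inequalities (i) and (ii)
    (∀ x, degreeFunction hm hmn ω Ω hS x / s ≤ degreeFunction hm hmn ω Ω hE x / r ∧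
      degreeFunction hm hmn ω Ω hE x / r ≤ degreeFunction hm hmn ω Ω hQ x / q) ∧
    -- equality in (i) iff equality in (ii) iff the sequence of Hermitian bundles splits
    ((∀ x, degreeFunction hm hmn ω Ω hS x / s = degreeFunction hm hmn ω Ω hE x / r) ↔
      (∀ x, degreeFunction hm hmn ω Ω hE x / r = degreeFunction hm hmn ω Ω hQ x / q)) ∧
    ((∀ x, degreeFunction hm hmn ω Ω hS x / s = degreeFunction hm hmn ω Ω hE x / r) ↔
      SplitsOrthogonally q g hE) ∧
    -- in this case `hS` and `hQ` are Hermite–Einstein with the same factor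
    ((∀ x, degreeFunction hm hmn ω Ω hS x / s = degreeFunction hm hmn ω Ω hE x / r) →
      IsHermiteEinstein hm hmn ω Ω hS lam ∧ IsHermiteEinstein hm hmn ω Ω hQ lam) ∧
    -- the compact case
    (∀ [CompactSpace X],
      ((∀ x, degreeFunction hm hmn ω Ω hS x / s = degreeFunction hm hmn ω Ω hE x / r) ↔
        SplitsHolomorphically n r q g) ∧
      -- the slopes may be computed with any metrics on the determinant bundles
      ∀ (kS : HermitianMetric n 1 (DetBundle s S)) (kE : HermitianMetric n 1 (DetBundle r E))
        (kQ : HermitianMetric n 1 (DetBundle q Q)),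
        slope hm hmn ω Ω kS ≤ slope hm hmn ω Ω kE ∧
        slope hm hmn ω Ω kE ≤ slope hm hmn ω Ω kQ ∧
        (slope hm hmn ω Ω kS = slope hm hmn ω Ω kE ↔ SplitsHolomorphically n r q g) ∧
        (slope hm hmn ω Ω kE = slope hm hmn ω Ω kQ ↔ SplitsHolomorphically n r q g)) := by
  obtain ⟨σ, hσ⟩ := exists_adjoint g hE hQ
  have hgσ : ∀ x w, g x (σ x w) = w := hQ_quot.apply_adjoint hfg.surjective hσ
  have hs0 : (s : ℝ) ≠ 0 := by exact_mod_cast (by omega : s ≠ 0)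
  have hq0 : (q : ℝ) ≠ 0 := by exact_mod_cast (by omega : q ≠ 0)
  have hspos : (0 : ℝ) < s := by exact_mod_cast hs
  have hqpos : (0 : ℝ) < q := by exact_mod_cast hq
  have hdE : ∀ x, degreeFunction hm hmn ω Ω hE x / r = lam := fun x => by
    have hr : (r : ℝ) ≠ 0 := by exact_mod_cast (rank_pos_of_injective hfg.injective hs x).ne'
    rw [hHE.degreeFunction_eq hω x, mul_div_cancel_left₀ _ hr]
  have hdS := exists_degreeFunction_sub_eq hfg hS_ind hσ hgσ hω hΩ hHE
  have hdQ := exists_degreeFunction_quotient_eq hfg.holomorphic_right hσ hgσ hω hΩ hHE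
  -- The middle term is the constant λ, and both equality cases reduce to ∂̄σ = 0 at x, which makes
  -- them equivalent to each other.
  have hi : ∀ x, degreeFunction hm hmn ω Ω hS x / s ≤ degreeFunction hm hmn ω Ω hE x / r ∧
      (degreeFunction hm hmn ω Ω hS x / s = degreeFunction hm hmn ω Ω hE x / r ↔
        ∀ v, mdlb (homMatrix n q r σ x) v (chartAt (Cn n) x x) = 0) := fun x => by
    obtain ⟨t, ht, ht0, hdeg⟩ := hdS x
    rw [hdE, hdeg, ← ht0, div_le_iff₀ hspos, div_eq_iff hs0]
    exact ⟨by linarith, fun h => by linarith, fun h => by rw [h]; ring⟩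
  have hii : ∀ x, degreeFunction hm hmn ω Ω hE x / r ≤ degreeFunction hm hmn ω Ω hQ x / q ∧
      (degreeFunction hm hmn ω Ω hE x / r = degreeFunction hm hmn ω Ω hQ x / q ↔
        ∀ v, mdlb (homMatrix n q r σ x) v (chartAt (Cn n) x x) = 0) := fun x => by
    obtain ⟨t, ht, ht0, hdeg⟩ := hdQ x
    rw [hdE, hdeg, ← ht0, le_div_iff₀ hqpos, eq_div_iff hq0]
    exact ⟨by linarith, fun h => by linarith, fun h => by rw [h]; ring⟩
  have hsplit := splitsOrthogonally_iff hfg.holomorphic_right hσ hgσ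
  have hi' : (∀ x, degreeFunction hm hmn ω Ω hS x / s = degreeFunction hm hmn ω Ω hE x / r) ↔
      ∀ x v, mdlb (homMatrix n q r σ x) v (chartAt (Cn n) x x) = 0 :=
    forall_congr' fun x => (hi x).2
  have hii' : (∀ x, degreeFunction hm hmn ω Ω hE x / r = degreeFunction hm hmn ω Ω hQ x / q) ↔
      ∀ x v, mdlb (homMatrix n q r σ x) v (chartAt (Cn n) x x) = 0 :=
    forall_congr' fun x => (hii x).2
  refine ⟨fun x => ⟨(hi x).1, (hii x).1⟩, hi'.trans hii'.symm, hi'.trans hsplit.symm,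
    fun h => ⟨hermiteEinstein_sub hfg hS_ind hσ hgσ hHE (hi'.1 h),
      hermiteEinstein_quotient hfg.holomorphic_right hσ hgσ hHE (hi'.1 h)⟩, ?_⟩
  intro _
  -- One direction forgets orthogonality. The other is the integral argument: on a compact manifold
  -- any holomorphic splitting forces equality in (ii).
  have hcompact : (∀ x v, mdlb (homMatrix n q r σ x) v (chartAt (Cn n) x x) = 0) ↔
      SplitsHolomorphically n r q g := by
    refine ⟨fun h => ?_, fun h => hii'.1 fun x => ?_⟩
    · obtain ⟨σ', hσ', hgσ', -⟩ := hsplit.2 h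
      exact ⟨σ', hσ', hgσ'⟩
    · have hge : ∀ x, q * lam ≤ degreeFunction hm hmn ω Ω hQ x := fun x => by
        obtain ⟨t, ht, -, hdeg⟩ := hdQ x
        linarith
      rw [hdE, degreeFunction_eq_of_splits hm hω hΩ hQ hHE hge h x, mul_div_cancel_left₀ _ hq0]
  refine ⟨hi'.trans hcompact, fun kS kE kQ => ?_⟩
  have h1 := slope_le_and_eq_iff hm hω hΩ hS hE (fun x => (hi x).1) kS kE
  have h2 := slope_le_and_eq_iff hm hω hΩ hE hQ (fun x => (hii x).1) kE kQ
  exact ⟨h1.1, h2.1, h1.2.trans (hi'.trans hcompact), h2.2.trans (hii'.trans hcompact)⟩
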